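/- Let $p$ be an odd prime, let $G=\langle\sigma,\tau : \sigma^p=\tau^2=1,\ \tau\sigma\tau^{-1}=\sigma^{-1}\rangle$ be the dihedral group $D_p$ of order $2p$, and let $\zeta_p=e^{2\pi i/p}$. Assume that $h_p^+=1$, where $h_p^+$ denotes the class number of $\mathbb{Q}(\zeta_p+\zeta_p^{-1})$. A $G$-lattice is a $\mathbb{Z}[G]$-module that is free of finite rank over $\mathbb{Z}$. It is *permutation* if it has a $\mathbb{Z}$-basis permuted by $G$, *stably permutation* if its direct sum with some permutation lattice is permutation, and *flabby* if the Tate cohomology groups $\hat H^{-1}(S,M)$ vanish for all subgroups $S\le G$. It is *indecomposable* if it is nonzero and is not the direct sum of two nonzero $G$-lattices. Let $\mathbb{Z}$ be the trivial lattice, $\mathbb{Z}_-$ the lattice of rank one on which $\sigma$ acts trivially and $\tau$ as $-1$, and $\mathbb{Z}[H]=\mathbb{Z}[G/\langle\sigma\rangle]$, where $H=\langle\tau\rangle$. Let $R=\mathbb{Z}[\zeta_p]$, on which $\sigma$ acts as multiplication by $\zeta_p$ and $\tau$ as complex conjugation, and let $P=(1-\zeta_p)R\subset R$. Let $V,X,Y_0,Y_1$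 be $G$-lattices that are non-split extensions $$0\to P\to V\to\mathbb{Z}\to0,\quad 0\to R\to X\to\mathbb{Z}_-\to0,\quad 0\to R\to Y_0\to\mathbb{Z}[H]\to0,\quad 0\to P\to Y_1\to\mathbb{Z}[H]\to0,$$ and let $Y_2$ be an indecomposable $G$-lattice that is a non-split extension $0\to R\oplus P\to Y_2\to\mathbb{Z}[H]\to0$. (1) Such lattices $V,X,Y_0,Y_1,Y_2$ exist. For any choice of them, the ten lattices $$\mathbb{Z},\ \mathbb{Z}_-,\ \mathbb{Z}[H],\ R,\ P,\ V,\ X,\ Y_0,\ Y_1,\ Y_2$$ are indecomposable and pairwise non-isomorphic, and every indecomposable $G$-lattice is isomorphic to one of them. Among them $\mathbb{Z},\mathbb{Z}[H],V,Y_2$ are permutation, $Y_0$ and $Y_1$ are stably permutation, and $\mathbb{Z}_-,R,P,X$ are not flabby. (2) Let $K/k$ be a finite Galois extension of fields with $\mathrm{Gal}(K/k)\simeq G$. Then every torus $T$ over $k$ (an affine algebraic group with $T\times_k K\simeq\mathbb{G}_{m,K}^d$ for some $d\ge0$) that splits over $K$ is integral and is stably rational over $k$, that is, its function field $L=k(T)$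 satisfies $L(y_1,\dots,y_m)\simeq k(x_1,\dots,x_n)$ over $k$ for some $m,n\ge0$. Equivalently phrased, for every isomorphism $G\simeq\mathrm{Gal}(K/k)$ and every $G$-lattice $M$, the fixed field $K(M)^G$ is stably rational over $k$, where $K(M)$ is the fraction field of the group algebra $K[M]$, on which $G$ acts through its actions on $K$ and on $M$. -/

import Mathlib

open scoped TensorProduct

universe u v w t

namespace DihedralTori

noncomputable section


/-! ### Lattices over a finite group -/

/-- A `G`-lattice: a `ℤ[G]`-module that is free of finite rank over `ℤ`. -/
structure GLattice (G : Type v) [Group G] where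
  carrier : Type w
  [addCommGroup : AddCommGroup carrier]
  [free : Module.Free ℤ carrier]
  [finite : Module.Finite ℤ carrier]
  ρ : Representation ℤ G carrier

attribute [instance] GLattice.addCommGroup GLattice.free GLattice.finite

instance (G : Type v) [Group G] : CoeSort (GLattice.{v, w} G) (Type w) := ⟨GLattice.carrier⟩

/-- Isomorphism of `G`-lattices (possibly living in different universes). -/
def IsoLattice {G : Type v} [Group G] (M : GLattice.{v, w} G) (N : GLattice.{v, u} G) : Prop :=
  Nonempty (M.ρ.Equiv N.ρ)

/-- The direct sum `M ⊕ N` of two `G`-lattices. -/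
abbrev directSum {G : Type v} [Group G] (M : GLattice.{v, w} G) (N : GLattice.{v, u} G) :
    GLattice.{v, max w u} G where
  carrier := M × N
  ρ := M.ρ.prod N.ρ

/-- `M` is nonzero, and in every decomposition of `M` as an (internal) direct sum of two
`G`-submodules one of the summands is zero. -/
def IsIndecomposable {G : Type v} [Group G] (M : GLattice.{v, w} G) : Prop :=
  Nontrivial M ∧ ∀ A B : Subrepresentation M.ρ,
    IsCompl A.toSubmodule B.toSubmodule → A.toSubmodule = ⊥ ∨ B.toSubmodule = ⊥

/-- `M` has a finite `ℤ`-basis permuted by `G`. -/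
def IsPermutation {G : Type v} [Group G] (M : GLattice.{v, w} G) : Prop :=
  ∃ (n : ℕ) (b : Module.Basis (Fin n) ℤ M), ∀ (g : G) (i : Fin n), ∃ j : Fin n, M.ρ g (b i) = b j

/-- `M ⊕ Q` is a permutation lattice for some permutation lattice `Q`. -/
def IsStablyPermutation {G : Type v} [Group G] (M : GLattice.{v, w} G) : Prop :=
  ∃ Q : GLattice.{v, 0} G, IsPermutation Q ∧ IsPermutation (directSum M Q)

open Classical in
/-- The Tate cohomology group `H⁻¹(S, M)` vanishes for every subgroup `S` of `G`. -/
def IsFlabby {G : Type} [Group G] [Finite G] (M : GLattice.{0, 0} G) : Prop :=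
  ∀ S : Subgroup G,
    letI : Fintype S := Fintype.ofFinite S
    Subsingleton (tateCohomology (Rep.of (M.ρ.comp S.subtype)) (-1))

/-- There is a short exact sequence `0 → A → M → C → 0` of `G`-modules that does not split. -/
def IsNonsplitExtension {G : Type v} [Group G] (A M C : GLattice.{v, w} G) : Prop :=
  ∃ (f : A.ρ.IntertwiningMap M.ρ) (g : M.ρ.IntertwiningMap C.ρ),
    Function.Injective f ∧ Function.Surjective g ∧ Function.Exact f g ∧
      ¬ ∃ s : C.ρ.IntertwiningMap M.ρ, ∀ c, g (s c) = c

/-! ### The class number of the maximal real subfield of the `p`-th cyclotomic field -/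

/-- The primitive `p`-th root of unity `ζ_p = exp (2 π i / p)`. -/
def zeta (p : ℕ) : ℂ := Complex.exp (2 * Real.pi * Complex.I / p)

lemma zeta_isPrimitiveRoot (p : ℕ) [NeZero p] : IsPrimitiveRoot (zeta p) p :=
  Complex.isPrimitiveRoot_exp p (NeZero.ne p)

/-- The field `ℚ(ζ_p + ζ_p⁻¹)`. -/
abbrev RealCyclotomicField (p : ℕ) : IntermediateField ℚ ℂ :=
  IntermediateField.adjoin ℚ {zeta p + (zeta p)⁻¹}

instance (p : ℕ) [NeZero p] : NumberField (RealCyclotomicField p) where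
  to_charZero := inferInstance
  to_finiteDimensional := by
    have h : IsIntegral ℚ (zeta p) :=
      ((zeta_isPrimitiveRoot p).isIntegral (NeZero.pos p)).tower_top
    exact IntermediateField.adjoin.finiteDimensional (h.add h.inv)

/-- The second factor `h_p⁺`: the class number of `ℚ(ζ_p + ζ_p⁻¹)`. -/
def hPlus (p : ℕ) [NeZero p] : ℕ := NumberField.classNumber (RealCyclotomicField p)

/-! ### Lattices over the dihedral group

The dihedral group of order `2p` is `DihedralGroup p`, generated by `σ = r 1` and `τ = sr 0`;
its elements are `r i = σ ^ i` and `sr i = τ σ ^ i`. -/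

/-- The trivial lattice `ℤ`. -/
abbrev latticeZ (p : ℕ) : GLattice.{0, 0} (DihedralGroup p) :=
  { carrier := ℤ
    ρ := Representation.trivial ℤ (DihedralGroup p) ℤ }

/-- The character with `σ ↦ 1` and `τ ↦ -1`. -/
def signChar (p : ℕ) : DihedralGroup p →* ℤ where
  toFun
    | .r _ => 1
    | .sr _ => -1
  map_one' := rfl
  map_mul' := by rintro (i | i) (j | j) <;> simp

/-- The lattice `ℤ_-`: `σ` acts trivially and `τ` acts as `-1`. -/
def latticeZMinus (p : ℕ) : GLattice.{0, 0} (DihedralGroup p) :=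
  { carrier := ℤ
    ρ :=
    { toFun := fun g => signChar p g • (LinearMap.id : ℤ →ₗ[ℤ] ℤ)
      map_one' := by ext; simp
      map_mul' := by intro g h; ext; simp } }

/-- The permutation lattice `ℤ[H] ≃ ℤ[G/⟨σ⟩]`, of rank two. -/
abbrev latticeZH (p : ℕ) [NeZero p] : GLattice.{0, 0} (DihedralGroup p) :=
  { carrier := MonoidAlgebra ℤ
      (DihedralGroup p ⧸ Subgroup.zpowers (DihedralGroup.r (1 : ZMod p)))
    ρ := Representation.ofMulAction ℤ (DihedralGroup p)
      (DihedralGroup p ⧸ Subgroup.zpowers (DihedralGroup.r (1 : ZMod p))) }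

lemma zeta_pow_val_add (p : ℕ) [NeZero p] (i j : ZMod p) :
    zeta p ^ (i + j).val = zeta p ^ i.val * zeta p ^ j.val := by
  rw [ZMod.val_add, ← pow_add, ← pow_mod_orderOf _ (i.val + j.val),
    ← (zeta_isPrimitiveRoot p).eq_orderOf]

lemma zeta_pow_val_neg (p : ℕ) [NeZero p] (i : ZMod p) :
    starRingEnd ℂ (zeta p ^ i.val) = zeta p ^ (-i).val := by
  have h1 : zeta p ^ i.val * zeta p ^ (-i).val = 1 := by
    rw [← zeta_pow_val_add]; simp
  have h2 : ‖zeta p ^ i.val‖ = 1 := by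
    rw [norm_pow, (zeta_isPrimitiveRoot p).norm'_eq_one (NeZero.ne p), one_pow]
  rw [← Complex.inv_eq_conj h2]
  exact inv_eq_of_mul_eq_one_right h1

/-- The action on `ℂ` by additive maps for which `σ` is multiplication by `ζ_p` and `τ` is complex
conjugation. -/
def complexRep (p : ℕ) [NeZero p] : Representation ℤ (DihedralGroup p) ℂ where
  toFun
    | .r i => LinearMap.mulLeft ℤ (zeta p ^ i.val)
    | .sr i => (Complex.conjAe.toLinearMap.restrictScalars ℤ) ∘ₗ
        LinearMap.mulLeft ℤ (zeta p ^ i.val)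
  map_one' := by
    change LinearMap.mulLeft ℤ (zeta p ^ (0 : ZMod p).val) = 1
    ext; simp
  map_mul' := by
    rintro (i | i) (j | j)
    · ext z; simp [zeta_pow_val_add]
    · ext z
      simp [sub_eq_add_neg, zeta_pow_val_add, ← zeta_pow_val_neg, -map_pow]
      ring
    · ext z; simp [zeta_pow_val_add]
    · ext z
      simp [sub_eq_add_neg, zeta_pow_val_add, ← zeta_pow_val_neg, -map_pow]
      ring

/-- The ring `R = ℤ[ζ_p]`. -/
abbrev ringR (p : ℕ) : Subalgebra ℤ ℂ := Algebra.adjoin ℤ {zeta p}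

lemma zeta_mem (p : ℕ) : zeta p ∈ ringR p := Algebra.subset_adjoin rfl

lemma conj_mem (p : ℕ) [NeZero p] {z : ℂ} (hz : z ∈ ringR p) : starRingEnd ℂ z ∈ ringR p := by
  have h : starRingEnd ℂ (zeta p) = zeta p ^ (p - 1) := by
    rw [← Complex.inv_eq_conj ((zeta_isPrimitiveRoot p).norm'_eq_one (NeZero.ne p))]
    refine inv_eq_of_mul_eq_one_right ?_
    rw [← pow_succ', Nat.sub_add_cancel (NeZero.pos p), (zeta_isPrimitiveRoot p).pow_eq_one]
  induction hz using Algebra.adjoin_induction with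
  | mem x hx =>
    rw [Set.mem_singleton_iff.1 hx, h]
    exact pow_mem (zeta_mem p) _
  | algebraMap r =>
    simp
  | add x y _ _ hx hy => rw [map_add]; exact add_mem hx hy
  | mul x y _ _ hx hy => rw [map_mul]; exact mul_mem hx hy

/-- `R = ℤ[ζ_p]`, on which `σ` acts as multiplication by `ζ_p` and `τ` as complex conjugation. -/
def subR (p : ℕ) [NeZero p] : Subrepresentation (complexRep p) where
  toSubmodule := Subalgebra.toSubmodule (ringR p)
  apply_mem_toSubmodule := by
    rintro (i | i) v hv
    · exact (ringR p).mul_mem (pow_mem (zeta_mem p) _) hv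
    · exact conj_mem p ((ringR p).mul_mem (pow_mem (zeta_mem p) _) hv)

/-- The ideal `P = (1 - ζ_p) R`, as a submodule of `R` stable under `σ` and `τ`. -/
def subP (p : ℕ) [NeZero p] : Subrepresentation (complexRep p) where
  toSubmodule := (Subalgebra.toSubmodule (ringR p)).map (LinearMap.mulLeft ℤ (1 - zeta p))
  apply_mem_toSubmodule := by
    rintro (i | i) v ⟨a, ha, rfl⟩
    · refine ⟨zeta p ^ i.val * a, (ringR p).mul_mem (pow_mem (zeta_mem p) _) ha, ?_⟩
      change (1 - zeta p) * (zeta p ^ i.val * a) = zeta p ^ i.val * ((1 - zeta p) * a)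
      ring
    · have hc := conj_mem p (zeta_mem p)
      have h1 : zeta p * starRingEnd ℂ (zeta p) = 1 := by
        rw [← Complex.inv_eq_conj ((zeta_isPrimitiveRoot p).norm'_eq_one (NeZero.ne p))]
        exact mul_inv_cancel₀ ((zeta_isPrimitiveRoot p).ne_zero (NeZero.ne p))
      refine ⟨-(starRingEnd ℂ (zeta p) * starRingEnd ℂ (zeta p ^ i.val * a)),
        (ringR p).neg_mem ((ringR p).mul_mem hc (conj_mem p ((ringR p).mul_mem (pow_mem (zeta_mem p) _) ha))), ?_⟩
      change (1 - zeta p) * -(starRingEnd ℂ (zeta p) * starRingEnd ℂ (zeta p ^ i.val * a)) =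
        starRingEnd ℂ (zeta p ^ i.val * ((1 - zeta p) * a))
      simp only [map_mul, map_sub, map_one]
      linear_combination (starRingEnd ℂ (zeta p ^ i.val) * starRingEnd ℂ a) * h1

instance (p : ℕ) [NeZero p] : Module.Finite ℤ (subR p).toSubmodule :=
  Module.Finite.iff_fg.2
    ((zeta_isPrimitiveRoot p).isIntegral (NeZero.pos p)).fg_adjoin_singleton

instance (p : ℕ) [NeZero p] : Module.Finite ℤ (subP p).toSubmodule :=
  Module.Finite.iff_fg.2
    (((zeta_isPrimitiveRoot p).isIntegral (NeZero.pos p)).fg_adjoin_singleton.map _)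

/-- The lattice `R`. -/
abbrev latticeR (p : ℕ) [NeZero p] : GLattice.{0, 0} (DihedralGroup p) :=
  { carrier := (subR p).toSubmodule
    ρ := (subR p).toRepresentation }

/-- The lattice `P`. -/
abbrev latticeP (p : ℕ) [NeZero p] : GLattice.{0, 0} (DihedralGroup p) :=
  { carrier := (subP p).toSubmodule
    ρ := (subP p).toRepresentation }

/-- `V`, `X`, `Y₀`, `Y₁`, `Y₂` are non-split extensions
`0 → P → V → ℤ → 0`, `0 → R → X → ℤ_- → 0`, `0 → R → Y₀ → ℤ[H] → 0`, `0 → P → Y₁ → ℤ[H] → 0` and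
`0 → R ⊕ P → Y₂ → ℤ[H] → 0`, the last one with `Y₂` indecomposable. -/
structure AreNonsplitExtensions (p : ℕ) [NeZero p]
    (V X Y₀ Y₁ Y₂ : GLattice.{0, 0} (DihedralGroup p)) : Prop where
  extV : IsNonsplitExtension (latticeP p) V (latticeZ p)
  extX : IsNonsplitExtension (latticeR p) X (latticeZMinus p)
  extY₀ : IsNonsplitExtension (latticeR p) Y₀ (latticeZH p)
  extY₁ : IsNonsplitExtension (latticeP p) Y₁ (latticeZH p)
  extY₂ : IsNonsplitExtension (directSum (latticeR p) (latticeP p)) Y₂ (latticeZH p)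
  indecY₂ : IsIndecomposable Y₂

/-- The list `ℤ, ℤ_-, ℤ[H], R, P, V, X, Y₀, Y₁, Y₂`. -/
def tenLattices (p : ℕ) [NeZero p] (V X Y₀ Y₁ Y₂ : GLattice.{0, 0} (DihedralGroup p)) :
    Fin 10 → GLattice.{0, 0} (DihedralGroup p) :=
  ![latticeZ p, latticeZMinus p, latticeZH p, latticeR p, latticeP p, V, X, Y₀, Y₁, Y₂]

/-! ### Stable rationality and tori -/

/-- The field `L` is stably rational over `k`: `L(Y₁, …, Y_m) ≃ k(X₁, …, X_n)` over `k` for some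
`m` and `n`. -/
def IsStablyRational (k : Type u) [Field k] (L : Type v) [CommRing L] [Algebra k L] : Prop :=
  ∃ m n : ℕ, Nonempty
    (FractionRing (MvPolynomial (Fin m) L) ≃ₐ[k] FractionRing (MvPolynomial (Fin n) k))

/-- The field `K(M)`: the fraction field of the group algebra `K[M]` of the lattice `M`. A basis
`e₁, …, e_n` of `M` identifies `K[M]` with `K[x₁^±¹, …, x_n^±¹]` and `K(M)` with
`K(x₁, …, x_n)`. -/
abbrev LatticeField {G : Type v} [Group G] (K : Type u) [Field K] (M : GLattice.{v, w} G) :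
    Type (max u w) :=
  FractionRing (AddMonoidAlgebra K M)

/-- The additive automorphism of `M` given by `g`. -/
def actAddEquiv {G : Type v} [Group G] (M : GLattice.{v, w} G) (g : G) : M ≃+ M where
  toFun := M.ρ g
  invFun := M.ρ g⁻¹
  left_inv x := by simp
  right_inv x := by simp
  map_add' := map_add _

/-- The automorphism of `K(M)` extending `a x^m ↦ s(a) x^(g m)`, for `s ∈ Gal(K/k)` and `g ∈ G`. -/
def latticeFieldAut {G : Type v} [Group G] {k : Type*} [Field k] {K : Type u} [Field K]
    [Algebra k K] (M : GLattice.{v, w} G) (s : Gal(K/k)) (g : G) : LatticeField K M ≃+* LatticeField K M :=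
  IsFractionRing.ringEquivOfRingEquiv
    ((AddMonoidAlgebra.mapRingEquiv M s.toRingEquiv).trans
      (AddMonoidAlgebra.mapDomainRingEquiv K (actAddEquiv M g)))

/-- The fixed field `K(M)^G`, where `G` acts on `K` through the isomorphism `e : G ≃* Gal(K/k)` and
on `M` as given. -/
def fixedField {G : Type v} [Group G] {k : Type*} [Field k] {K : Type u} [Field K]
    [Algebra k K] (e : G ≃* Gal(K/k)) (M : GLattice.{v, w} G) : Subalgebra k (LatticeField K M) where
  carrier := {x | ∀ g : G, latticeFieldAut M (e g) g x = x}
  mul_mem' hx hy g := by rw [map_mul, hx g, hy g]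
  add_mem' hx hy g := by rw [map_add, hx g, hy g]
  algebraMap_mem' a g := by
    rw [IsScalarTower.algebraMap_apply k (AddMonoidAlgebra K M) (LatticeField K M),
      latticeFieldAut, IsFractionRing.ringEquivOfRingEquiv_algebraMap]
    congr 1
    simp [AddMonoidAlgebra.coe_algebraMap]

/-- The affine algebraic group `T = Spec A` over `k`, given by the commutative Hopf algebra `A`, is
a torus that splits over `K`: `T ×_k K` is isomorphic to `𝔾_m^d` as a group over `K` for some `d`.
The coordinate Hopf algebra of `𝔾_m^d` over `K` is the group algebra `K[ℤ^d]`. -/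
def IsTorusSplitBy (k : Type u) [Field k] (K : Type v) [Field K] [Algebra k K]
    (A : Type w) [CommRing A] [HopfAlgebra k A] : Prop :=
  ∃ d : ℕ, Nonempty (K ⊗[k] A ≃ₐc[K] AddMonoidAlgebra K (Fin d → ℤ))

end

end DihedralTori

/-!
# Tori split by a dihedral extension of degree `2p`

Let `N` be the norm `1 + σ + ⋯ + σ^(p-1)` on a lattice `M`. Its kernel `E` (`sigmaKer`) is a torsion-free
module over `R = ℤ[ζ_p]` with a semilinear involution `τ`, the quotient `F = M / E` (`SigmaQuot`) is a
lattice on which `σ` is trivial, so that only an involution remains, and the map `σ - 1` induces the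
extension class, an anti-equivariant map `F → E / (1 - ζ)`. Since `R` contains an element with
`θ + θ̄ = 1`, nothing else obstructs: maps of the two parts that respect the class modulo `1 - ζ` come
from maps of lattices (`exists_map_of_compatible`).

The involution on `F` is elementary: a nonzero `F` has a summand `ℤ`, `ℤ_-` or `ℤ[C₂]`
(`exists_involution_summand`). On `E`, an eigenvector of `τ` modulo `1 - ζ` can be lifted to the generator
of a summand `R` or `P`. This is where `h_p⁺ = 1` enters, through the fact that an ideal of `R`
that is stable under complex conjugation and prime to `1 - ζ` is generated by a real element
(`exists_real_generator`), together with the cyclotomic units, which realize all residues modulo `1 - ζ`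
by real units (`exists_real_unit`). The `τ`-eigenparts of one value of the extension class thus generate a
summand of `E` (`exists_eigenSplitting`) of rank at most two. If `M` is indecomposable, it follows that
`E` is `R ε₊ ⊕ R ε₋` with one or both summands possibly zero, and that the generator of `F` has the class
`ε₊ + ε₋` (`exists_normalForm`). Such a lattice is determined by four yes-or-no invariants
(`latticeType`, `NormalForm.nonempty_equiv`), which take ten values.

The extensions are realized by functions. `V` is the lattice of functions on the vertices of the `p`-gon,
`X` its twist by the sign, `Y₀ = X ×_{ℤ_-} ℤ[H]`, `Y₁ = V ×_ℤ ℤ[H]` and `Y₂ = ℤ[G]`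
(`areNonsplitExtensions`). A non-split extension of an indecomposable `σ`-trivial lattice by `R` or `P` is
indecomposable, because then `σ - 1` maps onto the kernel; and as the types of all ten lattices are
known, the classification identifies any other choice with these models. The fibre product of two lattices
over `ℤ` becomes their direct sum after adding `ℤ`, if they contain invariant elements of coprime degrees
(`isoLattice_pullback`), which gives `V ⊕ ℤ[H] ≃ Y₁ ⊕ ℤ` and `V ⊕ Y₀ ≃ ℤ[G] ⊕ ℤ`. The lattices `ℤ_-`, `R`, `P`
and `X` have explicit elements of norm zero that are not in the augmentation submodule.

For stable rationality, every lattice fits into an exact sequence `0 → M ⊕ Q₀ → P → Q → 0` with permutation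
lattices `Q₀`, `P` and `Q` (`hasPermutationResolution`); by the classification this has to be checked for
ten lattices. Adjoining to a field of monomials further monomials that `G` permutes modulo the old ones
is a purely transcendental extension on the level of invariants, by the no-name lemma
(`isPurelyTranscendental_invariants`). Hence `K(P)^G` is purely transcendental over
`K(M ⊕ Q₀)^G`, which is so over `K(M)^G`, and it is rational over `k` since `P` is a permutation lattice
(`HasPermutationResolution.isStablyRational`). Finally, the units of the group algebra `K[ℤ^d]` are monomials,
so that the Galois action on the split coordinate ring of a torus comes from an action on its
characters, and Galois descent identifies the function field with `K(M)^G` for the character lattice `M`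
(`nonempty_functionField_equiv`).
-/


set_option linter.unusedSectionVars false

namespace DihedralTori

noncomputable section

/-! ### Arithmetic of `ℤ[ζ_p]` -/

section Arithmetic

variable (p : ℕ)

/-- The root of unity `ζ_p` as an element of `R = ℤ[ζ_p]`. -/
def zetaR : ringR p := ⟨zeta p, zeta_mem p⟩

variable [NeZero p]

/-- Complex conjugation on `R = ℤ[ζ_p]`. -/
def conjR : ringR p →+* ringR p where
  toFun x := ⟨starRingEnd ℂ x, conj_mem p x.2⟩
  map_one' := by ext; simp
  map_mul' x y := by ext; simp
  map_zero' := by ext; simp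
  map_add' x y := by ext; simp

lemma coe_conjR (x : ringR p) : (conjR p x : ℂ) = starRingEnd ℂ x := rfl

@[simp] lemma conjR_conjR (x : ringR p) : conjR p (conjR p x) = x := by
  ext; simp [coe_conjR]

lemma zetaR_pow_p : zetaR p ^ p = 1 := by
  ext; simpa [zetaR] using (zeta_isPrimitiveRoot p).pow_eq_one

lemma zetaR_mul_conj : zetaR p * conjR p (zetaR p) = 1 := by
  ext
  have := zeta_pow_val_neg p (1 : ZMod p)
  have h1 : zeta p * starRingEnd ℂ (zeta p) = 1 := by
    rw [← Complex.inv_eq_conj ((zeta_isPrimitiveRoot p).norm'_eq_one (NeZero.ne p))]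
    exact mul_inv_cancel₀ ((zeta_isPrimitiveRoot p).ne_zero (NeZero.ne p))
  simpa [zetaR, coe_conjR] using h1

lemma conj_mul_zetaR : conjR p (zetaR p) * zetaR p = 1 := by
  rw [mul_comm, zetaR_mul_conj]

lemma ringR_induction {P : ringR p → Prop} (hζ : P (zetaR p)) (hi : ∀ n : ℤ, P n)
    (ha : ∀ x y, P x → P y → P (x + y)) (hm : ∀ x y, P x → P y → P (x * y)) (x : ringR p) :
    P x := by
  obtain ⟨x, hx⟩ := x
  induction hx using Algebra.adjoin_induction with
  | mem x hx => obtain rfl := Set.mem_singleton_iff.1 hx; exact hζ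
  | algebraMap r => exact hi r
  | add x y hx hy h1 h2 => exact ha _ _ h1 h2
  | mul x y hx hy h1 h2 => exact hm _ _ h1 h2

/-- `R / (1 - ζ)` is generated by `1` as an additive group. -/
lemma exists_int_dvd_sub (x : ringR p) : ∃ n : ℤ, (1 - zetaR p) ∣ x - n := by
  induction x using ringR_induction with
  | hζ => exact ⟨1, -1, by push_cast; ring⟩
  | hi n => exact ⟨n, by simp⟩
  | ha x y hx hy =>
    obtain ⟨a, ha⟩ := hx
    obtain ⟨b, hb⟩ := hy
    exact ⟨a + b, by push_cast; convert dvd_add ha hb using 1; ring⟩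
  | hm x y hx hy =>
    obtain ⟨a, ha⟩ := hx
    obtain ⟨b, hb⟩ := hy
    refine ⟨a * b, ?_⟩
    have : x * y - ((a * b : ℤ) : ringR p) = (x - a) * y + a * (y - b) := by push_cast; ring
    rw [this]
    exact dvd_add (ha.mul_right _) (hb.mul_left _)

/-- Complex conjugation is trivial modulo `1 - ζ`. -/
lemma dvd_conj_sub (x : ringR p) : (1 - zetaR p) ∣ conjR p x - x := by
  induction x using ringR_induction with
  | hζ =>
    refine ⟨conjR p (zetaR p) * (1 + zetaR p), ?_⟩
    linear_combination (zetaR p) * (conj_mul_zetaR p)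
  | hi n => simp
  | ha x y hx hy => rw [map_add]; convert dvd_add hx hy using 1; ring
  | hm x y hx hy =>
    rw [map_mul]
    convert dvd_add (hx.mul_right (conjR p y)) (hy.mul_left x) using 1; ring

lemma dvd_conj {x : ringR p} (h : (1 - zetaR p) ∣ x) : (1 - zetaR p) ∣ conjR p x := by
  have := dvd_add (dvd_conj_sub p x) h
  simpa using this

variable [hpp : Fact p.Prime]

lemma aeval_zetaR (f : Polynomial ℤ) :
    ((Polynomial.aeval (zetaR p) f : ringR p) : ℂ) = Polynomial.aeval (zeta p) f := by
  rw [← Subalgebra.coe_val, ← Polynomial.aeval_algHom_apply]; rfl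

lemma aeval_zetaR_surjective (x : ringR p) : ∃ f : Polynomial ℤ, Polynomial.aeval (zetaR p) f = x := by
  have := x.2
  simp only [Algebra.adjoin_singleton_eq_range_aeval] at this
  obtain ⟨f, hf⟩ := this
  exact ⟨f, Subtype.ext (by rw [aeval_zetaR]; exact hf)⟩

lemma cyclotomic_dvd_of_aeval {f : Polynomial ℤ} (h : Polynomial.aeval (zetaR p) f = 0) :
    Polynomial.cyclotomic p ℤ ∣ f := by
  have hz := zeta_isPrimitiveRoot p
  rw [Polynomial.cyclotomic_eq_minpoly hz (NeZero.pos p)]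
  refine minpoly.isIntegrallyClosed_dvd (hz.isIntegral (NeZero.pos p)) ?_
  rw [← aeval_zetaR, h]; rfl

lemma aeval_cyclotomic_zetaR : Polynomial.aeval (zetaR p) (Polynomial.cyclotomic p ℤ) = 0 := by
  have hz := zeta_isPrimitiveRoot p
  ext
  rw [aeval_zetaR, Polynomial.cyclotomic_eq_minpoly hz (NeZero.pos p), minpoly.aeval]; rfl

lemma dvd_natCast_self : (1 - zetaR p) ∣ (p : ringR p) := by
  -- `p = Φ_p(1)`, and `X - 1` divides `Φ_p - Φ_p(1)`
  have h1 : (Polynomial.X - Polynomial.C (1 : ℤ)) ∣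
      Polynomial.cyclotomic p ℤ - Polynomial.C ((Polynomial.cyclotomic p ℤ).eval 1) :=
    Polynomial.X_sub_C_dvd_sub_C_eval
  rw [Polynomial.eval_one_cyclotomic_prime] at h1
  obtain ⟨g, hg⟩ := h1
  have := congrArg (Polynomial.aeval (zetaR p)) hg
  simp only [map_sub, map_mul, aeval_cyclotomic_zetaR, Polynomial.aeval_X, map_natCast, map_one]
    at this
  exact ⟨Polynomial.aeval (zetaR p) g, by linear_combination -this⟩

/-- The quotient `R / (1 - ζ)` has `p` elements. -/
lemma dvd_intCast_iff (n : ℤ) : (1 - zetaR p) ∣ (n : ringR p) ↔ (p : ℤ) ∣ n := by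
  constructor
  · rintro ⟨x, hx⟩
    obtain ⟨g, rfl⟩ := aeval_zetaR_surjective p x
    have h0 : Polynomial.aeval (zetaR p) (Polynomial.C n - (1 - Polynomial.X) * g) = 0 := by
      simp [hx]
    obtain ⟨q, hq⟩ := cyclotomic_dvd_of_aeval p h0
    have := congrArg (Polynomial.eval 1) hq
    simp only [Polynomial.eval_sub, Polynomial.eval_C, Polynomial.eval_mul, Polynomial.eval_one,
      Polynomial.eval_X, sub_self, zero_mul, sub_zero, Polynomial.eval_one_cyclotomic_prime] at this
    exact ⟨_, this⟩
  · rintro ⟨k, rfl⟩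
    push_cast
    exact (dvd_natCast_self p).mul_right _

lemma one_sub_zetaR_ne_zero : (1 - zetaR p) ≠ 0 := by
  intro h
  have : (1 : ℂ) - zeta p = 0 := congrArg Subtype.val h
  exact (zeta_isPrimitiveRoot p).ne_one hpp.out.one_lt (by linear_combination -this)

lemma one_sub_zetaR_prime : Prime (1 - zetaR p) := by
  refine ⟨one_sub_zetaR_ne_zero p, fun h => ?_, fun x y h => ?_⟩
  · have : (1 - zetaR p) ∣ ((1 : ℤ) : ringR p) := by simpa using h.dvd
    rw [dvd_intCast_iff] at this
    exact hpp.out.one_lt.ne' (by exact_mod_cast Int.natCast_dvd_natCast.1 this |> Nat.dvd_one.1)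
  · obtain ⟨a, ha⟩ := exists_int_dvd_sub p x
    obtain ⟨b, hb⟩ := exists_int_dvd_sub p y
    have h2 : (1 - zetaR p) ∣ ((a * b : ℤ) : ringR p) := by
      have : ((a * b : ℤ) : ringR p) = x * y - ((x - a) * y + a * (y - b)) := by push_cast; ring
      rw [this]
      exact dvd_sub h (dvd_add (ha.mul_right _) (hb.mul_left _))
    rw [dvd_intCast_iff] at h2
    rcases (Nat.prime_iff_prime_int.1 hpp.out).dvd_or_dvd h2 with h3 | h3
    · left; have := dvd_add ha ((dvd_intCast_iff p a).2 h3); simpa using this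
    · right; have := dvd_add hb ((dvd_intCast_iff p b).2 h3); simpa using this

lemma one_sub_zetaR_pow_dvd {m : ℕ} (hm : m.Coprime p) :
    (1 - zetaR p ^ m) ∣ (1 - zetaR p) := by
  obtain ⟨k, -, hk⟩ := Nat.exists_mul_mod_eq_one_of_coprime hm hpp.out.one_lt
  have h1 : zetaR p ^ (m * k) = zetaR p := by
    rw [← Nat.mod_add_div (m * k) p, hk, pow_add, pow_mul, zetaR_pow_p]; simp
  have := sub_dvd_pow_sub_pow (1 : ringR p) (zetaR p ^ m) k
  rwa [one_pow, ← pow_mul, h1] at this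

/-- The anti-invariant generator `ζ - ζ⁻¹` of the prime ideal `(1 - ζ)`. -/
def deltaR : ringR p := zetaR p - conjR p (zetaR p)

omit hpp in
lemma conj_deltaR : conjR p (deltaR p) = - deltaR p := by simp [deltaR]

variable (hp : p ≠ 2)
include hp

lemma two_coprime : Nat.Coprime 2 p :=
  (Nat.coprime_primes Nat.prime_two hpp.out).2 hp.symm

lemma deltaR_associated : Associated (deltaR p) (1 - zetaR p) := by
  have hu : deltaR p = (1 - zetaR p ^ 2) * (- conjR p (zetaR p)) := by
    rw [deltaR]; linear_combination (-zetaR p) * (zetaR_mul_conj p)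
  refine associated_of_dvd_dvd ?_ ?_
  · rw [hu]
    have := one_sub_zetaR_pow_dvd p (two_coprime p hp)
    have h2 : IsUnit (- conjR p (zetaR p)) := (IsUnit.of_mul_eq_one _ (conj_mul_zetaR p)).neg
    rwa [h2.mul_right_dvd]
  · rw [hu]
    exact Dvd.dvd.mul_right ⟨1 + zetaR p, by ring⟩ _

lemma deltaR_dvd_iff (x : ringR p) : deltaR p ∣ x ↔ (1 - zetaR p) ∣ x :=
  (deltaR_associated p hp).dvd_iff_dvd_left

lemma deltaR_ne_zero : deltaR p ≠ 0 :=
  (deltaR_associated p hp).ne_zero_iff.2 (one_sub_zetaR_ne_zero p)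

lemma eq_zero_of_conj_deltaR {b : ringR p} (h : conjR p (deltaR p * b) = - (deltaR p * b)) :
    conjR p b = b := by
  rw [map_mul, conj_deltaR] at h
  exact mul_left_cancel₀ (deltaR_ne_zero p hp) (by linear_combination -h)

omit hp in
lemma deltaR_dvd_sub_conj (x : ringR p) : deltaR p ∣ x - conjR p x := by
  induction x using ringR_induction with
  | hζ => exact dvd_rfl
  | hi n => simp
  | ha x y hx hy => rw [map_add]; convert dvd_add hx hy using 1; ring
  | hm x y hx hy =>
    rw [map_mul]
    convert dvd_add (hx.mul_right y) (hy.mul_left (conjR p x)) using 1; ring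

omit hp in
/-- `R = R₀ ⊕ R₀ ζ`, where `R₀` is the ring of real elements of `R`. -/
lemma exists_real_coordinates (hp : p ≠ 2) (x : ringR p) : ∃ a b : ringR p, conjR p a = a ∧ conjR p b = b ∧
    x = a + b * zetaR p ∧ x - conjR p x = deltaR p * b := by
  obtain ⟨b, hb⟩ := deltaR_dvd_sub_conj p x
  have hb' : conjR p b = b := by
    apply eq_zero_of_conj_deltaR p hp
    rw [← hb]; simp
  refine ⟨x - b * zetaR p, b, ?_, hb', by ring, hb⟩
  rw [map_sub, map_mul, hb']
  rw [deltaR] at hb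
  linear_combination -hb

lemma exists_two_mul : ∃ k : ℤ, (p : ℤ) ∣ 2 * k - 1 := by
  have := hpp.out.odd_of_ne_two hp
  obtain ⟨m, hm⟩ := this
  exact ⟨m + 1, 1, by push_cast [hm]; ring⟩

lemma deltaR_dvd_of_anti {x : ringR p} (h : conjR p x = -x) : deltaR p ∣ x := by
  obtain ⟨k, l, hk⟩ := exists_two_mul p hp
  have h1 := deltaR_dvd_sub_conj p x
  rw [h] at h1
  have h2 : deltaR p ∣ (p : ringR p) := (deltaR_dvd_iff p hp _).2 (dvd_natCast_self p)
  have hk' : 2 * (k : ringR p) - 1 = p * l := by exact_mod_cast congrArg (Int.cast : ℤ → ringR p) hk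
  have : x = (x - -x) * k - p * (l * x) := by linear_combination (-x) * hk'
  rw [this]
  exact dvd_sub (h1.mul_right _) (h2.mul_right _)

omit hp in
/-- The trace from `R` to its real subring is surjective: `R` is tamely ramified over it. -/
lemma exists_trace_eq_one (hp : p ≠ 2) : ∃ θ : ringR p, θ + conjR p θ = 1 := by
  obtain ⟨m, hm⟩ := hpp.out.odd_of_ne_two hp
  have hc : ∀ i, i ≤ p → conjR p (zetaR p ^ i) = zetaR p ^ (p - i) := by
    intro i hi
    have h1 : zetaR p ^ i * conjR p (zetaR p ^ i) = 1 := by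
      rw [map_pow, ← mul_pow, zetaR_mul_conj, one_pow]
    have h2 : zetaR p ^ (p - i) * zetaR p ^ i = 1 := by
      rw [← pow_add, Nat.sub_add_cancel hi, zetaR_pow_p]
    calc _ = (zetaR p ^ (p - i) * zetaR p ^ i) * conjR p (zetaR p ^ i) := by rw [h2, one_mul]
      _ = _ := by rw [mul_assoc, h1, mul_one]
  have hsum : ∑ i ∈ Finset.range p, zetaR p ^ i = 0 := by
    have := aeval_cyclotomic_zetaR p
    rw [Polynomial.cyclotomic_prime] at this
    simpa using this
  -- `0 = ∑ ζ^i` pairs off into `1` and the conjugates `ζ^i`, `ζ^(p - i)` for `0 < i ≤ (p - 1) / 2`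
  refine ⟨-∑ i ∈ Finset.range m, zetaR p ^ (i + 1), ?_⟩
  have h3 : ∑ i ∈ Finset.range m, conjR p (zetaR p ^ (i + 1)) =
      ∑ i ∈ Finset.range m, zetaR p ^ (m + i + 1) := by
    rw [← Finset.sum_range_reflect]
    refine Finset.sum_congr rfl fun i hi => ?_
    have := Finset.mem_range.1 hi
    rw [hc _ (by omega)]
    congr 1; omega
  have h4 : ∑ i ∈ Finset.range p, zetaR p ^ i = 1 + (∑ i ∈ Finset.range m, zetaR p ^ (i + 1) +
      ∑ i ∈ Finset.range m, zetaR p ^ (m + i + 1)) := by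
    have e : ∀ k, k = 2 * m + 1 → ∑ i ∈ Finset.range k, zetaR p ^ i =
        ∑ i ∈ Finset.range (m + m + 1), zetaR p ^ i := by rintro _ rfl; rw [two_mul]
    rw [e p hm, Finset.sum_range_succ', Finset.sum_range_add, pow_zero, add_comm]
  rw [map_neg, map_sum, h3]
  rw [h4] at hsum
  linear_combination -hsum

/-- Cyclotomic units: the real units of `R` represent all nonzero classes modulo `1 - ζ`. -/
lemma exists_real_unit {n : ℤ} (hn : ¬ (p : ℤ) ∣ n) :
    ∃ u : ringR p, IsUnit u ∧ conjR p u = u ∧ (1 - zetaR p) ∣ u - n := by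
  obtain ⟨m, hm⟩ : ∃ m : ℕ, (p : ℤ) ∣ n - m := by
    refine ⟨(n % p).toNat, ?_⟩
    rw [Int.toNat_of_nonneg (Int.emod_nonneg _ (by exact_mod_cast hpp.out.ne_zero))]
    exact Int.dvd_self_sub_emod
  have hm' : m.Coprime p := by
    rw [Nat.coprime_comm, hpp.out.coprime_iff_not_dvd]
    intro h
    exact hn (by simpa using dvd_add hm (Int.natCast_dvd_natCast.2 h))
  set z := zetaR p
  set c := conjR p (zetaR p) with hc
  have hu : deltaR p * ∑ i ∈ Finset.range m, z ^ i * c ^ (m - 1 - i) = z ^ m - c ^ m := by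
    rw [mul_comm, deltaR]; exact (Commute.all _ _).geom_sum₂_mul m
  -- the real unit `(ζ^m - ζ^(-m)) / (ζ - ζ⁻¹)`, which is congruent to `m`
  refine ⟨∑ i ∈ Finset.range m, z ^ i * c ^ (m - 1 - i), ?_, ?_, ?_⟩
  · obtain ⟨k, -, hk⟩ := Nat.exists_mul_mod_eq_one_of_coprime hm' hpp.out.one_lt
    have h1 : z ^ (m * k) = z := by
      rw [← Nat.mod_add_div (m * k) p, hk, pow_add, pow_mul, zetaR_pow_p]; simp
    have h2 : c ^ (m * k) = c := by rw [hc, ← map_pow, h1]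
    have h3 := sub_dvd_pow_sub_pow (z ^ m) (c ^ m) k
    rw [← pow_mul, ← pow_mul, h1, h2, ← hu] at h3
    obtain ⟨y, hy⟩ := h3
    refine IsUnit.of_mul_eq_one y (mul_left_cancel₀ (deltaR_ne_zero p hp) ?_)
    rw [mul_one, ← mul_assoc]; exact hy.symm
  · apply eq_zero_of_conj_deltaR p hp
    rw [hu]; simp [hc, z]
  · have hz : (1 - z) ∣ z - 1 := ⟨-1, by ring⟩
    have hc1 : (1 - z) ∣ c - 1 := ⟨c, by linear_combination (conj_mul_zetaR p)⟩
    have key : (1 - z) ∣ ∑ i ∈ Finset.range m, z ^ i * c ^ (m - 1 - i) - (m : ringR p) := by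
      have : (m : ringR p) = ∑ i ∈ Finset.range m, 1 := by simp
      rw [this, ← Finset.sum_sub_distrib]
      refine Finset.dvd_sum fun i _ => ?_
      have e : z ^ i * c ^ (m - 1 - i) - 1 =
        (z ^ i - 1) * c ^ (m - 1 - i) + (c ^ (m - 1 - i) - 1) := by ring
      rw [e]
      refine dvd_add (Dvd.dvd.mul_right (hz.trans ?_) _) (hc1.trans ?_)
      · simpa using sub_dvd_pow_sub_pow z 1 i
      · simpa using sub_dvd_pow_sub_pow c 1 (m - 1 - i)
    have h5 := (dvd_intCast_iff p (n - m)).2 hm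
    have := dvd_sub key h5
    convert this using 1; push_cast; ring

end Arithmetic

/-! ### Ideals of `ℤ[ζ_p]` stable under complex conjugation -/

section ClassGroup

variable (p : ℕ) [hpp : Fact p.Prime]

/-- The field `ℚ(ζ_p)` inside `ℂ`. -/
abbrev CycField : IntermediateField ℚ ℂ := IntermediateField.adjoin ℚ {zeta p}

instance : IsCyclotomicExtension {p} ℚ (CycField p) := by
  change IsCyclotomicExtension {p} ℚ (CycField p).toSubalgebra
  rw [IntermediateField.adjoin_simple_toSubalgebra_of_isAlgebraic
    ((zeta_isPrimitiveRoot p).isIntegral (NeZero.pos p)).tower_top.isAlgebraic]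
  exact (zeta_isPrimitiveRoot p).adjoin_isCyclotomicExtension ℚ

lemma ringR_le_cycField {x : ℂ} (hx : x ∈ ringR p) : x ∈ CycField p := by
  have : ringR p ≤ (CycField p).toSubalgebra.restrictScalars ℤ := by
    rw [Algebra.adjoin_le_iff, Set.singleton_subset_iff]
    exact IntermediateField.mem_adjoin_simple_self ℚ (zeta p)
  exact this hx

lemma mem_ringR_of_isIntegral {x : ℂ} (hx : x ∈ CycField p) (hi : IsIntegral ℤ x) : x ∈ ringR p := by
  set z : CycField p := ⟨zeta p, IntermediateField.mem_adjoin_simple_self ℚ _⟩ with hz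
  have hzp : IsPrimitiveRoot z p :=
    IsPrimitiveRoot.of_map_of_injective (f := algebraMap (CycField p) ℂ)
      (zeta_isPrimitiveRoot p) (algebraMap (CycField p) ℂ).injective
  have hint := IsCyclotomicExtension.Rat.isIntegralClosure_adjoin_singleton_of_prime hzp
  have hx' : IsIntegral ℤ (⟨x, hx⟩ : CycField p) :=
    (isIntegral_algHom_iff (IsScalarTower.toAlgHom ℤ (CycField p) ℂ)
      (algebraMap (CycField p) ℂ).injective).1 hi
  obtain ⟨y, hy⟩ := hint.isIntegral_iff.1 hx'
  have h2 : (Algebra.adjoin ℤ {z}).map (IsScalarTower.toAlgHom ℤ (CycField p) ℂ) = ringR p := by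
    rw [AlgHom.map_adjoin_singleton]; rfl
  rw [← h2]
  exact ⟨y, y.2, congrArg Subtype.val hy⟩

lemma isIntegral_of_mem_ringR {x : ℂ} (hx : x ∈ ringR p) : IsIntegral ℤ x := by
  have := Algebra.IsIntegral.adjoin (R := ℤ) (S := {zeta p})
    (fun y hy => by
      rw [Set.mem_singleton_iff.1 hy]
      exact (zeta_isPrimitiveRoot p).isIntegral (NeZero.pos p))
  exact (isIntegral_algHom_iff (ringR p).val Subtype.val_injective).2 (this.isIntegral ⟨x, hx⟩)

instance : IsDedekindDomain (ringR p) := by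
  let i : ringR p →+* CycField p :=
    { toFun x := ⟨x, ringR_le_cycField p x.2⟩
      map_one' := rfl
      map_mul' _ _ := rfl
      map_zero' := rfl
      map_add' _ _ := rfl }
  let _ : Algebra (ringR p) (CycField p) := i.toAlgebra
  have : IsScalarTower ℤ (ringR p) (CycField p) := IsScalarTower.of_algebraMap_eq' (Subsingleton.elim _ _)
  have : FiniteDimensional ℚ (CycField p) := IsCyclotomicExtension.finiteDimensional {p} ℚ _
  have : IsIntegralClosure (ringR p) ℤ (CycField p) :=
    { algebraMap_injective := fun x y h => Subtype.ext (congrArg (Subtype.val : CycField p → ℂ) h)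
      isIntegral_iff := fun {x} => by
        rw [← isIntegral_algHom_iff (IsScalarTower.toAlgHom ℤ (CycField p) ℂ)
          (algebraMap (CycField p) ℂ).injective]
        constructor
        · intro h
          exact ⟨⟨x, mem_ringR_of_isIntegral p x.2 h⟩, rfl⟩
        · rintro ⟨y, rfl⟩
          exact isIntegral_of_mem_ringR p y.2 }
  exact IsIntegralClosure.isDedekindDomain ℤ ℚ (CycField p) (ringR p)

open NumberField in
lemma realInteger_mem (x : 𝓞 (RealCyclotomicField p)) : ((x : RealCyclotomicField p) : ℂ) ∈ ringR p := by
  refine mem_ringR_of_isIntegral p ?_ ?_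
  · have : RealCyclotomicField p ≤ CycField p := by
      rw [IntermediateField.adjoin_le_iff, Set.singleton_subset_iff]
      have := IntermediateField.mem_adjoin_simple_self ℚ (zeta p)
      exact add_mem this (inv_mem this)
    exact this (x : RealCyclotomicField p).2
  · exact (isIntegral_algHom_iff (IsScalarTower.toAlgHom ℤ (RealCyclotomicField p) ℂ)
      (algebraMap (RealCyclotomicField p) ℂ).injective).2 x.isIntegral_coe

open NumberField in
/-- The inclusion of the ring of integers of `ℚ(ζ_p + ζ_p⁻¹)` into `R`. -/
def realIntegerHom : 𝓞 (RealCyclotomicField p) →+* ringR p where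
  toFun x := ⟨x, realInteger_mem p x⟩
  map_one' := rfl
  map_mul' _ _ := rfl
  map_zero' := rfl
  map_add' _ _ := rfl

lemma conj_of_mem_realCyclotomicField {x : ℂ} (hx : x ∈ RealCyclotomicField p) :
    starRingEnd ℂ x = x := by
  have h1 := (zeta_isPrimitiveRoot p).norm'_eq_one (NeZero.ne p)
  induction hx using IntermediateField.adjoin_induction with
  | mem x hx =>
    rw [Set.mem_singleton_iff.1 hx, map_add, map_inv₀, ← Complex.inv_eq_conj h1, inv_inv, add_comm]
  | algebraMap x => simp
  | add x y _ _ hx hy => rw [map_add, hx, hy]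
  | inv x _ hx => rw [map_inv₀, hx]
  | mul x y _ _ hx hy => rw [map_mul, hx, hy]

lemma add_conj_mem (x : ringR p) : (x + starRingEnd ℂ x : ℂ) ∈ RealCyclotomicField p := by
  have h1 := (zeta_isPrimitiveRoot p).norm'_eq_one (NeZero.ne p)
  set t := zeta p + (zeta p)⁻¹ with ht
  have htm : t ∈ RealCyclotomicField p := IntermediateField.mem_adjoin_simple_self ℚ _
  have hz0 := (zeta_isPrimitiveRoot p).ne_zero (NeZero.ne p)
  have hpow : ∀ n : ℕ, zeta p ^ n + (zeta p)⁻¹ ^ n ∈ RealCyclotomicField p ∧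
      zeta p ^ (n + 1) + (zeta p)⁻¹ ^ (n + 1) ∈ RealCyclotomicField p := by
    intro n
    induction n with
    | zero =>
      refine ⟨?_, by simpa using htm⟩
      simpa using add_mem (one_mem (RealCyclotomicField p)) (one_mem _)
    | succ n ih =>
      refine ⟨ih.2, ?_⟩
      have : zeta p ^ (n + 1 + 1) + (zeta p)⁻¹ ^ (n + 1 + 1) =
          t * (zeta p ^ (n + 1) + (zeta p)⁻¹ ^ (n + 1)) - (zeta p ^ n + (zeta p)⁻¹ ^ n) := by
        have hw : zeta p * (zeta p)⁻¹ = 1 := mul_inv_cancel₀ hz0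
        rw [ht]; linear_combination (-(zeta p ^ n + (zeta p)⁻¹ ^ n)) * hw
      rw [this]
      exact sub_mem (mul_mem htm ih.2) ih.1
  obtain ⟨f, rfl⟩ := aeval_zetaR_surjective p x
  rw [aeval_zetaR]
  induction f using Polynomial.induction_on' with
  | add f g hf hg =>
    simp only [map_add]
    convert add_mem hf hg using 1; ring
  | monomial n a =>
    have : Polynomial.aeval (zeta p) (Polynomial.monomial n a) +
        starRingEnd ℂ (Polynomial.aeval (zeta p) (Polynomial.monomial n a)) =
        (a : ℂ) * (zeta p ^ n + (zeta p)⁻¹ ^ n) := by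
      simp [Polynomial.aeval_monomial, ← Complex.inv_eq_conj h1, mul_add]
    rw [this]
    exact mul_mem (intCast_mem _ a) (hpow n).1

open NumberField in
/-- The real elements of `R` are the integers of `ℚ(ζ_p + ζ_p⁻¹)`. -/
lemma exists_realInteger {x : ringR p} (hx : conjR p x = x) : ∃ y, realIntegerHom p y = x := by
  have h2 : (x : ℂ) ∈ RealCyclotomicField p := by
    have h3 := add_conj_mem p x
    rw [← coe_conjR, hx] at h3
    have : (x : ℂ) = (x + x) * (2 : ℂ)⁻¹ := by ring
    rw [this]
    exact mul_mem h3 (inv_mem (ofNat_mem _ 2))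
  have h4 : IsIntegral ℤ (⟨x, h2⟩ : RealCyclotomicField p) :=
    (isIntegral_algHom_iff (IsScalarTower.toAlgHom ℤ (RealCyclotomicField p) ℂ)
      (algebraMap (RealCyclotomicField p) ℂ).injective).1 (isIntegral_of_mem_ringR p x.2)
  exact ⟨⟨_, h4⟩, rfl⟩

lemma conj_realIntegerHom (y) : conjR p (realIntegerHom p y) = realIntegerHom p y :=
  Subtype.ext (conj_of_mem_realCyclotomicField p (y : RealCyclotomicField p).2)

/-- If `h_p⁺ = 1`, an ideal of `R` stable under complex conjugation and not contained in
`(1 - ζ)` is generated by a real element. A generator `c` of the ideal of the real elements `b` with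
`δ b ∈ I`, where `δ = ζ - ζ⁻¹`, divides all of `I` by the decomposition `R = R₀ ⊕ R₀ ζ`, and `c` lies
in `I` because `δ c` does and `I` is prime to `δ`. -/
lemma exists_real_generator (hp : p ≠ 2) (h : hPlus p = 1) (I : Ideal (ringR p))
    (hI : ∀ x ∈ I, conjR p x ∈ I) (hI' : ∃ x ∈ I, ¬ (1 - zetaR p) ∣ x) :
    ∃ c : ringR p, conjR p c = c ∧ I = Ideal.span {c} := by
  have := NumberField.classNumber_eq_one_iff.1 h
  -- the ideal of the real elements `b` with `δ b ∈ I`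
  let J : Ideal (NumberField.RingOfIntegers (RealCyclotomicField p)) :=
    Ideal.comap (realIntegerHom p) (Submodule.comap (LinearMap.mulLeft (ringR p) (deltaR p)) I)
  obtain ⟨c0, hc0⟩ := (IsPrincipalIdealRing.principal J).principal
  have hJ : ∀ b, conjR p b = b → deltaR p * b ∈ I → realIntegerHom p c0 ∣ b := by
    intro b hb hbI
    obtain ⟨y, rfl⟩ := exists_realInteger p hb
    have hy : y ∈ J := hbI
    rw [hc0, Ideal.submodule_span_eq, Ideal.mem_span_singleton] at hy
    exact map_dvd _ hy
  set c := realIntegerHom p c0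
  have hcI : deltaR p * c ∈ I := by
    have : c0 ∈ J := by rw [hc0]; exact Submodule.mem_span_singleton_self c0
    exact this
  have hle : ∀ x ∈ I, c ∣ x := by
    intro x hx
    obtain ⟨a, b, ha, hb, hab, hd⟩ := exists_real_coordinates p hp x
    rw [hab]
    refine dvd_add (hJ a ha ?_) (Dvd.dvd.mul_right (hJ b hb ?_) _)
    · have : deltaR p * a = zetaR p * conjR p x - conjR p (zetaR p) * x := by
        have hx' : conjR p x = a + b * conjR p (zetaR p) := by
          rw [hab]; simp [ha, hb]
        rw [hx', hab, deltaR]; ring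
      rw [this]
      exact sub_mem (I.mul_mem_left _ (hI x hx)) (I.mul_mem_left _ hx)
    · rw [← hd]; exact sub_mem hx (hI x hx)
  refine ⟨c, conj_realIntegerHom p c0, le_antisymm ?_ ?_⟩
  · intro x hx
    exact Ideal.mem_span_singleton.2 (hle x hx)
  · rw [Ideal.span_singleton_le_iff_mem]
    obtain ⟨x, hx, hx'⟩ := hI'
    obtain ⟨y, rfl⟩ := hle x hx
    -- `y` is prime to `1 - ζ`, hence `1` is a combination of `y` and `δ`
    obtain ⟨n, hn⟩ := exists_int_dvd_sub p y
    have hny : ¬ (p : ℤ) ∣ n := by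
      rw [← dvd_intCast_iff]
      intro hd
      have := dvd_add hn hd
      rw [sub_add_cancel] at this
      exact hx' (this.mul_left _)
    obtain ⟨s, t, hst⟩ : IsCoprime n (p : ℤ) :=
      ((Nat.prime_iff_prime_int.1 hpp.out).coprime_iff_not_dvd.2 hny).symm
    have h1 : deltaR p ∣ y * s - 1 := by
      rw [deltaR_dvd_iff p hp]
      have hst' : (s : ringR p) * n + t * p = 1 := by exact_mod_cast congrArg (Int.cast : ℤ → ringR p) hst
      have e : y * s - 1 = (y - n) * s - p * t := by linear_combination hst'
      rw [e]
      exact dvd_sub (hn.mul_right _) ((dvd_natCast_self p).mul_right _)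
    obtain ⟨q, hq⟩ := h1
    have : c = (c * y) * s - deltaR p * c * q := by linear_combination (-c) * hq
    rw [this]
    exact sub_mem (I.mul_mem_right _ hx) (I.mul_mem_right _ hcI)

end ClassGroup

/-! ### Lattices over `R` with a semilinear involution -/

section Semilinear

variable (p : ℕ) [hpp : Fact p.Prime] {E : Type u} [AddCommGroup E] [Module (ringR p) E]

/-- As a finite torsion-free module over a Dedekind domain, `E` is projective, so that functionals detect
whether an element is divisible by `1 - ζ`. -/
lemma exists_functional [Module.Finite (ringR p) E] [Module.IsTorsionFree (ringR p) E]
    {w : E} (hw : ∀ y : E, w ≠ (1 - zetaR p) • y) :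
    ∃ f : E →ₗ[ringR p] ringR p, ¬ (1 - zetaR p) ∣ f w := by
  have : Module.FinitePresentation (ringR p) E := Module.finitePresentation_of_finite _ _
  have hproj : Module.Projective (ringR p) E := Module.Flat.projective_of_finitePresentation
  obtain ⟨s, hs⟩ := Module.projective_def'.1 hproj
  by_contra! hcon
  have h1 : ∀ i, (1 - zetaR p) ∣ s w i := fun i => hcon ((Finsupp.lapply i).comp s)
  choose y hy using h1
  have h2 : w = Finsupp.linearCombination (ringR p) id (s w) := (LinearMap.congr_fun hs w).symm
  rw [Finsupp.linearCombination_apply, Finsupp.sum] at h2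
  refine hw (∑ i ∈ (s w).support, y i • i) ?_
  rw [Finset.smul_sum]
  refine h2.trans (Finset.sum_congr rfl fun i _ => ?_)
  rw [hy i, mul_smul]; rfl

/-- The main construction over `R`: an eigenvector `w` of `τ` modulo `1 - ζ`, for the sign `s`,
spans a direct summand, up to changing `w` modulo `1 - ζ`. The equivariant projection `q` confines
the construction to a direct summand of `E`.

A functional with `f w` prime to `1 - ζ` is symmetrized to an equivariant `r₀`. The image of `r₀` is an
ideal stable under complex conjugation, hence generated by a real element `c`; dividing `r₀` by `c` and
by a real unit yields a functional `r` onto `R` with `r w ≡ 1`. Finally `w` is corrected to an element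
with `r x = 1`, which is made an eigenvector of `τ` by an element of trace one. -/
lemma exists_eigen_summand [Module.Finite (ringR p) E] [Module.IsTorsionFree (ringR p) E]
    (hp : p ≠ 2) (h : hPlus p = 1) (τ : E →+ E) (hτ : ∀ (a : ringR p) x, τ (a • x) = conjR p a • τ x)
    (hτ2 : ∀ x, τ (τ x) = x) {s : ringR p} (hs : s = 1 ∨ s = -1)
    (q : E →ₗ[ringR p] E) (hqτ : ∀ x, q (τ x) = τ (q x)) (hq : ∀ x, q (q x) = q x) {w : E}
    (hqw : ∃ y, w - q w = (1 - zetaR p) • y)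
    (hws : ∃ y, τ w - s • w = (1 - zetaR p) • y) (hw : ∀ y : E, w ≠ (1 - zetaR p) • y) :
    ∃ (r : E →ₗ[ringR p] ringR p) (e : E), (∀ x, r (τ x) = s * conjR p (r x)) ∧ τ e = s • e ∧
      r e = 1 ∧ (∃ y, w - e = (1 - zetaR p) • y) ∧ (∀ x, r (q x) = r x) ∧ q e = e := by
  have hss : s * s = 1 := by rcases hs with rfl | rfl <;> ring
  have hsc : conjR p s = s := by rcases hs with rfl | rfl <;> simp
  obtain ⟨f, hf⟩ := exists_functional p hw
  obtain ⟨yq, hyq⟩ := hqw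
  obtain ⟨ys, hys⟩ := hws
  have hpi := one_sub_zetaR_prime p
  -- the symmetrization of `f ∘ q`
  let r₀ : E →ₗ[ringR p] ringR p :=
    { toFun x := f (q x) + s * conjR p (f (q (τ x)))
      map_add' x y := by simp only [map_add]; ring
      map_smul' a x := by
        simp only [hτ, map_smul, smul_eq_mul, map_mul, conjR_conjR, RingHom.id_apply]; ring }
  have hr₀ : ∀ x, r₀ x = f (q x) + s * conjR p (f (q (τ x))) := fun _ => rfl
  have hr₀τ : ∀ x, r₀ (τ x) = s * conjR p (r₀ x) := by
    intro x
    rw [hr₀, hr₀, hτ2, map_add, map_mul, conjR_conjR, hsc]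
    linear_combination (- f (q (τ x))) * hss
  -- modulo `1 - ζ` the two terms of `r₀ w` agree, and `2` is invertible
  have hr₀w : ¬ (1 - zetaR p) ∣ r₀ w := by
    intro hd
    apply hf
    have h1 : τ w = s • w + (1 - zetaR p) • ys := by rw [← hys]; abel
    have h2 : q w = w - (1 - zetaR p) • yq := by rw [← hyq]; abel
    have h3 : (1 - zetaR p) ∣ f (q w) - f w := by
      rw [h2, map_sub, map_smul]; exact ⟨-f yq, by simp [smul_eq_mul]⟩
    have h4 : (1 - zetaR p) ∣ f (q (τ w)) - s * f w := by
      have : f (q (τ w)) - s * f w = s * (f (q w) - f w) + (1 - zetaR p) * f (q ys) := by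
        rw [h1]; simp only [map_add, map_smul, smul_eq_mul]; ring
      rw [this]
      exact dvd_add (h3.mul_left _) (dvd_mul_right _ _)
    have h5 : (1 - zetaR p) ∣ conjR p (f (q (τ w))) - s * f w := by
      have := dvd_add (dvd_conj_sub p (f (q (τ w)))) h4
      simpa using this
    have h6 : (1 - zetaR p) ∣ 2 * f w := by
      have : 2 * f w = r₀ w - (f (q w) - f w) - s * (conjR p (f (q (τ w))) - s * f w) := by
        rw [hr₀]; linear_combination (- f w) * hss
      rw [this]
      exact dvd_sub (dvd_sub hd h3) (h5.mul_left _)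
    refine (hpi.dvd_or_dvd h6).resolve_left fun h7 => ?_
    have : (1 - zetaR p) ∣ ((2 : ℤ) : ringR p) := by exact_mod_cast h7
    rw [dvd_intCast_iff] at this
    exact hp ((Nat.prime_dvd_prime_iff_eq hpp.out Nat.prime_two).1 (by exact_mod_cast this))
  obtain ⟨c, hc, hI⟩ := exists_real_generator p hp h (LinearMap.range r₀) (by
    rintro _ ⟨x, rfl⟩
    exact ⟨s • τ x, by rw [map_smul, hr₀τ, smul_eq_mul, ← mul_assoc, hss, one_mul]⟩)
    ⟨r₀ w, ⟨w, rfl⟩, hr₀w⟩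
  have hdiv : ∀ x, ∃ y, r₀ x = c * y := fun x => by
    have : r₀ x ∈ LinearMap.range r₀ := ⟨x, rfl⟩
    rw [hI] at this
    exact Ideal.mem_span_singleton.1 this
  have hc0 : c ≠ 0 := by
    rintro rfl
    obtain ⟨y, hy⟩ := hdiv w
    exact hr₀w (by rw [hy]; simp)
  choose r₁ hr₁ using hdiv
  have hpw : ¬ (1 - zetaR p) ∣ r₁ w := fun hd => hr₀w (by rw [hr₁]; exact hd.mul_left _)
  obtain ⟨n, hn⟩ := exists_int_dvd_sub p (r₁ w)
  have hnp : ¬ (p : ℤ) ∣ n := by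
    rw [← dvd_intCast_iff]
    intro hd
    exact hpw (by simpa using dvd_add hn hd)
  obtain ⟨u, hu, hur, hun⟩ := exists_real_unit p hp hnp
  obtain ⟨v, huv⟩ := hu.exists_right_inv
  have hv : conjR p v = v := by
    have := congrArg (conjR p) huv
    rw [map_mul, hur, map_one] at this
    exact hu.mul_left_cancel (this.trans huv.symm)
  -- `r = r₀ / (u c)`, where the unit `u` is chosen such that `r w ≡ 1`
  let r : E →ₗ[ringR p] ringR p :=
    { toFun x := v * r₁ x
      map_add' x y := by
        apply mul_left_cancel₀ hc0
        have := map_add r₀ x y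
        rw [hr₁, hr₁, hr₁] at this
        linear_combination v * this
      map_smul' a x := by
        apply mul_left_cancel₀ hc0
        have := map_smul r₀ a x
        rw [hr₁, hr₁, smul_eq_mul] at this
        rw [RingHom.id_apply, smul_eq_mul]
        linear_combination v * this }
  have hr : ∀ x, u * c * r x = r₀ x := fun x => by
    rw [hr₁]; change u * c * (v * r₁ x) = _; linear_combination (c * r₁ x) * huv
  have hu0 : u * c ≠ 0 := mul_ne_zero hu.ne_zero hc0
  have hrq : ∀ x, r (q x) = r x := fun x => mul_left_cancel₀ hu0 <| by
    rw [hr, hr, hr₀, hr₀, ← hqτ, hq, hq]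
  have hrτ : ∀ x, r (τ x) = s * conjR p (r x) := fun x => mul_left_cancel₀ hu0 <| by
    have := congrArg (conjR p) (hr x)
    rw [map_mul, map_mul, hur, hc] at this
    rw [hr, hr₀τ, ← this]; ring
  have hrw : (1 - zetaR p) ∣ r w - 1 := by
    have : r w - 1 = v * ((r₁ w - n) - (u - n)) := by
      change v * r₁ w - 1 = _; linear_combination huv
    rw [this]
    exact (dvd_sub hn hun).mul_left _
  obtain ⟨z, hz⟩ := hrw
  obtain ⟨e₀, he₀⟩ : ∃ e₀, r e₀ = 1 := by
    have : c ∈ LinearMap.range r₀ := by rw [hI]; exact Ideal.mem_span_singleton_self c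
    obtain ⟨e₁, he₁⟩ := this
    refine ⟨u • e₁, ?_⟩
    apply mul_left_cancel₀ hu0
    rw [map_smul, smul_eq_mul, mul_left_comm, hr, he₁, mul_one]
  obtain ⟨θ, hθ⟩ := exists_trace_eq_one p hp
  -- `e₀` corrects `w` by a multiple of `1 - ζ` to an element on which `r` is `1`
  set x := q (w + (1 - r w) • e₀) with hx
  have hrx : r x = 1 := by
    rw [hx, hrq, map_add, map_smul, he₀, smul_eq_mul]; ring
  have hqx : q x = x := by rw [hx, hq]
  have hxw : ∃ y, w - x = (1 - zetaR p) • y := by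
    refine ⟨yq + z • q e₀, ?_⟩
    have e1 : 1 - r w = -((1 - zetaR p) * z) := by rw [← hz]; ring
    rw [hx, e1, map_add, map_smul, smul_add, ← hyq, ← mul_smul, neg_smul]
    abel
  obtain ⟨yx, hyx⟩ := hxw
  have hxe : x = w - (1 - zetaR p) • yx := by rw [← hyx]; abel
  refine ⟨r, θ • x + s • τ (θ • x), hrτ, ?_, ?_, ?_, hrq, ?_⟩
  · rw [map_add, hτ s, hτ2, hsc, smul_add, ← mul_smul, ← mul_smul s s, hss, one_smul, mul_smul,
      add_comm]
  · rw [map_add, map_smul, map_smul, hrτ, map_smul, hrx, smul_eq_mul, smul_eq_mul, mul_one,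
      ← mul_assoc, hss, one_mul, hθ]
  · have hconj : conjR p (1 - zetaR p) = (1 - zetaR p) * (- conjR p (zetaR p)) := by
      rw [map_sub, map_one]; linear_combination -(conj_mul_zetaR p)
    refine ⟨θ • yx - (s * conjR p θ) • ys +
      (s * conjR p θ * (- conjR p (zetaR p))) • τ yx, ?_⟩
    have h1 : τ w = s • w + (1 - zetaR p) • ys := by rw [← hys]; abel
    have h2 : w = (θ + conjR p θ) • w := by rw [hθ, one_smul]
    have h3 : τ x = s • w + (1 - zetaR p) • ys - ((1 - zetaR p) * (- conjR p (zetaR p))) • τ yx := by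
      rw [hxe, map_sub, hτ, h1, hconj]
    rw [hτ, h3, hxe]
    nth_rewrite 1 [h2]
    have h4 : (s * conjR p θ * s) = conjR p θ := by linear_combination (conjR p θ) * hss
    simp only [smul_add, smul_sub, ← mul_smul, add_smul]
    have h5 : s * (conjR p θ * s) = conjR p θ := by linear_combination (conjR p θ) * hss
    rw [h5]
    module
  · rw [map_add, map_smul, map_smul, hqτ, map_smul, hqx]

/-- A pair of orthogonal (possibly zero) summands `R ε₊` and `R ε₋` of `E`, on which `τ` acts as
complex conjugation and as its negative: `ε₊` and `ε₋` are the generators, `r₊` and `r₋` the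
coordinates. -/
structure EigenSplitting (τ : E →+ E) where
  rP : E →ₗ[ringR p] ringR p
  rM : E →ₗ[ringR p] ringR p
  eP : E
  eM : E
  rP_tau : ∀ x, rP (τ x) = conjR p (rP x)
  rM_tau : ∀ x, rM (τ x) = - conjR p (rM x)
  tau_eP : τ eP = eP
  tau_eM : τ eM = -eM
  rP_eM : rP eM = 0
  rM_eP : rM eP = 0
  plus : rP eP = 1 ∨ rP = 0 ∧ eP = 0
  minus : rM eM = 1 ∨ rM = 0 ∧ eM = 0

/-- Every element is, modulo `1 - ζ`, the sum of the generators of a pair of orthogonal summands: its parts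
in the two eigenspaces of `τ` are obtained with an inverse `k` of `2` modulo `p`, and each of them spans a
summand unless it is divisible by `1 - ζ`. -/
lemma exists_eigenSplitting [Module.Finite (ringR p) E] [Module.IsTorsionFree (ringR p) E]
    (hp : p ≠ 2) (h : hPlus p = 1) (τ : E →+ E) (hτ : ∀ (a : ringR p) x, τ (a • x) = conjR p a • τ x)
    (hτ2 : ∀ x, τ (τ x) = x) (w : E) :
    ∃ S : EigenSplitting p τ, ∃ y, w - (S.eP + S.eM) = (1 - zetaR p) • y := by
  obtain ⟨k, l, hk⟩ := exists_two_mul p hp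
  obtain ⟨z, hz⟩ := dvd_natCast_self p
  have hk' : 2 * (k : ringR p) - 1 = (1 - zetaR p) * (z * l) := by
    rw [← mul_assoc, ← hz]; exact_mod_cast congrArg (Int.cast : ℤ → ringR p) hk
  have hkc : conjR p (k : ringR p) = k := by simp
  set wP := (k : ringR p) • (w + τ w) with hwP
  set wM := (k : ringR p) • (w - τ w) with hwM
  have hsum : wP + wM = w + (1 - zetaR p) • ((z * l) • w) := by
    rw [← mul_smul, ← hk', hwP, hwM]; module
  have hτP : τ wP = wP := by rw [hwP, hτ, map_add, hτ2, hkc, add_comm]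
  have hτM : τ wM = - wM := by rw [hwM, hτ, map_sub, hτ2, hkc]; module
  obtain ⟨rP, eP, h1, h2, h3, h4, ⟨yP, h5⟩⟩ : ∃ (rP : E →ₗ[ringR p] ringR p) (eP : E),
      (∀ x, rP (τ x) = conjR p (rP x)) ∧ τ eP = eP ∧ (rP eP = 1 ∨ rP = 0 ∧ eP = 0) ∧
      (1 - zetaR p) ∣ rP wM ∧ (∃ y, wP - eP = (1 - zetaR p) • y) := by
    by_cases hw : ∃ y : E, wP = (1 - zetaR p) • y
    · exact ⟨0, 0, by simp, by simp, by simp, by simp, by simpa using hw⟩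
    · push Not at hw
      obtain ⟨r, e, h1, h2, h3, h4, -⟩ := exists_eigen_summand p hp h τ hτ hτ2 (s := 1) (Or.inl rfl)
        LinearMap.id (by simp) (by simp) (w := wP) ⟨0, by simp⟩ ⟨0, by simp [hτP]⟩ hw
      refine ⟨r, e, by simpa using h1, by simpa using h2, Or.inl h3, ?_, h4⟩
      have := h1 wM
      rw [hτM, map_neg, one_mul] at this
      exact (deltaR_dvd_iff p hp _).1 (deltaR_dvd_of_anti p hp this.symm)
  -- the second summand is found in the complement of the first
  let q : E →ₗ[ringR p] E := LinearMap.id - LinearMap.toSpanSingleton _ _ eP ∘ₗ rP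
  have hq : ∀ x, q x = x - rP x • eP := fun x => rfl
  have hrq : ∀ x, rP (q x) = 0 := by
    intro x
    rw [hq, map_sub, map_smul]
    rcases h3 with h3 | ⟨h3, -⟩ <;> simp [h3]
  have hqe : q eP = 0 := by
    rw [hq]
    rcases h3 with h3 | ⟨h3, h3'⟩
    · simp [h3]
    · simp [h3']
  obtain ⟨rM, eM, g1, g2, g3, g4, g5, ⟨yM, g6⟩⟩ : ∃ (rM : E →ₗ[ringR p] ringR p) (eM : E),
      (∀ x, rM (τ x) = - conjR p (rM x)) ∧ τ eM = -eM ∧ (rM eM = 1 ∨ rM = 0 ∧ eM = 0) ∧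
      (∀ x, rM (q x) = rM x) ∧ q eM = eM ∧ (∃ y, wM - eM = (1 - zetaR p) • y) := by
    by_cases hw : ∃ y : E, wM = (1 - zetaR p) • y
    · exact ⟨0, 0, by simp, by simp, by simp, by simp, by simp, by simpa using hw⟩
    · push Not at hw
      obtain ⟨y, hy⟩ := h4
      obtain ⟨r, e, i1, i2, i3, i4, i5, i6⟩ := exists_eigen_summand p hp h τ hτ hτ2 (s := -1)
        (Or.inr rfl) q (by intro x; rw [hq, hq, map_sub, hτ, h1, h2])
        (by intro x; rw [hq (q x), hrq, zero_smul, sub_zero]) (w := wM)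
        ⟨y • eP, by rw [hq, hy, mul_smul]; abel⟩ ⟨0, by simp [hτM]⟩ hw
      exact ⟨r, e, by simpa using i1, by simpa using i2, Or.inl i3, i5, i6, i4⟩
  refine ⟨⟨rP, rM, eP, eM, h1, g1, h2, g2, ?_, ?_, h3, g3⟩, yP + yM - (z * l) • w, ?_⟩
  · rw [← g5, hrq]
  · rw [← g4, hqe, map_zero]
  · rw [smul_sub, smul_add, ← h5, ← g6]
    change w - (eP + eM) = _
    have e : w = wP + wM - (1 - zetaR p) • ((z * l) • w) := by rw [hsum]; abel
    nth_rewrite 1 [e]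
    abel

end Semilinear

/-! ### Lattices with an involution -/

/-- An equivariant projection onto a summand of type `ℤ`, `ℤ_-` or `ℤ[C₂]`: every nonzero lattice
with an involution `t` has one.

If `t ≠ 1`, the lattice is an extension of the image `B` of `t + 1`, on which `t` is trivial, by its
kernel `A`, on which `t` is `-1`, and its class is given by the coefficients of `α (t (u b_j))`, where
`u` is a section over `B` and `α` the projection to `A`. An odd coefficient leads to a summand `ℤ[C₂]`;
if the coefficients of some basis vector of `A` are all even, this vector spans a summand `ℤ_-`. -/
lemma exists_involution_summand {F : Type u} [AddCommGroup F] [Module.Free ℤ F] [Module.Finite ℤ F]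
    [Nontrivial F] (t : F →ₗ[ℤ] F) (ht : ∀ x, t (t x) = x) :
    ∃ (c : F) (q : F →ₗ[ℤ] F) (γ : F →ₗ[ℤ] ℤ), (∀ x, q (t x) = t (q x)) ∧ q c = c ∧ γ c = 1 ∧
      ((t c = c ∧ ∀ x, q x = γ x • c) ∨ (t c = -c ∧ ∀ x, q x = γ x • c) ∨
        (γ (t c) = 0 ∧ ∀ x, q x = γ x • c + γ (t x) • t c)) := by
  by_cases hbot : ∀ x, t x = -x → x = 0
  · have htx : ∀ x, t x = x := fun x => by
      have := hbot (t x - x) (by rw [map_sub, ht]; abel)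
      exact sub_eq_zero.1 this
    let b := Module.Free.chooseBasis ℤ F
    obtain ⟨i⟩ : Nonempty (Module.Free.ChooseBasisIndex ℤ F) := b.index_nonempty
    refine ⟨b i, LinearMap.toSpanSingleton ℤ F (b i) ∘ₗ b.coord i, b.coord i, fun x => ?_, ?_, ?_,
      Or.inl ⟨htx _, fun x => rfl⟩⟩
    · rw [htx, htx]
    · simp
    · simp
  · push Not at hbot
    obtain ⟨x₀, hx₀, hx₀'⟩ := hbot
    set A := LinearMap.ker (t + LinearMap.id) with hA
    have hAm : ∀ x, x ∈ A ↔ t x + x = 0 := fun x => Iff.rfl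
    set B := LinearMap.range (t + LinearMap.id)
    obtain ⟨u, hu⟩ := Module.projective_lifting_property (t + LinearMap.id).rangeRestrict
      (LinearMap.id : B →ₗ[ℤ] B) (LinearMap.surjective_rangeRestrict _)
    have hu' : ∀ y : B, t (u y) + u y = y := fun y => congrArg Subtype.val (LinearMap.congr_fun hu y)
    let b := Module.Free.chooseBasis ℤ B
    let f := Module.Free.chooseBasis ℤ A
    -- the projections onto `B` and, along the section `u`, onto `A`
    let β : F →ₗ[ℤ] B := (t + LinearMap.id).rangeRestrict
    have hβ : ∀ x, (β x : F) = t x + x := fun _ => rfl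
    have hβt : ∀ x, β (t x) = β x := fun x => Subtype.ext (by rw [hβ, hβ, ht, add_comm])
    have hβu : ∀ y, β (u y) = y := fun y => Subtype.ext (hu' y)
    let α : F →ₗ[ℤ] A := LinearMap.codRestrict A (LinearMap.id - u ∘ₗ β) fun x => by
      rw [hAm]
      change t (x - u (β x)) + (x - u (β x)) = 0
      have := hu' (β x)
      rw [hβ] at this
      rw [map_sub, sub_add_sub_comm, this, sub_self]
    have hα : ∀ x, (α x : F) = x - u (β x) := fun _ => rfl
    have hβA : ∀ x : A, β x = 0 := fun x => Subtype.ext ((hAm x).1 x.2)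
    have hαA : ∀ x : A, α x = x := fun x => Subtype.ext (by rw [hα, hβA, map_zero, sub_zero])
    have hαu : ∀ y, α (u y) = 0 := fun y => Subtype.ext (by rw [hα, hβu, sub_self]; rfl)
    by_cases hodd : ∃ i j, ¬ (2 : ℤ) ∣ f.coord i (α (t (u (b j))))
    · obtain ⟨i, j, hij⟩ := hodd
      obtain ⟨a, ha⟩ := (Int.not_even_iff_odd.1 (fun h => hij h.two_dvd) :
        Odd (f.coord i (α (t (u (b j))))))
      -- the coefficient is `2 a + 1`; the vector `c` is chosen such that `g c = 1` and `g (t c) = 0`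
      set c := u (b j) + a • (f i : F) with hc
      have hβc : β c = b j := by rw [hc, map_add, map_smul, hβA, smul_zero, add_zero, hβu]
      have htf : t (f i : F) = -(f i : F) := eq_neg_of_add_eq_zero_left ((hAm _).1 (f i).2)
      let g : F →ₗ[ℤ] ℤ := (1 + a) • b.coord j ∘ₗ β - f.coord i ∘ₗ α
      have hg : ∀ x, g x = (1 + a) * b.coord j (β x) - f.coord i (α x) := fun _ => rfl
      have hgc : g c = 1 := by
        rw [hg, hβc, hc, map_add, hαu, map_smul, hαA]
        simp
      have hgt : g (t c) = 0 := by
        rw [hg, hβt, hβc, hc, map_add, map_smul, htf, map_add, map_smul, map_neg, hαA, map_add, ha]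
        simp
        ring
      clear_value c
      refine ⟨c, LinearMap.toSpanSingleton ℤ F c ∘ₗ g + LinearMap.toSpanSingleton ℤ F (t c) ∘ₗ g ∘ₗ t,
        g, fun x => ?_, ?_, hgc, Or.inr (Or.inr ⟨hgt, fun x => rfl⟩)⟩
      · change g (t x) • c + g (t (t x)) • t c = t (g x • c + g (t x) • t c)
        rw [map_add, map_smul, map_smul, ht, ht, add_comm]
      · change g c • c + g (t c) • t c = c
        rw [hgc, hgt]; simp
    · push Not at hodd
      have hA0 : Nontrivial A := ⟨⟨⟨x₀, by rw [hAm, hx₀]; abel⟩, 0, fun h => hx₀' (congrArg Subtype.val h)⟩⟩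
      obtain ⟨i⟩ : Nonempty (Module.Free.ChooseBasisIndex ℤ A) := f.index_nonempty
      choose l hl using fun j => hodd i j
      let lam : B →ₗ[ℤ] ℤ := b.constr ℤ l
      have hlam : ∀ y, f.coord i (α (t (u y))) = 2 * lam y := by
        intro y
        have : f.coord i ∘ₗ α ∘ₗ t ∘ₗ u = (2 : ℤ) • lam := b.ext fun j => by
          simp only [LinearMap.comp_apply, LinearMap.smul_apply, lam, Module.Basis.constr_basis, hl j,
            smul_eq_mul]
        exact LinearMap.congr_fun this y
      -- half of the coefficients correct the coordinate to an anti-invariant functional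
      let g : F →ₗ[ℤ] ℤ := f.coord i ∘ₗ α - lam ∘ₗ β
      have hg : ∀ x, g x = f.coord i (α x) - lam (β x) := fun _ => rfl
      have hgt : ∀ x, g (t x) = - g x := by
        intro x
        have h1 : α (t x) = α (t (u (β x))) - α x := by
          have e : t x = t (u (β x)) - (α x : F) := by
            have h2 := (hAm _).1 (α x).2
            have h3 : x = u (β x) + α x := by rw [hα]; abel
            have h4 : t (α x : F) = -(α x : F) := eq_neg_of_add_eq_zero_left h2
            calc t x = t (u (β x) + α x) := by rw [← h3]
              _ = _ := by rw [map_add, h4]; abel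
          rw [e, map_sub, hαA]
        rw [hg, hg, hβt, h1, map_sub, hlam]; ring
      have hgc : g (f i : F) = 1 := by rw [hg, hαA, hβA]; simp
      have htf : t (f i : F) = -(f i : F) := eq_neg_of_add_eq_zero_left ((hAm _).1 (f i).2)
      refine ⟨f i, LinearMap.toSpanSingleton ℤ F (f i : F) ∘ₗ g, g, fun x => ?_, ?_, hgc,
        Or.inr (Or.inl ⟨htf, fun x => rfl⟩)⟩
      · change g (t x) • (f i : F) = t (g x • (f i : F))
        rw [map_smul, htf, hgt, neg_smul, smul_neg]
      · change g (f i : F) • (f i : F) = f i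
        rw [hgc, one_smul]

/-! ### The kernel of the norm of `σ` as a module over `R` -/

section SigmaKer

variable {p : ℕ} {M : Type u} [AddCommGroup M] (ρ : Representation ℤ (DihedralGroup p) M)

/-- The action of `σ`. -/
abbrev sig : M →ₗ[ℤ] M := ρ (.r 1)

/-- The action of `τ`. -/
abbrev tau : M →ₗ[ℤ] M := ρ (.sr 0)

lemma rho_mul_apply (g h : DihedralGroup p) (x : M) : ρ (g * h) x = ρ g (ρ h x) := by
  rw [map_mul]; rfl

@[simp] lemma tau_tau (x : M) : tau ρ (tau ρ x) = x := by
  rw [← rho_mul_apply]; simp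

lemma sig_tau_sig (x : M) : sig ρ (tau ρ (sig ρ x)) = tau ρ x := by
  rw [← rho_mul_apply, ← rho_mul_apply]; simp

lemma sig_pow_apply (i : ℕ) (x : M) : (sig ρ ^ i) x = ρ (.r i) x := by
  rw [← map_pow]; simp

lemma sig_pow_p : sig ρ ^ p = 1 := by
  ext x; rw [sig_pow_apply]; simp

lemma rho_mem_of_sig_tau [NeZero p] {s : Set M} (h1 : ∀ x ∈ s, sig ρ x ∈ s) (h2 : ∀ x ∈ s, tau ρ x ∈ s)
    (g : DihedralGroup p) : ∀ x ∈ s, ρ g x ∈ s := by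
  have hr : ∀ i : ℕ, ∀ x ∈ s, ρ (.r i) x ∈ s := by
    intro i x hx
    rw [← sig_pow_apply]
    induction i with
    | zero => simpa using hx
    | succ i ih => rw [pow_succ']; exact h1 _ ih
  intro x hx
  rcases g with i | i
  · rw [← ZMod.natCast_zmod_val i]; exact hr _ x hx
  · have : (DihedralGroup.sr i : DihedralGroup p) = .sr 0 * .r i := by simp
    rw [this, rho_mul_apply, ← ZMod.natCast_zmod_val i]
    exact h2 _ (hr _ x hx)

lemma map_rho_of_sig_tau [NeZero p] {M' : Type v} [AddCommGroup M'] (ρ' : Representation ℤ (DihedralGroup p) M')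
    (f : M → M') (h1 : ∀ x, f (sig ρ x) = sig ρ' (f x)) (h2 : ∀ x, f (tau ρ x) = tau ρ' (f x))
    (g : DihedralGroup p) (x : M) : f (ρ g x) = ρ' g (f x) := by
  have hr : ∀ i : ℕ, ∀ x, f (ρ (.r i) x) = ρ' (.r i) (f x) := by
    intro i x
    rw [← sig_pow_apply, ← sig_pow_apply]
    induction i with
    | zero => simp
    | succ i ih => rw [pow_succ', pow_succ', Module.End.mul_apply, h1, ih]; rfl
  rcases g with i | i
  · rw [← ZMod.natCast_zmod_val i]; exact hr _ x
  · have : (DihedralGroup.sr i : DihedralGroup p) = .sr 0 * .r i := by simp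
    rw [this, rho_mul_apply, rho_mul_apply, ← ZMod.natCast_zmod_val i, ← hr]
    exact h2 _

/-- The norm `1 + σ + ⋯ + σ^(p-1)`. -/
def normSig : M →ₗ[ℤ] M := ∑ i ∈ Finset.range p, sig ρ ^ i

lemma normSig_sig (x : M) : normSig ρ (sig ρ x) = normSig ρ x := by
  have h : normSig ρ * sig ρ = normSig ρ := by
    have := Finset.sum_range_succ' (fun i => sig ρ ^ i) p
    rw [Finset.sum_range_succ, sig_pow_p, pow_zero, add_left_inj] at this
    rw [normSig, Finset.sum_mul]
    simpa only [pow_succ] using this.symm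
  exact LinearMap.congr_fun h x

lemma normSig_of_fixed {x : M} (hx : sig ρ x = x) : normSig ρ x = (p : ℤ) • x := by
  have : ∀ i : ℕ, (sig ρ ^ i) x = x := by
    intro i
    induction i with
    | zero => rfl
    | succ i ih => rw [pow_succ', Module.End.mul_apply, ih, hx]
  simp [normSig, LinearMap.sum_apply, this]

lemma map_normSig {M' : Type v} [AddCommGroup M'] (ρ' : Representation ℤ (DihedralGroup p) M')
    (f : M →ₗ[ℤ] M') (h1 : ∀ x, f (sig ρ x) = sig ρ' (f x)) (x : M) :
    f (normSig ρ x) = normSig ρ' (f x) := by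
  have : ∀ i : ℕ, f ((sig ρ ^ i) x) = (sig ρ' ^ i) (f x) := by
    intro i
    induction i with
    | zero => rfl
    | succ i ih => rw [pow_succ', pow_succ', Module.End.mul_apply, h1, ih]; rfl
  simp [normSig, LinearMap.sum_apply, this]

lemma normSig_tau [NeZero p] (x : M) : normSig ρ (tau ρ x) = tau ρ (normSig ρ x) := by
  have hx : ∀ i : ℕ, ∀ y, (sig ρ ^ i) (tau ρ ((sig ρ ^ i) y)) = tau ρ y := by
    intro i y
    rw [sig_pow_apply, sig_pow_apply, ← rho_mul_apply, ← rho_mul_apply]; simp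
  have hinj : ∀ y, (sig ρ ^ p) y = y := fun y => by rw [sig_pow_p]; rfl
  have h2 : ∀ i ∈ Finset.range p, (sig ρ ^ i) (tau ρ x) = tau ρ ((sig ρ ^ (p - i)) x) := by
    intro i hi
    have hi' := (Finset.mem_range.1 hi).le
    rw [← hx i ((sig ρ ^ (p - i)) x), ← Module.End.mul_apply (sig ρ ^ i) (sig ρ ^ (p - i)), ← pow_add,
      Nat.add_sub_cancel' hi', hinj]
  rw [normSig, LinearMap.sum_apply, LinearMap.sum_apply, map_sum, Finset.sum_congr rfl h2]
  have h3 := Finset.sum_range_reflect (fun i => tau ρ ((sig ρ ^ (i + 1)) x)) p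
  have h4 : ∑ j ∈ Finset.range p, tau ρ ((sig ρ ^ (p - 1 - j + 1)) x) =
      ∑ j ∈ Finset.range p, tau ρ ((sig ρ ^ (p - j)) x) :=
    Finset.sum_congr rfl fun j hj => by
      have := Finset.mem_range.1 hj
      rw [show p - 1 - j + 1 = p - j by omega]
  rw [← h4, h3]
  have h5 := Finset.sum_range_succ' (fun i => tau ρ ((sig ρ ^ i) x)) p
  rw [Finset.sum_range_succ, hinj, pow_zero, Module.End.one_apply, add_left_inj] at h5
  exact h5.symm

/-- The sublattice of `M` killed by `1 + σ + ⋯ + σ^(p-1)`. -/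
def sigmaKer : Submodule ℤ M := LinearMap.ker (normSig ρ)

lemma mem_sigmaKer {x : M} : x ∈ sigmaKer ρ ↔ normSig ρ x = 0 := Iff.rfl

lemma sig_sub_mem (x : M) : sig ρ x - x ∈ sigmaKer ρ := by
  rw [mem_sigmaKer, map_sub, normSig_sig, sub_self]

variable [hpp : Fact p.Prime]

/-- The action of `σ` on the kernel of `1 + σ + ⋯ + σ^(p-1)`. -/
def sigKer : Module.End ℤ (sigmaKer ρ) :=
  (sig ρ).restrict fun x hx => (mem_sigmaKer ρ).2 ((normSig_sig ρ x).trans hx)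

lemma sigKer_pow (i : ℕ) (x : sigmaKer ρ) : ((sigKer ρ ^ i) x : M) = (sig ρ ^ i) x := by
  induction i with
  | zero => rfl
  | succ i ih =>
    rw [pow_succ', pow_succ', Module.End.mul_apply, Module.End.mul_apply, ← ih]; rfl

/-- The action of `R = ℤ[ζ_p]` on the kernel of `1 + σ + ⋯ + σ^(p-1)`, for which `ζ_p` acts
as `σ`. -/
def sigmaKerHom : ringR p →ₐ[ℤ] Module.End ℤ (sigmaKer ρ) :=
  (Algebra.adjoin.powerBasis' ((zeta_isPrimitiveRoot p).isIntegral (NeZero.pos p))).lift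
    (sigKer ρ) (by
      rw [Algebra.adjoin.powerBasis'_gen, ← (minpoly.algHom_eq (ringR p).val Subtype.val_injective
        ⟨zeta p, zeta_mem p⟩)]
      change Polynomial.aeval _ (minpoly ℤ (zeta p)) = 0
      rw [← Polynomial.cyclotomic_eq_minpoly (zeta_isPrimitiveRoot p) (NeZero.pos p),
        Polynomial.cyclotomic_prime, map_sum]
      ext x
      have hx : normSig ρ x = 0 := x.2
      rw [normSig, LinearMap.sum_apply] at hx
      simp only [map_pow, Polynomial.aeval_X, LinearMap.sum_apply, AddSubmonoidClass.coe_finsetSum,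
        LinearMap.zero_apply, ZeroMemClass.coe_zero, sigKer_pow]
      exact hx)

instance sigmaKerModule : Module (ringR p) (sigmaKer ρ) :=
  Module.compHom _ (sigmaKerHom ρ).toRingHom

lemma zetaR_smul (x : sigmaKer ρ) : ((zetaR p • x : sigmaKer ρ) : M) = sig ρ x := by
  have hg : (Algebra.adjoin.powerBasis' ((zeta_isPrimitiveRoot p).isIntegral (NeZero.pos p))).gen =
    zetaR p := Algebra.adjoin.powerBasis'_gen _
  have : sigmaKerHom ρ (zetaR p) = sigKer ρ := by
    rw [← hg]; exact PowerBasis.lift_gen _ _ _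
  change ((sigmaKerHom ρ (zetaR p) x : sigmaKer ρ) : M) = _
  rw [this]; rfl

instance [Module.Finite ℤ M] : Module.Finite (ringR p) (sigmaKer ρ) :=
  Module.Finite.of_restrictScalars_finite ℤ _ _

instance [Module.IsTorsionFree ℤ M] : Module.IsTorsionFree (ringR p) (sigmaKer ρ) := by
  rw [Module.isTorsionFree_iff_smul_eq_zero]
  intro a x hax
  by_contra! hcon
  obtain ⟨ha, hx⟩ := hcon
  have hint : IsIntegral ℤ a :=
    (isIntegral_algHom_iff (ringR p).val Subtype.val_injective).1 (isIntegral_of_mem_ringR p a.2)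
  -- the integral element `a` divides a nonzero integer, which acts injectively
  obtain ⟨n, hn, hn0⟩ := (Submodule.ne_bot_iff _).1 (Ideal.comap_ne_bot_of_integral_mem ha
    (Ideal.mem_span_singleton_self a) hint)
  obtain ⟨b, hb⟩ := Ideal.mem_span_singleton.1 hn
  have h1 : n • x = 0 := by
    rw [← Int.cast_smul_eq_zsmul (ringR p) n x]
    change (algebraMap ℤ (ringR p) n) • x = 0
    rw [hb, mul_comm, mul_smul, hax, smul_zero]
  exact (smul_eq_zero.1 h1).elim hn0 hx

/-- The action of `τ` on the kernel of `1 + σ + ⋯ + σ^(p-1)`. -/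
def tauKer : sigmaKer ρ →+ sigmaKer ρ :=
  ((tau ρ).restrict fun x hx => by
    rw [mem_sigmaKer, normSig_tau, (mem_sigmaKer ρ).1 hx, map_zero]).toAddMonoidHom

lemma coe_tauKer (x : sigmaKer ρ) : (tauKer ρ x : M) = tau ρ x := rfl

lemma tauKer_tauKer (x : sigmaKer ρ) : tauKer ρ (tauKer ρ x) = x :=
  Subtype.ext (tau_tau ρ x)

lemma tauKer_smul (a : ringR p) (x : sigmaKer ρ) : tauKer ρ (a • x) = conjR p a • tauKer ρ x := by
  induction a using ringR_induction generalizing x with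
  | hζ =>
    have h1 : zetaR p • tauKer ρ (zetaR p • x) = tauKer ρ x := by
      ext; rw [zetaR_smul, coe_tauKer, zetaR_smul, sig_tau_sig, coe_tauKer]
    rw [← h1, ← mul_smul, conj_mul_zetaR, one_smul]
  | hi n => rw [map_intCast, Int.cast_smul_eq_zsmul, Int.cast_smul_eq_zsmul, map_zsmul]
  | ha a b ha hb => rw [add_smul, map_add, ha, hb, map_add, add_smul]
  | hm a b ha hb => rw [mul_smul, ha, hb, map_mul, mul_smul]

lemma smul_eq_zero_of_ne [Module.IsTorsionFree ℤ M] {a : ringR p} (ha : a ≠ 0) {x : sigmaKer ρ}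
    (h : a • x = 0) : x = 0 := (smul_eq_zero.1 h).resolve_left ha

end SigmaKer

/-! ### The extension of the `σ`-trivial quotient by the kernel of the norm -/

section Extension

variable {p : ℕ} {M : Type u} [AddCommGroup M] (ρ : Representation ℤ (DihedralGroup p) M)

/-- The quotient of `M` by the kernel of `1 + σ + ⋯ + σ^(p-1)`: the largest torsion-free quotient
on which `σ` acts trivially. -/
abbrev SigmaQuot := M ⧸ sigmaKer ρ

/-- The projection `M → M / ker (1 + σ + ⋯ + σ^(p-1))`. -/
abbrev toQuot : M →ₗ[ℤ] SigmaQuot ρ := (sigmaKer ρ).mkQ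

/-- The map `σ - 1` with values in the kernel of `1 + σ + ⋯ + σ^(p-1)`. -/
def sigDiff : M →ₗ[ℤ] sigmaKer ρ :=
  LinearMap.codRestrict _ (sig ρ - LinearMap.id) fun x => sig_sub_mem ρ x

lemma coe_sigDiff (x : M) : (sigDiff ρ x : M) = sig ρ x - x := rfl

lemma toQuot_eq_zero {x : M} : toQuot ρ x = 0 ↔ x ∈ sigmaKer ρ := by
  simp

lemma toQuot_sig (x : M) : toQuot ρ (sig ρ x) = toQuot ρ x := by
  rw [← sub_eq_zero, ← map_sub, toQuot_eq_zero]; exact sig_sub_mem ρ x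

instance [Module.IsTorsionFree ℤ M] : Module.IsTorsionFree ℤ (SigmaQuot ρ) := by
  rw [Module.isTorsionFree_iff_smul_eq_zero]
  intro n x
  obtain ⟨x, rfl⟩ := (sigmaKer ρ).mkQ_surjective x
  rw [← map_smul, Submodule.mkQ_apply, Submodule.mkQ_apply, Submodule.Quotient.mk_eq_zero,
    Submodule.Quotient.mk_eq_zero, mem_sigmaKer, mem_sigmaKer, map_smul]
  exact smul_eq_zero.1

variable [hpp : Fact p.Prime]

/-- The action of `τ` on the quotient of `M` by the kernel of `1 + σ + ⋯ + σ^(p-1)`. -/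
def tauQuot : SigmaQuot ρ →ₗ[ℤ] SigmaQuot ρ :=
  (sigmaKer ρ).mapQ (sigmaKer ρ) (tau ρ) fun x hx => (tauKer ρ ⟨x, hx⟩).2

lemma tauQuot_toQuot (x : M) : tauQuot ρ (toQuot ρ x) = toQuot ρ (tau ρ x) := rfl

lemma tauQuot_tauQuot (x : SigmaQuot ρ) : tauQuot ρ (tauQuot ρ x) = x := by
  obtain ⟨x, rfl⟩ := (sigmaKer ρ).mkQ_surjective x
  rw [tauQuot_toQuot, tauQuot_toQuot, tau_tau]

lemma sigDiff_tau (x : M) : sigDiff ρ (tau ρ x) = -(zetaR p • tauKer ρ (sigDiff ρ x)) := by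
  ext
  rw [coe_sigDiff, Submodule.coe_neg, zetaR_smul, coe_tauKer, coe_sigDiff, map_sub, map_sub,
    sig_tau_sig]
  abel

lemma sigDiff_coe (e : sigmaKer ρ) : sigDiff ρ e = (zetaR p - 1) • e := by
  ext
  rw [coe_sigDiff, sub_smul, one_smul, Submodule.coe_sub, zetaR_smul]

/-- The extension of the quotient by the kernel of the norm splits over `⟨τ⟩`, because `R` has
elements of trace one: for a linear section `s₀` with `d = τ s₀ τ - s₀`, the section `s₀ + θ d` is
equivariant if `θ` has trace one. -/
lemma exists_tau_section (hp : p ≠ 2) [Module.Free ℤ (SigmaQuot ρ)] :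
    ∃ s : SigmaQuot ρ →ₗ[ℤ] M, (∀ x, toQuot ρ (s x) = x) ∧ ∀ x, s (tauQuot ρ x) = tau ρ (s x) := by
  obtain ⟨s₀, hs₀⟩ := Module.projective_lifting_property (toQuot ρ) LinearMap.id
    (sigmaKer ρ).mkQ_surjective
  have hs : ∀ x, toQuot ρ (s₀ x) = x := fun x => LinearMap.congr_fun hs₀ x
  obtain ⟨θ, hθ⟩ := exists_trace_eq_one p hp
  let d : SigmaQuot ρ →ₗ[ℤ] sigmaKer ρ := LinearMap.codRestrict _ (tau ρ ∘ₗ s₀ ∘ₗ tauQuot ρ - s₀)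
    fun x => by
      rw [← toQuot_eq_zero, LinearMap.sub_apply, map_sub, hs, LinearMap.comp_apply,
        LinearMap.comp_apply, ← tauQuot_toQuot, hs, tauQuot_tauQuot, sub_self]
  have hd : ∀ x, (d x : M) = tau ρ (s₀ (tauQuot ρ x)) - s₀ x := fun x => rfl
  have hdt : ∀ x, tauKer ρ (d x) = - d (tauQuot ρ x) := fun x => Subtype.ext <| by
    rw [coe_tauKer, Submodule.coe_neg, hd, hd, map_sub, tau_tau, tauQuot_tauQuot]; abel
  let s : SigmaQuot ρ →ₗ[ℤ] M := s₀ + (sigmaKer ρ).subtype ∘ₗ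
    (AddMonoidHom.toIntLinearMap (DistribSMul.toAddMonoidHom (sigmaKer ρ) θ)) ∘ₗ d
  have hsd : ∀ x, s x = s₀ x + (θ • d x : sigmaKer ρ) := fun x => rfl
  refine ⟨s, fun x => ?_, fun x => ?_⟩
  · rw [hsd, map_add, hs, (toQuot_eq_zero ρ).2 (θ • d x).2, add_zero]
  · have h1 : tau ρ (s x) = tau ρ (s₀ x) - (conjR p θ • d (tauQuot ρ x) : sigmaKer ρ) := by
      rw [hsd, map_add, ← coe_tauKer, tauKer_smul, hdt, smul_neg, Submodule.coe_neg, sub_eq_add_neg]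
    have h2 : tau ρ (s₀ x) = s₀ (tauQuot ρ x) + d (tauQuot ρ x) := by
      rw [hd, tauQuot_tauQuot]; abel
    have h3 : (d (tauQuot ρ x) : M) = (θ • d (tauQuot ρ x) : sigmaKer ρ) +
        (conjR p θ • d (tauQuot ρ x) : sigmaKer ρ) := by
      rw [← Submodule.coe_add, ← add_smul, hθ, one_smul]
    rw [h1, h2, hsd, h3]
    abel

lemma fixed_eq_zero [Module.IsTorsionFree ℤ M] {x : M} (h1 : x ∈ sigmaKer ρ) (h2 : sig ρ x = x) :
    x = 0 := by
  rw [mem_sigmaKer, normSig_of_fixed ρ h2] at h1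
  exact (smul_eq_zero.1 h1).resolve_left (by exact_mod_cast hpp.out.ne_zero)

variable {M' : Type v} [AddCommGroup M'] (ρ' : Representation ℤ (DihedralGroup p) M')

/-- Compatible maps on the kernel of the norm and on the quotient come from a map of lattices if
they are compatible with the extension classes, that is, with `σ - 1` modulo `(1 - ζ)`.

The map is `Φ = α ∘ pr + s' ∘ β ∘ π + T ∘ π` for `τ`-equivariant sections `s`, `s'`, the projection `pr`
along `s` and the projection `π` to the quotient, where the correction term `T` solves
`(1 - ζ) T = (σ - 1) s' β - α (σ - 1) s`. -/
lemma exists_map_of_compatible (hp : p ≠ 2) [Module.IsTorsionFree ℤ M'] [Module.Free ℤ (SigmaQuot ρ)]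
    [Module.Free ℤ (SigmaQuot ρ')]
    (α : sigmaKer ρ →ₗ[ringR p] sigmaKer ρ') (hα : ∀ x, α (tauKer ρ x) = tauKer ρ' (α x))
    (β : SigmaQuot ρ →ₗ[ℤ] SigmaQuot ρ') (hβ : ∀ x, β (tauQuot ρ x) = tauQuot ρ' (β x))
    (hc : ∀ x, ∃ m m' y, toQuot ρ m = x ∧ toQuot ρ' m' = β x ∧
      sigDiff ρ' m' - α (sigDiff ρ m) = (1 - zetaR p) • y) :
    ∃ Φ : M →ₗ[ℤ] M', (∀ g x, Φ (ρ g x) = ρ' g (Φ x)) ∧ (∀ e : sigmaKer ρ, Φ e = α e) ∧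
      ∀ x, toQuot ρ' (Φ x) = β (toQuot ρ x) := by
  obtain ⟨s, hs, hst⟩ := exists_tau_section ρ hp
  obtain ⟨s', hs', hst'⟩ := exists_tau_section ρ' hp
  have hpi := one_sub_zetaR_ne_zero p
  have hinj : ∀ {a b : sigmaKer ρ'}, (1 - zetaR p) • a = (1 - zetaR p) • b → a = b := by
    intro a b hab
    rw [← sub_eq_zero, ← smul_sub] at hab
    exact sub_eq_zero.1 (smul_eq_zero_of_ne ρ' hpi hab)
  have hT : ∀ x, ∃ y, (1 - zetaR p) • y = sigDiff ρ' (s' (β x)) - α (sigDiff ρ (s x)) := by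
    intro x
    obtain ⟨m, m', y, h1, h2, h3⟩ := hc x
    have e1 : s x - m ∈ sigmaKer ρ := by rw [← toQuot_eq_zero, map_sub, hs, h1, sub_self]
    have e2 : s' (β x) - m' ∈ sigmaKer ρ' := by rw [← toQuot_eq_zero, map_sub, hs', h2, sub_self]
    refine ⟨y - ⟨_, e2⟩ + α ⟨_, e1⟩, ?_⟩
    have f1 := sigDiff_coe ρ ⟨_, e1⟩
    have f2 := sigDiff_coe ρ' ⟨_, e2⟩
    rw [map_sub] at f1 f2
    have f3 := congrArg α f1
    rw [map_sub, map_smul] at f3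
    rw [smul_add, smul_sub, ← h3]
    have g2 : (1 - zetaR p) • (⟨_, e2⟩ : sigmaKer ρ') =
      sigDiff ρ' m' - sigDiff ρ' (s' (β x)) := by
      rw [← neg_sub (sigDiff ρ' (s' (β x))), f2, ← neg_smul, neg_sub]
    have g3 : (1 - zetaR p) • α ⟨_, e1⟩ = α (sigDiff ρ m) - α (sigDiff ρ (s x)) := by
      rw [← neg_sub (α (sigDiff ρ (s x))), f3, ← neg_smul, neg_sub]
    rw [g2, g3]
    abel
  choose T₀ hT₀ using hT
  let T : SigmaQuot ρ →ₗ[ℤ] sigmaKer ρ' := AddMonoidHom.toIntLinearMap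
    { toFun := T₀
      map_zero' := hinj (by rw [hT₀]; simp)
      map_add' x y := hinj (by rw [smul_add, hT₀, hT₀, hT₀]; simp only [map_add]; abel) }
  have hT : ∀ x, (1 - zetaR p) • T x = sigDiff ρ' (s' (β x)) - α (sigDiff ρ (s x)) := hT₀
  have hTt : ∀ x, T (tauQuot ρ x) = tauKer ρ' (T x) := by
    intro x
    apply hinj
    rw [hT, hβ, hst, hst', sigDiff_tau, sigDiff_tau, map_neg, map_smul, hα]
    have h1 := congrArg (tauKer ρ') (hT x)
    rw [tauKer_smul, map_sub, map_sub, map_one] at h1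
    have h2 : (1 - zetaR p) • tauKer ρ' (T x) =
        -(zetaR p • ((1 - conjR p (zetaR p)) • tauKer ρ' (T x))) := by
      rw [← mul_smul, ← neg_smul]
      congr 1
      linear_combination -(zetaR_mul_conj p)
    rw [h2, h1, smul_sub]
    abel
  let pr : M →ₗ[ℤ] sigmaKer ρ := LinearMap.codRestrict _ (LinearMap.id - s ∘ₗ toQuot ρ) fun x => by
    rw [← toQuot_eq_zero, LinearMap.sub_apply, map_sub, LinearMap.comp_apply, hs]; exact sub_self _
  have hpr : ∀ x, (pr x : M) = x - s (toQuot ρ x) := fun _ => rfl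
  have hpre : ∀ e : sigmaKer ρ, pr e = e := fun e => Subtype.ext (by
    rw [hpr, (toQuot_eq_zero ρ).2 e.2, map_zero, sub_zero])
  let Φ : M →ₗ[ℤ] M' := (sigmaKer ρ').subtype ∘ₗ α.toAddMonoidHom.toIntLinearMap ∘ₗ pr +
    s' ∘ₗ β ∘ₗ toQuot ρ + (sigmaKer ρ').subtype ∘ₗ T ∘ₗ toQuot ρ
  have hΦ : ∀ x, Φ x = α (pr x) + s' (β (toQuot ρ x)) + T (toQuot ρ x) := fun _ => rfl
  refine ⟨Φ, map_rho_of_sig_tau ρ ρ' Φ (fun x => ?_) (fun x => ?_), fun e => ?_, fun x => ?_⟩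
  · have h1 : pr (sig ρ x) = zetaR p • pr x + sigDiff ρ (s (toQuot ρ x)) := by
      ext
      rw [hpr, toQuot_sig, Submodule.coe_add, zetaR_smul, hpr, coe_sigDiff, map_sub]
      abel
    have h2 := hT (toQuot ρ x)
    rw [sub_smul, one_smul, sub_eq_iff_eq_add] at h2
    have h3 := congrArg (Subtype.val : sigmaKer ρ' → M') h2
    simp only [Submodule.coe_add, Submodule.coe_sub, coe_sigDiff] at h3
    rw [zetaR_smul] at h3
    rw [hΦ, hΦ, h1, toQuot_sig, map_add α, map_smul, map_add (sig ρ'), map_add (sig ρ'),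
      Submodule.coe_add, zetaR_smul]
    generalize sig ρ' (T (toQuot ρ x) : M') = z at h3 ⊢
    rw [h3]
    abel
  · have h1 : pr (tau ρ x) = tauKer ρ (pr x) := by
      ext
      rw [hpr, coe_tauKer, hpr, map_sub, ← hst, tauQuot_toQuot]
    rw [hΦ, hΦ, h1, ← tauQuot_toQuot, hTt, hβ, hst', hα, map_add, map_add]
    rfl
  · rw [hΦ, hpre, (toQuot_eq_zero ρ).2 e.2]; simp
  · rw [hΦ, map_add, map_add, hs', (toQuot_eq_zero ρ').2 (Subtype.property _),
      (toQuot_eq_zero ρ').2 (Subtype.property _), zero_add, add_zero]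

/-- There are no nonzero maps from the quotient to the kernel of the norm. -/
lemma map_eq_zero_of_kernel [Module.IsTorsionFree ℤ M'] (Φ : M →ₗ[ℤ] M')
    (h1 : ∀ x, Φ (sig ρ x) = sig ρ' (Φ x))
    (h2 : ∀ e ∈ sigmaKer ρ, Φ e = 0) (h3 : ∀ x, Φ x ∈ sigmaKer ρ') (x : M) : Φ x = 0 := by
  refine fixed_eq_zero ρ' (h3 x) ?_
  rw [← h1, ← sub_eq_zero, ← map_sub]
  exact h2 _ (sig_sub_mem ρ x)

end Extension

lemma IsIndecomposable.eq_zero_or_eq_id {p : ℕ} {M : GLattice.{0, u} (DihedralGroup p)}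
    (hM : IsIndecomposable M) (Φ : M →ₗ[ℤ] M) (h1 : ∀ g x, Φ (M.ρ g x) = M.ρ g (Φ x))
    (h2 : ∀ x, Φ (Φ x) = Φ x) : (∀ x, Φ x = 0) ∨ ∀ x, Φ x = x := by
  have hc : IsCompl (LinearMap.range Φ) (LinearMap.ker Φ) :=
    LinearMap.IsIdempotentElem.isCompl (LinearMap.ext h2)
  rcases hM.2 ⟨LinearMap.range Φ, by rintro g _ ⟨x, rfl⟩; exact ⟨M.ρ g x, h1 g x⟩⟩
    ⟨LinearMap.ker Φ, by intro g x hx; rw [LinearMap.mem_ker] at *; rw [h1, hx, map_zero]⟩ hc with h | h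
  · exact Or.inl fun x => LinearMap.congr_fun (LinearMap.range_eq_bot.1 h) x
  · refine Or.inr fun x => ?_
    have : x - Φ x ∈ LinearMap.ker Φ := by rw [LinearMap.mem_ker, map_sub, h2, sub_self]
    change LinearMap.ker Φ = ⊥ at h
    rw [h, Submodule.mem_bot, sub_eq_zero] at this
    exact this.symm

/-- The idempotent endomorphisms of the two parts of an indecomposable lattice which are compatible
with its extension class are trivial. -/
lemma IsIndecomposable.compatible_eq_zero_or_eq_id {p : ℕ} [Fact p.Prime] (hp : p ≠ 2)
    {M : GLattice.{0, u} (DihedralGroup p)} (hM : IsIndecomposable M)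
    (α : sigmaKer M.ρ →ₗ[ringR p] sigmaKer M.ρ) (hα : ∀ x, α (tauKer M.ρ x) = tauKer M.ρ (α x))
    (hα2 : ∀ x, α (α x) = α x)
    (β : SigmaQuot M.ρ →ₗ[ℤ] SigmaQuot M.ρ) (hβ : ∀ x, β (tauQuot M.ρ x) = tauQuot M.ρ (β x))
    (hβ2 : ∀ x, β (β x) = β x)
    (hc : ∀ x, ∃ m m' y, toQuot M.ρ m = x ∧ toQuot M.ρ m' = β x ∧
      sigDiff M.ρ m' - α (sigDiff M.ρ m) = (1 - zetaR p) • y) :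
    ((∀ x, α x = 0) ∧ ∀ x, β x = 0) ∨ ((∀ x, α x = x) ∧ ∀ x, β x = x) := by
  obtain ⟨Φ, h1, h2, h3⟩ := exists_map_of_compatible M.ρ M.ρ hp α hα β hβ hc
  have hid : ∀ x, (Φ ∘ₗ Φ - Φ) x = 0 := by
    apply map_eq_zero_of_kernel M.ρ M.ρ
    · intro x; simp [h1]
    · intro e he
      have := h2 ⟨e, he⟩
      rw [LinearMap.sub_apply, LinearMap.comp_apply, this, h2, hα2, sub_self]
    · intro x
      rw [← toQuot_eq_zero, LinearMap.sub_apply, map_sub, LinearMap.comp_apply, h3, h3, hβ2, sub_self]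
  rcases hM.eq_zero_or_eq_id Φ h1 (fun x => sub_eq_zero.1 (hid x)) with h | h
  · refine Or.inl ⟨fun x => Subtype.ext ?_, fun x => ?_⟩
    · rw [← h2, h]; rfl
    · obtain ⟨x, rfl⟩ := (sigmaKer M.ρ).mkQ_surjective x
      rw [← h3, h, map_zero]
  · refine Or.inr ⟨fun x => Subtype.ext ?_, fun x => ?_⟩
    · rw [← h2, h]
    · obtain ⟨x, rfl⟩ := (sigmaKer M.ρ).mkQ_surjective x
      rw [← h3, h]

/-! ### The normal form of an indecomposable lattice -/

section NormalForm

variable {p : ℕ} [hpp : Fact p.Prime]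

/-- Modulo `1 - ζ`, a linear map from a free `ℤ`-module to `R` lifts to a linear map to `ℤ`, because
`R / (1 - ζ)` is generated by `1`. -/
lemma exists_int_lift {F : Type u} [AddCommGroup F] [Module.Free ℤ F] (f : F →ₗ[ℤ] ringR p) :
    ∃ l : F →ₗ[ℤ] ℤ, ∀ x, (1 - zetaR p) ∣ f x - l x := by
  let b := Module.Free.chooseBasis ℤ F
  choose n hn using fun i => exists_int_dvd_sub p (f (b i))
  refine ⟨b.constr ℤ n, fun x => ?_⟩
  rw [← Ideal.mem_span_singleton, ← Ideal.Quotient.eq_zero_iff_mem]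
  let q : ringR p →ₗ[ℤ] ringR p ⧸ Ideal.span {1 - zetaR p} :=
    (Ideal.Quotient.mk (Ideal.span {1 - zetaR p})).toAddMonoidHom.toIntLinearMap
  have : q ∘ₗ (f - (algebraMap ℤ (ringR p)).toAddMonoidHom.toIntLinearMap ∘ₗ b.constr ℤ n) = 0 :=
    b.ext fun i => by
      rw [LinearMap.comp_apply, LinearMap.sub_apply, LinearMap.comp_apply, Module.Basis.constr_basis]
      change Ideal.Quotient.mk _ (f (b i) - (n i : ringR p)) = 0
      rw [Ideal.Quotient.eq_zero_iff_mem, Ideal.mem_span_singleton]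
      exact hn i
  exact LinearMap.congr_fun this x

variable {M : Type u} [AddCommGroup M] (ρ : Representation ℤ (DihedralGroup p) M)

/-- An integral lift of the coordinate of `σ - 1` modulo `1 - ζ`, multiplied by the inverse `k`
of `2`, on which `τ` acts by a sign. One factor `k` in the formula for `l` averages over `τ`, the other
one is the factor of the coordinate. -/
lemma exists_int_coordinate [Module.Free ℤ (SigmaQuot ρ)] {k : ℤ} (hk : (p : ℤ) ∣ 2 * k - 1) {s : ℤ}
    (hs : s = 1 ∨ s = -1) (r : sigmaKer ρ →ₗ[ringR p] ringR p)
    (hr : ∀ x, r (tauKer ρ x) = s * conjR p (r x)) :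
    ∃ l : SigmaQuot ρ →ₗ[ℤ] ℤ, (∀ x, l (tauQuot ρ x) = -s * l x) ∧
      ∀ m, (1 - zetaR p) ∣ (l (toQuot ρ m) : ringR p) - k * r (sigDiff ρ m) := by
  obtain ⟨s₀, hs₀⟩ := Module.projective_lifting_property (toQuot ρ) LinearMap.id
    (sigmaKer ρ).mkQ_surjective
  obtain ⟨l₀, hl₀⟩ := exists_int_lift (r.toAddMonoidHom.toIntLinearMap ∘ₗ sigDiff ρ ∘ₗ s₀)
  have h1 : ∀ m, (1 - zetaR p) ∣ r (sigDiff ρ m) - l₀ (toQuot ρ m) := by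
    intro m
    have e : m - s₀ (toQuot ρ m) ∈ sigmaKer ρ := by
      rw [← toQuot_eq_zero, map_sub, ← LinearMap.comp_apply, hs₀]; exact sub_self _
    have h2 := sigDiff_coe ρ ⟨_, e⟩
    rw [map_sub, sub_eq_iff_eq_add] at h2
    have h3 := hl₀ (toQuot ρ m)
    rw [h2, map_add, map_smul, smul_eq_mul, add_sub_assoc]
    refine dvd_add (Dvd.dvd.mul_right ⟨-1, by ring⟩ _) h3
  have hss : (s : ringR p) * s = 1 := by rcases hs with rfl | rfl <;> simp
  have hss' : s * s = 1 := by rcases hs with rfl | rfl <;> simp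
  refine ⟨(k * k) • (l₀ - s • l₀ ∘ₗ tauQuot ρ), fun x => ?_, fun m => ?_⟩
  · simp only [LinearMap.smul_apply, LinearMap.sub_apply, LinearMap.comp_apply, tauQuot_tauQuot,
      smul_eq_mul]
    linear_combination (-k * k * l₀ (tauQuot ρ x)) * hss'
  · have h3 := h1 m
    have h4 := h1 (tau ρ m)
    set a := r (sigDiff ρ m)
    have h5 : r (sigDiff ρ (tau ρ m)) = - (zetaR p * (s * conjR p a)) := by
      rw [sigDiff_tau, map_neg, map_smul, smul_eq_mul, hr]
    rw [h5] at h4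
    have h6 : (1 - zetaR p) ∣ (2 * k - 1 : ringR p) := by
      have := (dvd_intCast_iff p _).2 hk
      push_cast at this
      exact this
    simp only [LinearMap.smul_apply, LinearMap.sub_apply, LinearMap.comp_apply, smul_eq_mul,
      tauQuot_toQuot]
    set x := (l₀ (toQuot ρ m) : ringR p) with hx
    set y := (l₀ (toQuot ρ (tau ρ m)) : ringR p) with hy
    have h7 := dvd_conj_sub p a
    have : ((k * k * (l₀ (toQuot ρ m) - s * l₀ (toQuot ρ (tau ρ m))) : ℤ) : ringR p) - k * a =
        - ((a - x) * (k * k)) + (-(zetaR p * (s * conjR p a)) - y) * (k * k * s) +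
        (conjR p a - a) * (k * k) - (1 - zetaR p) * (k * k * conjR p a) +
        (2 * k - 1) * (k * a) := by
      push_cast
      rw [← hx, ← hy]
      linear_combination (k * k * zetaR p * conjR p a) * hss
    rw [this]
    refine dvd_add (dvd_sub (dvd_add (dvd_add ?_ ?_) ?_) (dvd_mul_right _ _)) (h6.mul_right _)
    · exact (h3.mul_right _).neg_right
    · exact h4.mul_right _
    · exact h7.mul_right _

section ModPi

variable (p) (E : Type u) [AddCommGroup E] [Module (ringR p) E]

/-- The quotient `E / (1 - ζ) E`. -/
def PiQuot : Type u := E ⧸ LinearMap.range (LinearMap.lsmul (ringR p) E (1 - zetaR p))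

instance : AddCommGroup (PiQuot p E) := Submodule.Quotient.addCommGroup _

/-- Reduction modulo `1 - ζ`. -/
def modPi : E →+ PiQuot p E :=
  (LinearMap.range (LinearMap.lsmul (ringR p) E (1 - zetaR p))).mkQ.toAddMonoidHom

variable {p E}

lemma modPi_eq_zero {x : E} : modPi p E x = 0 ↔ ∃ y, x = (1 - zetaR p) • y := by
  refine (Submodule.Quotient.mk_eq_zero _).trans ?_
  exact ⟨fun ⟨y, hy⟩ => ⟨y, hy.symm⟩, fun ⟨y, hy⟩ => ⟨y, hy.symm⟩⟩

lemma modPi_eq_iff {x y : E} : modPi p E x = modPi p E y ↔ ∃ z, x - y = (1 - zetaR p) • z := by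
  rw [← sub_eq_zero, ← map_sub, modPi_eq_zero]

lemma modPi_smul_congr {a b : ringR p} (h : (1 - zetaR p) ∣ a - b) (x : E) :
    modPi p E (a • x) = modPi p E (b • x) := by
  obtain ⟨c, hc⟩ := h
  exact modPi_eq_iff.2 ⟨c • x, by rw [← sub_smul, hc, mul_smul]⟩

lemma modPi_zetaR_smul (x : E) : modPi p E (zetaR p • x) = modPi p E x := by
  conv_rhs => rw [← one_smul (ringR p) x]
  exact modPi_smul_congr ⟨-1, by ring⟩ x

lemma modPi_tau {τ : E →+ E} (hτ : ∀ (a : ringR p) x, τ (a • x) = conjR p a • τ x) {x y : E}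
    (h : modPi p E x = modPi p E y) : modPi p E (τ x) = modPi p E (τ y) := by
  obtain ⟨z, hz⟩ := modPi_eq_iff.1 h
  obtain ⟨c, hc⟩ := dvd_conj p (dvd_refl (1 - zetaR p))
  exact modPi_eq_iff.2 ⟨c • τ z, by rw [← map_sub, hz, hτ, hc, mul_smul]⟩

end ModPi

namespace EigenSplitting

variable {E : Type u} [AddCommGroup E] [Module (ringR p) E] {τ : E →+ E} (S : EigenSplitting p τ)

/-- The projection onto `R ε₊ ⊕ R ε₋`. -/
def proj : E →ₗ[ringR p] E :=
  LinearMap.toSpanSingleton _ _ S.eP ∘ₗ S.rP + LinearMap.toSpanSingleton _ _ S.eM ∘ₗ S.rM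

lemma proj_apply (x : E) : S.proj x = S.rP x • S.eP + S.rM x • S.eM := rfl

lemma rP_smul_eP (x : ringR p) : (x * S.rP S.eP) • S.eP = x • S.eP := by
  rcases S.plus with h | ⟨-, h⟩ <;> simp [h]

lemma rM_smul_eM (x : ringR p) : (x * S.rM S.eM) • S.eM = x • S.eM := by
  rcases S.minus with h | ⟨-, h⟩ <;> simp [h]

lemma proj_eP : S.proj S.eP = S.eP := by
  have := S.rP_smul_eP 1
  rw [one_mul, one_smul] at this
  rw [proj_apply, S.rM_eP, zero_smul, add_zero, this]

lemma proj_eM : S.proj S.eM = S.eM := by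
  have := S.rM_smul_eM 1
  rw [one_mul, one_smul] at this
  rw [proj_apply, S.rP_eM, zero_smul, zero_add, this]

lemma proj_proj (x : E) : S.proj (S.proj x) = S.proj x := by
  nth_rewrite 2 [proj_apply]
  rw [map_add, map_smul, map_smul, proj_eP, proj_eM]; rfl

lemma proj_tau (hτ : ∀ (a : ringR p) x, τ (a • x) = conjR p a • τ x) (x : E) :
    S.proj (τ x) = τ (S.proj x) := by
  rw [proj_apply, proj_apply, S.rP_tau, S.rM_tau, map_add, hτ, hτ, S.tau_eP, S.tau_eM, smul_neg,
    neg_smul]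

/-- The splitting with only the summand `R ε₊`. -/
def plusPart : EigenSplitting p τ where
  rP := S.rP
  rM := 0
  eP := S.eP
  eM := 0
  rP_tau := S.rP_tau
  rM_tau := by simp
  tau_eP := S.tau_eP
  tau_eM := by simp
  rP_eM := by simp
  rM_eP := by simp
  plus := S.plus
  minus := by simp

/-- The splitting with only the summand `R ε₋`. -/
def minusPart : EigenSplitting p τ where
  rP := 0
  rM := S.rM
  eP := 0
  eM := S.eM
  rP_tau := by simp
  rM_tau := S.rM_tau
  tau_eP := by simp
  tau_eM := S.tau_eM
  rP_eM := by simp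
  rM_eP := by simp
  plus := by simp
  minus := S.minus

end EigenSplitting

/-- The normal form of an indecomposable lattice `M`: the kernel of the norm is `R ε₊ ⊕ R ε₋` with
one or both summands possibly zero, the quotient is zero, `ℤ`, `ℤ_-` or `ℤ[C₂]`, generated by `c`,
and `(σ - 1) m = ε₊ + ε₋` for some lift `m` of `c`. -/
structure NormalForm where
  S : EigenSplitting p (tauKer ρ)
  full : ∀ e, S.proj e = e
  c : SigmaQuot ρ
  γ : SigmaQuot ρ →ₗ[ℤ] ℤ
  kind : ((∀ x : SigmaQuot ρ, x = 0) ∧ (S.eP = 0 ∨ S.eM = 0) ∧ (S.eP ≠ 0 ∨ S.eM ≠ 0)) ∨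
    (γ c = 1 ∧ (∃ m, toQuot ρ m = c ∧ sigDiff ρ m = S.eP + S.eM) ∧
      (((∀ x, tauQuot ρ x = x) ∧ ∀ x, x = γ x • c) ∨ ((∀ x, tauQuot ρ x = -x) ∧ ∀ x, x = γ x • c) ∨
      (γ (tauQuot ρ c) = 0 ∧ ∀ x, x = γ x • c + γ (tauQuot ρ x) • tauQuot ρ c)))

/-- By Nakayama's lemma, a nonzero finite torsion-free module is not divisible by `1 - ζ`. -/
lemma exists_not_mem_pi {E : Type u} [AddCommGroup E] [Module (ringR p) E] [Module.Finite (ringR p) E]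
    [Module.IsTorsionFree (ringR p) E] [Nontrivial E] : ∃ w : E, modPi p E w ≠ 0 := by
  by_contra! h
  have hle : (⊤ : Submodule (ringR p) E) ≤ Ideal.span {1 - zetaR p} • ⊤ := by
    intro x _
    obtain ⟨y, rfl⟩ := modPi_eq_zero.1 (h x)
    exact Submodule.smul_mem_smul (Ideal.mem_span_singleton_self _) trivial
  obtain ⟨r, hr, hr0⟩ := Submodule.exists_sub_one_mem_and_smul_eq_zero_of_fg_of_le_smul _ _
    Module.Finite.fg_top hle
  obtain ⟨x, hx⟩ := exists_ne (0 : E)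
  have : r = 0 := (smul_eq_zero.1 (hr0 x trivial)).resolve_right hx
  rw [this, Ideal.mem_span_singleton, zero_sub, dvd_neg] at hr
  exact (one_sub_zetaR_prime p).not_isUnit (isUnit_of_dvd_one hr)

end NormalForm

section Classification

variable {p : ℕ} [hpp : Fact p.Prime] (hp : p ≠ 2) {M : GLattice.{0, u} (DihedralGroup p)}
include hp

/-- If the quotient is zero, `M` is a module over `R`, and one of the summands `R ε₊`, `R ε₋` that belong to
an element not divisible by `1 - ζ` is all of `M`. -/
lemma normalForm_of_quot_eq_zero (h : hPlus p = 1) (hM : IsIndecomposable M)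
    (hF : ∀ x : SigmaQuot M.ρ, x = 0) : Nonempty (NormalForm M.ρ) := by
  have hmem : ∀ x, x ∈ sigmaKer M.ρ := fun x => (toQuot_eq_zero _).1 (hF _)
  have := hM.1
  have : Nontrivial (sigmaKer M.ρ) := by
    obtain ⟨x, hx⟩ := exists_ne (0 : M)
    exact ⟨⟨x, hmem x⟩, 0, fun h => hx (congrArg Subtype.val h)⟩
  obtain ⟨w, hw⟩ := exists_not_mem_pi (p := p) (E := sigmaKer M.ρ)
  obtain ⟨S, y, hy⟩ := exists_eigenSplitting p hp h (tauKer M.ρ) (tauKer_smul M.ρ)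
    (tauKer_tauKer M.ρ) w
  have key : ∀ S' : EigenSplitting p (tauKer M.ρ), (S'.eP ≠ 0 ∨ S'.eM ≠ 0) → ∀ e, S'.proj e = e := by
    intro S' hS'
    rcases hM.compatible_eq_zero_or_eq_id hp S'.proj (S'.proj_tau (tauKer_smul M.ρ)) S'.proj_proj
      0 (by simp) (by simp) (fun x => ⟨0, 0, 0, by simp [hF x], by simp, by simp⟩) with h1 | h1
    · rcases hS' with h2 | h2
      · exact absurd (S'.proj_eP.symm.trans (h1.1 _)) h2
      · exact absurd (S'.proj_eM.symm.trans (h1.1 _)) h2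
    · exact h1.1
  by_cases h1 : S.eP = 0
  · have h2 : S.eM ≠ 0 := by
      intro h2
      rw [h1, h2, add_zero, sub_zero] at hy
      exact hw (modPi_eq_zero.2 ⟨y, hy⟩)
    exact ⟨⟨S.minusPart, key _ (Or.inr h2), 0, 0, Or.inl ⟨hF, Or.inl rfl, Or.inr h2⟩⟩⟩
  · exact ⟨⟨S.plusPart, key _ (Or.inl h1), 0, 0, Or.inl ⟨hF, Or.inr rfl, Or.inl h1⟩⟩⟩

/-- A summand of the quotient of type `ℤ`, `ℤ_-` or `ℤ[C₂]` with generator `c` and a splitting of the kernel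
such that the extension class takes the value `ε₊ + ε₋` at `c` define a summand of the kernel and one of
the quotient. The projection `q` to the latter is modified to a projection `κ` that is compatible with the
extension class, so that both projections come from an idempotent endomorphism of `M`. -/
lemma normalForm_of_quot_nontrivial (h : hPlus p = 1) (hM : IsIndecomposable M)
    [Nontrivial (SigmaQuot M.ρ)] : Nonempty (NormalForm M.ρ) := by
  set ρ := M.ρ
  obtain ⟨c, q, γ, hqt, hqc, hγc, hkind⟩ := exists_involution_summand (tauQuot ρ) (tauQuot_tauQuot ρ)
  obtain ⟨m₀, hm₀⟩ := (sigmaKer ρ).mkQ_surjective c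
  obtain ⟨S, y, hy⟩ := exists_eigenSplitting p hp h (tauKer ρ) (tauKer_smul ρ)
    (tauKer_tauKer ρ) (sigDiff ρ m₀)
  obtain ⟨k, hk⟩ := exists_two_mul p hp
  have hk2 : (1 - zetaR p) ∣ (k + k : ringR p) - 1 := by
    have := (dvd_intCast_iff p _).2 hk
    push_cast at this
    rwa [two_mul] at this
  obtain ⟨lP, hlP, hlP'⟩ := exists_int_coordinate ρ hk (Or.inl rfl) S.rP (by simpa using S.rP_tau)
  obtain ⟨lM, hlM, hlM'⟩ := exists_int_coordinate ρ hk (Or.inr rfl) S.rM (by simpa using S.rM_tau)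
  obtain ⟨s, hs, hst⟩ := exists_tau_section ρ hp
  -- the extension class, as a map from the quotient to the kernel modulo `1 - ζ`
  obtain ⟨D, hD⟩ : ∃ D : SigmaQuot ρ →+ sigmaKer ρ, ∀ x, D x = sigDiff ρ (s x) :=
    ⟨(sigDiff ρ ∘ₗ s).toAddMonoidHom, fun _ => rfl⟩
  set μ := modPi p (sigmaKer ρ)
  have hDt : ∀ x, μ (D (tauQuot ρ x)) = - μ (tauKer ρ (D x)) := by
    intro x
    rw [hD, hD, hst, sigDiff_tau, map_neg, modPi_zetaR_smul]
  have hDc : μ (D c) = μ S.eP + μ S.eM := by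
    have e : s c - m₀ ∈ sigmaKer ρ := by rw [← toQuot_eq_zero, map_sub, hs, hm₀, sub_self]
    have h2 := sigDiff_coe ρ ⟨_, e⟩
    rw [map_sub, sub_eq_iff_eq_add] at h2
    rw [hD, h2, map_add, ← map_add μ S.eP, modPi_eq_iff.2 ⟨y, hy⟩]
    have : μ ((zetaR p - 1) • ⟨s c - m₀, e⟩) = 0 := modPi_eq_zero.2 ⟨-⟨s c - m₀, e⟩, by module⟩
    rw [this, zero_add]
  have hDtc : μ (D (tauQuot ρ c)) = - μ S.eP + μ S.eM := by
    rw [hDt]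
    have : μ (D c) = μ (S.eP + S.eM) := by rw [hDc, map_add]
    rw [modPi_tau (tauKer_smul ρ) this, map_add, S.tau_eP, S.tau_eM, map_add, map_neg]
    abel
  -- the equivariant map to the span of `c` and `τ c` with the same extension class as `D`
  let ψ : SigmaQuot ρ →ₗ[ℤ] SigmaQuot ρ := LinearMap.toSpanSingleton ℤ _ (c - tauQuot ρ c) ∘ₗ lP +
    LinearMap.toSpanSingleton ℤ _ (c + tauQuot ρ c) ∘ₗ lM
  have hψ : ∀ x, ψ x = lP x • (c - tauQuot ρ c) + lM x • (c + tauQuot ρ c) := fun _ => rfl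
  have hψt : ∀ x, ψ (tauQuot ρ x) = tauQuot ρ (ψ x) := by
    intro x
    rw [hψ, hψ, hlP, hlM, map_add, map_smul, map_smul, map_sub, map_add, tauQuot_tauQuot]
    module
  have hψD : ∀ x, μ (D (ψ x)) = μ (S.proj (D x)) := by
    intro x
    have h1 := hlP' (s x)
    have h2 := hlM' (s x)
    rw [hs, ← hD] at h1 h2
    have aux : ∀ (l : ℤ) (r : ringR p) (e : sigmaKer ρ), (1 - zetaR p) ∣ (l : ringR p) - k * r →
        l • (μ e + μ e) = μ (r • e) := by
      intro l r e hd
      rw [← map_add, ← map_zsmul, ← two_smul (ringR p) e, ← Int.cast_smul_eq_zsmul (ringR p) l,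
        ← mul_smul]
      apply modPi_smul_congr
      have : (l : ringR p) * 2 - r = ((l : ringR p) - k * r) * 2 + (k + k - 1) * r := by ring
      rw [this]
      exact dvd_add (hd.mul_right _) (hk2.mul_right _)
    rw [hψ, S.proj_apply, map_add μ (_ • _), ← aux _ _ _ h1, ← aux _ _ _ h2]
    simp only [map_add, map_sub, map_zsmul, hDc, hDtc]
    abel_nf
  have hεc : ∀ x, (∃ a b : ℤ, x = a • c + b • tauQuot ρ c) → μ (D x) = μ (S.proj (D x)) := by
    have hμ : ∀ {a b : sigmaKer ρ}, μ a = μ b → μ (S.proj a) = μ (S.proj b) := by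
      intro a b hab
      obtain ⟨z, hz⟩ := modPi_eq_iff.1 hab
      exact modPi_eq_iff.2 ⟨S.proj z, by rw [← map_sub, hz, map_smul]⟩
    have h1 : μ (D c) = μ (S.proj (D c)) := by
      have e : μ (D c) = μ (S.eP + S.eM) := by rw [hDc, map_add]
      rw [hμ e, e, map_add S.proj, S.proj_eP, S.proj_eM]
    have h2 : μ (D (tauQuot ρ c)) = μ (S.proj (D (tauQuot ρ c))) := by
      have e : μ (D (tauQuot ρ c)) = μ (-S.eP + S.eM) := by rw [hDtc, map_add, map_neg]
      rw [hμ e, e, map_add S.proj, map_neg S.proj, S.proj_eP, S.proj_eM]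
    rintro x ⟨a, b, rfl⟩
    simp only [map_add, map_zsmul]
    rw [h1, h2]
  have hspan : ∀ x, ∃ a b : ℤ, q x = a • c + b • tauQuot ρ c := by
    intro x
    rcases hkind with ⟨-, h1⟩ | ⟨-, h1⟩ | ⟨-, h1⟩
    · exact ⟨γ x, 0, by rw [h1]; simp⟩
    · exact ⟨γ x, 0, by rw [h1]; simp⟩
    · exact ⟨γ x, _, h1 x⟩
  have hqtc : q (tauQuot ρ c) = tauQuot ρ c := by rw [hqt, hqc]
  have hqspan : ∀ x, (∃ a b : ℤ, x = a • c + b • tauQuot ρ c) → q x = x := by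
    rintro x ⟨a, b, rfl⟩
    rw [map_add, map_smul, map_smul, hqc, hqtc]
  have hqψ : ∀ x, q (ψ x) = ψ x := fun x => hqspan _ ⟨lP x + lM x, lM x - lP x, by rw [hψ]; module⟩
  have hqq : ∀ x, q (q x) = q x := fun x => hqspan _ (hspan x)
  -- a projection with the image of `q` for which `D ∘ κ` is the part of `D` in the summand
  let κ : SigmaQuot ρ →ₗ[ℤ] SigmaQuot ρ := q + ψ - ψ ∘ₗ q
  have hκ : ∀ x, κ x = q x + ψ x - ψ (q x) := fun _ => rfl
  have hqκ : ∀ x, q (κ x) = κ x := fun x => by rw [hκ, map_sub, map_add, hqq, hqψ, hqψ]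
  have hκq : ∀ x, κ (q x) = q x := fun x => by rw [hκ, hqq]; abel
  have hκc : κ c = c := by
    have := hκq c
    rwa [hqc] at this
  rcases hM.compatible_eq_zero_or_eq_id hp S.proj (S.proj_tau (tauKer_smul ρ)) S.proj_proj κ
    (fun x => by rw [hκ, hκ, hqt, hψt, hψt, map_sub, map_add])
    (fun x => by rw [← hqκ x, hκq])
    (fun x => by
      have : μ (D (κ x)) = μ (S.proj (D x)) := by
        rw [hκ, map_sub, map_add, map_sub, map_add, hψD, hψD, hεc _ (hspan x)]
        abel
      obtain ⟨z, hz⟩ := modPi_eq_iff.1 this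
      exact ⟨s x, s (κ x), z, hs x, hs _, by rw [← hD, ← hD]; exact hz⟩) with h1 | h1
  · have := h1.2 c
    rw [hκc] at this
    rw [this, map_zero] at hγc
    exact absurd hγc zero_ne_one
  · have hq1 : ∀ x, q x = x := fun x => by
      have := hqκ x
      rwa [h1.2] at this
    refine ⟨⟨S, h1.1, c, γ, Or.inr ⟨hγc, ⟨m₀ + y, ?_, ?_⟩, ?_⟩⟩⟩
    · rw [map_add, hm₀, (toQuot_eq_zero ρ).2 y.2, add_zero]
    · have : sigDiff ρ m₀ = (1 - zetaR p) • y + (S.eP + S.eM) := by rw [← hy]; abel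
      rw [map_add, sigDiff_coe, this]
      module
    · simp only [hq1] at hkind
      rcases hkind with ⟨h2, h3⟩ | ⟨h2, h3⟩ | h2
      · exact Or.inl ⟨fun x => by rw [h3 x, map_smul, h2], h3⟩
      · exact Or.inr (Or.inl ⟨fun x => by rw [h3 x, map_smul, h2, smul_neg], h3⟩)
      · exact Or.inr (Or.inr h2)

theorem exists_normalForm (h : hPlus p = 1) (hM : IsIndecomposable M) :
    Nonempty (NormalForm M.ρ) := by
  rcases subsingleton_or_nontrivial (SigmaQuot M.ρ) with hF | hF
  · exact normalForm_of_quot_eq_zero hp h hM fun x => Subsingleton.elim _ _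
  · exact normalForm_of_quot_nontrivial hp h hM

end Classification

/-! ### The type of a lattice -/

section LatticeType

variable {p : ℕ} [hpp : Fact p.Prime] {M : Type u} [AddCommGroup M]
  (ρ : Representation ℤ (DihedralGroup p) M)

/-- `τ` acts as `s` on a nonzero class of the kernel of the norm modulo `σ - 1`. -/
def HasEigenclass (s : ℤ) : Prop :=
  ∃ e ∈ sigmaKer ρ, (¬ ∃ y ∈ sigmaKer ρ, e = y - sig ρ y) ∧
    ∃ y ∈ sigmaKer ρ, tau ρ e - s • e = y - sig ρ y

/-- `τ` acts as `s` on the quotient of the lattice by the kernel of the norm. -/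
def QuotSign (s : ℤ) : Prop := ∀ x : M, tau ρ x - s • x ∈ sigmaKer ρ

open Classical in
/-- The four isomorphism invariants which distinguish the indecomposable lattices: whether `τ` acts
as `1`, or as `-1`, on the quotient by the kernel of the norm of `σ`, and whether it has eigenvalue
`1`, or `-1`, on that kernel modulo `σ - 1`. -/
def latticeType : Bool × Bool × Bool × Bool :=
  (decide (QuotSign ρ 1), decide (QuotSign ρ (-1)), decide (HasEigenclass ρ 1),
    decide (HasEigenclass ρ (-1)))

open Classical in
lemma latticeType_eq_iff {a b c d : Bool} : latticeType ρ = (a, b, c, d) ↔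
    (QuotSign ρ 1 ↔ a = true) ∧ (QuotSign ρ (-1) ↔ b = true) ∧
    (HasEigenclass ρ 1 ↔ c = true) ∧ (HasEigenclass ρ (-1) ↔ d = true) := by
  simp only [latticeType, Prod.mk.injEq]
  refine and_congr ?_ (and_congr ?_ (and_congr ?_ ?_)) <;>
  · rw [Bool.eq_iff_iff, decide_eq_true_iff (p := _)]

lemma hasEigenclass_iff {s : ℤ} : HasEigenclass ρ s ↔ ∃ e : sigmaKer ρ, modPi p _ e ≠ 0 ∧
    modPi p _ (tauKer ρ e) = s • modPi p _ e := by
  have h1 : ∀ e : sigmaKer ρ, (∃ y ∈ sigmaKer ρ, (e : M) = y - sig ρ y) ↔ modPi p _ e = 0 := by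
    intro e
    rw [modPi_eq_zero]
    constructor
    · rintro ⟨y, hy, h⟩
      refine ⟨⟨y, hy⟩, Subtype.ext ?_⟩
      rw [sub_smul, one_smul, Submodule.coe_sub, zetaR_smul, h]
    · rintro ⟨y, rfl⟩
      refine ⟨y, y.2, ?_⟩
      rw [sub_smul, one_smul, Submodule.coe_sub, zetaR_smul]
  have h2 : ∀ e : sigmaKer ρ, (∃ y ∈ sigmaKer ρ, tau ρ e - s • (e : M) = y - sig ρ y) ↔
      modPi p _ (tauKer ρ e) = s • modPi p _ e := by
    intro e
    rw [← sub_eq_zero, ← map_zsmul, ← map_sub, ← h1]; rfl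
  constructor
  · rintro ⟨e, he, ha, hb⟩
    exact ⟨⟨e, he⟩, mt (h1 ⟨e, he⟩).2 ha, (h2 ⟨e, he⟩).1 hb⟩
  · rintro ⟨e, ha, hb⟩
    exact ⟨e, e.2, mt (h1 e).1 ha, (h2 e).2 hb⟩

lemma quotSign_iff {s : ℤ} : QuotSign ρ s ↔ ∀ x, tauQuot ρ x = s • x := by
  constructor
  · intro h x
    obtain ⟨x, rfl⟩ := (sigmaKer ρ).mkQ_surjective x
    rw [tauQuot_toQuot, ← sub_eq_zero, ← map_zsmul, ← map_sub, toQuot_eq_zero]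
    exact h x
  · intro h x
    rw [← toQuot_eq_zero, map_sub, ← tauQuot_toQuot, h, map_zsmul, sub_self]

lemma Equiv.apply_rho {M' : Type v} [AddCommGroup M'] {ρ' : Representation ℤ (DihedralGroup p) M'}
    (f : ρ.Equiv ρ') (g : DihedralGroup p) (x : M) : f (ρ g x) = ρ' g (f x) :=
  LinearMap.congr_fun (f.isIntertwining' g) x

lemma Equiv.mem_sigmaKer_iff {M' : Type v} [AddCommGroup M']
    {ρ' : Representation ℤ (DihedralGroup p) M'} (f : ρ.Equiv ρ') (x : M) :
    f x ∈ sigmaKer ρ' ↔ x ∈ sigmaKer ρ := by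
  have := map_normSig ρ ρ' (f.toLinearEquiv : M →ₗ[ℤ] M') (fun x => Equiv.apply_rho ρ f _ x) x
  rw [mem_sigmaKer, mem_sigmaKer]
  refine Iff.trans ?_ f.toLinearEquiv.map_eq_zero_iff
  exact Eq.congr_left this.symm

lemma Equiv.quotSign_and_hasEigenclass {M' : Type v} [AddCommGroup M']
    {ρ' : Representation ℤ (DihedralGroup p) M'} (f : ρ.Equiv ρ') (s : ℤ) :
    (QuotSign ρ s → QuotSign ρ' s) ∧ (HasEigenclass ρ s → HasEigenclass ρ' s) := by
  have hg := Equiv.apply_rho ρ f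
  have hs : ∀ x, ∃ y, f y = x := f.toLinearEquiv.surjective
  refine ⟨fun h x => ?_, ?_⟩
  · obtain ⟨x, rfl⟩ := hs x
    rw [← hg, ← map_zsmul, ← map_sub, Equiv.mem_sigmaKer_iff]
    exact h x
  · rintro ⟨e, he, h1, y, hy, h2⟩
    refine ⟨f e, (Equiv.mem_sigmaKer_iff ρ f _).2 he, ?_, f y, (Equiv.mem_sigmaKer_iff ρ f _).2 hy, ?_⟩
    · rintro ⟨z, hz, h3⟩
      obtain ⟨z, rfl⟩ := hs z
      refine h1 ⟨z, (Equiv.mem_sigmaKer_iff ρ f _).1 hz, f.toLinearEquiv.injective ?_⟩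
      change f e = f (z - sig ρ z)
      rw [map_sub, hg, h3]
    · rw [← hg, ← map_zsmul, ← map_sub, h2, map_sub, hg]

lemma latticeType_congr {M' : Type v} [AddCommGroup M'] {ρ' : Representation ℤ (DihedralGroup p) M'}
    (f : ρ.Equiv ρ') : latticeType ρ = latticeType ρ' := by
  have h1 := Equiv.quotSign_and_hasEigenclass ρ f
  have h2 := Equiv.quotSign_and_hasEigenclass ρ' f.symm
  simp only [latticeType, Prod.mk.injEq, decide_eq_decide]
  exact ⟨⟨(h1 _).1, (h2 _).1⟩, ⟨(h1 _).1, (h2 _).1⟩, ⟨(h1 _).2, (h2 _).2⟩, ⟨(h1 _).2, (h2 _).2⟩⟩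

namespace NormalForm

variable {ρ} (N : NormalForm ρ)

lemma smul_eP_mem {x : ringR p} (h : modPi p _ (x • N.S.eP) = 0) : N.S.eP = 0 ∨ (1 - zetaR p) ∣ x := by
  obtain ⟨y, hy⟩ := modPi_eq_zero.1 h
  rcases N.S.plus with h1 | h1
  · right
    have := congrArg N.S.rP hy
    rw [map_smul, map_smul, h1, smul_eq_mul, mul_one] at this
    exact ⟨_, this⟩
  · exact Or.inl h1.2

lemma smul_eM_mem {x : ringR p} (h : modPi p _ (x • N.S.eM) = 0) : N.S.eM = 0 ∨ (1 - zetaR p) ∣ x := by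
  obtain ⟨y, hy⟩ := modPi_eq_zero.1 h
  rcases N.S.minus with h1 | h1
  · right
    have := congrArg N.S.rM hy
    rw [map_smul, map_smul, h1, smul_eq_mul, mul_one] at this
    exact ⟨_, this⟩
  · exact Or.inl h1.2

lemma two_not_dvd (hp : p ≠ 2) : ¬ (1 - zetaR p) ∣ (2 : ringR p) := by
  intro h
  have : (1 - zetaR p) ∣ ((2 : ℤ) : ringR p) := by exact_mod_cast h
  rw [dvd_intCast_iff] at this
  exact hp ((Nat.prime_dvd_prime_iff_eq hpp.out Nat.prime_two).1 (by exact_mod_cast this))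

lemma hasEigenclass_one_iff (hp : p ≠ 2) : HasEigenclass ρ 1 ↔ N.S.eP ≠ 0 := by
  rw [hasEigenclass_iff]
  constructor
  · rintro ⟨e, h1, h2⟩ h0
    have he := N.full e
    rw [N.S.proj_apply, h0, smul_zero, zero_add] at he
    set x := N.S.rM e
    rw [one_smul] at h2
    have h3 : modPi p _ (tauKer ρ e) = - modPi p _ e := by
      conv_lhs => rw [← he]
      rw [tauKer_smul, N.S.tau_eM, smul_neg, map_neg, modPi_smul_congr (dvd_conj_sub p x), he]
    rw [h3] at h2
    have h4 : modPi p _ ((2 : ringR p) • e) = 0 := by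
      rw [two_smul, map_add]; nth_rewrite 1 [← h2]; exact neg_add_cancel _
    rw [← he, ← mul_smul] at h4
    rcases N.smul_eM_mem h4 with h5 | h5
    · exact h1 (by rw [← he, h5]; simp)
    · rcases (one_sub_zetaR_prime p).dvd_or_dvd h5 with h6 | ⟨z, h6⟩
      · exact two_not_dvd hp h6
      · exact h1 (modPi_eq_zero.2 ⟨z • N.S.eM, by rw [← he, h6, mul_smul]⟩)
  · intro h
    refine ⟨N.S.eP, fun h0 => ?_, by rw [N.S.tau_eP, one_smul]⟩
    rw [← one_smul (ringR p) N.S.eP] at h0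
    exact (N.smul_eP_mem h0).elim h fun h1 => (one_sub_zetaR_prime p).not_isUnit (isUnit_of_dvd_one h1)

lemma hasEigenclass_neg_one_iff (hp : p ≠ 2) : HasEigenclass ρ (-1) ↔ N.S.eM ≠ 0 := by
  rw [hasEigenclass_iff]
  constructor
  · rintro ⟨e, h1, h2⟩ h0
    have he := N.full e
    rw [N.S.proj_apply, h0, smul_zero, add_zero] at he
    set x := N.S.rP e
    rw [neg_smul, one_smul] at h2
    have h3 : modPi p _ (tauKer ρ e) = modPi p _ e := by
      conv_lhs => rw [← he]
      rw [tauKer_smul, N.S.tau_eP, modPi_smul_congr (dvd_conj_sub p x), he]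
    rw [h3] at h2
    have h4 : modPi p _ ((2 : ringR p) • e) = 0 := by
      rw [two_smul, map_add]; nth_rewrite 1 [h2]; exact neg_add_cancel _
    rw [← he, ← mul_smul] at h4
    rcases N.smul_eP_mem h4 with h5 | h5
    · exact h1 (by rw [← he, h5]; simp)
    · rcases (one_sub_zetaR_prime p).dvd_or_dvd h5 with h6 | ⟨z, h6⟩
      · exact two_not_dvd hp h6
      · exact h1 (modPi_eq_zero.2 ⟨z • N.S.eP, by rw [← he, h6, mul_smul]⟩)
  · intro h
    refine ⟨N.S.eM, fun h0 => ?_, by rw [N.S.tau_eM, map_neg, neg_smul, one_smul]⟩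
    rw [← one_smul (ringR p) N.S.eM] at h0
    exact (N.smul_eM_mem h0).elim h fun h1 => (one_sub_zetaR_prime p).not_isUnit (isUnit_of_dvd_one h1)

/-- If `τ` fixes the generator of the quotient up to the sign `s`, the extension class lies in the
`-s`-eigenspace of `τ`. -/
lemma two_smul_mem {m : M} (hm : sigDiff ρ m = N.S.eP + N.S.eM) {s : ℤ}
    (ht : tauQuot ρ (toQuot ρ m) = s • toQuot ρ m) :
    modPi p _ N.S.eM - modPi p _ N.S.eP = s • (modPi p _ N.S.eP + modPi p _ N.S.eM) := by
  have e : tau ρ m - s • m ∈ sigmaKer ρ := by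
    rw [← toQuot_eq_zero, map_sub, ← tauQuot_toQuot, ht, map_zsmul, sub_self]
  have h1 := sigDiff_coe ρ ⟨_, e⟩
  rw [map_sub, map_zsmul, sigDiff_tau, hm, map_add, N.S.tau_eP, N.S.tau_eM] at h1
  have h2 := congrArg (modPi p _) h1
  have h3 : modPi p _ ((zetaR p - 1) • (⟨_, e⟩ : sigmaKer ρ)) = 0 :=
    modPi_eq_zero.2 ⟨-⟨_, e⟩, by module⟩
  rw [h3, map_sub, map_zsmul, map_neg, modPi_zetaR_smul, map_add, map_neg, map_add, sub_eq_zero] at h2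
  rw [← h2]; abel

end NormalForm

/-- The possible types of an indecomposable lattice, those of `ℤ, ℤ_-, ℤ[H], R, P, V, X, Y₀, Y₁, Y₂`. -/
def tenTypes : Fin 10 → Bool × Bool × Bool × Bool :=
  ![(true, false, false, false), (false, true, false, false), (false, false, false, false),
    (true, true, true, false), (true, true, false, true), (true, false, false, true),
    (false, true, true, false), (false, false, true, false), (false, false, false, true),
    (false, false, true, true)]

lemma tenTypes_injective : Function.Injective tenTypes := by decide

/-- Which of the signs occur on the quotient determines its shape. -/
lemma NormalForm.quotSign_cases {ρ : Representation ℤ (DihedralGroup p) M}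
    [Module.IsTorsionFree ℤ M] (N : NormalForm ρ) :
    (QuotSign ρ 1 ∧ QuotSign ρ (-1) ∧ (∀ x : SigmaQuot ρ, x = 0) ∧ (N.S.eP = 0 ∨ N.S.eM = 0) ∧
      (N.S.eP ≠ 0 ∨ N.S.eM ≠ 0)) ∨
    (N.γ N.c = 1 ∧ (∃ m, toQuot ρ m = N.c ∧ sigDiff ρ m = N.S.eP + N.S.eM) ∧
      ((QuotSign ρ 1 ∧ ¬ QuotSign ρ (-1) ∧ (∀ x, tauQuot ρ x = x) ∧ ∀ x, x = N.γ x • N.c) ∨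
      (¬ QuotSign ρ 1 ∧ QuotSign ρ (-1) ∧ (∀ x, tauQuot ρ x = -x) ∧ ∀ x, x = N.γ x • N.c) ∨
      (¬ QuotSign ρ 1 ∧ ¬ QuotSign ρ (-1) ∧ N.γ (tauQuot ρ N.c) = 0 ∧
        ∀ x, x = N.γ x • N.c + N.γ (tauQuot ρ x) • tauQuot ρ N.c))) := by
  have hneg : ∀ {x : SigmaQuot ρ}, x = -x → x = 0 := fun {x} h => by
    have : (2 : ℤ) • x = 0 := by rw [two_smul]; nth_rewrite 1 [h]; exact neg_add_cancel x
    exact (smul_eq_zero.1 this).resolve_left two_ne_zero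
  rcases N.kind with ⟨h0, h1, h2⟩ | ⟨h0, hm, h1⟩
  · exact Or.inl ⟨(quotSign_iff ρ).2 fun x => by rw [h0 x]; simp,
      (quotSign_iff ρ).2 fun x => by rw [h0 x]; simp, h0, h1, h2⟩
  · have hc0 : N.c ≠ 0 := by
      intro h; rw [h, map_zero] at h0; exact zero_ne_one h0
    refine Or.inr ⟨h0, hm, ?_⟩
    rcases h1 with ⟨h1, h2⟩ | ⟨h1, h2⟩ | ⟨h1, h2⟩
    · refine Or.inl ⟨(quotSign_iff ρ).2 fun x => by rw [h1 x, one_smul], fun h => hc0 (hneg ?_), h1, h2⟩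
      have := (quotSign_iff ρ).1 h N.c
      rwa [h1, neg_one_smul] at this
    · refine Or.inr (Or.inl ⟨fun h => hc0 (hneg ?_),
        (quotSign_iff ρ).2 fun x => by rw [h1 x, neg_one_smul], h1, h2⟩)
      have := (quotSign_iff ρ).1 h N.c
      rw [h1, one_smul] at this
      exact this.symm
    · refine Or.inr (Or.inr ⟨fun h => ?_, fun h => ?_, h1, h2⟩)
      · have := (quotSign_iff ρ).1 h N.c
        rw [one_smul] at this
        rw [this] at h1; exact zero_ne_one (h1.symm.trans h0)
      · have := (quotSign_iff ρ).1 h N.c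
        rw [neg_one_smul] at this
        rw [this, map_neg, h0] at h1; simp at h1

/-- If `τ` acts on the quotient by a sign, only one of the two summands of the kernel can be nonzero, by
`NormalForm.two_smul_mem`. -/
lemma NormalForm.latticeType_mem {ρ : Representation ℤ (DihedralGroup p) M}
    [Module.IsTorsionFree ℤ M] (hp : p ≠ 2) (N : NormalForm ρ) :
    ∃ i, latticeType ρ = tenTypes i := by
  have hP := N.hasEigenclass_one_iff hp
  have hM := N.hasEigenclass_neg_one_iff hp
  have hzP : modPi p _ N.S.eP + modPi p _ N.S.eP = 0 → N.S.eP = 0 := fun h => by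
    rw [← map_add, ← two_smul (ringR p)] at h
    exact (N.smul_eP_mem h).resolve_right (NormalForm.two_not_dvd hp)
  have hzM : modPi p _ N.S.eM + modPi p _ N.S.eM = 0 → N.S.eM = 0 := fun h => by
    rw [← map_add, ← two_smul (ringR p)] at h
    exact (N.smul_eM_mem h).resolve_right (NormalForm.two_not_dvd hp)
  rcases N.quotSign_cases with ⟨q1, q2, h0, h1, h2⟩ |
      ⟨h0, ⟨m, hm, hm'⟩, ⟨q1, q2, h1, -⟩ | ⟨q1, q2, h1, -⟩ | ⟨q1, q2, h1, -⟩⟩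
  · by_cases h3 : N.S.eP = 0
    · exact ⟨4, (latticeType_eq_iff ρ (a := true) (b := true) (c := false) (d := true)).2
          ⟨by simp [q1], by simp [q2], by simp [hP, h3],
            by simp [hM, h2.resolve_left (not_not.2 h3)]⟩⟩
    · exact ⟨3, (latticeType_eq_iff ρ (a := true) (b := true) (c := true) (d := false)).2
          ⟨by simp [q1], by simp [q2], by simp [hP, h3], by simp [hM, h1.resolve_left h3]⟩⟩
  · have h3 : N.S.eP = 0 := hzP (by
      have := N.two_smul_mem (s := 1) hm' (by rw [hm, h1, one_smul])
      rw [one_smul, sub_eq_iff_eq_add, add_right_comm] at this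
      exact (right_eq_add.1 this))
    by_cases h4 : N.S.eM = 0
    · exact ⟨0, (latticeType_eq_iff ρ (a := true) (b := false) (c := false) (d := false)).2
        ⟨by simp [q1], by simp [q2], by simp [hP, h3], by simp [hM, h4]⟩⟩
    · exact ⟨5, (latticeType_eq_iff ρ (a := true) (b := false) (c := false) (d := true)).2
        ⟨by simp [q1], by simp [q2], by simp [hP, h3], by simp [hM, h4]⟩⟩
  · have h3 : N.S.eM = 0 := hzM (by
      have := N.two_smul_mem (s := -1) hm' (by rw [hm, h1, neg_one_smul])
      rw [neg_one_smul, neg_add, sub_eq_add_neg, add_comm, add_right_inj] at this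
      nth_rewrite 1 [this]; exact neg_add_cancel _)
    by_cases h4 : N.S.eP = 0
    · exact ⟨1, (latticeType_eq_iff ρ (a := false) (b := true) (c := false) (d := false)).2
        ⟨by simp [q1], by simp [q2], by simp [hP, h4], by simp [hM, h3]⟩⟩
    · exact ⟨6, (latticeType_eq_iff ρ (a := false) (b := true) (c := true) (d := false)).2
        ⟨by simp [q1], by simp [q2], by simp [hP, h4], by simp [hM, h3]⟩⟩
  · by_cases h3 : N.S.eP = 0 <;> by_cases h4 : N.S.eM = 0
    · exact ⟨2, (latticeType_eq_iff ρ (a := false) (b := false) (c := false) (d := false)).2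
        ⟨by simp [q1], by simp [q2], by simp [hP, h3], by simp [hM, h4]⟩⟩
    · exact ⟨8, (latticeType_eq_iff ρ (a := false) (b := false) (c := false) (d := true)).2
        ⟨by simp [q1], by simp [q2], by simp [hP, h3], by simp [hM, h4]⟩⟩
    · exact ⟨7, (latticeType_eq_iff ρ (a := false) (b := false) (c := true) (d := false)).2
        ⟨by simp [q1], by simp [q2], by simp [hP, h3], by simp [hM, h4]⟩⟩
    · exact ⟨9, (latticeType_eq_iff ρ (a := false) (b := false) (c := true) (d := true)).2
        ⟨by simp [q1], by simp [q2], by simp [hP, h3], by simp [hM, h4]⟩⟩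

section Iso

variable {ρ} {M' : Type v} [AddCommGroup M'] {ρ' : Representation ℤ (DihedralGroup p) M'}

/-- If the quotients of two normal forms have the same shape, there is an equivariant map which matches
their generators. -/
lemma NormalForm.exists_quotMap [Module.IsTorsionFree ℤ M] [Module.IsTorsionFree ℤ M']
    (N : NormalForm ρ) (N' : NormalForm ρ') (h1 : QuotSign ρ 1 ↔ QuotSign ρ' 1)
    (h2 : QuotSign ρ (-1) ↔ QuotSign ρ' (-1)) :
    ∃ β : SigmaQuot ρ →ₗ[ℤ] SigmaQuot ρ', (∀ x, β (tauQuot ρ x) = tauQuot ρ' (β x)) ∧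
      β N.c = N'.c := by
  let β₁ : SigmaQuot ρ →ₗ[ℤ] SigmaQuot ρ' := LinearMap.toSpanSingleton ℤ _ N'.c ∘ₗ N.γ
  have hβ₁ : ∀ x, β₁ x = N.γ x • N'.c := fun _ => rfl
  rcases N.quotSign_cases with ⟨q1, q2, h0, -⟩ | ⟨h0, -, ⟨q1, q2, a1, a2⟩ | ⟨q1, q2, a1, a2⟩ | ⟨q1, q2, a1, a2⟩⟩ <;>
    rcases N'.quotSign_cases with ⟨q1', q2', h0', -⟩ | ⟨h0', -, ⟨q1', q2', b1, b2⟩ | ⟨q1', q2', b1, b2⟩ | ⟨q1', q2', b1, b2⟩⟩ <;>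
    first | (exfalso; tauto) | skip
  · exact ⟨0, by simp, by rw [h0' N'.c]; simp⟩
  · exact ⟨β₁, fun x => by rw [a1, b1], by rw [hβ₁, h0, one_smul]⟩
  · exact ⟨β₁, fun x => by rw [a1, b1, map_neg], by rw [hβ₁, h0, one_smul]⟩
  · let β₂ : SigmaQuot ρ →ₗ[ℤ] SigmaQuot ρ' :=
      β₁ + LinearMap.toSpanSingleton ℤ _ (tauQuot ρ' N'.c) ∘ₗ N.γ ∘ₗ tauQuot ρ
    have hβ₂ : ∀ x, β₂ x = N.γ x • N'.c + N.γ (tauQuot ρ x) • tauQuot ρ' N'.c := fun _ => rfl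
    exact ⟨β₂, fun x => by
      rw [hβ₂, hβ₂, map_add, map_smul, map_smul, tauQuot_tauQuot, tauQuot_tauQuot, add_comm],
      by rw [hβ₂, h0, a1]; simp⟩

lemma NormalForm.span [Module.IsTorsionFree ℤ M] (N : NormalForm ρ) (x : SigmaQuot ρ) :
    ∃ a b : ℤ, x = a • N.c + b • tauQuot ρ N.c := by
  rcases N.kind with ⟨h0, -⟩ | ⟨-, -, ⟨-, h2⟩ | ⟨-, h2⟩ | ⟨-, h2⟩⟩
  · exact ⟨0, 0, by rw [h0 x]; simp⟩
  · exact ⟨N.γ x, 0, by rw [← h2]; simp⟩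
  · exact ⟨N.γ x, 0, by rw [← h2]; simp⟩
  · exact ⟨_, _, h2 x⟩

/-- The map which matches the generators of two normal forms. -/
lemma NormalForm.exists_map [Module.IsTorsionFree ℤ M] [Module.IsTorsionFree ℤ M']
    [Module.Finite ℤ M] [Module.Finite ℤ M'] (hp : p ≠ 2)
    (N : NormalForm ρ) (N' : NormalForm ρ') (h1 : QuotSign ρ 1 ↔ QuotSign ρ' 1)
    (h2 : QuotSign ρ (-1) ↔ QuotSign ρ' (-1)) (h3 : N.S.eP = 0 ↔ N'.S.eP = 0)
    (h4 : N.S.eM = 0 ↔ N'.S.eM = 0) :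
    ∃ Φ : M →ₗ[ℤ] M', (∀ g x, Φ (ρ g x) = ρ' g (Φ x)) ∧
      (∀ e : sigmaKer ρ, Φ e = (N.S.rP e • N'.S.eP + N.S.rM e • N'.S.eM : sigmaKer ρ')) ∧
      ∃ β : SigmaQuot ρ →ₗ[ℤ] SigmaQuot ρ', (∀ x, β (tauQuot ρ x) = tauQuot ρ' (β x)) ∧
        β N.c = N'.c ∧ ∀ x, toQuot ρ' (Φ x) = β (toQuot ρ x) := by
  obtain ⟨β, hβ, hβc⟩ := N.exists_quotMap N' h1 h2
  let α : sigmaKer ρ →ₗ[ringR p] sigmaKer ρ' :=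
    LinearMap.toSpanSingleton _ _ N'.S.eP ∘ₗ N.S.rP + LinearMap.toSpanSingleton _ _ N'.S.eM ∘ₗ N.S.rM
  have hα : ∀ e, α e = N.S.rP e • N'.S.eP + N.S.rM e • N'.S.eM := fun _ => rfl
  have hαt : ∀ x, α (tauKer ρ x) = tauKer ρ' (α x) := fun x => by
    rw [hα, hα, N.S.rP_tau, N.S.rM_tau, map_add, tauKer_smul, tauKer_smul, N'.S.tau_eP, N'.S.tau_eM,
      smul_neg, neg_smul]
  have hαP : α N.S.eP = N'.S.eP := by
    rw [hα, N.S.rM_eP, zero_smul, add_zero]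
    rcases N.S.plus with h | ⟨-, h⟩
    · rw [h, one_smul]
    · rw [h3.1 h, smul_zero]
  have hαM : α N.S.eM = N'.S.eM := by
    rw [hα, N.S.rP_eM, zero_smul, zero_add]
    rcases N.S.minus with h | ⟨-, h⟩
    · rw [h, one_smul]
    · rw [h4.1 h, smul_zero]
  have hc : ∃ m m', toQuot ρ m = N.c ∧ toQuot ρ' m' = N'.c ∧ sigDiff ρ' m' = α (sigDiff ρ m) := by
    rcases N.quotSign_cases with ⟨q1, q2, h0, -⟩ | ⟨h0, ⟨m, hm, hm'⟩, hN⟩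
    · refine ⟨0, 0, by rw [h0 N.c, map_zero], ?_, by simp⟩
      rw [← hβc, h0 N.c, map_zero, map_zero]
    · rcases N'.quotSign_cases with ⟨q1, q2, h0, -⟩ | ⟨h0, ⟨n, hn, hn'⟩, hN⟩
      · rcases hN with hN | hN | hN <;> tauto
      · exact ⟨m, n, hm, hn, by rw [hn', hm', map_add, hαP, hαM]⟩
  obtain ⟨m, m', hm, hm', hmm⟩ := hc
  obtain ⟨Φ, hΦ1, hΦ2, hΦ3⟩ := exists_map_of_compatible ρ ρ' hp α hαt β hβ (fun x => by
    obtain ⟨a, b, rfl⟩ := N.span x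
    refine ⟨a • m + b • tau ρ m, a • m' + b • tau ρ' m', 0, ?_, ?_, ?_⟩
    · rw [map_add, map_smul, map_smul, hm, ← tauQuot_toQuot, hm]
    · rw [map_add, map_smul, map_smul, hm', ← tauQuot_toQuot, hm', map_add, map_smul, map_smul, hβ, hβc]
    · rw [smul_zero, sub_eq_zero]
      simp only [map_add, map_zsmul, sigDiff_tau, map_neg, map_smul, hαt, hmm])
  exact ⟨Φ, hΦ1, fun e => by rw [hΦ2, hα], β, hβ, hβc, hΦ3⟩

/-- The maps of `NormalForm.exists_map` in both directions are inverse to each other. -/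
lemma NormalForm.map_map_eq [Module.IsTorsionFree ℤ M]
    (N : NormalForm ρ) (N' : NormalForm ρ') (hP : N'.S.eP = 0 → N.S.eP = 0)
    (hM : N'.S.eM = 0 → N.S.eM = 0)
    (Φ : M →ₗ[ℤ] M') (Ψ : M' →ₗ[ℤ] M) (a : ∀ g x, Φ (ρ g x) = ρ' g (Φ x))
    (a' : ∀ g x, Ψ (ρ' g x) = ρ g (Ψ x))
    (b : ∀ e : sigmaKer ρ, Φ e = (N.S.rP e • N'.S.eP + N.S.rM e • N'.S.eM : sigmaKer ρ'))
    (b' : ∀ e : sigmaKer ρ', Ψ e = (N'.S.rP e • N.S.eP + N'.S.rM e • N.S.eM : sigmaKer ρ))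
    (β : SigmaQuot ρ →ₗ[ℤ] SigmaQuot ρ') (β' : SigmaQuot ρ' →ₗ[ℤ] SigmaQuot ρ)
    (c : ∀ x, β (tauQuot ρ x) = tauQuot ρ' (β x)) (c' : ∀ x, β' (tauQuot ρ' x) = tauQuot ρ (β' x))
    (d : β N.c = N'.c) (d' : β' N'.c = N.c) (f : ∀ x, toQuot ρ' (Φ x) = β (toQuot ρ x))
    (f' : ∀ x, toQuot ρ (Ψ x) = β' (toQuot ρ' x)) (x : M) : Ψ (Φ x) = x := by
  refine sub_eq_zero.1 (map_eq_zero_of_kernel ρ ρ (Ψ ∘ₗ Φ - LinearMap.id) (fun x => ?_)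
    (fun e he => ?_) (fun x => ?_) x)
  · simp only [LinearMap.sub_apply, LinearMap.comp_apply, LinearMap.id_apply, a, a', map_sub]
  · have h1 := b ⟨e, he⟩
    have h2 : N.S.rP ⟨e, he⟩ • N.S.eP + N.S.rM ⟨e, he⟩ • N.S.eM = ⟨e, he⟩ := N.full ⟨e, he⟩
    generalize N.S.rP ⟨e, he⟩ = x at h1 h2
    generalize N.S.rM ⟨e, he⟩ = y at h1 h2
    have h3 : N'.S.rP (x • N'.S.eP + y • N'.S.eM) • N.S.eP = x • N.S.eP := by
      rw [map_add, map_smul, map_smul, N'.S.rP_eM, smul_zero, add_zero]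
      rcases N'.S.plus with h | ⟨-, h⟩
      · rw [h, smul_eq_mul, mul_one]
      · rw [hP h, smul_zero, smul_zero]
    have h4 : N'.S.rM (x • N'.S.eP + y • N'.S.eM) • N.S.eM = y • N.S.eM := by
      rw [map_add, map_smul, map_smul, N'.S.rM_eP, smul_zero, zero_add]
      rcases N'.S.minus with h | ⟨-, h⟩
      · rw [h, smul_eq_mul, mul_one]
      · rw [hM h, smul_zero, smul_zero]
    have h5 := b' (x • N'.S.eP + y • N'.S.eM)
    rw [h3, h4, h2] at h5
    rw [LinearMap.sub_apply, LinearMap.comp_apply, LinearMap.id_apply]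
    exact sub_eq_zero.2 ((congrArg Ψ h1).trans h5)
  · rw [← toQuot_eq_zero, LinearMap.sub_apply, map_sub, LinearMap.comp_apply, f', f,
      LinearMap.id_apply, sub_eq_zero]
    obtain ⟨m, n, h⟩ := N.span (toQuot ρ x)
    rw [h]
    simp only [map_add, map_smul, c, c', d, d']

/-- Lattices with normal forms of the same type are isomorphic. -/
theorem NormalForm.nonempty_equiv [Module.IsTorsionFree ℤ M] [Module.IsTorsionFree ℤ M']
    [Module.Finite ℤ M] [Module.Finite ℤ M'] (hp : p ≠ 2)
    (N : NormalForm ρ) (N' : NormalForm ρ') (h : latticeType ρ = latticeType ρ') :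
    Nonempty (ρ.Equiv ρ') := by
  simp only [latticeType, Prod.mk.injEq, decide_eq_decide] at h
  obtain ⟨h1, h2, h3, h4⟩ := h
  rw [N.hasEigenclass_one_iff hp, N'.hasEigenclass_one_iff hp, not_iff_not] at h3
  rw [N.hasEigenclass_neg_one_iff hp, N'.hasEigenclass_neg_one_iff hp, not_iff_not] at h4
  obtain ⟨Φ, f1, f2, β, f3, f4, f5⟩ := N.exists_map hp N' h1 h2 h3 h4
  obtain ⟨Ψ, g1, g2, β', g3, g4, g5⟩ := N'.exists_map hp N h1.symm h2.symm h3.symm h4.symm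
  exact ⟨Representation.Equiv.mk
    (LinearEquiv.ofLinearMap Φ Ψ
      (LinearMap.ext (N'.map_map_eq N h3.1 h4.1 Ψ Φ g1 f1 g2 f2 β' β g3 f3 g4 f4 g5 f5))
      (LinearMap.ext (N.map_map_eq N' h3.2 h4.2 Φ Ψ f1 g1 f2 g2 β β' f3 g3 f4 g4 f5 g5)))
    fun g => LinearMap.ext (f1 g)⟩

end Iso

end LatticeType

/-! ### The lattices `R`, `P` and `ℤ[H]` in coordinates -/

section RankOne

variable {p : ℕ} [hpp : Fact p.Prime]

/-- A coordinate `R ≃ A` on a lattice `A` for which `σ` is multiplication by `ζ` and `τ` is complex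
conjugation multiplied by the sign `s`. -/
structure RankOne {A : Type u} [AddCommGroup A] (ρ : Representation ℤ (DihedralGroup p) A) (s : ℤ) where
  j : ringR p ≃ₗ[ℤ] A
  sig_j : ∀ x, sig ρ (j x) = j (zetaR p * x)
  tau_j : ∀ x, tau ρ (j x) = s • j (conjR p x)

variable (p) in
/-- The lattice `R` is of rank one with `τ` acting as complex conjugation. -/
def rankOneR : RankOne (latticeR p).ρ 1 where
  j := LinearEquiv.refl ℤ _
  sig_j x := Subtype.ext (by
    change zeta p ^ (1 : ZMod p).val * (x : ℂ) = zeta p * x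
    rw [ZMod.val_one'' hpp.out.ne_one, pow_one])
  tau_j x := Subtype.ext (by
    rw [one_smul]
    change starRingEnd ℂ (zeta p ^ (0 : ZMod p).val * (x : ℂ)) = starRingEnd ℂ x
    simp)

variable (p) in
lemma subP_eq (hp : p ≠ 2) : (subP p).toSubmodule =
    ((Subalgebra.toSubmodule (ringR p)).map (LinearMap.mulLeft ℤ (deltaR p : ℂ))) := by
  obtain ⟨u, hu⟩ := deltaR_associated p hp
  have h1 : (deltaR p : ℂ) * (u : ringR p) = 1 - zeta p := congrArg Subtype.val hu
  have h2 : (1 - zeta p) * ((u⁻¹ : (ringR p)ˣ) : ringR p) = (deltaR p : ℂ) := by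
    rw [← h1, mul_assoc]
    have : ((u : ringR p) : ℂ) * ((u⁻¹ : (ringR p)ˣ) : ringR p) = 1 :=
      congrArg Subtype.val u.mul_inv
    rw [this, mul_one]
  ext z
  constructor
  · rintro ⟨x, hx, rfl⟩
    refine ⟨(u : ringR p) * x, (ringR p).mul_mem (u : ringR p).2 hx, ?_⟩
    change (deltaR p : ℂ) * ((u : ringR p) * x) = (1 - zeta p) * x
    rw [← mul_assoc, h1]
  · rintro ⟨x, hx, rfl⟩
    refine ⟨((u⁻¹ : (ringR p)ˣ) : ringR p) * x, (ringR p).mul_mem (Subtype.property _) hx, ?_⟩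
    change (1 - zeta p) * (((u⁻¹ : (ringR p)ˣ) : ringR p) * x) = (deltaR p : ℂ) * x
    rw [← mul_assoc, h2]

variable (p) in
/-- The lattice `P` is generated by `ζ - ζ⁻¹`, and hence of rank one with `τ` acting as the negative
of complex conjugation. -/
def rankOneP (hp : p ≠ 2) : RankOne (latticeP p).ρ (-1) where
  j := (Submodule.equivMapOfInjective (LinearMap.mulLeft ℤ (deltaR p : ℂ))
    (mul_right_injective₀ fun h => deltaR_ne_zero p hp (Subtype.ext h))
    (Subalgebra.toSubmodule (ringR p))).trans (LinearEquiv.ofEq _ _ (subP_eq p hp).symm)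
  sig_j x := Subtype.ext (by
    change zeta p ^ (1 : ZMod p).val * ((deltaR p : ℂ) * (x : ℂ)) = (deltaR p : ℂ) * (zeta p * x)
    rw [ZMod.val_one'' hpp.out.ne_one, pow_one]
    ring)
  tau_j x := Subtype.ext (by
    rw [neg_smul, one_smul]
    change starRingEnd ℂ (zeta p ^ (0 : ZMod p).val * ((deltaR p : ℂ) * (x : ℂ))) =
      -((deltaR p : ℂ) * starRingEnd ℂ x)
    rw [ZMod.val_zero, pow_zero, one_mul, map_mul, ← coe_conjR, conj_deltaR]
    simp)

variable (p) in
lemma sum_zetaR_pow : ∑ i ∈ Finset.range p, zetaR p ^ i = 0 := by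
  have := mul_neg_geom_sum (zetaR p) p
  rw [zetaR_pow_p, sub_self] at this
  exact (mul_eq_zero.1 this).resolve_left (one_sub_zetaR_ne_zero p)

namespace RankOne

variable {A : Type u} [AddCommGroup A] {ρ : Representation ℤ (DihedralGroup p) A} {s : ℤ}
  (J : RankOne ρ s)

include J

lemma normSig_eq_zero (a : A) : normSig ρ a = 0 := by
  obtain ⟨x, rfl⟩ := J.j.surjective a
  have h : ∀ i : ℕ, (sig ρ ^ i) (J.j x) = J.j (zetaR p ^ i * x) := by
    intro i
    induction i with
    | zero => simp
    | succ i ih => rw [pow_succ', Module.End.mul_apply, ih, J.sig_j, pow_succ', mul_assoc]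
  rw [normSig, LinearMap.sum_apply, Finset.sum_congr rfl fun i _ => h i, ← map_sum, ← Finset.sum_mul,
    sum_zetaR_pow, zero_mul, map_zero]

lemma mem_sigmaKer (a : A) : a ∈ sigmaKer ρ := J.normSig_eq_zero a

/-- A subgroup stable under `σ` is an ideal. -/
lemma mul_mem {B : Submodule ℤ A} (hB : ∀ b ∈ B, sig ρ b ∈ B) (r : ringR p) {x : ringR p}
    (hx : J.j x ∈ B) : J.j (r * x) ∈ B := by
  induction r using ringR_induction generalizing x with
  | hζ => rw [← J.sig_j]; exact hB _ hx
  | hi n => rw [← zsmul_eq_mul, map_zsmul]; exact B.smul_mem _ hx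
  | ha a b ha hb => rw [add_mul, map_add]; exact B.add_mem (ha hx) (hb hx)
  | hm a b ha hb => rw [mul_assoc]; exact ha (hb hx)

lemma hasEigenclass : HasEigenclass ρ s := by
  refine ⟨J.j 1, J.mem_sigmaKer _, ?_, 0, J.mem_sigmaKer _, ?_⟩
  · rintro ⟨y, -, h⟩
    obtain ⟨y, rfl⟩ := J.j.surjective y
    rw [J.sig_j, ← map_sub] at h
    have h2 := J.j.injective h
    exact (one_sub_zetaR_prime p).not_isUnit (isUnit_of_dvd_one ⟨y, by rw [sub_mul, one_mul]; exact h2⟩)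
  · rw [J.tau_j, map_one, sub_self, map_zero, sub_zero]

lemma not_hasEigenclass (hp : p ≠ 2) (hs : s = 1 ∨ s = -1) : ¬ HasEigenclass ρ (-s) := by
  rintro ⟨e, -, h1, y, -, h2⟩
  obtain ⟨e, rfl⟩ := J.j.surjective e
  obtain ⟨y, rfl⟩ := J.j.surjective y
  rw [J.sig_j, J.tau_j] at h2
  have h3 : s • conjR p e - (-s) • e = y - zetaR p * y := J.j.injective (by
    rw [map_sub, map_sub, map_smul, map_smul]; exact h2)
  have h4 : (1 - zetaR p) ∣ conjR p e + e := by
    rcases hs with rfl | rfl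
    · exact ⟨y, by rw [sub_mul, one_mul, ← h3]; simp⟩
    · exact ⟨-y, by rw [mul_neg, sub_mul, one_mul, ← h3]; simp; ring⟩
  have h5 : (1 - zetaR p) ∣ 2 * e := by
    have := dvd_sub h4 (dvd_conj_sub p e)
    ring_nf at this ⊢
    exact this
  obtain ⟨z, hz⟩ := ((one_sub_zetaR_prime p).dvd_or_dvd h5).resolve_left (NormalForm.two_not_dvd hp)
  exact h1 ⟨J.j z, J.mem_sigmaKer _, by rw [J.sig_j, ← map_sub, hz]; congr 1; ring⟩

end RankOne

/-- Two nonzero ideals of a domain have a nonzero intersection. -/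
lemma RankOne.isIndecomposable {A : GLattice.{0, u} (DihedralGroup p)} {s : ℤ} (J : RankOne A.ρ s) :
    IsIndecomposable A := by
  refine ⟨J.j.symm.toEquiv.nontrivial, fun B C h => ?_⟩
  by_contra! hne
  obtain ⟨b, hb, hb0⟩ := (Submodule.ne_bot_iff _).1 hne.1
  obtain ⟨c, hc, hc0⟩ := (Submodule.ne_bot_iff _).1 hne.2
  obtain ⟨b, rfl⟩ := J.j.surjective b
  obtain ⟨c, rfl⟩ := J.j.surjective c
  have h1 := J.mul_mem (fun b hb => B.apply_mem_toSubmodule (.r 1) hb) c hb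
  have h2 := J.mul_mem (fun b hb => C.apply_mem_toSubmodule (.r 1) hb) b hc
  have h3 := Submodule.disjoint_def.1 h.disjoint _ h1 (by rwa [mul_comm])
  rw [J.j.map_eq_zero_iff] at h3
  rcases mul_eq_zero.1 h3 with h4 | h4
  · exact hc0 (by rw [h4, map_zero])
  · exact hb0 (by rw [h4, map_zero])

lemma isIndecomposable_of_int {M : GLattice.{0, u} (DihedralGroup p)} (f : ℤ ≃ₗ[ℤ] M) :
    IsIndecomposable M := by
  refine ⟨f.symm.toEquiv.nontrivial, fun B C h => ?_⟩
  by_contra! hne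
  obtain ⟨b, hb, hb0⟩ := (Submodule.ne_bot_iff _).1 hne.1
  obtain ⟨c, hc, hc0⟩ := (Submodule.ne_bot_iff _).1 hne.2
  obtain ⟨b, rfl⟩ := f.surjective b
  obtain ⟨c, rfl⟩ := f.surjective c
  have h1 := B.toSubmodule.smul_mem c hb
  have h2 := C.toSubmodule.smul_mem b hc
  rw [← map_smul, smul_eq_mul] at h1 h2
  have h3 := Submodule.disjoint_def.1 h.disjoint _ h1 (by rwa [mul_comm])
  rw [f.map_eq_zero_iff] at h3
  rcases mul_eq_zero.1 h3 with h4 | h4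
  · exact hc0 (by rw [h4, map_zero])
  · exact hb0 (by rw [h4, map_zero])

variable (p)

/-- Whether an element of the dihedral group is a reflection. -/
def isReflection : DihedralGroup p → Bool
  | .r _ => false
  | .sr _ => true

lemma isReflection_mul (g h : DihedralGroup p) :
    isReflection p (g * h) = xor (isReflection p g) (isReflection p h) := by
  rcases g with i | i <;> rcases h with j | j <;> rfl

lemma mem_zpowers_r_one (g : DihedralGroup p) :
    g ∈ Subgroup.zpowers (DihedralGroup.r (1 : ZMod p)) ↔ isReflection p g = false := by
  rw [Subgroup.mem_zpowers_iff]
  constructor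
  · rintro ⟨n, rfl⟩
    rw [DihedralGroup.r_one_zpow]; rfl
  · rcases g with i | i
    · intro _
      exact ⟨(i.val : ℤ), by rw [DihedralGroup.r_one_zpow]; simp⟩
    · intro h; exact absurd h (by simp [isReflection])

/-- The lattice `ℤ × ℤ` with `τ` exchanging the coordinates. -/
abbrev latticeSwap : GLattice.{0, 0} (DihedralGroup p) where
  carrier := ℤ × ℤ
  ρ :=
  { toFun
      | .r _ => LinearMap.id
      | .sr _ => (LinearEquiv.prodComm ℤ ℤ ℤ).toLinearMap
    map_one' := rfl
    map_mul' := by rintro (i | i) (j | j) <;> rfl }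

/-- The two classes of the quotient by the rotations. -/
def cosetBool : DihedralGroup p ⧸ Subgroup.zpowers (DihedralGroup.r (1 : ZMod p)) ≃ Bool where
  toFun := Quotient.lift (isReflection p) (by
    intro a b h
    have := (mem_zpowers_r_one p _).1 (QuotientGroup.leftRel_apply.1 h)
    rcases a with i | i <;> rcases b with j | j <;> simp_all [isReflection])
  invFun b := if b then QuotientGroup.mk (.sr 0 : DihedralGroup p) else QuotientGroup.mk (1 : DihedralGroup p)
  left_inv x := by
    obtain ⟨g, rfl⟩ := QuotientGroup.mk_surjective x
    change (if isReflection p g then QuotientGroup.mk (.sr 0 : DihedralGroup p) else QuotientGroup.mk (1 : DihedralGroup p)) = _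
    rcases g with i | i
    · rw [if_neg (by simp [isReflection]), QuotientGroup.eq, mem_zpowers_r_one]
      simp [isReflection]
    · rw [if_pos (by simp [isReflection]), QuotientGroup.eq, mem_zpowers_r_one]
      simp [isReflection]
  right_inv b := by cases b <;> rfl

lemma cosetBool_smul (g : DihedralGroup p)
    (x : DihedralGroup p ⧸ Subgroup.zpowers (DihedralGroup.r (1 : ZMod p))) :
    cosetBool p (g • x) = xor (isReflection p g) (cosetBool p x) := by
  obtain ⟨h, rfl⟩ := QuotientGroup.mk_surjective x
  exact isReflection_mul p g h

lemma smul_cosetBool_symm (g : DihedralGroup p) (b : Bool) :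
    g⁻¹ • (cosetBool p).symm b = (cosetBool p).symm (xor (isReflection p g) b) := by
  rw [Equiv.eq_symm_apply, cosetBool_smul, Equiv.apply_symm_apply]
  rcases g with i | i <;> rfl

/-- The lattice `ℤ[H]` is `ℤ × ℤ` with `τ` exchanging the coordinates. -/
def equivSwap : (latticeZH p).ρ.Equiv (latticeSwap p).ρ :=
  Representation.Equiv.mk
    { toFun := fun x => (x.coeff ((cosetBool p).symm false), x.coeff ((cosetBool p).symm true))
      invFun := fun a => MonoidAlgebra.single ((cosetBool p).symm false) a.1 +
        MonoidAlgebra.single ((cosetBool p).symm true) a.2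
      left_inv := fun x => by
        ext q
        obtain ⟨b, rfl⟩ := (cosetBool p).symm.surjective q
        cases b <;> simp
      right_inv := fun a => by ext <;> simp
      map_add' := fun _ _ => rfl
      map_smul' := fun _ _ => rfl } (by
    intro g
    refine LinearMap.ext fun x => ?_
    change (((latticeZH p).ρ g x).coeff ((cosetBool p).symm false),
      ((latticeZH p).ρ g x).coeff ((cosetBool p).symm true)) = _
    rw [Representation.coeff_ofMulAction, Representation.coeff_ofMulAction, smul_cosetBool_symm,
      smul_cosetBool_symm]
    rcases g with i | i <;> rfl)

/-- The idempotents of the group ring `ℤ[C₂]` are trivial: `m + n τ` with `n (2 m - 1) = 0` and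
`m ^ 2 + n ^ 2 = m`. -/
lemma isIndecomposable_of_swap {M : GLattice.{0, u} (DihedralGroup p)}
    (f : M.ρ.Equiv (latticeSwap p).ρ) : IsIndecomposable M := by
  refine ⟨f.toLinearEquiv.toEquiv.nontrivial, fun B C h => ?_⟩
  let q : M →ₗ[ℤ] M := B.toSubmodule.subtype ∘ₗ B.toSubmodule.projectionOnto _ h
  have hq : ∀ x y, x ∈ B.toSubmodule → y ∈ C.toSubmodule → q (x + y) = x := by
    intro x y hx hy
    have h1 : q x = x := congrArg Subtype.val (Submodule.projectionOnto_apply_left h ⟨x, hx⟩)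
    have h2 : q y = 0 := congrArg Subtype.val (Submodule.projectionOnto_apply_right h ⟨y, hy⟩)
    rw [map_add, h1, h2, add_zero]
  have hqt : ∀ x, q (tau M.ρ x) = tau M.ρ (q x) := by
    intro x
    obtain ⟨a, ha, b, hb, rfl⟩ := Submodule.mem_sup.1 (h.sup_eq_top.ge (Submodule.mem_top (x := x)))
    rw [map_add (tau M.ρ), hq _ _ (B.apply_mem_toSubmodule _ ha) (C.apply_mem_toSubmodule _ hb), hq _ _ ha hb]
  obtain ⟨e, he⟩ := f.toLinearEquiv.surjective (1, 0)
  have hft : ∀ x, f (tau M.ρ x) = Prod.swap (f x) := fun x => Equiv.apply_rho M.ρ f _ x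
  have hspan : ∀ x, x = (f x).1 • e + (f x).2 • tau M.ρ e := by
    intro x
    apply f.toLinearEquiv.injective
    rw [map_add, map_zsmul, map_zsmul]
    change f x = (f x).1 • f e + (f x).2 • f (tau M.ρ e)
    rw [hft]
    change f e = (1, 0) at he
    rw [he]
    ext <;> simp
  have hidem : q (q e) = q e := by
    have := hq (q e) 0 (Subtype.property _) (Submodule.zero_mem _)
    rwa [add_zero] at this
  have h1 : ∀ x, f (q x) = (f x).1 • f (q e) + (f x).2 • Prod.swap (f (q e)) := by
    intro x
    conv_lhs => rw [hspan x]
    rw [map_add, map_zsmul, map_zsmul, hqt, ← hft]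
    exact f.toLinearEquiv.map_add _ _ |>.trans
      (congrArg₂ (· + ·) (f.toLinearEquiv.map_smul _ _) (f.toLinearEquiv.map_smul _ _))
  have h2 := h1 (q e)
  rw [hidem] at h2
  generalize hm : f (q e) = m at h1 h2
  obtain ⟨m, n⟩ := m
  simp only [Prod.swap, Prod.smul_mk, Prod.mk_add_mk, Prod.mk.injEq, smul_eq_mul] at h2
  have hn : n = 0 := by
    have : n * (2 * m - 1) = 0 := by linarith [h2.2]
    exact (mul_eq_zero.1 this).resolve_right (by omega)
  subst hn
  have hm1 : m = 0 ∨ m = 1 := by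
    have : m * (m - 1) = 0 := by linarith [h2.1]
    exact (mul_eq_zero.1 this).imp id fun h => by linarith
  rcases hm1 with rfl | rfl
  · left
    refine (Submodule.eq_bot_iff _).2 fun x hx => ?_
    have h3 := h1 x
    have h4 := hq x 0 hx (Submodule.zero_mem _)
    rw [add_zero] at h4
    rw [h4] at h3
    apply f.toLinearEquiv.injective
    rw [map_zero]
    exact h3.trans (by ext <;> simp)
  · right
    refine (Submodule.eq_bot_iff _).2 fun x hx => ?_
    have h3 := h1 x
    have h4 := hq 0 x (Submodule.zero_mem _) hx
    rw [zero_add] at h4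
    rw [h4] at h3
    apply f.toLinearEquiv.injective
    rw [map_zero]
    refine Eq.trans ?_ (h3.symm.trans (f.toLinearEquiv.map_zero))
    change f x = _
    ext <;> simp

end RankOne

/-! ### Extensions of a `σ`-trivial lattice by a lattice without `σ`-invariants -/

section KernelExtension

variable {p : ℕ} [hpp : Fact p.Prime]

/-- A short exact sequence `0 → A → M → C → 0` such that the norm of `σ` vanishes on `A` and `σ` is
trivial on `C`. -/
structure KernelExtension {A : Type u} {M : Type v} {C : Type w} [AddCommGroup A] [AddCommGroup M]
    [AddCommGroup C] (ρA : Representation ℤ (DihedralGroup p) A)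
    (ρ : Representation ℤ (DihedralGroup p) M) (ρC : Representation ℤ (DihedralGroup p) C) where
  f : A →ₗ[ℤ] M
  g : M →ₗ[ℤ] C
  map_f : ∀ h x, f (ρA h x) = ρ h (f x)
  map_g : ∀ h x, g (ρ h x) = ρC h (g x)
  injective : Function.Injective f
  surjective : Function.Surjective g
  exact : ∀ x, g x = 0 ↔ ∃ a, f a = x
  norm_eq_zero : ∀ a, normSig ρA a = 0
  sig_eq : ∀ c, sig ρC c = c

namespace KernelExtension

section

variable {A : Type u} {M : Type v} {C : Type w} [AddCommGroup A] [AddCommGroup M]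
  [AddCommGroup C] {ρA : Representation ℤ (DihedralGroup p) A}
  {ρ : Representation ℤ (DihedralGroup p) M} {ρC : Representation ℤ (DihedralGroup p) C}
  (E : KernelExtension ρA ρ ρC)

include E

lemma f_mem (a : A) : E.f a ∈ sigmaKer ρ := by
  rw [mem_sigmaKer, ← map_normSig ρA ρ E.f (E.map_f _), E.norm_eq_zero, map_zero]

lemma mem_sigmaKer_iff [Module.IsTorsionFree ℤ C] (x : M) : x ∈ sigmaKer ρ ↔ E.g x = 0 := by
  constructor
  · intro hx
    have h := map_normSig ρ ρC E.g (E.map_g _) x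
    rw [(mem_sigmaKer ρ).1 hx, map_zero, normSig_of_fixed ρC (E.sig_eq _)] at h
    exact (smul_eq_zero.1 h.symm).resolve_left (by exact_mod_cast hpp.out.ne_zero)
  · intro hx
    obtain ⟨a, rfl⟩ := (E.exact x).1 hx
    exact E.f_mem a

lemma quotSign_iff [Module.IsTorsionFree ℤ C] (s : ℤ) : QuotSign ρ s ↔ ∀ c, tau ρC c = s • c := by
  constructor
  · intro h c
    obtain ⟨x, rfl⟩ := E.surjective c
    rw [← E.map_g, ← sub_eq_zero, ← map_zsmul, ← map_sub, ← E.mem_sigmaKer_iff]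
    exact h x
  · intro h x
    rw [E.mem_sigmaKer_iff, map_sub, map_zsmul, E.map_g, h, sub_self]

lemma hasEigenclass_iff [Module.IsTorsionFree ℤ C] (s : ℤ) : HasEigenclass ρ s ↔ HasEigenclass ρA s := by
  have hmem : ∀ a : A, a ∈ sigmaKer ρA := E.norm_eq_zero
  have hex : ∀ x ∈ sigmaKer ρ, ∃ a, E.f a = x := fun x hx =>
    (E.exact x).1 ((E.mem_sigmaKer_iff x).1 hx)
  have h1 : ∀ a b : A, (E.f a = E.f b - sig ρ (E.f b)) ↔ a = b - sig ρA b := fun a b => by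
    rw [← E.map_f, ← map_sub, E.injective.eq_iff]
  have h2 : ∀ a b : A, (tau ρ (E.f a) - s • E.f a = E.f b - sig ρ (E.f b)) ↔
      tau ρA a - s • a = b - sig ρA b := fun a b => by
    rw [← h1, map_sub, map_zsmul, E.map_f]
  constructor
  · rintro ⟨e, he, h3, y, hy, h4⟩
    obtain ⟨e, rfl⟩ := hex e he
    obtain ⟨y, rfl⟩ := hex y hy
    exact ⟨e, hmem e, fun ⟨z, _, hz⟩ => h3 ⟨E.f z, E.f_mem z, (h1 _ _).2 hz⟩, y, hmem y, (h2 _ _).1 h4⟩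
  · rintro ⟨e, he, h3, y, hy, h4⟩
    refine ⟨E.f e, E.f_mem e, ?_, E.f y, E.f_mem y, (h2 _ _).2 h4⟩
    rintro ⟨z, hz, hz'⟩
    obtain ⟨z, rfl⟩ := hex z hz
    exact h3 ⟨z, hmem z, (h1 _ _).1 hz'⟩

/-- If `A` has rank one over `R` and the extension does not split, every element of `A` is of the
form `(σ - 1) m`: otherwise `M` would be the sum of `A` and of the `σ`-invariants. -/
lemma exists_sig_sub [Module.IsTorsionFree ℤ C] {s : ℤ} (J : RankOne ρA s)
    [Module.IsTorsionFree ℤ M]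
    (hE : ¬ ∃ t : C →ₗ[ℤ] M, (∀ h c, t (ρC h c) = ρ h (t c)) ∧ ∀ c, E.g (t c) = c) (a : A) :
    ∃ m, sig ρ m - m = E.f a := by
  have hd : ∀ m, ∃ x : ringR p, E.f (J.j x) = sig ρ m - m := fun m => by
    obtain ⟨a, ha⟩ := (E.exact _).1 ((E.mem_sigmaKer_iff _).1 (sig_sub_mem ρ m))
    obtain ⟨x, rfl⟩ := J.j.surjective a
    exact ⟨x, ha⟩
  have hpi : ∀ y : ringR p, sig ρ (E.f (J.j (-y))) - E.f (J.j (-y)) = E.f (J.j ((1 - zetaR p) * y)) := by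
    intro y
    rw [← E.map_f, J.sig_j, ← map_sub, ← map_sub]
    congr 2; ring
  -- the image of `σ - 1` contains `(1 - ζ) A`, a subgroup of prime index: it is this subgroup or all of `A`
  by_cases h : ∃ m x, E.f (J.j x) = sig ρ m - m ∧ ¬ (1 - zetaR p) ∣ x
  · obtain ⟨m, x, h1, h2⟩ := h
    obtain ⟨y, rfl⟩ := J.j.surjective a
    obtain ⟨n, hn⟩ := exists_int_dvd_sub p x
    obtain ⟨k, hk⟩ := exists_int_dvd_sub p y
    have hpn : IsCoprime (n : ℤ) p := by
      rw [isCoprime_comm, (Nat.prime_iff_prime_int.1 hpp.out).coprime_iff_not_dvd, ← dvd_intCast_iff]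
      intro h3
      have := dvd_add hn h3
      rw [sub_add_cancel] at this
      exact h2 this
    obtain ⟨b, c, hbc⟩ := hpn
    obtain ⟨z, hz⟩ : (1 - zetaR p) ∣ y - (k * b : ℤ) * x := by
      have e : y - (k * b : ℤ) * x = (y - k) - (k * b : ℤ) * (x - n) + k * ((c * p : ℤ) : ringR p) := by
        have : ((b * n + c * p : ℤ) : ringR p) = 1 := by rw [hbc]; simp
        push_cast at this ⊢
        linear_combination (-k : ringR p) * this
      rw [e]
      refine dvd_add (dvd_sub hk (hn.mul_left _)) (Dvd.dvd.mul_left ?_ _)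
      exact (dvd_intCast_iff p _).2 (dvd_mul_left _ _)
    refine ⟨(k * b) • m + E.f (J.j (-z)), ?_⟩
    have e : y = (k * b) • x + (1 - zetaR p) * z := by rw [zsmul_eq_mul, ← hz]; ring
    conv_rhs => rw [e]
    rw [map_add J.j, map_zsmul J.j, map_add E.f, map_zsmul E.f, h1, ← hpi, map_add, map_zsmul]
    module
  · exfalso
    push Not at h
    -- every class of the quotient has a unique `σ`-invariant representative, which defines a splitting
    have hfix : ∀ c, ∃ m, E.g m = c ∧ sig ρ m = m := by
      intro c
      obtain ⟨m, rfl⟩ := E.surjective c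
      obtain ⟨x, hx⟩ := hd m
      obtain ⟨y, rfl⟩ := h m x hx
      refine ⟨m - E.f (J.j (-y)), ?_, ?_⟩
      · rw [map_sub, (E.exact _).2 ⟨_, rfl⟩, sub_zero]
      · rw [← hpi, sub_eq_sub_iff_add_eq_add] at hx
        rw [map_sub, sub_eq_sub_iff_add_eq_add, ← hx]
        abel
    have huniq : ∀ m n, E.g m = E.g n → sig ρ m = m → sig ρ n = n → m = n := by
      intro m n h1 h2 h3
      rw [← sub_eq_zero]
      refine fixed_eq_zero ρ ?_ (by rw [map_sub, h2, h3])
      rw [E.mem_sigmaKer_iff, map_sub, h1, sub_self]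
    choose t ht1 ht2 using hfix
    refine hE ⟨⟨⟨t, fun x y => huniq _ _ (by simp [ht1]) (ht2 _) (by simp [ht2])⟩,
      fun n x => huniq _ _ (by simp [ht1]) (ht2 _) (by simp [ht2])⟩, ?_, ht1⟩
    refine map_rho_of_sig_tau ρC ρ t (fun c => ?_) (fun c => ?_)
    · rw [E.sig_eq, ht2]
    · refine huniq _ _ (by rw [E.map_g, ht1, ht1]) (ht2 _) ?_
      have := sig_tau_sig ρ (t c)
      rwa [ht2] at this

end

/-- If `C` is indecomposable and every element of `A` is of the form `(σ - 1) m`, then `M` is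
indecomposable: a summand contained in `A` would be divisible by `1 - ζ`. -/
lemma isIndecomposable {A : Type u} {M : GLattice.{0, v} (DihedralGroup p)}
    {C : GLattice.{0, w} (DihedralGroup p)} [AddCommGroup A]
    {ρA : Representation ℤ (DihedralGroup p) A} (E : KernelExtension ρA M.ρ C.ρ)
    (hC : IsIndecomposable C) (h : ∀ a, ∃ m, sig M.ρ m - m = E.f a) : IsIndecomposable M := by
  -- a summand `B` contained in `A` is divisible by `1 - ζ`, because the component in `B` of a solution of
  -- `(σ - 1) m = b` is again a solution
  have key : ∀ B B' : Subrepresentation M.ρ, IsCompl B.toSubmodule B'.toSubmodule →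
      (∀ b ∈ B.toSubmodule, E.g b = 0) → B.toSubmodule = ⊥ := by
    intro B B' hB hb
    by_contra hne
    have : Nontrivial B.toSubmodule := Submodule.nontrivial_iff_ne_bot.2 hne
    have hcoe : ∀ x : B.toSubmodule, (normSig B.toRepresentation x : M) = normSig M.ρ x := fun x =>
      map_normSig B.toRepresentation M.ρ B.toSubmodule.subtype (fun _ => rfl) x
    have hmem : ∀ x : B.toSubmodule, x ∈ sigmaKer B.toRepresentation := fun x => by
      rw [mem_sigmaKer]
      exact Subtype.ext ((hcoe x).trans ((E.mem_sigmaKer_iff x).2 (hb x x.2)))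
    have : Nontrivial (sigmaKer B.toRepresentation) := by
      obtain ⟨x, hx⟩ := exists_ne (0 : B.toSubmodule)
      exact ⟨⟨x, hmem x⟩, 0, fun h => hx (congrArg Subtype.val h)⟩
    obtain ⟨⟨⟨x, hxB⟩, hx⟩, hx'⟩ := exists_not_mem_pi (p := p) (E := sigmaKer B.toRepresentation)
    obtain ⟨a, rfl⟩ := (E.exact x).1 (hb x hxB)
    obtain ⟨m, hm⟩ := h a
    obtain ⟨y, hy, z, hz, rfl⟩ := Submodule.mem_sup.1 (hB.sup_eq_top.ge (Submodule.mem_top (x := m)))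
    have hd : sig M.ρ y - y = E.f a := by
      have h1 : sig M.ρ y - y - E.f a = z - sig M.ρ z := by
        rw [← hm, map_add]; abel
      rw [← sub_eq_zero]
      refine Submodule.disjoint_def.1 hB.disjoint _ ?_ ?_
      · exact sub_mem (sub_mem (B.apply_mem_toSubmodule _ hy) hy) hxB
      · rw [h1]; exact sub_mem hz (B'.apply_mem_toSubmodule _ hz)
    refine hx' (modPi_eq_zero.2 ⟨-⟨⟨y, hy⟩, hmem _⟩, Subtype.ext (Subtype.ext ?_)⟩)
    rw [sub_smul, one_smul, smul_neg, Submodule.coe_sub, Submodule.coe_neg, Submodule.coe_neg,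
      zetaR_smul]
    change E.f a = -y - -(sig M.ρ y)
    rw [← hd]; abel
  refine ⟨?_, fun B B' hB => ?_⟩
  · obtain ⟨c, hc⟩ := @exists_ne _ hC.1 (0 : C)
    obtain ⟨m, rfl⟩ := E.surjective c
    exact ⟨m, 0, fun h => hc (by rw [h, map_zero])⟩
  · let D : Subrepresentation M.ρ → Subrepresentation C.ρ := fun B =>
      ⟨B.toSubmodule.map E.g, by
        rintro k _ ⟨b, hb, rfl⟩
        exact ⟨M.ρ k b, B.apply_mem_toSubmodule k hb, E.map_g k b⟩⟩
    -- the images of the summands in `C` are disjoint, because the norm of `σ` is injective on `C`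
    have hD : IsCompl (D B).toSubmodule (D B').toSubmodule := by
      constructor
      · rw [Submodule.disjoint_def]
        rintro _ ⟨b, hb, rfl⟩ ⟨b', hb', h'⟩
        have h1 : b - b' ∈ sigmaKer M.ρ := by
          rw [E.mem_sigmaKer_iff, map_sub, h', sub_self]
        rw [mem_sigmaKer, map_sub, sub_eq_zero] at h1
        have hN : ∀ (B : Subrepresentation M.ρ) b, b ∈ B.toSubmodule → normSig M.ρ b ∈ B.toSubmodule := by
          intro B b hb
          rw [normSig, LinearMap.sum_apply]
          refine sum_mem fun i _ => ?_
          rw [sig_pow_apply]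
          exact B.apply_mem_toSubmodule _ hb
        exact (E.mem_sigmaKer_iff b).1 (Submodule.disjoint_def.1 hB.disjoint _ (hN B b hb)
          (h1 ▸ hN B' b' hb'))
      · rw [codisjoint_iff, eq_top_iff]
        rintro c -
        obtain ⟨m, rfl⟩ := E.surjective c
        obtain ⟨y, hy, z, hz, rfl⟩ := Submodule.mem_sup.1 (hB.sup_eq_top.ge (Submodule.mem_top (x := m)))
        rw [map_add]
        exact Submodule.add_mem_sup ⟨y, hy, rfl⟩ ⟨z, hz, rfl⟩
    rcases hC.2 _ _ hD with h1 | h1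
    · exact Or.inl (key B B' hB fun b hb => (Submodule.eq_bot_iff _).1 h1 _ ⟨b, hb, rfl⟩)
    · exact Or.inr (key B' B hB.symm fun b hb => (Submodule.eq_bot_iff _).1 h1 _ ⟨b, hb, rfl⟩)

end KernelExtension

lemma IsNonsplitExtension.exists_kernelExtension {A M C : GLattice.{0, 0} (DihedralGroup p)}
    (h : IsNonsplitExtension A M C) (hA : ∀ a, normSig A.ρ a = 0) (hC : ∀ c, sig C.ρ c = c) :
    ∃ E : KernelExtension A.ρ M.ρ C.ρ,
      ¬ ∃ t : C →ₗ[ℤ] M, (∀ h c, t (C.ρ h c) = M.ρ h (t c)) ∧ ∀ c, E.g (t c) = c := by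
  obtain ⟨f, g, hf, hg, hfg, hs⟩ := h
  exact ⟨⟨f.toLinearMap, g.toLinearMap, fun k x => LinearMap.congr_fun (f.isIntertwining' k) x,
    fun k x => LinearMap.congr_fun (g.isIntertwining' k) x, hf, hg, hfg, hA, hC⟩,
    fun ⟨t, h1, h2⟩ => hs ⟨⟨t, fun k => LinearMap.ext (h1 k)⟩, h2⟩⟩

/-- An extension of nonzero lattices with an indecomposable middle term does not split. -/
lemma KernelExtension.isNonsplitExtension {A M C : GLattice.{0, 0} (DihedralGroup p)}
    (E : KernelExtension A.ρ M.ρ C.ρ) (hM : IsIndecomposable M) [Nontrivial A] [Nontrivial C] :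
    IsNonsplitExtension A M C := by
  refine ⟨⟨E.f, fun k => LinearMap.ext (E.map_f k)⟩, ⟨E.g, fun k => LinearMap.ext (E.map_g k)⟩,
    E.injective, E.surjective, E.exact, ?_⟩
  rintro ⟨s, hs⟩
  have hsm : ∀ k x, s (C.ρ k x) = M.ρ k (s x) := fun k x => LinearMap.congr_fun (s.isIntertwining' k) x
  change ∀ c, E.g (s c) = c at hs
  rcases hM.eq_zero_or_eq_id (s.toLinearMap ∘ₗ E.g) (fun k x => by
    change s (E.g (M.ρ k x)) = M.ρ k (s (E.g x)); rw [E.map_g, hsm]) (fun x => by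
    change s (E.g (s (E.g x))) = s (E.g x); rw [hs]) with h | h
  · obtain ⟨c, hc⟩ := exists_ne (0 : C)
    obtain ⟨x, hx⟩ := E.surjective c
    have h1 : s (E.g x) = 0 := h x
    have h2 := hs (E.g x)
    rw [h1, map_zero] at h2
    exact hc (by rw [← hx, h2])
  · obtain ⟨a, ha⟩ := exists_ne (0 : A)
    have h1 : s (E.g (E.f a)) = E.f a := h (E.f a)
    rw [(E.exact _).2 ⟨a, rfl⟩] at h1
    have h2 : s 0 = 0 := s.toLinearMap.map_zero
    rw [h2] at h1
    exact ha (E.injective (by rw [← h1, map_zero]))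

end KernelExtension

/-! ### Lattices of functions on the polygon and on the group -/

section Models

variable {p : ℕ} [hpp : Fact p.Prime]

/-- An eigenvector `m` of `τ`, no translate of which by the kernel of the norm is `σ`-invariant, provides the
eigenclass of `(σ - 1) m`, with the opposite sign. -/
lemma hasEigenclass_of_tau {M : Type u} [AddCommGroup M] {ρ : Representation ℤ (DihedralGroup p) M}
    {s : ℤ} {m : M} (h1 : tau ρ m = -s • m) (h2 : ∀ y ∈ sigmaKer ρ, sig ρ (m + y) ≠ m + y) :
    HasEigenclass ρ s := by
  rw [hasEigenclass_iff]
  refine ⟨sigDiff ρ m, fun h => ?_, ?_⟩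
  · obtain ⟨y, hy⟩ := modPi_eq_zero.1 h
    have h3 := congrArg (Subtype.val : sigmaKer ρ → M) hy
    rw [sub_smul, one_smul, Submodule.coe_sub, zetaR_smul, coe_sigDiff,
      sub_eq_sub_iff_add_eq_add] at h3
    exact h2 y y.2 (by rw [map_add, h3, add_comm])
  · have h3 := sigDiff_tau ρ m
    rw [h1, neg_smul, map_neg, map_smul, neg_inj] at h3
    rw [← map_zsmul, h3, modPi_zetaR_smul]

section OfMap

variable {M : Type u} {C : Type v} [AddCommGroup M] [AddCommGroup C]
  (ρ : Representation ℤ (DihedralGroup p) M) (ρC : Representation ℤ (DihedralGroup p) C)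

/-- The kernel of the norm as a subrepresentation. -/
def sigmaKerRep : Subrepresentation ρ where
  toSubmodule := sigmaKer ρ
  apply_mem_toSubmodule g v hv := rho_mem_of_sig_tau ρ (s := sigmaKer ρ)
    (fun x hx => (normSig_sig ρ x).trans hx) (fun x hx => (tauKer ρ ⟨x, hx⟩).2) g v hv

variable (p) in
/-- A function on the vertices of the polygon with sum zero is a difference of successive values. -/
lemma exists_sum_zero {f : ZMod p → ℤ} (hf : ∑ x, f x = 0) :
    ∃ m : ZMod p → ℤ, ∀ x, m (x - 1) - m x = f x := by
  have hp1 : 1 < p := hpp.out.one_lt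
  have hs : ∑ k ∈ Finset.range p, f (k : ZMod p) = 0 := by
    rw [← hf]
    exact Finset.sum_nbij' (fun k => (k : ZMod p)) ZMod.val (by simp)
      (fun x _ => Finset.mem_range.2 (ZMod.val_lt x))
      (fun k hk => ZMod.val_cast_of_lt (Finset.mem_range.1 hk)) (by simp) (by simp)
  refine ⟨fun x => -∑ k ∈ Finset.range (x.val + 1), f (k : ZMod p), fun x => ?_⟩
  by_cases hx : x = 0
  · subst hx
    have h1 : (0 - 1 : ZMod p).val + 1 = p := by
      rw [zero_sub]
      obtain ⟨n, rfl⟩ : ∃ n, p = n + 1 := ⟨p - 1, by omega⟩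
      rw [ZMod.val_neg_one]
    simp only [h1, hs, ZMod.val_zero]
    simp
  · have h1 : (x - 1).val + 1 = x.val := by
      have h2 : ((x.val - 1 : ℕ) : ZMod p) = x - 1 := by
        rw [Nat.cast_sub (by rwa [Nat.one_le_iff_ne_zero, ZMod.val_ne_zero])]; simp
      have h3 : x.val ≠ 0 := by rwa [ZMod.val_ne_zero]
      rw [← h2, ZMod.val_cast_of_lt (by have := ZMod.val_lt x; omega)]
      omega
    simp only [h1, Finset.sum_range_succ _ x.val, ZMod.natCast_zmod_val]
    ring

variable {ρ ρC}

/-- The extension of the target of `g` by the kernel of the norm, if that is the kernel of `g`. -/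
def KernelExtension.ofMap (g : M →ₗ[ℤ] C) (hg : ∀ h x, g (ρ h x) = ρC h (g x))
    (hs : Function.Surjective g) (hk : ∀ x, g x = 0 ↔ x ∈ sigmaKer ρ) (hC : ∀ c, sig ρC c = c) :
    KernelExtension (sigmaKerRep ρ).toRepresentation ρ ρC where
  f := (sigmaKer ρ).subtype
  g := g
  map_f _ _ := rfl
  map_g := hg
  injective := Subtype.val_injective
  surjective := hs
  exact x := (hk x).trans ⟨fun h => ⟨⟨x, h⟩, rfl⟩, fun ⟨a, ha⟩ => ha ▸ a.2⟩
  norm_eq_zero a := Subtype.ext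
    ((map_normSig (sigmaKerRep ρ).toRepresentation ρ (sigmaKer ρ).subtype (fun _ => rfl) a).trans a.2)
  sig_eq := hC

/-- Replace the kernel of an extension by a lattice with the same image. -/
def KernelExtension.replaceKernel {A B : Type*} [AddCommGroup A] [AddCommGroup B]
    {ρA : Representation ℤ (DihedralGroup p) A} {ρB : Representation ℤ (DihedralGroup p) B}
    (E : KernelExtension ρA ρ ρC) (f : B →ₗ[ℤ] M) (hf : ∀ h x, f (ρB h x) = ρ h (f x))
    (hi : Function.Injective f) (hr : ∀ x, (∃ a, E.f a = x) ↔ ∃ b, f b = x) :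
    KernelExtension ρB ρ ρC where
  f := f
  g := E.g
  map_f := hf
  map_g := E.map_g
  injective := hi
  surjective := E.surjective
  exact x := (E.exact x).trans (hr x)
  norm_eq_zero b := hi (by
    obtain ⟨a, ha⟩ := (hr _).2 ⟨b, rfl⟩
    rw [map_normSig ρB ρ f (hf _), ← ha, ← map_normSig ρA ρ E.f (E.map_f _), E.norm_eq_zero, map_zero,
      map_zero])
  sig_eq := E.sig_eq

end OfMap

section FromNormalForm

variable {M : Type u} {A : Type v} {C : Type w} [AddCommGroup M] [AddCommGroup A] [AddCommGroup C]
  {ρ : Representation ℤ (DihedralGroup p) M} {ρA : Representation ℤ (DihedralGroup p) A}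
  {ρC : Representation ℤ (DihedralGroup p) C}

/-- The map from a lattice of rank one over `R` to `M` with prescribed image of the generator. -/
def RankOne.toKer {s : ℤ} (J : RankOne ρA s) (e : sigmaKer ρ) : A →ₗ[ℤ] M :=
  (sigmaKer ρ).subtype ∘ₗ
    (LinearMap.toSpanSingleton (ringR p) _ e).toAddMonoidHom.toIntLinearMap ∘ₗ J.j.symm.toLinearMap

lemma RankOne.toKer_apply {s : ℤ} (J : RankOne ρA s) (e : sigmaKer ρ) (x : ringR p) :
    J.toKer e (J.j x) = (x • e : sigmaKer ρ) := by
  change ((J.j.symm (J.j x) • e : sigmaKer ρ) : M) = _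
  rw [J.j.symm_apply_apply]

lemma RankOne.toKer_rho {s : ℤ} (J : RankOne ρA s) {e : sigmaKer ρ} (he : tauKer ρ e = s • e)
    (h : DihedralGroup p) (a : A) : J.toKer e (ρA h a) = ρ h (J.toKer e a) := by
  refine map_rho_of_sig_tau ρA ρ _ (fun a => ?_) (fun a => ?_) h a
  · obtain ⟨x, rfl⟩ := J.j.surjective a
    rw [J.sig_j, J.toKer_apply, J.toKer_apply, mul_smul, zetaR_smul]
  · obtain ⟨x, rfl⟩ := J.j.surjective a
    rw [J.tau_j, map_smul, J.toKer_apply, J.toKer_apply, ← coe_tauKer, tauKer_smul, he,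
      smul_comm, Submodule.coe_smul]

end FromNormalForm

section KernelOfType

variable {M : Type u} {B : Type v} {C : Type w} [AddCommGroup M] [AddCommGroup B] [AddCommGroup C]
  {ρ : Representation ℤ (DihedralGroup p) M} {ρB : Representation ℤ (DihedralGroup p) B}
  {ρC : Representation ℤ (DihedralGroup p) C} (hp : p ≠ 2) [Module.IsTorsionFree ℤ C]
  [Module.IsTorsionFree ℤ M]
  (N : NormalForm ρ) (E : KernelExtension ρB ρ ρC)

include N E hp

lemma KernelExtension.exists_f_iff (x : M) : (∃ a, E.f a = x) ↔ x ∈ sigmaKer ρ := by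
  rw [E.mem_sigmaKer_iff, E.exact]

/-- If the kernel of the norm has the form `R ε₊`, an extension of `C` by it is an extension by `R`. -/
lemma NormalForm.exists_extR (h1 : HasEigenclass ρ 1) (h2 : ¬ HasEigenclass ρ (-1)) :
    ∃ E' : KernelExtension (latticeR p).ρ ρ ρC, E'.g = E.g := by
  rw [N.hasEigenclass_one_iff hp] at h1
  rw [N.hasEigenclass_neg_one_iff hp, not_not] at h2
  refine ⟨E.replaceKernel ((rankOneR p).toKer N.S.eP)
    ((rankOneR p).toKer_rho (by rw [N.S.tau_eP, one_smul])) ?_ fun x => ?_, rfl⟩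
  · rw [injective_iff_map_eq_zero]
    intro a ha
    obtain ⟨x, rfl⟩ := (rankOneR p).j.surjective a
    rw [RankOne.toKer_apply] at ha
    have : x = 0 := (smul_eq_zero.1 (Subtype.ext ha)).resolve_right h1
    rw [this, map_zero]
  · rw [E.exists_f_iff hp N]
    constructor
    · intro hx
      refine ⟨(rankOneR p).j (N.S.rP ⟨x, hx⟩), ?_⟩
      have := N.full ⟨x, hx⟩
      rw [N.S.proj_apply, h2, smul_zero, add_zero] at this
      rw [RankOne.toKer_apply, this]
    · rintro ⟨a, rfl⟩
      exact Subtype.property _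

/-- If the kernel of the norm has the form `R ε₋`, an extension of `C` by it is an extension by `P`. -/
lemma NormalForm.exists_extP (h1 : ¬ HasEigenclass ρ 1) (h2 : HasEigenclass ρ (-1)) :
    ∃ E' : KernelExtension (latticeP p).ρ ρ ρC, E'.g = E.g := by
  rw [N.hasEigenclass_one_iff hp, not_not] at h1
  rw [N.hasEigenclass_neg_one_iff hp] at h2
  refine ⟨E.replaceKernel ((rankOneP p hp).toKer N.S.eM)
    ((rankOneP p hp).toKer_rho (by rw [N.S.tau_eM, neg_smul, one_smul])) ?_ fun x => ?_, rfl⟩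
  · rw [injective_iff_map_eq_zero]
    intro a ha
    obtain ⟨x, rfl⟩ := (rankOneP p hp).j.surjective a
    rw [RankOne.toKer_apply] at ha
    have : x = 0 := (smul_eq_zero.1 (Subtype.ext ha)).resolve_right h2
    rw [this, map_zero]
  · rw [E.exists_f_iff hp N]
    constructor
    · intro hx
      refine ⟨(rankOneP p hp).j (N.S.rM ⟨x, hx⟩), ?_⟩
      have := N.full ⟨x, hx⟩
      rw [N.S.proj_apply, h1, smul_zero, zero_add] at this
      rw [RankOne.toKer_apply, this]
    · rintro ⟨a, rfl⟩
      exact Subtype.property _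

/-- If the kernel of the norm has the form `R ε₊ ⊕ R ε₋`, an extension of `C` by it is an extension by
`R ⊕ P`. -/
lemma NormalForm.nonempty_extRP (h1 : HasEigenclass ρ 1) (h2 : HasEigenclass ρ (-1)) :
    Nonempty (KernelExtension (directSum (latticeR p) (latticeP p)).ρ ρ ρC) := by
  rw [N.hasEigenclass_one_iff hp] at h1
  rw [N.hasEigenclass_neg_one_iff hp] at h2
  have hP := N.S.plus.resolve_right fun h => h1 h.2
  have hM := N.S.minus.resolve_right fun h => h2 h.2
  refine ⟨E.replaceKernel (LinearMap.coprod ((rankOneR p).toKer N.S.eP) ((rankOneP p hp).toKer N.S.eM))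
    (fun h x => ?_) ?_ fun x => ?_⟩
  · rw [LinearMap.coprod_apply, LinearMap.coprod_apply, map_add,
      ← (rankOneR p).toKer_rho (by rw [N.S.tau_eP, one_smul]),
      ← (rankOneP p hp).toKer_rho (by rw [N.S.tau_eM, neg_smul, one_smul])]
    rfl
  · rw [injective_iff_map_eq_zero]
    rintro ⟨a, b⟩ hab
    obtain ⟨x, rfl⟩ := (rankOneR p).j.surjective a
    obtain ⟨y, rfl⟩ := (rankOneP p hp).j.surjective b
    rw [LinearMap.coprod_apply, RankOne.toKer_apply, RankOne.toKer_apply, ← Submodule.coe_add] at hab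
    have hab' : x • N.S.eP + y • N.S.eM = 0 := Subtype.ext hab
    have e1 := congrArg N.S.rP hab'
    have e2 := congrArg N.S.rM hab'
    rw [map_add, map_smul, map_smul, hP, N.S.rP_eM, map_zero] at e1
    rw [map_add, map_smul, map_smul, hM, N.S.rM_eP, map_zero] at e2
    have hx : x = 0 := by simpa using e1
    have hy : y = 0 := by simpa using e2
    rw [hx, hy, map_zero, map_zero]; rfl
  · rw [E.exists_f_iff hp N]
    constructor
    · intro hx
      refine ⟨((rankOneR p).j (N.S.rP ⟨x, hx⟩), (rankOneP p hp).j (N.S.rM ⟨x, hx⟩)), ?_⟩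
      have := N.full ⟨x, hx⟩
      rw [N.S.proj_apply] at this
      rw [LinearMap.coprod_apply, RankOne.toKer_apply, RankOne.toKer_apply, ← Submodule.coe_add, this]
    · rintro ⟨⟨a, b⟩, rfl⟩
      exact Submodule.add_mem _ (Subtype.property _) (Subtype.property _)

end KernelOfType

section FunctionModels

variable (p)

/-- The action of `g⁻¹` on the vertices of the polygon. -/
def vertexAct : DihedralGroup p → ZMod p → ZMod p
  | .r i, x => x - i
  | .sr i, x => -(x + i)

lemma vertexAct_mul (g h : DihedralGroup p) (x : ZMod p) :
    vertexAct p (g * h) x = vertexAct p h (vertexAct p g x) := by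
  rcases g with i | i <;> rcases h with j | j <;> simp [vertexAct] <;> ring

/-- The lattice of functions on the vertices of the polygon, twisted by a character. -/
abbrev latticeVertex (χ : DihedralGroup p →* ℤ) : GLattice.{0, 0} (DihedralGroup p) where
  carrier := ZMod p → ℤ
  ρ :=
  { toFun := fun g => χ g • LinearMap.funLeft ℤ ℤ (vertexAct p g)
    map_one' := by
      refine LinearMap.ext fun f => funext fun x => ?_
      change χ 1 * f (x - 0) = f x
      rw [map_one, one_mul, sub_zero]
    map_mul' := fun g h => by
      refine LinearMap.ext fun f => funext fun x => ?_
      change χ (g * h) * f (vertexAct p (g * h) x) = χ g * (χ h * f (vertexAct p h (vertexAct p g x)))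
      rw [map_mul, vertexAct_mul, mul_assoc] }

variable {p} in
lemma latticeVertex_rho (χ : DihedralGroup p →* ℤ) (g : DihedralGroup p) (f : ZMod p → ℤ) (x : ZMod p) :
    (latticeVertex p χ).ρ g f x = χ g * f (vertexAct p g x) := rfl

/-- The regular lattice `ℤ[G]`, as the lattice of functions on `G`. -/
abbrev latticeG : GLattice.{0, 0} (DihedralGroup p) where
  carrier := DihedralGroup p → ℤ
  ρ :=
  { toFun := fun g => LinearMap.funLeft ℤ ℤ fun h => g⁻¹ * h
    map_one' := by
      refine LinearMap.ext fun f => funext fun x => ?_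
      change f (1⁻¹ * x) = f x
      rw [inv_one, one_mul]
    map_mul' := fun g h => by
      refine LinearMap.ext fun f => funext fun x => ?_
      change f ((g * h)⁻¹ * x) = f (h⁻¹ * (g⁻¹ * x))
      rw [mul_inv_rev, mul_assoc] }

lemma latticeG_rho (g : DihedralGroup p) (f : DihedralGroup p → ℤ) (x : DihedralGroup p) :
    (latticeG p).ρ g f x = f (g⁻¹ * x) := rfl

/-- The sum of the values of a function. -/
def vertexSum : (ZMod p → ℤ) →ₗ[ℤ] ℤ := ∑ x, LinearMap.proj x

lemma vertexSum_apply (f : ZMod p → ℤ) : vertexSum p f = ∑ x, f x := by simp [vertexSum]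

lemma vertexAct_bijective (g : DihedralGroup p) : Function.Bijective (vertexAct p g) := by
  refine Finite.injective_iff_bijective.1 ?_
  rcases g with i | i <;> intro x y h <;> simpa [vertexAct] using h

lemma vertexSum_rho (χ : DihedralGroup p →* ℤ) (g : DihedralGroup p) (f : ZMod p → ℤ) :
    vertexSum p ((latticeVertex p χ).ρ g f) = χ g * vertexSum p f := by
  rw [vertexSum_apply, vertexSum_apply, Finset.mul_sum]
  exact (vertexAct_bijective p g).sum_comp (fun x => χ g * f x)

lemma fixed_of_sub {f : ZMod p → ℤ} (h : ∀ x, f (x - 1) = f x) (x : ZMod p) : f x = f 0 := by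
  have : ∀ n : ℕ, f n = f 0 := by
    intro n
    induction n with
    | zero => simp
    | succ n ih => rw [← ih, ← h]; simp
  rw [← ZMod.natCast_zmod_val x, this]

end FunctionModels

end Models

/-! ### Existence of the five extensions -/

section Existence

variable {p : ℕ} [hpp : Fact p.Prime]

/-- The pullback of the extension `M → C` along a map `q : C' → C`. -/
abbrev pullback {M : GLattice.{0, u} (DihedralGroup p)} {C : GLattice.{0, v} (DihedralGroup p)}
    {C' : GLattice.{0, w} (DihedralGroup p)} (g : M →ₗ[ℤ] C) (hg : ∀ h x, g (M.ρ h x) = C.ρ h (g x))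
    (q : C' →ₗ[ℤ] C) (hq : ∀ h x, q (C'.ρ h x) = C.ρ h (q x)) : GLattice.{0, max u w} (DihedralGroup p) :=
  let S : Subrepresentation (M.ρ.prod C'.ρ) :=
    { toSubmodule := LinearMap.eqLocus (g ∘ₗ LinearMap.fst ℤ M C') (q ∘ₗ LinearMap.snd ℤ M C')
      apply_mem_toSubmodule := fun h x (hx : g x.1 = q x.2) => by
        change g (M.ρ h x.1) = q (C'.ρ h x.2)
        rw [hg, hq, hx] }
  { carrier := S.toSubmodule
    ρ := S.toRepresentation }

/-- The extension given by a pullback. -/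
def KernelExtension.pullback {A : Type t} [AddCommGroup A] {ρA : Representation ℤ (DihedralGroup p) A}
    {M : GLattice.{0, u} (DihedralGroup p)} {C : GLattice.{0, v} (DihedralGroup p)}
    {C' : GLattice.{0, w} (DihedralGroup p)} (E : KernelExtension ρA M.ρ C.ρ)
    (q : C' →ₗ[ℤ] C) (hq : ∀ h x, q (C'.ρ h x) = C.ρ h (q x)) (hC' : ∀ c, sig C'.ρ c = c) :
    KernelExtension ρA (DihedralTori.pullback E.g E.map_g q hq).ρ C'.ρ where
  f := LinearMap.codRestrict _ (LinearMap.inl ℤ M C' ∘ₗ E.f) fun a => by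
    change E.g (E.f a) = q 0
    rw [map_zero, E.exact]
    exact ⟨a, rfl⟩
  g := LinearMap.snd ℤ M C' ∘ₗ Submodule.subtype _
  map_f h a := Subtype.ext (Prod.ext (E.map_f h a) (map_zero (C'.ρ h)).symm)
  map_g h x := rfl
  injective a b h := E.injective (congrArg (fun x => x.1.1) h)
  surjective c := by
    obtain ⟨m, hm⟩ := E.surjective (q c)
    exact ⟨⟨(m, c), hm⟩, rfl⟩
  exact x := by
    obtain ⟨⟨m, c⟩, h⟩ := x
    change c = 0 ↔ _
    constructor
    · rintro rfl
      change E.g m = q 0 at h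
      rw [map_zero, E.exact] at h
      obtain ⟨a, rfl⟩ := h
      exact ⟨a, rfl⟩
    · rintro ⟨a, h⟩
      exact (congrArg (fun x => x.1.2) h).symm
  norm_eq_zero := E.norm_eq_zero
  sig_eq := hC'

/-- If every element of the kernel has the form `(σ - 1) m`, this is still so for the pullback. -/
lemma KernelExtension.pullback_isIndecomposable {A : Type t} [AddCommGroup A]
    {ρA : Representation ℤ (DihedralGroup p) A}
    {M : GLattice.{0, u} (DihedralGroup p)} {C : GLattice.{0, v} (DihedralGroup p)}
    {C' : GLattice.{0, w} (DihedralGroup p)} (E : KernelExtension ρA M.ρ C.ρ)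
    (q : C' →ₗ[ℤ] C) (hq : ∀ h x, q (C'.ρ h x) = C.ρ h (q x)) (hC' : ∀ c, sig C'.ρ c = c)
    (hqs : Function.Surjective q) (hind : IsIndecomposable C')
    (h : ∀ x ∈ sigmaKer M.ρ, ∃ m, sig M.ρ m - m = x) :
    IsIndecomposable (DihedralTori.pullback E.g E.map_g q hq) := by
  refine (E.pullback q hq hC').isIndecomposable hind fun a => ?_
  obtain ⟨m, hm⟩ := h _ (E.f_mem a)
  obtain ⟨c, hc⟩ := hqs (E.g m)
  refine ⟨⟨(m, c), hc.symm⟩, Subtype.ext (Prod.ext hm ?_)⟩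
  change sig C'.ρ c - c = 0
  rw [hC', sub_self]

section Vertex

variable (χ : DihedralGroup p →* ℤ) (hχ : χ (.r 1) = 1)

include hχ

lemma exists_of_vertexSum_eq_zero {f : latticeVertex p χ} (h : vertexSum p f = 0) :
    ∃ m, sig (latticeVertex p χ).ρ m - m = f := by
  rw [vertexSum_apply] at h
  obtain ⟨m, hm⟩ := exists_sum_zero p h
  refine ⟨m, funext fun x => ?_⟩
  change χ (.r 1) * m (x - 1) - m x = f x
  rw [hχ, one_mul, hm]

lemma vertexSum_eq_zero_iff (f : latticeVertex p χ) :
    vertexSum p f = 0 ↔ f ∈ sigmaKer (latticeVertex p χ).ρ := by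
  constructor
  · intro h
    obtain ⟨m, rfl⟩ := exists_of_vertexSum_eq_zero χ hχ h
    exact sig_sub_mem _ m
  · intro h
    have h1 : ∀ i : ℕ, vertexSum p ((sig (latticeVertex p χ).ρ ^ i) f) = vertexSum p f := by
      intro i
      induction i with
      | zero => rfl
      | succ i ih => rw [pow_succ', Module.End.mul_apply, vertexSum_rho, hχ, one_mul, ih]
    rw [mem_sigmaKer, normSig, LinearMap.sum_apply] at h
    have h2 := congrArg (vertexSum p) h
    rw [map_sum, Finset.sum_congr rfl fun i _ => h1 i, map_zero, Finset.sum_const, Finset.card_range,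
      smul_eq_zero] at h2
    exact h2.resolve_left hpp.out.ne_zero

/-- The function supported at the vertex `0` is an eigenvector of `τ`; it is modulo the functions of sum zero
it is congruent to no constant function, because its sum is not divisible by `p`. -/
lemma vertex_hasEigenclass : HasEigenclass (latticeVertex p χ).ρ (-χ (.sr 0)) := by
  refine hasEigenclass_of_tau (m := Pi.single 0 1) (funext fun x => ?_) fun y hy hfix => ?_
  · change χ (.sr 0) * (Pi.single 0 1 : ZMod p → ℤ) (-(x + 0)) = _
    by_cases hx : x = 0
    · simp [hx]
    · simp [hx]
  · have h1 : ∀ x, (Pi.single 0 1 + y : ZMod p → ℤ) (x - 1) = (Pi.single 0 1 + y : ZMod p → ℤ) x := by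
      intro x
      have := congrFun hfix x
      rwa [latticeVertex_rho, hχ, one_mul] at this
    have h2 : vertexSum p (Pi.single 0 1 + y) = 1 := by
      rw [map_add, (vertexSum_eq_zero_iff χ hχ y).2 hy, vertexSum_apply]
      simp
    rw [vertexSum_apply, Finset.sum_congr rfl fun x _ => fixed_of_sub p h1 x, Finset.sum_const,
      Finset.card_univ, ZMod.card, nsmul_eq_mul] at h2
    exact hpp.out.one_lt.ne' (by
      have := Int.isUnit_iff.1 (IsUnit.of_mul_eq_one _ h2)
      omega)

/-- The extension of a lattice of rank one given by the sum of the values. -/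
def vertexExtension {C : GLattice.{0, 0} (DihedralGroup p)} (e : ℤ ≃ₗ[ℤ] C)
    (he : ∀ g n, C.ρ g (e n) = χ g • e n) :
    KernelExtension (sigmaKerRep (latticeVertex p χ).ρ).toRepresentation (latticeVertex p χ).ρ C.ρ :=
  KernelExtension.ofMap (e.toLinearMap ∘ₗ vertexSum p)
    (fun h x => by
      change e (vertexSum p _) = C.ρ h (e (vertexSum p x))
      rw [vertexSum_rho, he, ← smul_eq_mul, map_smul])
    (e.surjective.comp fun n => ⟨Pi.single 0 n, by rw [vertexSum_apply]; simp⟩)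
    (fun x => by
      rw [← vertexSum_eq_zero_iff χ hχ]
      exact e.map_eq_zero_iff)
    (fun c => by
      obtain ⟨n, rfl⟩ := e.surjective c
      change C.ρ (.r 1) (e n) = e n
      rw [he, hχ, one_smul])

lemma vertex_exists_sub (x : latticeVertex p χ) (hx : x ∈ sigmaKer (latticeVertex p χ).ρ) :
    ∃ m, sig (latticeVertex p χ).ρ m - m = x :=
  exists_of_vertexSum_eq_zero χ hχ ((vertexSum_eq_zero_iff χ hχ x).2 hx)

end Vertex

lemma tenTypes_of_fst {i : Fin 10} {c d : Bool} (h : tenTypes i = (true, false, c, d)) : c = false := by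
  revert i c d; decide

lemma tenTypes_of_snd {i : Fin 10} {c d : Bool} (h : tenTypes i = (false, true, c, d)) : d = false := by
  revert i c d; decide

section

variable {M : Type u} [AddCommGroup M] {ρ : Representation ℤ (DihedralGroup p) M}
  [Module.IsTorsionFree ℤ M] (hp : p ≠ 2) (N : NormalForm ρ)

include hp N

lemma NormalForm.not_hasEigenclass_one (h1 : QuotSign ρ 1) (h2 : ¬ QuotSign ρ (-1)) :
    ¬ HasEigenclass ρ 1 := by
  obtain ⟨i, hi⟩ := N.latticeType_mem hp
  obtain ⟨⟨a, b, c, d⟩, ht⟩ : ∃ t, t = tenTypes i := ⟨_, rfl⟩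
  obtain ⟨e1, e2, e3, -⟩ := (latticeType_eq_iff ρ).1 (hi.trans ht.symm)
  have ha : a = true := e1.1 h1
  have hb : b = false := Bool.eq_false_iff.2 fun hb => h2 (e2.2 hb)
  subst ha hb
  rw [e3, tenTypes_of_fst ht.symm]
  exact Bool.false_ne_true

lemma NormalForm.not_hasEigenclass_neg_one (h1 : ¬ QuotSign ρ 1) (h2 : QuotSign ρ (-1)) :
    ¬ HasEigenclass ρ (-1) := by
  obtain ⟨i, hi⟩ := N.latticeType_mem hp
  obtain ⟨⟨a, b, c, d⟩, ht⟩ : ∃ t, t = tenTypes i := ⟨_, rfl⟩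
  obtain ⟨e1, e2, -, e4⟩ := (latticeType_eq_iff ρ).1 (hi.trans ht.symm)
  have ha : a = false := Bool.eq_false_iff.2 fun ha => h1 (e1.2 ha)
  have hb : b = true := e2.1 h2
  subst ha hb
  rw [e4, tenTypes_of_snd ht.symm]
  exact Bool.false_ne_true

end

variable (p)

/-- The lattice `V`: the permutation lattice on the vertices of the polygon. -/
abbrev latticeV : GLattice.{0, 0} (DihedralGroup p) := latticeVertex p 1

/-- The lattice `X`: the lattice `V` twisted by the sign character. -/
abbrev latticeX : GLattice.{0, 0} (DihedralGroup p) := latticeVertex p (signChar p)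

variable {p} (hp : p ≠ 2) (h : hPlus p = 1)

lemma isIndecomposable_latticeZ : IsIndecomposable (latticeZ p) :=
  isIndecomposable_of_int (LinearEquiv.refl ℤ ℤ)

lemma isIndecomposable_latticeZMinus : IsIndecomposable (latticeZMinus p) :=
  isIndecomposable_of_int (LinearEquiv.refl ℤ ℤ)

lemma isIndecomposable_latticeZH : IsIndecomposable (latticeZH p) :=
  isIndecomposable_of_swap p (equivSwap p)

include hp h

/-- The kernel of the norm on `V` is `P`, by its eigenclass and the possible types of an
indecomposable lattice. -/
lemma exists_extensionV :
    ∃ E : KernelExtension (latticeP p).ρ (latticeV p).ρ (latticeZ p).ρ, E.g = vertexSum p := by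
  let E := vertexExtension (p := p) 1 rfl (C := latticeZ p) (LinearEquiv.refl ℤ ℤ) (by intro g n; simp)
  have hE := E.isIndecomposable isIndecomposable_latticeZ
    fun a => vertex_exists_sub 1 rfl _ (E.f_mem a)
  obtain ⟨N⟩ := exists_normalForm hp h hE
  have h1 : QuotSign (latticeV p).ρ 1 := (E.quotSign_iff 1).2 fun c => by simp
  have h2 : ¬ QuotSign (latticeV p).ρ (-1) := fun h => by
    have := (E.quotSign_iff (-1)).1 h 1
    simp at this
  exact N.exists_extP hp E (N.not_hasEigenclass_one hp h1 h2) (vertex_hasEigenclass 1 rfl)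

/-- The kernel of the norm on `X` is `R`, by its eigenclass and the possible types of an
indecomposable lattice. -/
lemma exists_extensionX :
    ∃ E : KernelExtension (latticeR p).ρ (latticeX p).ρ (latticeZMinus p).ρ, E.g = vertexSum p := by
  let E := vertexExtension (p := p) (signChar p) rfl (C := latticeZMinus p) (LinearEquiv.refl ℤ ℤ)
    (by intro g n; rfl)
  have hE := E.isIndecomposable isIndecomposable_latticeZMinus
    fun a => vertex_exists_sub _ rfl _ (E.f_mem a)
  obtain ⟨N⟩ := exists_normalForm hp h hE
  have ht : ∀ c : latticeZMinus p, tau (latticeZMinus p).ρ c = -c := fun c => neg_one_mul (α := ℤ) c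
  have h1 : QuotSign (latticeX p).ρ (-1) := (E.quotSign_iff (-1)).2 fun c => by
    rw [ht, neg_one_smul]
  have h2 : ¬ QuotSign (latticeX p).ρ 1 := fun h => by
    have := (ht _).symm.trans ((E.quotSign_iff 1).1 h (1 : ℤ))
    have h9 : (-1 : ℤ) = 1 := this.trans (one_smul ℤ _)
    exact absurd h9 (by norm_num)
  have h3 : HasEigenclass (latticeX p).ρ 1 := by
    have := vertex_hasEigenclass (p := p) (signChar p) rfl
    have e : -signChar p (.sr 0) = 1 := neg_neg (1 : ℤ)
    rwa [e] at this
  exact N.exists_extR hp E h3 (N.not_hasEigenclass_neg_one hp h2 h1)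

omit hp h

variable (p) in
/-- The map `ℤ[H] → ℤ` which sends both basis elements to `1`. -/
def sumZH : latticeZH p →ₗ[ℤ] latticeZ p :=
  (LinearMap.fst ℤ ℤ ℤ + LinearMap.snd ℤ ℤ ℤ) ∘ₗ (equivSwap p).toLinearEquiv.toLinearMap

variable (p) in
/-- The map `ℤ[H] → ℤ_-` which sends the basis elements to `1` and `-1`. -/
def diffZH : latticeZH p →ₗ[ℤ] latticeZMinus p :=
  (LinearMap.fst ℤ ℤ ℤ - LinearMap.snd ℤ ℤ ℤ) ∘ₗ (equivSwap p).toLinearEquiv.toLinearMap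

lemma sumZH_apply (x : latticeZH p) : sumZH p x = (equivSwap p x).1 + (equivSwap p x).2 := rfl

lemma sumZH_rho (g : DihedralGroup p) (x : latticeZH p) :
    sumZH p ((latticeZH p).ρ g x) = (latticeZ p).ρ g (sumZH p x) := by
  rw [sumZH_apply, Equiv.apply_rho]
  rcases g with i | i
  · rfl
  · exact add_comm _ _

lemma diffZH_rho (g : DihedralGroup p) (x : latticeZH p) :
    diffZH p ((latticeZH p).ρ g x) = (latticeZMinus p).ρ g (diffZH p x) := by
  have := Equiv.apply_rho _ (equivSwap p) g x
  rcases g with i | i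
  · refine (congrArg (fun y : ℤ × ℤ => y.1 - y.2) this).trans ?_
    exact (one_mul ((equivSwap p x).1 - (equivSwap p x).2)).symm
  · refine (congrArg (fun y : ℤ × ℤ => y.1 - y.2) this).trans ?_
    change (equivSwap p x).2 - (equivSwap p x).1 = (-1) * ((equivSwap p x).1 - (equivSwap p x).2)
    ring

lemma sumZH_surjective : Function.Surjective (sumZH p) := fun n => by
  obtain ⟨x, hx⟩ := (equivSwap p).toLinearEquiv.surjective (n, 0)
  refine ⟨x, ?_⟩
  change (equivSwap p x) = _ at hx
  rw [sumZH_apply, hx, add_zero]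

lemma diffZH_surjective : Function.Surjective (diffZH p) := fun n => by
  obtain ⟨x, hx⟩ := (equivSwap p).toLinearEquiv.surjective ((n : ℤ), 0)
  refine ⟨x, ?_⟩
  change (equivSwap p x) = _ at hx
  exact (congrArg (fun y : ℤ × ℤ => y.1 - y.2) hx).trans (sub_zero (n : ℤ))

lemma sig_latticeZH (x : latticeZH p) : sig (latticeZH p).ρ x = x :=
  (equivSwap p).toLinearEquiv.injective (Equiv.apply_rho _ (equivSwap p) _ x)

lemma exists_tau_latticeZH : ∃ x : latticeZH p, tau (latticeZH p).ρ x ≠ x ∧ tau (latticeZH p).ρ x ≠ -x := by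
  obtain ⟨x, hx⟩ := (equivSwap p).toLinearEquiv.surjective (1, 0)
  have h1 : equivSwap p (tau (latticeZH p).ρ x) = (equivSwap p x).swap := Equiv.apply_rho _ (equivSwap p) _ x
  change equivSwap p x = _ at hx
  rw [hx] at h1
  refine ⟨x, fun h => ?_, fun h => ?_⟩
  · rw [h, hx] at h1
    exact absurd (show ((1 : ℤ), (0 : ℤ)) = (0, 1) from h1) (by decide)
  · rw [h] at h1
    have h2 : equivSwap p (-x) = - equivSwap p x := (equivSwap p).toLinearEquiv.map_neg x
    rw [h2, hx] at h1
    exact absurd (show ((-1 : ℤ), (0 : ℤ)) = (0, 1) from h1) (by decide)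

section Regular

variable (p)

/-- The map `ℤ[G] → ℤ[H]`, in coordinates. -/
def sumCosets : (DihedralGroup p → ℤ) →ₗ[ℤ] ℤ × ℤ :=
  LinearMap.prod (∑ i : ZMod p, LinearMap.proj (.r i)) (∑ i : ZMod p, LinearMap.proj (.sr i))

lemma sumCosets_apply (f : DihedralGroup p → ℤ) :
    sumCosets p f = (∑ i : ZMod p, f (.r i), ∑ i : ZMod p, f (.sr i)) := by
  simp [sumCosets]

/-- The function with value `a` at the identity, `b` at `τ` and zero elsewhere. -/
def baseFun (a b : ℤ) : DihedralGroup p → ℤ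
  | .r i => if i = 0 then a else 0
  | .sr i => if i = 0 then b else 0

lemma sumCosets_baseFun (a b : ℤ) : sumCosets p (baseFun p a b) = (a, b) := by
  rw [sumCosets_apply]
  simp [baseFun]

lemma sumCosets_rho (g : DihedralGroup p) (f : latticeG p) :
    sumCosets p ((latticeG p).ρ g f) = (latticeSwap p).ρ g (sumCosets p f) := by
  rw [sumCosets_apply, sumCosets_apply]
  rcases g with i | i
  · refine Prod.ext ?_ ?_
    · exact Equiv.sum_comp (Equiv.addLeft (-i)) fun x => f (.r x)
    · exact Equiv.sum_comp (Equiv.subRight (-i)) fun x => f (.sr x)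
  · refine Prod.ext ?_ ?_
    · exact Equiv.sum_comp (Equiv.addLeft i) fun x => f (.sr x)
    · exact Equiv.sum_comp (Equiv.subRight i) fun x => f (.r x)

lemma exists_of_sumCosets_eq_zero {f : latticeG p} (hf : sumCosets p f = 0) :
    ∃ m, sig (latticeG p).ρ m - m = f := by
  rw [sumCosets_apply, Prod.mk_eq_zero] at hf
  obtain ⟨m₁, h1⟩ := exists_sum_zero p hf.1
  obtain ⟨m₂, h2⟩ := exists_sum_zero p (f := fun i => f (.sr (-i)))
    ((Equiv.sum_comp (Equiv.neg (ZMod p)) fun x => f (.sr x)).trans hf.2)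
  refine ⟨fun g => match g with
    | .r i => m₁ i
    | .sr i => m₂ (-i), funext fun g => ?_⟩
  rcases g with i | i
  · rw [Pi.sub_apply, latticeG_rho, DihedralGroup.inv_r, DihedralGroup.r_mul_r]
    change m₁ (-1 + i) - m₁ i = _
    rw [← h1, neg_add_eq_sub]
  · rw [Pi.sub_apply, latticeG_rho, DihedralGroup.inv_r, DihedralGroup.r_mul_sr]
    change m₂ (-(i - -1)) - m₂ (-i) = _
    have := h2 (-i)
    rw [neg_neg] at this
    rw [← this, sub_neg_eq_add, neg_add, ← sub_eq_add_neg]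

lemma sumCosets_eq_zero_iff (f : latticeG p) :
    sumCosets p f = 0 ↔ f ∈ sigmaKer (latticeG p).ρ := by
  constructor
  · intro h
    obtain ⟨m, rfl⟩ := exists_of_sumCosets_eq_zero p h
    exact sig_sub_mem _ m
  · intro h
    have h1 := map_normSig (latticeG p).ρ (latticeSwap p).ρ (sumCosets p) (sumCosets_rho p _) f
    rw [(mem_sigmaKer _).1 h, map_zero, normSig_of_fixed (latticeSwap p).ρ rfl] at h1
    exact (smul_eq_zero.1 h1.symm).resolve_left (by exact_mod_cast hpp.out.ne_zero)

/-- The map from the regular lattice `ℤ[G]` to `ℤ[H]`. -/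
def regularExtension : KernelExtension (sigmaKerRep (latticeG p).ρ).toRepresentation (latticeG p).ρ
    (latticeZH p).ρ :=
  KernelExtension.ofMap ((equivSwap p).toLinearEquiv.symm.toLinearMap ∘ₗ sumCosets p)
    (fun g x => by
      apply (equivSwap p).toLinearEquiv.injective
      refine Eq.trans ?_ (Equiv.apply_rho _ (equivSwap p) g _).symm
      rw [LinearMap.comp_apply, LinearMap.comp_apply, sumCosets_rho]
      refine ((equivSwap p).toLinearEquiv.apply_symm_apply _).trans ?_
      exact congrArg _ ((equivSwap p).toLinearEquiv.apply_symm_apply _).symm)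
    ((equivSwap p).toLinearEquiv.symm.surjective.comp fun a =>
      ⟨baseFun p a.1 a.2, sumCosets_baseFun p a.1 a.2⟩)
    (fun x => by
      rw [← sumCosets_eq_zero_iff]
      exact (equivSwap p).toLinearEquiv.symm.map_eq_zero_iff)
    sig_latticeZH

lemma isIndecomposable_latticeG : IsIndecomposable (latticeG p) :=
  (regularExtension p).isIndecomposable isIndecomposable_latticeZH fun a =>
    exists_of_sumCosets_eq_zero p ((sumCosets_eq_zero_iff p _).2 ((regularExtension p).f_mem a))

lemma hasEigenclass_latticeG {s : ℤ} (hs : s * s = 1) : HasEigenclass (latticeG p).ρ s := by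
  refine hasEigenclass_of_tau (m := baseFun p 1 (-s))
    (funext fun g => ?_) fun y hy hfix => ?_
  · rw [latticeG_rho]
    rcases g with i | i
    · rw [DihedralGroup.inv_sr, DihedralGroup.sr_mul_r]
      change (if 0 + i = 0 then -s else 0) = -s • (if i = 0 then (1 : ℤ) else 0)
      by_cases hi : i = 0 <;> simp [hi]
    · rw [DihedralGroup.inv_sr, DihedralGroup.sr_mul_sr]
      change (if i - 0 = 0 then (1 : ℤ) else 0) = -s • (if i = 0 then -s else 0)
      by_cases hi : i = 0 <;> simp [hi, hs]
  · set w : DihedralGroup p → ℤ := baseFun p 1 (-s) + y with hw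
    have h1 : ∀ x, w (.r (x - 1)) = w (.r x) := by
      intro x
      have := congrFun hfix (.r x)
      rw [latticeG_rho, DihedralGroup.inv_r, DihedralGroup.r_mul_r, neg_add_eq_sub] at this
      exact this
    have h2 : ∑ i : ZMod p, w (.r i) = 1 := by
      have h3 : (sumCosets p w).1 = 1 := by
        rw [hw, map_add, (sumCosets_eq_zero_iff p y).2 hy, add_zero,
          sumCosets_baseFun]
      rwa [sumCosets_apply] at h3
    rw [Finset.sum_congr rfl fun x _ => fixed_of_sub p (f := fun i => w (.r i)) h1 x, Finset.sum_const,
      Finset.card_univ, ZMod.card, nsmul_eq_mul] at h2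
    exact hpp.out.one_lt.ne' (by
      have := Int.isUnit_iff.1 (IsUnit.of_mul_eq_one _ h2)
      omega)

end Regular

include hp h

lemma nonempty_extensionG :
    Nonempty (KernelExtension (directSum (latticeR p) (latticeP p)).ρ (latticeG p).ρ (latticeZH p).ρ) := by
  obtain ⟨N⟩ := exists_normalForm hp h (isIndecomposable_latticeG p)
  exact N.nonempty_extRP hp (regularExtension p) (hasEigenclass_latticeG p (by norm_num))
    (hasEigenclass_latticeG p (by norm_num))

omit h in
lemma nontrivial_latticeP : Nontrivial (latticeP p) := (rankOneP p hp).isIndecomposable.1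

omit hp h in
/-- The extensions `V` and `X` of rank `p` on the vertices of the polygon, the pullbacks `Y₀` and
`Y₁` to `ℤ[H]` and `Y₂ = ℤ[G]`. -/
theorem areNonsplitExtensions (hp : p ≠ 2) (h : hPlus p = 1)
    (EV : KernelExtension (latticeP p).ρ (latticeV p).ρ (latticeZ p).ρ)
    (EX : KernelExtension (latticeR p).ρ (latticeX p).ρ (latticeZMinus p).ρ) :
    AreNonsplitExtensions p (latticeV p) (latticeX p) (pullback EX.g EX.map_g (diffZH p) diffZH_rho)
      (pullback EV.g EV.map_g (sumZH p) sumZH_rho) (latticeG p) := by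
  obtain ⟨EG⟩ := nonempty_extensionG hp h
  have : Nontrivial (latticeP p) := nontrivial_latticeP hp
  have : Nontrivial (latticeR p) := (rankOneR p).isIndecomposable.1
  have : Nontrivial (latticeZH p) := isIndecomposable_latticeZH.1
  have : Nontrivial (latticeZMinus p) := isIndecomposable_latticeZMinus.1
  have hV := fun x hx => vertex_exists_sub (p := p) 1 rfl x hx
  have hX := fun x hx => vertex_exists_sub (p := p) (signChar p) rfl x hx
  refine ⟨?_, ?_, ?_, ?_, ?_, ?_⟩
  · exact EV.isNonsplitExtension (EV.isIndecomposable isIndecomposable_latticeZ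
      fun a => hV _ (EV.f_mem a))
  · exact EX.isNonsplitExtension (EX.isIndecomposable isIndecomposable_latticeZMinus
      fun a => hX _ (EX.f_mem a))
  · exact (EX.pullback (diffZH p) diffZH_rho sig_latticeZH).isNonsplitExtension
      (EX.pullback_isIndecomposable (diffZH p) diffZH_rho sig_latticeZH diffZH_surjective
        isIndecomposable_latticeZH hX)
  · exact (EV.pullback (sumZH p) sumZH_rho sig_latticeZH).isNonsplitExtension
      (EV.pullback_isIndecomposable (sumZH p) sumZH_rho sig_latticeZH sumZH_surjective
        isIndecomposable_latticeZH hV)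
  · exact EG.isNonsplitExtension (isIndecomposable_latticeG p)
  · exact isIndecomposable_latticeG p

theorem exists_nonsplitExtensions : ∃ V X Y₀ Y₁ Y₂ : GLattice.{0, 0} (DihedralGroup p),
    AreNonsplitExtensions p V X Y₀ Y₁ Y₂ := by
  obtain ⟨EV, -⟩ := exists_extensionV hp h
  obtain ⟨EX, -⟩ := exists_extensionX hp h
  exact ⟨_, _, _, _, _, areNonsplitExtensions hp h EV EX⟩

end Existence

/-! ### The ten indecomposable lattices -/

section Ten

variable {p : ℕ} [hpp : Fact p.Prime]

section SigTrivial

variable {M : Type u} [AddCommGroup M] [Module.IsTorsionFree ℤ M]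
  {ρ : Representation ℤ (DihedralGroup p) M} (hρ : ∀ x, sig ρ x = x)

include hρ

lemma eq_zero_of_mem_sigmaKer {x : M} (hx : x ∈ sigmaKer ρ) : x = 0 := fixed_eq_zero ρ hx (hρ x)

lemma not_hasEigenclass_of_sig (s : ℤ) : ¬ HasEigenclass ρ s := by
  rintro ⟨e, he, h, -⟩
  exact h ⟨0, zero_mem _, by rw [eq_zero_of_mem_sigmaKer hρ he, map_zero, sub_zero]⟩

lemma quotSign_iff_of_sig (s : ℤ) : QuotSign ρ s ↔ ∀ x, tau ρ x = s • x := by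
  refine forall_congr' fun x => ⟨fun h => sub_eq_zero.1 (eq_zero_of_mem_sigmaKer hρ h), fun h => ?_⟩
  rw [h, sub_self]; exact zero_mem _

end SigTrivial

section Prod

variable {A : Type u} {B : Type v} [AddCommGroup A] [AddCommGroup B]
  {ρA : Representation ℤ (DihedralGroup p) A} {ρB : Representation ℤ (DihedralGroup p) B}

lemma normSig_prod_eq_zero (hA : ∀ a, normSig ρA a = 0) (hB : ∀ b, normSig ρB b = 0) (x : A × B) :
    normSig (ρA.prod ρB) x = 0 :=
  Prod.ext ((map_normSig (ρA.prod ρB) ρA (LinearMap.fst ℤ A B) (fun _ => rfl) x).trans (hA _))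
    ((map_normSig (ρA.prod ρB) ρB (LinearMap.snd ℤ A B) (fun _ => rfl) x).trans (hB _))

lemma HasEigenclass.inl (hA : ∀ a, normSig ρA a = 0) (hB : ∀ b, normSig ρB b = 0) {s : ℤ}
    (h : HasEigenclass ρA s) : HasEigenclass (ρA.prod ρB) s := by
  obtain ⟨e, -, h1, y, -, h2⟩ := h
  refine ⟨(e, 0), normSig_prod_eq_zero hA hB _, ?_, (y, 0), normSig_prod_eq_zero hA hB _, ?_⟩
  · rintro ⟨z, -, hz⟩
    exact h1 ⟨z.1, hA _, congrArg Prod.fst hz⟩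
  · refine Prod.ext h2 ?_
    change tau ρB 0 - s • 0 = 0 - sig ρB 0
    simp

lemma HasEigenclass.inr (hA : ∀ a, normSig ρA a = 0) (hB : ∀ b, normSig ρB b = 0) {s : ℤ}
    (h : HasEigenclass ρB s) : HasEigenclass (ρA.prod ρB) s := by
  obtain ⟨e, -, h1, y, -, h2⟩ := h
  refine ⟨(0, e), normSig_prod_eq_zero hA hB _, ?_, (0, y), normSig_prod_eq_zero hA hB _, ?_⟩
  · rintro ⟨z, -, hz⟩
    exact h1 ⟨z.2, hB _, congrArg Prod.snd hz⟩
  · refine Prod.ext ?_ h2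
    change tau ρA 0 - s • 0 = 0 - sig ρA 0
    simp

end Prod

lemma IsNonsplitExtension.isIndecomposable {A M C : GLattice.{0, 0} (DihedralGroup p)}
    (h : IsNonsplitExtension A M C) {s : ℤ} (J : RankOne A.ρ s) (hC : ∀ c, sig C.ρ c = c)
    (hind : IsIndecomposable C) : IsIndecomposable M := by
  obtain ⟨E, hE⟩ := h.exists_kernelExtension J.normSig_eq_zero hC
  exact E.isIndecomposable hind (E.exists_sig_sub J hE)

lemma IsNonsplitExtension.quotSign_iff {A M C : GLattice.{0, 0} (DihedralGroup p)}
    (h : IsNonsplitExtension A M C) (hA : ∀ a, normSig A.ρ a = 0) (hC : ∀ c, sig C.ρ c = c) (s : ℤ) :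
    QuotSign M.ρ s ↔ QuotSign C.ρ s := by
  obtain ⟨E, -⟩ := h.exists_kernelExtension hA hC
  rw [E.quotSign_iff, quotSign_iff_of_sig hC]

lemma IsNonsplitExtension.hasEigenclass_iff {A M C : GLattice.{0, 0} (DihedralGroup p)}
    (h : IsNonsplitExtension A M C) (hA : ∀ a, normSig A.ρ a = 0) (hC : ∀ c, sig C.ρ c = c) (s : ℤ) :
    HasEigenclass M.ρ s ↔ HasEigenclass A.ρ s := by
  obtain ⟨E, -⟩ := h.exists_kernelExtension hA hC
  rw [E.hasEigenclass_iff]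

lemma sig_latticeZ (c : latticeZ p) : sig (latticeZ p).ρ c = c := rfl

lemma sig_latticeZMinus (c : latticeZMinus p) : sig (latticeZMinus p).ρ c = c := one_mul (M := ℤ) c

lemma tau_latticeZMinus (c : latticeZMinus p) : tau (latticeZMinus p).ρ c = -c :=
  neg_one_mul (α := ℤ) c

lemma quotSign_latticeZ : QuotSign (latticeZ p).ρ 1 ∧ ¬ QuotSign (latticeZ p).ρ (-1) := by
  rw [quotSign_iff_of_sig sig_latticeZ, quotSign_iff_of_sig sig_latticeZ]
  refine ⟨fun c => by simp, fun h => ?_⟩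
  have := h 1
  simp at this

lemma quotSign_latticeZMinus : ¬ QuotSign (latticeZMinus p).ρ 1 ∧ QuotSign (latticeZMinus p).ρ (-1) := by
  rw [quotSign_iff_of_sig sig_latticeZMinus, quotSign_iff_of_sig sig_latticeZMinus]
  refine ⟨fun h => ?_, fun c => by rw [tau_latticeZMinus, neg_one_smul]⟩
  have := (tau_latticeZMinus _).symm.trans (h (1 : ℤ))
  have h9 : (-1 : ℤ) = 1 := this.trans (one_smul ℤ _)
  exact absurd h9 (by norm_num)

lemma quotSign_latticeZH : ¬ QuotSign (latticeZH p).ρ 1 ∧ ¬ QuotSign (latticeZH p).ρ (-1) := by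
  rw [quotSign_iff_of_sig sig_latticeZH, quotSign_iff_of_sig sig_latticeZH]
  obtain ⟨x, h1, h2⟩ := exists_tau_latticeZH (p := p)
  exact ⟨fun h => h1 (by rw [h, one_smul]), fun h => h2 (by rw [h, neg_one_smul])⟩

lemma RankOne.quotSign {A : Type u} [AddCommGroup A] {ρ : Representation ℤ (DihedralGroup p) A} {s : ℤ}
    (J : RankOne ρ s) (t : ℤ) : QuotSign ρ t := fun _ => J.mem_sigmaKer _

variable (hp : p ≠ 2) {V X Y₀ Y₁ Y₂ : GLattice.{0, 0} (DihedralGroup p)}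
  (H : AreNonsplitExtensions p V X Y₀ Y₁ Y₂)

include hp

lemma hasEigenclass_latticeR : HasEigenclass (latticeR p).ρ 1 ∧ ¬ HasEigenclass (latticeR p).ρ (-1) :=
  ⟨(rankOneR p).hasEigenclass, (rankOneR p).not_hasEigenclass hp (Or.inl rfl)⟩

lemma hasEigenclass_latticeP : ¬ HasEigenclass (latticeP p).ρ 1 ∧ HasEigenclass (latticeP p).ρ (-1) :=
  ⟨(rankOneP p hp).not_hasEigenclass hp (Or.inr rfl), (rankOneP p hp).hasEigenclass⟩

include H

/-- The type of an extension is read off from its kernel and its quotient. -/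
theorem latticeType_tenLattices (i : Fin 10) :
    latticeType (tenLattices p V X Y₀ Y₁ Y₂ i).ρ = tenTypes i := by
  have hR := hasEigenclass_latticeR (p := p) hp
  have hP := hasEigenclass_latticeP (p := p) hp
  have nR := (rankOneR p).normSig_eq_zero
  have nP := (rankOneP p hp).normSig_eq_zero
  have hZ := quotSign_latticeZ (p := p)
  have hZm := quotSign_latticeZMinus (p := p)
  have hZH := quotSign_latticeZH (p := p)
  have key : ∀ (i : Fin 10) (M : GLattice.{0, 0} (DihedralGroup p)),
      ((QuotSign M.ρ 1 ↔ (tenTypes i).1 = true) ∧ (QuotSign M.ρ (-1) ↔ (tenTypes i).2.1 = true) ∧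
      (HasEigenclass M.ρ 1 ↔ (tenTypes i).2.2.1 = true) ∧
      (HasEigenclass M.ρ (-1) ↔ (tenTypes i).2.2.2 = true)) → latticeType M.ρ = tenTypes i :=
    fun i M h => (latticeType_eq_iff M.ρ).2 h
  have yes : ∀ {P Q : Prop}, (P ↔ Q) → Q → (P ↔ true = true) := fun h hQ => iff_of_true (h.2 hQ) rfl
  have no : ∀ {P Q : Prop}, (P ↔ Q) → ¬ Q → (P ↔ false = true) := fun h hQ =>
    iff_of_false (mt h.1 hQ) Bool.false_ne_true
  have nRP := normSig_prod_eq_zero nR nP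
  fin_cases i
  · exact key 0 _ ⟨yes Iff.rfl hZ.1, no Iff.rfl hZ.2,
      no Iff.rfl (not_hasEigenclass_of_sig sig_latticeZ 1), no Iff.rfl (not_hasEigenclass_of_sig sig_latticeZ (-1))⟩
  · exact key 1 _ ⟨no Iff.rfl hZm.1, yes Iff.rfl hZm.2,
      no Iff.rfl (not_hasEigenclass_of_sig sig_latticeZMinus 1), no Iff.rfl (not_hasEigenclass_of_sig sig_latticeZMinus (-1))⟩
  · exact key 2 _ ⟨no Iff.rfl hZH.1, no Iff.rfl hZH.2,
      no Iff.rfl (not_hasEigenclass_of_sig sig_latticeZH 1), no Iff.rfl (not_hasEigenclass_of_sig sig_latticeZH (-1))⟩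
  · exact key 3 (latticeR p) ⟨yes Iff.rfl ((rankOneR p).quotSign 1), yes Iff.rfl ((rankOneR p).quotSign (-1)),
      yes Iff.rfl hR.1, no Iff.rfl hR.2⟩
  · exact key 4 (latticeP p) ⟨yes Iff.rfl ((rankOneP p hp).quotSign 1),
      yes Iff.rfl ((rankOneP p hp).quotSign (-1)), no Iff.rfl hP.1, yes Iff.rfl hP.2⟩
  · have h1 := H.extV.quotSign_iff nP sig_latticeZ
    have h2 := H.extV.hasEigenclass_iff nP sig_latticeZ
    exact key 5 V ⟨yes (h1 _) hZ.1, no (h1 _) hZ.2, no (h2 _) hP.1, yes (h2 _) hP.2⟩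
  · have h1 := H.extX.quotSign_iff nR sig_latticeZMinus
    have h2 := H.extX.hasEigenclass_iff nR sig_latticeZMinus
    exact key 6 X ⟨no (h1 _) hZm.1, yes (h1 _) hZm.2, yes (h2 _) hR.1, no (h2 _) hR.2⟩
  · have h1 := H.extY₀.quotSign_iff nR sig_latticeZH
    have h2 := H.extY₀.hasEigenclass_iff nR sig_latticeZH
    exact key 7 Y₀ ⟨no (h1 _) hZH.1, no (h1 _) hZH.2, yes (h2 _) hR.1, no (h2 _) hR.2⟩
  · have h1 := H.extY₁.quotSign_iff nP sig_latticeZH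
    have h2 := H.extY₁.hasEigenclass_iff nP sig_latticeZH
    exact key 8 Y₁ ⟨no (h1 _) hZH.1, no (h1 _) hZH.2, no (h2 _) hP.1, yes (h2 _) hP.2⟩
  · have h1 := H.extY₂.quotSign_iff nRP sig_latticeZH
    have h2 := H.extY₂.hasEigenclass_iff nRP sig_latticeZH
    exact key 9 Y₂ ⟨no (h1 _) hZH.1, no (h1 _) hZH.2, yes (h2 _) (hR.1.inl nR nP), yes (h2 _) (hP.2.inr nR nP)⟩

theorem isIndecomposable_tenLattices (i : Fin 10) :
    IsIndecomposable (tenLattices p V X Y₀ Y₁ Y₂ i) := by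
  fin_cases i
  · exact isIndecomposable_latticeZ
  · exact isIndecomposable_latticeZMinus
  · exact isIndecomposable_latticeZH
  · exact (rankOneR p).isIndecomposable
  · exact (rankOneP p hp).isIndecomposable
  · exact H.extV.isIndecomposable (rankOneP p hp) sig_latticeZ isIndecomposable_latticeZ
  · exact H.extX.isIndecomposable (rankOneR p) sig_latticeZMinus isIndecomposable_latticeZMinus
  · exact H.extY₀.isIndecomposable (rankOneR p) sig_latticeZH isIndecomposable_latticeZH
  · exact H.extY₁.isIndecomposable (rankOneP p hp) sig_latticeZH isIndecomposable_latticeZH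
  · exact H.indecY₂

theorem eq_of_isoLattice (i j : Fin 10)
    (h : IsoLattice (tenLattices p V X Y₀ Y₁ Y₂ i) (tenLattices p V X Y₀ Y₁ Y₂ j)) : i = j := by
  obtain ⟨f⟩ := h
  refine tenTypes_injective ?_
  rw [← latticeType_tenLattices hp H i, ← latticeType_tenLattices hp H j]
  exact latticeType_congr _ f

/-- Every indecomposable lattice of the same type as one of the ten is isomorphic to it. -/
theorem isoLattice_of_latticeType (h : hPlus p = 1) {M : GLattice.{0, u} (DihedralGroup p)}
    (hM : IsIndecomposable M) {i : Fin 10} (hi : latticeType M.ρ = tenTypes i) :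
    IsoLattice M (tenLattices p V X Y₀ Y₁ Y₂ i) := by
  obtain ⟨N⟩ := exists_normalForm hp h hM
  obtain ⟨N'⟩ := exists_normalForm hp h (isIndecomposable_tenLattices hp H i)
  exact N.nonempty_equiv hp N' (hi.trans (latticeType_tenLattices hp H i).symm)

/-- The normal form leaves only the ten types, and the type determines the lattice. -/
theorem exists_isoLattice (h : hPlus p = 1) (M : GLattice.{0, u} (DihedralGroup p))
    (hM : IsIndecomposable M) : ∃ i, IsoLattice M (tenLattices p V X Y₀ Y₁ Y₂ i) := by
  obtain ⟨N⟩ := exists_normalForm hp h hM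
  obtain ⟨i, hi⟩ := N.latticeType_mem hp
  exact ⟨i, isoLattice_of_latticeType hp H h hM hi⟩

end Ten

/-! ### Permutation lattices and stably permutation lattices -/

section Permutation

variable {G : Type v} [Group G]

lemma isPermutation_of_basis {ι : Type*} [Finite ι] {M : GLattice.{v, w} G} (b : Module.Basis ι ℤ M)
    (hb : ∀ g i, ∃ j, M.ρ g (b i) = b j) : IsPermutation M := by
  have := Fintype.ofFinite ι
  let e := Fintype.equivFin ι
  refine ⟨Fintype.card ι, b.reindex e, fun g i => ?_⟩
  obtain ⟨j, hj⟩ := hb g (e.symm i)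
  exact ⟨e j, by simp [hj]⟩

lemma IsPermutation.of_equiv {M : GLattice.{v, w} G} {N : GLattice.{v, u} G} (h : IsPermutation M)
    (f : M ≃ₗ[ℤ] N) (hf : ∀ g x, f (M.ρ g x) = N.ρ g (f x)) : IsPermutation N := by
  obtain ⟨n, b, hb⟩ := h
  refine ⟨n, b.map f, fun g i => ?_⟩
  obtain ⟨j, hj⟩ := hb g i
  exact ⟨j, by rw [Module.Basis.map_apply, ← hf, hj, Module.Basis.map_apply]⟩

lemma IsPermutation.of_isoLattice {M : GLattice.{v, w} G} {N : GLattice.{v, u} G} (h : IsPermutation M)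
    (hMN : IsoLattice M N) : IsPermutation N := by
  obtain ⟨f⟩ := hMN
  exact h.of_equiv f.toLinearEquiv fun g x => LinearMap.congr_fun (f.isIntertwining' g) x

lemma IsPermutation.directSum {M : GLattice.{v, w} G} {N : GLattice.{v, u} G} (hM : IsPermutation M)
    (hN : IsPermutation N) : IsPermutation (directSum M N) := by
  obtain ⟨m, b, hb⟩ := hM
  obtain ⟨n, c, hc⟩ := hN
  refine isPermutation_of_basis (M := DihedralTori.directSum M N) (b.prod c) ?_
  rintro g (i | i)
  · obtain ⟨j, hj⟩ := hb g i
    refine ⟨Sum.inl j, ?_⟩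
    rw [Module.Basis.prod_apply, Module.Basis.prod_apply]
    refine Prod.ext ?_ ?_
    · exact hj
    · exact map_zero (N.ρ g)
  · obtain ⟨j, hj⟩ := hc g i
    refine ⟨Sum.inr j, ?_⟩
    rw [Module.Basis.prod_apply, Module.Basis.prod_apply]
    refine Prod.ext ?_ ?_
    · exact map_zero (M.ρ g)
    · exact hj

lemma isoLattice_symm {M : GLattice.{v, w} G} {N : GLattice.{v, u} G} (h : IsoLattice M N) :
    IsoLattice N M := h.map fun f => f.symm

lemma isoLattice_of_linearEquiv {M : GLattice.{v, w} G} {N : GLattice.{v, u} G}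
    (f : M ≃ₗ[ℤ] N) (hf : ∀ g x, f (M.ρ g x) = N.ρ g (f x)) : IsoLattice M N :=
  ⟨Representation.Equiv.mk f fun g => LinearMap.ext (hf g)⟩

end Permutation

section Dihedral

variable (p : ℕ) [hpp : Fact p.Prime]

lemma isPermutation_latticeZ : IsPermutation (latticeZ p) :=
  isPermutation_of_basis (M := latticeZ p) (Module.Basis.singleton Unit ℤ) fun _ i => ⟨i, rfl⟩

lemma isPermutation_latticeZH : IsPermutation (latticeZH p) := by
  have : Finite (DihedralGroup p ⧸ Subgroup.zpowers (DihedralGroup.r (1 : ZMod p))) :=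
    Finite.of_equiv _ (cosetBool p).symm
  refine isPermutation_of_basis (M := latticeZH p) (Module.Basis.ofRepr (MonoidAlgebra.coeffLinearEquiv ℤ))
    fun g i => ⟨g • i, ?_⟩
  exact Representation.ofMulAction_single (k := ℤ) g i (1 : ℤ)

lemma isPermutation_latticeV : IsPermutation (latticeV p) := by
  refine isPermutation_of_basis (M := latticeV p) (Pi.basisFun ℤ (ZMod p)) fun g i => ?_
  obtain ⟨j, hj⟩ := (vertexAct_bijective p g).2 i
  refine ⟨j, funext fun x => ?_⟩
  rw [latticeVertex_rho, Pi.basisFun_apply, Pi.basisFun_apply, MonoidHom.one_apply, one_mul,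
    Pi.single_apply, Pi.single_apply, ← hj]
  simp only [(vertexAct_bijective p g).1.eq_iff]

lemma isPermutation_latticeG : IsPermutation (latticeG p) := by
  refine isPermutation_of_basis (M := latticeG p) (Pi.basisFun ℤ (DihedralGroup p)) fun g i =>
    ⟨g * i, funext fun x => ?_⟩
  rw [latticeG_rho, Pi.basisFun_apply, Pi.basisFun_apply, Pi.single_apply, Pi.single_apply]
  simp only [inv_mul_eq_iff_eq_mul]

variable {p}

/-- If `a : A → ℤ` and `b : B → ℤ` take coprime values on invariant elements, then
`A ⊕ B ≃ (A ×_ℤ B) ⊕ ℤ`. -/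
lemma isoLattice_pullback {A : GLattice.{0, u} (DihedralGroup p)} {B : GLattice.{0, w} (DihedralGroup p)}
    (a : A →ₗ[ℤ] latticeZ p) (ha : ∀ g x, a (A.ρ g x) = (latticeZ p).ρ g (a x))
    (b : B →ₗ[ℤ] latticeZ p) (hb : ∀ g x, b (B.ρ g x) = (latticeZ p).ρ g (b x))
    {x : A} (hx : ∀ g, A.ρ g x = x) {y : B} (hy : ∀ g, B.ρ g y = y)
    (hxy : IsCoprime (a x : ℤ) (b y : ℤ)) :
    IsoLattice (directSum A B) (directSum (pullback a ha b hb) (latticeZ p)) := by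
  obtain ⟨k, l, hkl⟩ := hxy
  -- an invariant element of degree one for `a - b`
  let z : A × B := (k • x, -(l • y))
  have hz : (a z.1 : ℤ) - b z.2 = 1 := by
    change a (k • x) - b (-(l • y)) = 1
    rw [map_smul, map_neg, map_smul, smul_eq_mul, smul_eq_mul, sub_neg_eq_add, hkl]
  have hzg : ∀ g, (A.ρ.prod B.ρ) g z = z := fun g => Prod.ext
    (by change A.ρ g (k • x) = k • x; rw [map_smul, hx])
    (by change B.ρ g (-(l • y)) = -(l • y); rw [map_neg, map_smul, hy])
  let d : A × B →ₗ[ℤ] ℤ := a ∘ₗ LinearMap.fst ℤ A B - b ∘ₗ LinearMap.snd ℤ A B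
  have hd : ∀ w, d w = a w.1 - b w.2 := fun _ => rfl
  have hdg : ∀ g w, d ((A.ρ.prod B.ρ) g w) = d w := fun g w => by
    rw [hd, hd]
    change a (A.ρ g w.1) - b (B.ρ g w.2) = _
    rw [ha, hb]; rfl
  let f : (pullback a ha b hb).carrier × ℤ →ₗ[ℤ] A × B :=
    LinearMap.coprod (Submodule.subtype _) (LinearMap.toSpanSingleton ℤ _ z)
  have hf : ∀ w, f w = (w.1 : A × B) + w.2 • z := fun _ => rfl
  have hdf : ∀ w, d (f w) = w.2 := fun w => by
    rw [hf, map_add, map_smul, hd z, hz, smul_eq_mul, mul_one]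
    have : d (w.1 : A × B) = 0 := sub_eq_zero.2 w.1.2
    rw [this, zero_add]
  have hinj : Function.Injective f := by
    rw [injective_iff_map_eq_zero]
    intro w hw
    have h1 := hdf w
    rw [hw, map_zero] at h1
    rw [hf, ← h1, zero_smul, add_zero] at hw
    exact Prod.ext (Subtype.ext hw) h1.symm
  have hsurj : Function.Surjective f := fun w =>
    ⟨(⟨w - d w • z, by
      change a (w - d w • z).1 = b (w - d w • z).2
      rw [← sub_eq_zero, ← hd, map_sub, map_smul, hd z, hz, smul_eq_mul, mul_one, sub_self]⟩, d w), by
      rw [hf]; exact sub_add_cancel _ _⟩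
  refine isoLattice_symm (isoLattice_of_linearEquiv (LinearEquiv.ofBijective f ⟨hinj, hsurj⟩) ?_)
  intro g w
  change f (_, w.2) = (A.ρ.prod B.ρ) g (f w)
  rw [hf, hf, map_add, map_smul, hzg]
  rfl

variable (hp : p ≠ 2)

lemma latticeV_fixed (g : DihedralGroup p) : (latticeV p).ρ g (fun _ => 1) = fun _ => 1 := by
  funext x
  rw [latticeVertex_rho, MonoidHom.one_apply, one_mul]

variable (p) in
/-- The sum of the two basis elements of `ℤ[H]`. -/
def sumBasisZH : latticeZH p := (equivSwap p).toLinearEquiv.symm (1, 1)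

lemma equivSwap_sumBasisZH : equivSwap p (sumBasisZH p) = (1, 1) :=
  (equivSwap p).toLinearEquiv.apply_symm_apply _

lemma sumBasisZH_fixed (g : DihedralGroup p) : (latticeZH p).ρ g (sumBasisZH p) = sumBasisZH p := by
  apply (equivSwap p).toLinearEquiv.injective
  refine (Equiv.apply_rho _ (equivSwap p) g _).trans ?_
  change _ = equivSwap p (sumBasisZH p)
  rw [equivSwap_sumBasisZH]
  rcases g with i | i <;> rfl

include hp in
/-- The constant function has the odd sum `p`. -/
lemma isCoprime_vertexSum_two : IsCoprime (vertexSum p (fun _ => 1)) 2 := by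
  have : vertexSum p (fun _ => 1) = (p : ℤ) := by
    rw [vertexSum_apply]; simp
  rw [this, isCoprime_comm]
  exact_mod_cast Nat.isCoprime_iff_coprime.2 (two_coprime p hp)

lemma sumZH_sumBasisZH : (sumZH p (sumBasisZH p) : ℤ) = 2 := by
  rw [sumZH_apply, equivSwap_sumBasisZH]; rfl

lemma diffZH_sumBasisZH : diffZH p (sumBasisZH p) = 0 :=
  congrArg (fun x : ℤ × ℤ => x.1 - x.2) equivSwap_sumBasisZH

/-- The composite of extensions `A → M → C` and `A' → M' → C'` along a map `C' → C`: an extension of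
`C'` by `A' ⊕ A`. -/
def KernelExtension.compPullback {A : Type t} [AddCommGroup A] {ρA : Representation ℤ (DihedralGroup p) A}
    {A' : Type t} [AddCommGroup A'] {ρA' : Representation ℤ (DihedralGroup p) A'}
    {M : GLattice.{0, u} (DihedralGroup p)} {C : GLattice.{0, v} (DihedralGroup p)}
    {M' : GLattice.{0, u} (DihedralGroup p)} {C' : GLattice.{0, w} (DihedralGroup p)}
    (E : KernelExtension ρA M.ρ C.ρ) (E' : KernelExtension ρA' M'.ρ C'.ρ)
    (q : C' →ₗ[ℤ] C) (hq : ∀ h x, q (C'.ρ h x) = C.ρ h (q x)) :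
    KernelExtension (ρA'.prod ρA) (DihedralTori.pullback E.g E.map_g (q ∘ₗ E'.g)
      (fun h x => by rw [LinearMap.comp_apply, E'.map_g, hq]; rfl)).ρ C'.ρ where
  f := LinearMap.codRestrict _ (LinearMap.prod (E.f ∘ₗ LinearMap.snd ℤ A' A)
    (E'.f ∘ₗ LinearMap.fst ℤ A' A)) fun a => by
      change E.g (E.f a.2) = q (E'.g (E'.f a.1))
      rw [(E.exact _).2 ⟨_, rfl⟩, (E'.exact _).2 ⟨_, rfl⟩, map_zero]
  g := E'.g ∘ₗ LinearMap.snd ℤ M M' ∘ₗ Submodule.subtype _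
  map_f h a := Subtype.ext (Prod.ext (E.map_f h a.2) (E'.map_f h a.1))
  map_g h x := E'.map_g h _
  injective a b h := Prod.ext (E'.injective (congrArg (fun x => x.1.2) h))
    (E.injective (congrArg (fun x => x.1.1) h))
  surjective c := by
    obtain ⟨m', hm'⟩ := E'.surjective c
    obtain ⟨m, hm⟩ := E.surjective (q c)
    exact ⟨⟨(m, m'), by change E.g m = q (E'.g m'); rw [hm, hm']⟩, hm'⟩
  exact x := by
    obtain ⟨⟨m, m'⟩, h⟩ := x
    change E.g m = q (E'.g m') at h
    change E'.g m' = 0 ↔ _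
    constructor
    · intro h0
      rw [h0, map_zero] at h
      obtain ⟨a, rfl⟩ := (E.exact _).1 h
      obtain ⟨a', rfl⟩ := (E'.exact _).1 h0
      exact ⟨(a', a), rfl⟩
    · rintro ⟨a, h⟩
      have h2 : E'.f a.1 = m' := congrArg (fun x => x.1.2) h
      rw [← h2]
      exact (E'.exact _).2 ⟨_, rfl⟩
  norm_eq_zero := normSig_prod_eq_zero E'.norm_eq_zero E.norm_eq_zero
  sig_eq := E'.sig_eq

variable (EV : KernelExtension (latticeP p).ρ (latticeV p).ρ (latticeZ p).ρ)
  (EX : KernelExtension (latticeR p).ρ (latticeX p).ρ (latticeZMinus p).ρ)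
  {V X Y₀ Y₁ Y₂ : GLattice.{0, 0} (DihedralGroup p)}
  (H : AreNonsplitExtensions p V X Y₀ Y₁ Y₂)

include hp H in
lemma isoLattice_tenLattices (h : hPlus p = 1) {V' X' Y₀' Y₁' Y₂' : GLattice.{0, 0} (DihedralGroup p)}
    (H' : AreNonsplitExtensions p V' X' Y₀' Y₁' Y₂') (i : Fin 10) :
    IsoLattice (tenLattices p V X Y₀ Y₁ Y₂ i) (tenLattices p V' X' Y₀' Y₁' Y₂' i) :=
  isoLattice_of_latticeType hp H' h (isIndecomposable_tenLattices hp H i)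
    (latticeType_tenLattices hp H i)

/-- The model `X ×_{ℤ_-} ℤ[H]` of `Y₀`. -/
abbrev latticeY₀ : GLattice.{0, 0} (DihedralGroup p) := pullback EX.g EX.map_g (diffZH p) diffZH_rho

/-- The model `V ×_ℤ ℤ[H]` of `Y₁`. -/
abbrev latticeY₁ : GLattice.{0, 0} (DihedralGroup p) := pullback EV.g EV.map_g (sumZH p) sumZH_rho

include hp in
/-- `V ⊕ ℤ[H] ≃ Y₁ ⊕ ℤ` -/
lemma isPermutation_latticeY₁ (hEV : EV.g = vertexSum p) :
    IsPermutation (directSum (latticeY₁ EV) (latticeZ p)) := by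
  refine ((isPermutation_latticeV p).directSum (isPermutation_latticeZH p)).of_isoLattice
    (isoLattice_pullback EV.g EV.map_g (sumZH p) sumZH_rho latticeV_fixed sumBasisZH_fixed ?_)
  rw [sumZH_sumBasisZH, hEV]
  exact isCoprime_vertexSum_two hp

/-- The map `Y₀ → ℤ[H] → ℤ`. -/
def sumY₀ : latticeY₀ EX →ₗ[ℤ] latticeZ p :=
  sumZH p ∘ₗ (EX.pullback (diffZH p) diffZH_rho sig_latticeZH).g

lemma sumY₀_rho (g : DihedralGroup p) (x : latticeY₀ EX) :
    sumY₀ EX ((latticeY₀ EX).ρ g x) = (latticeZ p).ρ g (sumY₀ EX x) := by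
  rw [sumY₀, LinearMap.comp_apply, KernelExtension.map_g, sumZH_rho]; rfl

/-- The invariant element of `Y₀` over the sum of the basis elements of `ℤ[H]`. -/
def fixedY₀ : latticeY₀ EX := ⟨(0, sumBasisZH p), by
  change EX.g 0 = diffZH p (sumBasisZH p)
  rw [map_zero, diffZH_sumBasisZH]⟩

lemma fixedY₀_fixed (g : DihedralGroup p) : (latticeY₀ EX).ρ g (fixedY₀ EX) = fixedY₀ EX :=
  Subtype.ext (Prod.ext (map_zero ((latticeX p).ρ g)) (sumBasisZH_fixed g))

lemma sumY₀_fixedY₀ : (sumY₀ EX (fixedY₀ EX) : ℤ) = 2 := sumZH_sumBasisZH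

include hp in
/-- The pullback `V ×_ℤ Y₀` is isomorphic to `ℤ[G]`, because it is indecomposable of the same type. -/
lemma isoLattice_pullback_latticeG (h : hPlus p = 1) (hEV : EV.g = vertexSum p) :
    IsoLattice (latticeG p) (pullback EV.g EV.map_g (sumY₀ EX) (sumY₀_rho EX)) := by
  let E' := EX.pullback (diffZH p) diffZH_rho sig_latticeZH
  let E := EV.compPullback E' (sumZH p) sumZH_rho
  have hsub : ∀ a, ∃ m, sig (pullback EV.g EV.map_g (sumY₀ EX) (sumY₀_rho EX)).ρ m - m = E.f a := by
    rintro ⟨a', a⟩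
    obtain ⟨m, hm⟩ := vertex_exists_sub (p := p) 1 rfl _ (EV.f_mem a)
    obtain ⟨x, hx⟩ := vertex_exists_sub (p := p) (signChar p) rfl _ (EX.f_mem a')
    obtain ⟨c, hc⟩ := diffZH_surjective (p := p) (EX.g x)
    have hone := isCoprime_vertexSum_two hp
    obtain ⟨k, l, hkl⟩ := hone
    -- invariant elements are added to reach the same degree in both factors
    let y : latticeY₀ EX := ⟨(x, c), hc.symm⟩
    let n : ℤ := (sumY₀ EX y : ℤ) - EV.g m
    have hdeg : EV.g (m + (n * k) • (fun _ => 1 : ZMod p → ℤ)) =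
        sumY₀ EX (y - (n * l) • fixedY₀ EX) := by
      rw [map_add, map_smul, map_sub, map_smul]
      have h1 : EV.g (fun _ => 1 : ZMod p → ℤ) = vertexSum p (fun _ => 1) := by rw [hEV]
      have h2 := sumY₀_fixedY₀ EX
      rw [h1]
      change EV.g m + n * k * vertexSum p (fun _ => 1) = sumY₀ EX y - n * l * sumY₀ EX (fixedY₀ EX)
      rw [h2]
      have h3 : n = (sumY₀ EX y : ℤ) - EV.g m := rfl
      linear_combination n * hkl + h3
    refine ⟨⟨(_, _), hdeg⟩, Subtype.ext (Prod.ext ?_ (Subtype.ext (Prod.ext ?_ ?_)))⟩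
    · change sig (latticeV p).ρ (m + _) - (m + _) = EV.f a
      rw [map_add, map_smul, latticeV_fixed, ← hm]; abel
    · change sig (latticeX p).ρ (x - (n * l) • 0) - (x - (n * l) • 0) = EX.f a'
      rw [smul_zero, sub_zero, hx]
    · exact sub_eq_zero.2 (sig_latticeZH _)
  have hind := E.isIndecomposable isIndecomposable_latticeZH hsub
  have H₀ := areNonsplitExtensions hp h EV EX
  refine isoLattice_symm (isoLattice_of_latticeType hp H₀ h hind (i := 9) ?_)
  have hR := hasEigenclass_latticeR (p := p) hp
  have hP := hasEigenclass_latticeP (p := p) hp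
  have hZH := quotSign_latticeZH (p := p)
  rw [quotSign_iff_of_sig sig_latticeZH, quotSign_iff_of_sig sig_latticeZH] at hZH
  have nR := (rankOneR p).normSig_eq_zero
  have nP := (rankOneP p hp).normSig_eq_zero
  refine (latticeType_eq_iff _).2 ⟨?_, ?_, ?_, ?_⟩
  · rw [E.quotSign_iff]; exact iff_of_false hZH.1 Bool.false_ne_true
  · rw [E.quotSign_iff]; exact iff_of_false hZH.2 Bool.false_ne_true
  · rw [E.hasEigenclass_iff]; exact iff_of_true (hR.1.inl nR nP) rfl
  · rw [E.hasEigenclass_iff]; exact iff_of_true (hP.2.inr nR nP) rfl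

include hp in
/-- `V ⊕ Y₀ ≃ ℤ[G] ⊕ ℤ` -/
lemma isPermutation_latticeY₀ (h : hPlus p = 1) (hEV : EV.g = vertexSum p) :
    IsPermutation (directSum (latticeV p) (latticeY₀ EX)) := by
  have h1 := isoLattice_pullback EV.g EV.map_g (sumY₀ EX) (sumY₀_rho EX) latticeV_fixed
    (fixedY₀_fixed EX) (by rw [sumY₀_fixedY₀, hEV]; exact isCoprime_vertexSum_two hp)
  refine IsPermutation.of_isoLattice ?_ (isoLattice_symm h1)
  exact ((isPermutation_latticeG p).of_isoLattice (isoLattice_pullback_latticeG hp EV EX h hEV)).directSum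
    (isPermutation_latticeZ p)

section Transfer

variable {G : Type v} [Group G]

lemma isoLattice_directSum_comm (M : GLattice.{v, w} G) (N : GLattice.{v, u} G) :
    IsoLattice (directSum M N) (directSum N M) :=
  isoLattice_of_linearEquiv (LinearEquiv.prodComm ℤ M N) fun _ _ => rfl

lemma isoLattice_directSum {M : GLattice.{v, w} G} {N : GLattice.{v, u} G} {L : GLattice.{v, t} G}
    (h : IsoLattice M N) : IsoLattice (directSum M L) (directSum N L) := by
  obtain ⟨f⟩ := h
  exact isoLattice_of_linearEquiv (M := directSum M L) (N := directSum N L)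
    (LinearEquiv.prodCongr f.toLinearEquiv (LinearEquiv.refl ℤ L)) fun g x =>
      Prod.ext (LinearMap.congr_fun (f.isIntertwining' g) x.1) rfl

end Transfer

include hp H in
theorem isPermutation_tenLattices (h : hPlus p = 1) :
    (IsPermutation (latticeZ p) ∧ IsPermutation (latticeZH p) ∧ IsPermutation V ∧ IsPermutation Y₂) ∧
    ∃ Q₀ Q₁ : GLattice.{0, 0} (DihedralGroup p), IsPermutation Q₀ ∧ IsPermutation Q₁ ∧
      IsPermutation (directSum Y₀ Q₀) ∧ IsPermutation (directSum Y₁ Q₁) := by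
  obtain ⟨EV, hEV⟩ := exists_extensionV hp h
  obtain ⟨EX, -⟩ := exists_extensionX hp h
  have H₀ := areNonsplitExtensions hp h EV EX
  have iso := isoLattice_tenLattices hp H₀ h H
  refine ⟨⟨isPermutation_latticeZ p, isPermutation_latticeZH p,
    (isPermutation_latticeV p).of_isoLattice (iso 5), (isPermutation_latticeG p).of_isoLattice (iso 9)⟩,
    latticeV p, latticeZ p, isPermutation_latticeV p, isPermutation_latticeZ p, ?_, ?_⟩
  · exact ((isPermutation_latticeY₀ hp EV EX h hEV).of_isoLattice (isoLattice_directSum_comm _ _)).of_isoLattice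
      (isoLattice_directSum (iso 7))
  · exact (isPermutation_latticeY₁ hp EV hEV).of_isoLattice (isoLattice_directSum (iso 8))

end Dihedral

/-! ### Lattices which are not flabby -/

section Flabby

open CategoryTheory in
/-- If the Tate cohomology group `H⁻¹` vanishes, the kernel of the norm is generated by the elements
`s m - m`. -/
lemma mem_coinvariantsKer_of_tateCohomology {k S : Type} [CommRing k] [Group S] [Fintype S]
    (A : Rep.{0} k S) (h : Subsingleton (tateCohomology A (-1))) {x : A}
    (hx : ∑ s : S, A.ρ s x = 0) : x ∈ Representation.Coinvariants.ker A.ρ := by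
  have h1 : (tateComplex A).ExactAt (-1) := by
    rw [HomologicalComplex.exactAt_iff_isZero_homology]
    exact @ModuleCat.isZero_of_subsingleton _ _ _ h
  rw [HomologicalComplex.exactAt_iff' (tateComplex A) (-2) (-1) 0 (by simp) (by simp),
    ShortComplex.moduleCat_exact_iff] at h1
  obtain ⟨y, hy⟩ := h1 ((groupHomology.chainsIso₀ A).inv x) (by
    change A.tateNorm _ = 0
    have e : (groupHomology.chainsIso₀ A).inv ≫ A.tateNorm =
        A.norm.toModuleCatHom ≫ (groupCohomology.cochainsIso₀ A).inv := by
      rw [Rep.tateNorm, Iso.inv_hom_id_assoc]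
    have h2 := congrArg (fun f => f x) (congrArg (fun f => f.hom) e)
    refine h2.trans ?_
    have h3 : A.norm.toModuleCatHom.hom x = 0 := by
      rw [← hx]
      change A.ρ.norm x = _
      rw [Representation.norm, LinearMap.sum_apply]
    change (groupCohomology.cochainsIso₀ A).inv.hom (A.norm.toModuleCatHom.hom x) = 0
    rw [h3, map_zero])
  change (groupHomology.inhomogeneousChains A).d 1 0 y = _ at hy
  rw [← groupHomology.range_d₁₀_eq_coinvariantsKer]
  refine ⟨(groupHomology.chainsIso₁ A).hom y, ?_⟩
  have h2 := congrArg (fun f => f y) (congrArg (fun f => f.hom) (groupHomology.comp_d₁₀_eq A))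
  refine h2.trans ?_
  change (groupHomology.chainsIso₀ A).hom ((groupHomology.inhomogeneousChains A).d 1 0 y) = x
  rw [hy]
  exact congrArg (fun f => f x) (congrArg (fun f => f.hom) (groupHomology.chainsIso₀ A).inv_hom_id)

/-- A lattice is not flabby if some element of norm zero lies outside of a sublattice which contains
all `s m - m`. That the norm is zero follows if the span of the orbit contains no invariants. -/
lemma not_isFlabby {G : Type} [Group G] [Finite G] {M : GLattice.{0, 0} G} (S : Subgroup G) (x : M)
    (h1 : ∀ y, (∀ s ∈ S, M.ρ s y = y) → y ∈ Submodule.span ℤ (Set.range fun s : S => M.ρ s x) → y = 0)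
    (I : Submodule ℤ M)
    (hI : ∀ s ∈ S, ∀ m, M.ρ s m - m ∈ I) (hx : x ∉ I) : ¬ IsFlabby M := by
  intro h
  have h2 := h S
  let _ : Fintype S := Fintype.ofFinite S
  refine hx ?_
  have h3 := mem_coinvariantsKer_of_tateCohomology (Rep.of (M.ρ.comp S.subtype)) h2 (x := x) (by
    refine h1 _ (fun s hs => ?_) (sum_mem fun s _ => Submodule.subset_span ⟨s, rfl⟩)
    rw [map_sum]
    refine (Finset.sum_congr rfl fun t _ => ?_).trans
      (Equiv.sum_comp (Equiv.mulLeft (⟨s, hs⟩ : S)) fun t => (M.ρ.comp S.subtype) t x)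
    rw [Equiv.coe_mulLeft, map_mul]; rfl)
  refine Submodule.span_le.2 ?_ h3
  rintro _ ⟨⟨s, m⟩, rfl⟩
  exact hI s s.2 m

variable {p : ℕ} [hpp : Fact p.Prime]

/-- The generator of a lattice of rank one over `R` has norm zero for `⟨σ⟩`, and is
not divisible by `1 - ζ`. -/
lemma RankOne.not_isFlabby {A : GLattice.{0, 0} (DihedralGroup p)} {s : ℤ} (J : RankOne A.ρ s) :
    ¬ IsFlabby A := by
  refine DihedralTori.not_isFlabby (Subgroup.zpowers (.r 1)) (J.j 1) (fun y hy _ => ?_)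
    (Submodule.map J.j.toLinearMap
      ((Ideal.span {1 - zetaR p}).restrictScalars ℤ)) ?_ ?_
  · have h1 : sig A.ρ y = y := hy _ (Subgroup.mem_zpowers _)
    obtain ⟨x, rfl⟩ := J.j.surjective y
    rw [J.sig_j] at h1
    have h2 : (1 - zetaR p) * x = 0 := by rw [sub_mul, one_mul, J.j.injective h1, sub_self]
    rw [(mul_eq_zero.1 h2).resolve_left (one_sub_zetaR_ne_zero p), map_zero]
  · intro g hg m
    obtain ⟨n, rfl⟩ : ∃ n : ℕ, g = .r 1 ^ n := by
      obtain ⟨n, hn⟩ := (mem_powers_iff_mem_zpowers.2 hg)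
      exact ⟨n, hn.symm⟩
    have hs : ∀ a, sig A.ρ a - a ∈ Submodule.map J.j.toLinearMap
        ((Ideal.span {1 - zetaR p}).restrictScalars ℤ) := by
      intro a
      obtain ⟨x, rfl⟩ := J.j.surjective a
      refine ⟨-((1 - zetaR p) * x), neg_mem (Ideal.mul_mem_right _ _ (Ideal.mem_span_singleton_self _)), ?_⟩
      rw [J.sig_j, ← map_sub]
      change J.j _ = _
      congr 1; ring
    induction n with
    | zero => simp
    | succ n ih =>
      have e : A.ρ (.r 1 ^ (n + 1)) m - m = sig A.ρ (A.ρ (.r 1 ^ n) m) - A.ρ (.r 1 ^ n) m +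
          (A.ρ (.r 1 ^ n) m - m) := by
        rw [pow_succ', rho_mul_apply]; abel
      rw [e]
      exact add_mem (hs _) (ih ⟨n, by simp⟩)
  · rintro ⟨x, hx, h⟩
    have h1 : x = 1 := J.j.injective h
    rw [h1] at hx
    have h2 := Ideal.mem_span_singleton.1 hx
    exact (one_sub_zetaR_prime p).not_isUnit (isUnit_of_dvd_one h2)

lemma signChar_two_dvd (g : DihedralGroup p) : (2 : ℤ) ∣ signChar p g - 1 := by
  rcases g with i | i
  · exact ⟨0, rfl⟩
  · exact ⟨-1, rfl⟩

/-- A lattice with an element on which `G` acts through the sign is not flabby, if some map to the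
twisted lattice of rank one takes an odd value there. -/
lemma not_isFlabby_of_sign {M : GLattice.{0, 0} (DihedralGroup p)} (x : M)
    (hx : ∀ g, M.ρ g x = signChar p g • x) (φ : M →ₗ[ℤ] ℤ) (hφ : ∀ g m, φ (M.ρ g m) = signChar p g * φ m)
    (h : ¬ (2 : ℤ) ∣ φ x) : ¬ IsFlabby M := by
  refine not_isFlabby ⊤ x (fun y hy hys => ?_)
    (Submodule.comap φ ((Ideal.span {(2 : ℤ)}).restrictScalars ℤ)) (fun g _ m => ?_) fun h1 => ?_
  · have h2 : y ∈ Submodule.span ℤ {x} := by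
      refine Submodule.span_le.2 ?_ hys
      rintro _ ⟨g, rfl⟩
      change M.ρ g x ∈ _
      rw [hx]
      exact Submodule.smul_mem _ _ (Submodule.mem_span_singleton_self x)
    obtain ⟨n, rfl⟩ := Submodule.mem_span_singleton.1 h2
    have h3 := hy (.sr 0) trivial
    rw [map_smul, hx, show signChar p (.sr 0) = -1 from rfl, neg_one_smul, smul_neg] at h3
    have h4 : (2 : ℤ) • (n • x) = 0 := by rw [two_smul]; nth_rewrite 1 [← h3]; exact neg_add_cancel _
    exact (smul_eq_zero.1 h4).resolve_left two_ne_zero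
  · change φ (M.ρ g m - m) ∈ Ideal.span {(2 : ℤ)}
    rw [map_sub, hφ, Ideal.mem_span_singleton, show signChar p g * φ m - φ m = (signChar p g - 1) * φ m by ring]
    exact (signChar_two_dvd g).mul_right _
  · exact h (Ideal.mem_span_singleton.1 h1)

lemma not_isFlabby_latticeZMinus : ¬ IsFlabby (latticeZMinus p) :=
  not_isFlabby_of_sign (M := latticeZMinus p) (1 : ℤ) (fun _ => rfl) LinearMap.id
    (fun _ _ => rfl) (show ¬ (2 : ℤ) ∣ 1 by norm_num)

lemma not_isFlabby_of_isoLattice_latticeX (hp : p ≠ 2) {X : GLattice.{0, 0} (DihedralGroup p)}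
    (h : IsoLattice X (latticeX p)) : ¬ IsFlabby X := by
  obtain ⟨f⟩ := h
  have hf := Equiv.apply_rho _ f
  let x := f.toLinearEquiv.symm (fun _ => 1)
  have hfx : f x = fun _ => 1 := f.toLinearEquiv.apply_symm_apply _
  refine not_isFlabby_of_sign x (fun g => ?_)
    (vertexSum p ∘ₗ f.toLinearEquiv.toLinearMap) (fun g m => ?_) ?_
  · apply f.toLinearEquiv.injective
    rw [map_smul]
    change f (X.ρ g x) = signChar p g • f x
    rw [hf, hfx]
    funext y
    exact latticeVertex_rho _ _ _ _
  · change vertexSum p (f (X.ρ g m)) = signChar p g * vertexSum p (f m)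
    rw [hf, vertexSum_rho]
  · change ¬ (2 : ℤ) ∣ vertexSum p (f x)
    rw [hfx]
    intro h2
    exact absurd ((isCoprime_vertexSum_two hp).isUnit_of_dvd' h2 dvd_rfl) (by decide)

end Flabby

/-! ### Resolutions by permutation lattices -/

section Resolution

variable {G : Type v} [Group G]

/-- There is a short exact sequence `0 → M ⊕ Q₀ → P → Q → 0` of lattices with `Q₀`, `P` and `Q`
permutation. -/
def HasPermutationResolution (M : GLattice.{v, w} G) : Prop :=
  ∃ Q₀ P Q : GLattice.{v, 0} G, IsPermutation Q₀ ∧ IsPermutation P ∧ IsPermutation Q ∧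
    ∃ (f : (directSum M Q₀).carrier →ₗ[ℤ] P) (g : P →ₗ[ℤ] Q),
      (∀ s x, f ((directSum M Q₀).ρ s x) = P.ρ s (f x)) ∧ (∀ s x, g (P.ρ s x) = Q.ρ s (g x)) ∧
      Function.Injective f ∧ Function.Surjective g ∧ (∀ a, g (f a) = 0) ∧ ∀ x, g x = 0 → ∃ a, f a = x

variable (G) in
/-- The zero lattice. -/
abbrev latticeZero : GLattice.{v, 0} G where
  carrier := PUnit
  ρ := Representation.trivial ℤ G PUnit

lemma isPermutation_latticeZero : IsPermutation (latticeZero G) :=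
  isPermutation_of_basis (M := latticeZero G) (Module.Basis.empty PUnit (ι := Empty)) fun _ i => i.elim

/-- An extension of a permutation lattice by `A`, which becomes permutation after adding a
permutation lattice, gives a resolution of `A`. -/
lemma HasPermutationResolution.of_extension {A : GLattice.{v, w} G} {Y C Q₀ : GLattice.{v, 0} G}
    (hC : IsPermutation C) (hQ₀ : IsPermutation Q₀) (hY : IsPermutation (directSum Y Q₀))
    (f : A →ₗ[ℤ] Y) (g : Y →ₗ[ℤ] C) (hf : ∀ s x, f (A.ρ s x) = Y.ρ s (f x))
    (hg : ∀ s x, g (Y.ρ s x) = C.ρ s (g x)) (hinj : Function.Injective f)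
    (hsurj : Function.Surjective g) (hgf : ∀ a, g (f a) = 0) (hex : ∀ x, g x = 0 → ∃ a, f a = x) :
    HasPermutationResolution A := by
  refine ⟨Q₀, directSum Y Q₀, C, hQ₀, hY, hC, LinearMap.prodMap f LinearMap.id,
    g ∘ₗ LinearMap.fst ℤ Y Q₀, fun s x => Prod.ext (hf s x.1) rfl, fun s x => hg s x.1,
    fun x y h => Prod.ext (hinj (congrArg Prod.fst h)) (congrArg (fun z : Y × Q₀ => z.2) h), fun c => ?_,
    fun a => hgf a.1, fun x hx => ?_⟩
  · obtain ⟨y, rfl⟩ := hsurj c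
    exact ⟨(y, 0), rfl⟩
  · obtain ⟨a, ha⟩ := hex x.1 hx
    exact ⟨(a, x.2), Prod.ext ha rfl⟩

lemma HasPermutationResolution.of_exact {A : GLattice.{v, w} G} {P C : GLattice.{v, 0} G}
    (hC : IsPermutation C) (hP : IsPermutation P)
    (f : A →ₗ[ℤ] P) (g : P →ₗ[ℤ] C) (hf : ∀ s x, f (A.ρ s x) = P.ρ s (f x))
    (hg : ∀ s x, g (P.ρ s x) = C.ρ s (g x)) (hinj : Function.Injective f)
    (hsurj : Function.Surjective g) (hgf : ∀ a, g (f a) = 0) (hex : ∀ x, g x = 0 → ∃ a, f a = x) :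
    HasPermutationResolution A :=
  .of_extension hC isPermutation_latticeZero (hP.directSum isPermutation_latticeZero) f g hf hg
    hinj hsurj hgf hex

lemma HasPermutationResolution.of_subsingleton {M : GLattice.{v, w} G} (h : Subsingleton M) :
    HasPermutationResolution M :=
  .of_exact (P := latticeZero G) (C := latticeZero G) isPermutation_latticeZero
    isPermutation_latticeZero 0 0 (fun _ _ => rfl) (fun _ _ => rfl)
    (fun _ _ _ => Subsingleton.elim _ _) (fun _ => ⟨0, rfl⟩) (fun _ => rfl) fun _ _ => ⟨0, rfl⟩

lemma HasPermutationResolution.of_directSum {M Q : GLattice.{v, 0} G} (hQ : IsPermutation Q)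
    (h : IsPermutation (DihedralTori.directSum M Q)) : HasPermutationResolution M :=
  .of_extension (C := latticeZero G) isPermutation_latticeZero hQ h LinearMap.id 0
    (fun _ _ => rfl) (fun _ _ => rfl) (fun _ _ h => h) (fun _ => ⟨0, rfl⟩) (fun _ => rfl) fun x _ => ⟨x, rfl⟩

lemma IsPermutation.hasPermutationResolution {M : GLattice.{v, 0} G} (h : IsPermutation M) :
    HasPermutationResolution M :=
  .of_directSum isPermutation_latticeZero (h.directSum isPermutation_latticeZero)

lemma HasPermutationResolution.of_isoLattice {M : GLattice.{v, w} G} {N : GLattice.{v, u} G}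
    (h : HasPermutationResolution N) (hMN : IsoLattice M N) : HasPermutationResolution M := by
  obtain ⟨Q₀, P, Q, h1, h2, h3, f, g, hf, hg, hinj, hsurj, hgf, hex⟩ := h
  obtain ⟨e⟩ := hMN
  have he : ∀ s x, e.toLinearEquiv (M.ρ s x) = N.ρ s (e.toLinearEquiv x) := fun s x =>
    LinearMap.congr_fun (e.isIntertwining' s) x
  refine ⟨Q₀, P, Q, h1, h2, h3, f ∘ₗ LinearMap.prodMap e.toLinearEquiv.toLinearMap LinearMap.id, g,
    fun s x => ?_, hg, hinj.comp (e.toLinearEquiv.injective.prodMap Function.injective_id), hsurj,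
    fun a => hgf _, fun x hx => ?_⟩
  · refine Eq.trans ?_ (hf s (e.toLinearEquiv x.1, x.2))
    exact congrArg f (Prod.ext (he s x.1) rfl)
  · obtain ⟨a, ha⟩ := hex x hx
    refine ⟨(e.toLinearEquiv.symm a.1, a.2), Eq.trans (congrArg f ?_) ha⟩
    exact Prod.ext (e.toLinearEquiv.apply_symm_apply a.1) rfl

lemma HasPermutationResolution.directSum {M : GLattice.{v, w} G} {N : GLattice.{v, u} G}
    (h : HasPermutationResolution M) (h' : HasPermutationResolution N) :
    HasPermutationResolution (DihedralTori.directSum M N) := by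
  obtain ⟨Q₀, P, Q, h1, h2, h3, f, g, hf, hg, hinj, hsurj, hgf, hex⟩ := h
  obtain ⟨Q₀', P', Q', h1', h2', h3', f', g', hf', hg', hinj', hsurj', hgf', hex'⟩ := h'
  refine ⟨DihedralTori.directSum Q₀ Q₀', DihedralTori.directSum P P', DihedralTori.directSum Q Q',
    h1.directSum h1', h2.directSum h2', h3.directSum h3',
    LinearMap.prodMap f f' ∘ₗ (LinearEquiv.prodProdProdComm ℤ M N Q₀ Q₀').toLinearMap,
    LinearMap.prodMap g g', fun s x => ?_, fun s x => ?_, ?_, hsurj.prodMap hsurj',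
    fun a => Prod.ext (hgf _) (hgf' _), fun x hx => ?_⟩
  · exact Prod.ext (hf s (x.1.1, x.2.1)) (hf' s (x.1.2, x.2.2))
  · exact Prod.ext (hg s x.1) (hg' s x.2)
  · exact (hinj.prodMap hinj').comp (LinearEquiv.injective _)
  · obtain ⟨a, ha⟩ := hex x.1 (congrArg Prod.fst hx)
    obtain ⟨b, hb⟩ := hex' x.2 (congrArg Prod.snd hx)
    exact ⟨((a.1, b.1), (a.2, b.2)), Prod.ext ha hb⟩

/-- Resolutions of the indecomposable lattices suffice, by induction on the rank. -/
lemma HasPermutationResolution.of_indecomposable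
    (H : ∀ M : GLattice.{v, w} G, IsIndecomposable M → HasPermutationResolution M)
    (M : GLattice.{v, w} G) : HasPermutationResolution M := by
  induction hn : Module.finrank ℤ M using Nat.strong_induction_on generalizing M with
  | _ n ih =>
    by_cases h0 : Subsingleton M
    · exact .of_subsingleton h0
    rw [not_subsingleton_iff_nontrivial] at h0
    by_cases hM : IsIndecomposable M
    · exact H M hM
    simp only [IsIndecomposable, h0, true_and, not_forall, not_or] at hM
    obtain ⟨A, B, hAB, hA, hB⟩ := hM
    let A' : GLattice.{v, w} G := { carrier := A.toSubmodule, ρ := A.toRepresentation }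
    let B' : GLattice.{v, w} G := { carrier := B.toSubmodule, ρ := B.toRepresentation }
    have hsum : Module.finrank ℤ A' + Module.finrank ℤ B' = n := by
      rw [← hn, ← (Submodule.prodEquivOfIsCompl _ _ hAB).finrank_eq, Module.finrank_prod]
    have hpos : ∀ S : Submodule ℤ M, S ≠ ⊥ → 0 < Module.finrank ℤ S := fun S hS => by
      have := Submodule.nontrivial_iff_ne_bot.2 hS
      exact Module.finrank_pos
    have hA1 : 0 < Module.finrank ℤ A' := hpos _ hA
    have hB1 : 0 < Module.finrank ℤ B' := hpos _ hB
    refine ((ih _ (by omega) A' rfl).directSum (ih _ (by omega) B' rfl)).of_isoLattice ?_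
    refine isoLattice_symm (isoLattice_of_linearEquiv (M := DihedralTori.directSum A' B')
      (Submodule.prodEquivOfIsCompl _ _ hAB) fun g x => ?_)
    rw [Submodule.coe_prodEquivOfIsCompl', Submodule.coe_prodEquivOfIsCompl', map_add]
    rfl

end Resolution

section Dihedral

variable {p : ℕ} [hpp : Fact p.Prime]

lemma KernelExtension.hasPermutationResolution {A Y C Q : GLattice.{0, 0} (DihedralGroup p)}
    (E : KernelExtension A.ρ Y.ρ C.ρ) (hC : IsPermutation C) (hQ : IsPermutation Q)
    (hY : IsPermutation (directSum Y Q)) : HasPermutationResolution A :=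
  .of_extension hC hQ hY E.f E.g E.map_f E.map_g E.injective E.surjective
    (fun a => (E.exact _).2 ⟨a, rfl⟩) fun x => (E.exact x).1

/-- The sequence `0 → ℤ_- → ℤ[H] → ℤ → 0`. -/
lemma hasPermutationResolution_latticeZMinus : HasPermutationResolution (latticeZMinus p) := by
  let e := (equivSwap p).toLinearEquiv
  let f : latticeZMinus p →ₗ[ℤ] latticeZH p :=
    e.symm.toLinearMap ∘ₗ LinearMap.prod (LinearMap.id (R := ℤ) (M := ℤ)) (-LinearMap.id)
  let c : latticeZMinus p → ℤ := fun n => n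
  have hef : ∀ n, e (f n) = (c n, -c n) := fun n => e.apply_symm_apply _
  refine .of_exact (isPermutation_latticeZ p) (isPermutation_latticeZH p) f (sumZH p) (fun s n => ?_)
    sumZH_rho ?_ sumZH_surjective (fun n => ?_) fun x hx => ?_
  · apply e.injective
    rw [hef]
    refine Eq.trans ?_ (Equiv.apply_rho _ (equivSwap p) s (f n)).symm
    change _ = (latticeSwap p).ρ s (e (f n))
    rw [hef]
    rcases s with i | i
    · exact Prod.ext (one_mul (c n)) (congrArg (fun m : ℤ => -m) (one_mul (c n)))
    · refine Prod.ext ?_ ?_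
      · exact neg_one_mul (c n)
      · exact (congrArg (fun m : ℤ => -m) (neg_one_mul (c n))).trans (neg_neg _)
  · intro m n h
    have h1 := congrArg e h
    rw [hef, hef] at h1
    exact congrArg (fun z : ℤ × ℤ => z.1) h1
  · exact (congrArg (fun z : ℤ × ℤ => z.1 + z.2) (hef n)).trans (add_neg_cancel (c n))
  · rw [sumZH_apply] at hx
    exact ⟨(e x).1, e.injective ((hef _).trans (Prod.ext rfl (neg_eq_of_add_eq_zero_right hx)))⟩

/-- The sequence `0 → X → ℤ[G] → V → 0`, where `X` is induced from the sign character of the subgroup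
generated by `τ` and `V` is induced from the trivial one. -/
lemma hasPermutationResolution_latticeX : HasPermutationResolution (latticeX p) := by
  let f : latticeX p →ₗ[ℤ] latticeG p :=
    { toFun := fun x s => DihedralGroup.casesOn (motive := fun _ => ℤ) s (fun i => x i) fun i => -x (-i)
      map_add' := fun x y => funext fun s => by
        rcases s with i | i
        · rfl
        · exact neg_add _ _
      map_smul' := fun n x => funext fun s => by
        rcases s with i | i
        · rfl
        · exact (mul_neg _ _).symm }
  let g : latticeG p →ₗ[ℤ] latticeV p :=
    LinearMap.funLeft ℤ ℤ DihedralGroup.r + LinearMap.funLeft ℤ ℤ fun i => DihedralGroup.sr (-i)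
  have hg : ∀ (F : latticeG p) i, g F i = F (.r i) + F (.sr (-i)) := fun _ _ => rfl
  refine .of_exact (isPermutation_latticeV p) (isPermutation_latticeG p) f g (fun s x => ?_)
    (fun s x => ?_) ?_ (fun y => ?_) (fun x => ?_) fun F hF => ?_
  · funext y
    rw [latticeG_rho]
    rcases s with a | a <;> rcases y with j | j
    · change 1 * x (j - a) = x (-a + j)
      rw [one_mul]; congr 1; ring
    · change -(1 * x (-j - a)) = -x (-(j - -a))
      rw [one_mul]; congr 2; ring
    · change (-1) * x (-(j + a)) = -x (-(a + j))
      rw [neg_one_mul, add_comm]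
    · change -((-1) * x (-(-j + a))) = x (j - a)
      rw [neg_one_mul, neg_neg]; congr 1; ring
  · funext i
    rw [hg, latticeVertex_rho, MonoidHom.one_apply, one_mul, hg, latticeG_rho, latticeG_rho]
    rcases s with a | a
    · change x (.r (-a + i)) + x (.sr (-i - -a)) = x (.r (i - a)) + x (.sr (-(i - a)))
      congr 3 <;> ring
    · change x (.sr (a + i)) + x (.r (-i - a)) = x (.r (-(i + a))) + x (.sr (-(-(i + a))))
      rw [add_comm]
      congr 3 <;> ring
  · intro x y h
    funext i
    exact congrFun h (.r i)
  · refine ⟨fun s => DihedralGroup.casesOn (motive := fun _ => ℤ) s (fun i => y i) fun _ => 0, ?_⟩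
    funext i
    exact add_zero _
  · funext i
    refine (congrArg (fun n : ℤ => x i + n) (congrArg (fun j => -x j) (neg_neg i))).trans ?_
    exact add_neg_cancel (x i)
  · refine ⟨fun i => F (.r i), funext fun s => ?_⟩
    rcases s with i | i
    · rfl
    · have h1 := congrFun hF (-i)
      rw [hg, neg_neg] at h1
      exact neg_eq_of_add_eq_zero_right h1

/-- The lattices `R` and `P` are resolved by `R → Y₀ → ℤ[H]` and `P → V → ℤ`, where
`Y₀` is stably permutation. -/
theorem hasPermutationResolution (hp : p ≠ 2) (h : hPlus p = 1)
    (M : GLattice.{0, u} (DihedralGroup p)) : HasPermutationResolution M := by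
  refine .of_indecomposable (fun M hM => ?_) M
  obtain ⟨EV, hEV⟩ := exists_extensionV hp h
  obtain ⟨EX, -⟩ := exists_extensionX hp h
  obtain ⟨i, hi⟩ := exists_isoLattice hp (areNonsplitExtensions hp h EV EX) h M hM
  have hV := isPermutation_latticeV p
  have hY₀ := (isPermutation_latticeY₀ hp EV EX h hEV).of_isoLattice (isoLattice_directSum_comm _ _)
  refine HasPermutationResolution.of_isoLattice ?_ hi
  fin_cases i
  · exact (isPermutation_latticeZ p).hasPermutationResolution
  · exact hasPermutationResolution_latticeZMinus
  · exact (isPermutation_latticeZH p).hasPermutationResolution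
  · exact (EX.pullback (diffZH p) diffZH_rho sig_latticeZH).hasPermutationResolution
      (isPermutation_latticeZH p) hV hY₀
  · exact EV.hasPermutationResolution (isPermutation_latticeZ p) hV (hV.directSum hV)
  · exact hV.hasPermutationResolution
  · exact hasPermutationResolution_latticeX
  · exact .of_directSum hV hY₀
  · exact .of_directSum (isPermutation_latticeZ p) (isPermutation_latticeY₁ hp EV hEV)
  · exact (isPermutation_latticeG p).hasPermutationResolution

end Dihedral

/-! ### Invariants of rational function fields under semilinear actions -/

section NoName

/-- Over a field, `n` generators of a polynomial ring in `n` variables are algebraically independent. -/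
lemma algebraicIndependent_of_adjoin_eq {ι F E : Type*} [Finite ι] [Field F] [Field E] [Algebra F E]
    {y z : ι → E} (hy : AlgebraicIndependent F y)
    (h : Algebra.adjoin F (Set.range z) = Algebra.adjoin F (Set.range y)) :
    AlgebraicIndependent F z := by
  let S := Algebra.adjoin F (Set.range z)
  have hyS : ∀ i, y i ∈ S := fun i => by
    change _ ∈ Algebra.adjoin F (Set.range z)
    rw [h]; exact Algebra.subset_adjoin ⟨i, rfl⟩
  let y' : ι → S := fun i => ⟨y i, hyS i⟩
  let z' : ι → S := fun i => ⟨z i, Algebra.subset_adjoin ⟨i, rfl⟩⟩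
  have hy' : AlgebraicIndependent F y' := AlgebraicIndependent.of_comp S.val hy
  have hz' : Algebra.adjoin F (Set.range z') = ⊤ := by
    rw [← Algebra.adjoin_adjoin_coe_preimage (s := Set.range z)]
    congr 1
    ext x
    exact ⟨fun ⟨i, h⟩ => ⟨i, congrArg Subtype.val h⟩, fun ⟨i, h⟩ => ⟨i, Subtype.ext h⟩⟩
  have : Algebra.IsAlgebraic (Algebra.adjoin F (Set.range z')) S := by
    refine ⟨fun x => isAlgebraic_algebraMap (⟨x, ?_⟩ : Algebra.adjoin F (Set.range z'))⟩
    rw [hz']; trivial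
  have h1 := Algebra.IsAlgebraic.isTranscendenceBasis_of_lift_le_trdeg_of_finite F z' hy'.lift_cardinalMk_le_trdeg
  exact h1.1.map' (f := S.val) Subtype.val_injective

lemma restrictScalars_adjoin_le {k Ω : Type*} [Field k] [Field Ω] [Algebra k Ω]
    {F E : IntermediateField k Ω} (h : F ≤ E) {S : Set Ω} (hS : S ⊆ E) :
    (IntermediateField.adjoin F S).restrictScalars k ≤ E := by
  have h1 : IntermediateField.adjoin F S ≤ IntermediateField.extendScalars h :=
    IntermediateField.adjoin_le_iff.2 hS
  exact fun x hx => h1 hx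

variable {k Ω G : Type*} [Field k] [Field Ω] [Algebra k Ω] [Group G] (φ : G →* Gal(Ω/k))

/-- The subfield of invariant elements of an intermediate field. -/
def invariants (L : IntermediateField k Ω) : IntermediateField k Ω :=
  L ⊓ IntermediateField.fixedField φ.range

variable {φ}

lemma mem_invariants {L : IntermediateField k Ω} {x : Ω} :
    x ∈ invariants φ L ↔ x ∈ L ∧ ∀ g, φ g x = x := by
  rw [invariants, IntermediateField.mem_inf, IntermediateField.mem_fixedField_iff]
  simp

variable (φ) in
/-- The sum over the group. -/
def groupTrace [Fintype G] (x : Ω) : Ω := ∑ g, φ g x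

variable [Fintype G] {L : IntermediateField k Ω}

lemma groupTrace_fixed (x : Ω) (g : G) : φ g (groupTrace φ x) = groupTrace φ x := by
  rw [groupTrace, map_sum]
  refine (Finset.sum_congr rfl fun t _ => ?_).trans (Equiv.sum_comp (Equiv.mulLeft g) fun t => φ t x)
  rw [Equiv.coe_mulLeft, map_mul]; rfl

lemma groupTrace_add (x y : Ω) : groupTrace φ (x + y) = groupTrace φ x + groupTrace φ y := by
  simp only [groupTrace, map_add, Finset.sum_add_distrib]

lemma groupTrace_mul {y : Ω} (hy : ∀ g, φ g y = y) (x : Ω) :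
    groupTrace φ (x * y) = groupTrace φ x * y := by
  simp only [groupTrace, map_mul, hy, Finset.sum_mul]

variable (hL : ∀ g, ∀ x ∈ L, φ g x ∈ L)

include hL

lemma groupTrace_mem {x : Ω} (hx : x ∈ L) : groupTrace φ x ∈ invariants φ L :=
  mem_invariants.2 ⟨sum_mem fun g _ => hL g x hx, groupTrace_fixed x⟩

variable (hf : ∀ g, (∀ x ∈ L, φ g x = x) → g = 1)

include hf

omit hL in
/-- Dedekind's independence of characters. -/
lemma eq_zero_of_sum_characters {a : G → Ω} (h : ∀ c ∈ L, ∑ g, a g * φ g c = 0) (g : G) : a g = 0 := by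
  let χ : G → (L →* Ω) := fun g => ((φ g : Ω →ₐ[k] Ω) : Ω →* Ω).comp (L.val : L →* Ω)
  have hχ : ∀ g (c : L), χ g c = φ g c := fun _ _ => rfl
  have hinj : Function.Injective χ := fun g g' h => by
    rw [← inv_mul_eq_one]
    refine hf _ fun x hx => ?_
    have h1 : φ g x = φ g' x := DFunLike.congr_fun h (⟨x, hx⟩ : L)
    rw [map_mul, AlgEquiv.mul_apply, ← h1, ← AlgEquiv.mul_apply, ← map_mul, inv_mul_cancel, map_one]
    rfl
  have h1 := (linearIndependent_monoidHom L Ω).comp χ hinj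
  rw [Fintype.linearIndependent_iff] at h1
  refine h1 a (funext fun c => ?_) g
  rw [Finset.sum_apply]
  exact h c c.2

lemma exists_groupTrace_eq_one : ∃ c ∈ L, groupTrace φ c = 1 := by
  have h1 : ∃ c ∈ L, groupTrace φ c ≠ 0 := by
    by_contra! h
    refine one_ne_zero (α := Ω) (eq_zero_of_sum_characters hf (a := fun _ => 1) (fun c hc => ?_) 1)
    simp only [one_mul]
    exact h c hc
  obtain ⟨c, hc, h⟩ := h1
  have h2 := mem_invariants.1 (groupTrace_mem hL hc)
  refine ⟨c * (groupTrace φ c)⁻¹, mul_mem hc (inv_mem h2.1), ?_⟩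
  rw [groupTrace_mul (fun g => by rw [map_inv₀, h2.2]), mul_inv_cancel₀ h]

/-- A vector space with a semilinear action is spanned by invariant vectors. -/
lemma mem_span_fixed {W : Submodule L Ω} (hW : ∀ g, ∀ w ∈ W, φ g w ∈ W) {w : Ω} (hw : w ∈ W) :
    w ∈ Submodule.span L {x | x ∈ W ∧ ∀ g, φ g x = x} := by
  by_contra h
  -- a functional that vanishes on the invariant vectors vanishes on all `∑ g(c) g(w)` with `c ∈ L`, and
  -- hence at `w` by the independence of the automorphisms of `L`
  obtain ⟨f, hfw, hf0⟩ := Submodule.exists_le_ker_of_notMem h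
  have h1 : ∀ c ∈ L, ∑ g, ((f (φ g w) : L) : Ω) * φ g c = 0 := by
    intro c hc
    have h2 : groupTrace φ (c * w) ∈ Submodule.span L {x | x ∈ W ∧ ∀ g, φ g x = x} :=
      Submodule.subset_span ⟨sum_mem fun g _ => hW g _ (W.smul_mem (⟨c, hc⟩ : L) hw), groupTrace_fixed _⟩
    have h3 : f (groupTrace φ (c * w)) = 0 := hf0 h2
    have h4 : groupTrace φ (c * w) = ∑ g, (⟨φ g c, hL g c hc⟩ : L) • φ g w := by
      refine Finset.sum_congr rfl fun g _ => ?_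
      rw [map_mul]; rfl
    rw [h4, map_sum] at h3
    have h5 := congrArg (fun x : L => (x : Ω)) h3
    simp only [map_smul, AddSubmonoidClass.coe_finsetSum, smul_eq_mul, MulMemClass.coe_mul,
      ZeroMemClass.coe_zero] at h5
    rw [← h5]
    exact Finset.sum_congr rfl fun g _ => mul_comm _ _
  have h2 := eq_zero_of_sum_characters hf h1 1
  rw [map_one] at h2
  exact hfw (Subtype.ext h2)

variable {ι : Type*} [Finite ι] {y : ι → Ω}

/-- The span of the variables has a basis of invariant vectors. -/
lemma exists_fixed_generators (hy : AlgebraicIndependent L y)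
    (hspan : ∀ g i, φ g (y i) ∈ Submodule.span L (Set.range y)) :
    ∃ z : ι → Ω, (∀ g i, φ g (z i) = z i) ∧ Algebra.adjoin L (Set.range z) = Algebra.adjoin L (Set.range y) := by
  let W := Submodule.span L (Set.range y)
  have hW : ∀ g, ∀ w ∈ W, φ g w ∈ W := by
    intro g w hw
    induction hw using Submodule.span_induction with
    | mem x hx => obtain ⟨i, rfl⟩ := hx; exact hspan g i
    | zero => rw [map_zero]; exact zero_mem _
    | add x y _ _ hx hy => rw [map_add]; exact add_mem hx hy
    | smul a x _ hx =>
      change φ g ((a : Ω) * x) ∈ W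
      rw [map_mul]
      exact W.smul_mem (⟨φ g a, hL g a a.2⟩ : L) hx
  obtain ⟨b, hb, hspan', hli⟩ := exists_linearIndependent L {x | x ∈ W ∧ ∀ g, φ g x = x}
  have hbW : Submodule.span L b = W := by
    rw [hspan']
    exact le_antisymm (Submodule.span_le.2 fun x hx => hx.1) fun w hw => mem_span_fixed hL hf hW hw
  let B₁ : Module.Basis ι L W := Module.Basis.span hy.linearIndependent
  let B₂ : Module.Basis b L (Submodule.span L (Set.range ((↑) : b → Ω))) := Module.Basis.span hli
  rw [Subtype.range_coe, hbW] at B₂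
  let e := B₁.indexEquiv B₂
  have hr : Set.range (fun i => (e i : Ω)) = b := by
    ext x
    constructor
    · rintro ⟨i, rfl⟩; exact (e i).2
    · intro hx; exact ⟨e.symm ⟨x, hx⟩, by simp⟩
  refine ⟨fun i => e i, fun g i => (hb (e i).2).2 g, ?_⟩
  rw [hr, ← Algebra.adjoin_span, hbW]
  exact Algebra.adjoin_span L

omit hL hf in
/-- An invariant fraction of elements of a stable subring is a fraction of invariant elements. -/
lemma exists_fixed_div {S : Subring Ω} (hS : ∀ g, ∀ x ∈ S, φ g x ∈ S) {a b : Ω} (ha : a ∈ S) (hb : b ∈ S)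
    (h : ∀ g, φ g (a / b) = a / b) :
    ∃ a' ∈ S, ∃ b' ∈ S, (∀ g, φ g a' = a') ∧ (∀ g, φ g b' = b') ∧ a / b = a' / b' := by
  classical
  by_cases hb0 : b = 0
  · exact ⟨0, zero_mem _, 1, one_mem _, fun _ => map_zero _, fun _ => map_one _, by simp [hb0]⟩
  -- the denominator is replaced by its norm
  let d := ∏ g, φ g b
  have hd0 : d ≠ 0 := Finset.prod_ne_zero_iff.2 fun g _ => (map_ne_zero (φ g)).2 hb0
  have hdg : ∀ g, φ g d = d := fun g => by
    rw [map_prod]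
    refine (Finset.prod_congr rfl fun t _ => ?_).trans
      (Equiv.prod_comp (Equiv.mulLeft g) fun t => φ t b)
    rw [Equiv.coe_mulLeft, map_mul]; rfl
  have hxd : a / b * d = a * ∏ g ∈ Finset.univ.erase 1, φ g b := by
    change a / b * ∏ g, _ = _
    rw [← Finset.mul_prod_erase _ _ (Finset.mem_univ 1), map_one, AlgEquiv.one_apply, ← mul_assoc,
      div_mul_cancel₀ _ hb0]
  refine ⟨a / b * d, ?_, d, prod_mem fun g _ => hS g _ hb, fun g => by rw [map_mul, h, hdg], hdg, ?_⟩
  · rw [hxd]; exact mul_mem ha (prod_mem fun g _ => hS g _ hb)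
  · rw [mul_div_cancel_right₀ _ hd0]

omit [Finite ι] in
/-- An invariant polynomial in invariant elements with coefficients in `L` is a polynomial with
coefficients in the invariants of `L`. -/
lemma mem_adjoin_invariants {z : ι → Ω} (hz : ∀ g i, φ g (z i) = z i) {x : Ω}
    (hx : x ∈ Algebra.adjoin L (Set.range z)) (hxg : ∀ g, φ g x = x) :
    x ∈ Algebra.adjoin (invariants φ L) (Set.range z) := by
  rw [Algebra.adjoin_range_eq_range_aeval] at hx
  obtain ⟨q, rfl⟩ := hx
  have h : ∀ c ∈ L, groupTrace φ (c * MvPolynomial.aeval z q) ∈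
      Algebra.adjoin (invariants φ L) (Set.range z) := by
    clear hxg
    induction q using MvPolynomial.induction_on with
    | C a =>
      intro c hc
      rw [MvPolynomial.aeval_C]
      exact Subalgebra.algebraMap_mem _ (⟨_, groupTrace_mem hL (mul_mem hc a.2)⟩ : invariants φ L)
    | add p q hp hq =>
      intro c hc
      rw [map_add, mul_add, groupTrace_add]
      exact add_mem (hp c hc) (hq c hc)
    | mul_X p i hp =>
      intro c hc
      rw [map_mul, MvPolynomial.aeval_X, ← mul_assoc, groupTrace_mul fun g => hz g i]
      exact mul_mem (hp c hc) (Algebra.subset_adjoin ⟨i, rfl⟩)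
  obtain ⟨c, hc, hc1⟩ := exists_groupTrace_eq_one hL hf
  have h1 := h c hc
  have h2 := groupTrace_mul hxg c
  rw [hc1, one_mul] at h2
  exact h2 ▸ h1

omit [Finite ι] in
/-- The invariants of `L(z)` for invariant elements `z` are the rational functions of `z` with
invariant coefficients. -/
lemma invariants_adjoin {z : ι → Ω} (hz : ∀ g i, φ g (z i) = z i) :
    invariants φ ((IntermediateField.adjoin L (Set.range z)).restrictScalars k) =
      (IntermediateField.adjoin (invariants φ L) (Set.range z)).restrictScalars k := by
  have hstab : ∀ g, ∀ x ∈ Algebra.adjoin L (Set.range z), φ g x ∈ Algebra.adjoin L (Set.range z) := by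
    intro g x hx
    induction hx using Algebra.adjoin_induction with
    | mem x hx => obtain ⟨i, rfl⟩ := hx; rw [hz]; exact Algebra.subset_adjoin ⟨i, rfl⟩
    | algebraMap a => exact Subalgebra.algebraMap_mem _ (⟨φ g a, hL g a a.2⟩ : L)
    | add x y _ _ hx hy => rw [map_add]; exact add_mem hx hy
    | mul x y _ _ hx hy => rw [map_mul]; exact mul_mem hx hy
  apply le_antisymm
  · intro x hx
    rw [mem_invariants, IntermediateField.mem_restrictScalars, IntermediateField.mem_adjoin_range_iff] at hx
    obtain ⟨⟨r, s, hrs⟩, hx⟩ := hx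
    rw [IntermediateField.mem_restrictScalars]
    have hmem : ∀ q : MvPolynomial ι L, MvPolynomial.aeval z q ∈ Algebra.adjoin L (Set.range z) := fun q => by
      rw [Algebra.adjoin_range_eq_range_aeval]; exact ⟨q, rfl⟩
    have hle := IntermediateField.algebra_adjoin_le_adjoin (invariants φ L) (Set.range z)
    rw [hrs] at hx
    obtain ⟨a, ha, b, hb, hag, hbg, hab⟩ := exists_fixed_div
      (S := (Algebra.adjoin L (Set.range z)).toSubring) hstab (hmem r) (hmem s) hx
    rw [hrs, hab]
    exact div_mem (hle (mem_adjoin_invariants hL hf hz ha hag)) (hle (mem_adjoin_invariants hL hf hz hb hbg))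
  · refine restrictScalars_adjoin_le (fun x hx => ?_) ?_
    · have ha := mem_invariants.1 hx
      have h1 : x ∈ IntermediateField.adjoin L (Set.range z) :=
        IntermediateField.algebraMap_mem _ (⟨x, ha.1⟩ : L)
      exact mem_invariants.2 ⟨h1, ha.2⟩
    · rintro _ ⟨i, rfl⟩
      have h1 : z i ∈ IntermediateField.adjoin L (Set.range z) :=
        IntermediateField.subset_adjoin L _ (Set.mem_range_self i)
      exact mem_invariants.2 ⟨h1, fun g => hz g i⟩

omit hL hf in
variable (k) in
/-- `E` is obtained from `F` by adjoining finitely many algebraically independent elements. -/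
def IsPurelyTranscendental (F E : IntermediateField k Ω) : Prop :=
  ∃ (n : ℕ) (x : Fin n → Ω), AlgebraicIndependent F x ∧
    E = (IntermediateField.adjoin F (Set.range x)).restrictScalars k

/-- The no-name lemma: the invariants of a purely transcendental extension `L(y)` with a faithful action
on `L` and a semilinear action on the span of `y` are purely transcendental over the invariants of
`L`. -/
theorem isPurelyTranscendental_invariants (hy : AlgebraicIndependent L y)
    (hspan : ∀ g i, φ g (y i) ∈ Submodule.span L (Set.range y)) :
    IsPurelyTranscendental k (invariants φ L)
      (invariants φ ((IntermediateField.adjoin L (Set.range y)).restrictScalars k)) := by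
  obtain ⟨z, hz, hzy⟩ := exists_fixed_generators hL hf hy hspan
  have := Fintype.ofFinite ι
  let e := (Fintype.equivFin ι).symm
  have hzi := algebraicIndependent_of_adjoin_eq hy hzy
  have hr : Set.range (z ∘ e) = Set.range z := e.surjective.range_comp z
  refine ⟨Fintype.card ι, z ∘ e, ?_, ?_⟩
  · have hle : invariants φ L ≤ L := inf_le_left
    let _ : Algebra (invariants φ L) L := (IntermediateField.inclusion hle).toAlgebra
    have : IsScalarTower (invariants φ L) L Ω := .of_algebraMap_eq fun _ => rfl
    exact (hzi.restrictScalars (RingHom.injective _)).comp e e.injective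
  · have h1 : IntermediateField.adjoin L (Set.range y) = IntermediateField.adjoin L (Set.range z) := by
      apply le_antisymm <;> rw [IntermediateField.adjoin_le_iff]
      · refine fun x hx => IntermediateField.algebra_adjoin_le_adjoin _ _ ?_
        rw [hzy]; exact Algebra.subset_adjoin hx
      · refine fun x hx => IntermediateField.algebra_adjoin_le_adjoin _ _ ?_
        rw [← hzy]; exact Algebra.subset_adjoin hx
    rw [hr, h1, invariants_adjoin hL hf hz]

end NoName

/-! ### Purely transcendental extensions and stable rationality -/

section StablyRational

variable {k : Type u} {Ω : Type v} [Field k] [Field Ω] [Algebra k Ω] {F E H : IntermediateField k Ω}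

lemma le_restrictScalars_adjoin (F : IntermediateField k Ω) (S : Set Ω) :
    F ≤ (IntermediateField.adjoin F S).restrictScalars k := fun x hx =>
  IntermediateField.algebraMap_mem (IntermediateField.adjoin F S) (⟨x, hx⟩ : F)

lemma IsPurelyTranscendental.trans (h : IsPurelyTranscendental k F E)
    (h' : IsPurelyTranscendental k E H) : IsPurelyTranscendental k F H := by
  obtain ⟨m, x, hx, hE⟩ := h
  obtain ⟨n, y, hy, hH⟩ := h'
  have hFE : F ≤ E := hE ▸ le_restrictScalars_adjoin F _
  have hxE : Set.range x ⊆ E := by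
    rw [hE]; exact IntermediateField.subset_adjoin F _
  let _ : Algebra F E := (IntermediateField.inclusion hFE).toAlgebra
  have : IsScalarTower F E Ω := .of_algebraMap_eq fun _ => rfl
  have hxy : AlgebraicIndependent F (Sum.elim y x) := hx.sumElim_of_tower (S := E)
    (by rintro _ ⟨i, rfl⟩; exact ⟨⟨x i, hxE ⟨i, rfl⟩⟩, rfl⟩) hy
  refine ⟨n + m, Sum.elim y x ∘ finSumFinEquiv.symm, hxy.comp _ finSumFinEquiv.symm.injective, ?_⟩
  rw [finSumFinEquiv.symm.surjective.range_comp, Set.Sum.elim_range]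
  have hsub := IntermediateField.subset_adjoin F (Set.range y ∪ Set.range x)
  apply le_antisymm
  · rw [hH]
    refine restrictScalars_adjoin_le ?_ fun z hz => hsub (Or.inl hz)
    rw [hE]
    exact restrictScalars_adjoin_le (le_restrictScalars_adjoin F _) fun z hz => hsub (Or.inr hz)
  · have hEH : E ≤ H := hH ▸ le_restrictScalars_adjoin E _
    refine restrictScalars_adjoin_le (hFE.trans hEH) (Set.union_subset ?_ (hxE.trans hEH))
    rw [hH]; exact IntermediateField.subset_adjoin E _

lemma IsPurelyTranscendental.exists_algEquiv (h : IsPurelyTranscendental k F E) :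
    ∃ n : ℕ, Nonempty (FractionRing (MvPolynomial (Fin n) F) ≃ₐ[k] E) := by
  obtain ⟨n, x, hx, rfl⟩ := h
  exact ⟨n, ⟨hx.aevalEquivField.restrictScalars k⟩⟩

/-- An isomorphism of algebras extends to the fields of rational functions. -/
def fractionRingCongr {L : Type v} {L' : Type w} [CommRing L] [CommRing L'] [Algebra k L] [Algebra k L']
    (e : L ≃ₐ[k] L') (n : ℕ) :
    FractionRing (MvPolynomial (Fin n) L) ≃ₐ[k] FractionRing (MvPolynomial (Fin n) L') :=
  IsFractionRing.algEquivOfAlgEquiv (MvPolynomial.mapAlgEquiv (Fin n) e)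

lemma IsStablyRational.of_algEquiv {L : Type v} {L' : Type w} [CommRing L] [CommRing L'] [Algebra k L]
    [Algebra k L'] (h : IsStablyRational k L) (e : L ≃ₐ[k] L') : IsStablyRational k L' := by
  obtain ⟨m, n, ⟨f⟩⟩ := h
  exact ⟨m, n, ⟨(fractionRingCongr e m).symm.trans f⟩⟩

/-- A field is stably rational if some rational function field over it is rational. -/
lemma IsPurelyTranscendental.isStablyRational (h : IsPurelyTranscendental k F E)
    (h' : IsPurelyTranscendental k ⊥ E) : IsStablyRational k F := by
  obtain ⟨m, ⟨f⟩⟩ := h.exists_algEquiv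
  obtain ⟨n, ⟨f'⟩⟩ := h'.exists_algEquiv
  exact ⟨m, n, ⟨f.trans (f'.symm.trans (fractionRingCongr (IntermediateField.botEquiv k Ω) n))⟩⟩

end StablyRational

/-! ### The fields `K(M)` -/

section LatticeField

variable {G : Type v} [Group G] {k : Type t} [Field k] {K : Type u} [Field K] [Algebra k K]
  (e : G ≃* Gal(K/k)) (M : GLattice.{v, w} G)

instance : TwoUniqueSums M := by
  let b := Module.Free.chooseBasis ℤ M
  exact TwoUniqueSums.of_injective_addHom b.equivFun.toLinearMap.toAddHom b.equivFun.injective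
    inferInstance

instance : IsDomain (AddMonoidAlgebra K M) := NoZeroDivisors.to_isDomain _

variable (K) {M} in
/-- The monomial `x^m`, as an element of `K(M)`. -/
def mon (m : M) : LatticeField K M := algebraMap (AddMonoidAlgebra K M) _ (AddMonoidAlgebra.single m 1)

variable {M}

lemma mon_zero : mon K (0 : M) = 1 := map_one _

lemma mon_add (m n : M) : mon K (m + n) = mon K m * mon K n := by
  rw [mon, mon, mon, ← map_mul, AddMonoidAlgebra.single_mul_single, mul_one]

lemma mon_neg (m : M) : mon K (-m) = (mon K m)⁻¹ := by
  refine eq_inv_of_mul_eq_one_left ?_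
  rw [← mon_add, neg_add_cancel, mon_zero]

lemma algebraMap_latticeField (a : K) : algebraMap K (LatticeField K M) a =
    algebraMap (AddMonoidAlgebra K M) _ (AddMonoidAlgebra.single 0 a) := by
  rw [IsScalarTower.algebraMap_apply K (AddMonoidAlgebra K M) (LatticeField K M),
    AddMonoidAlgebra.coe_algebraMap]
  rfl

lemma algebraMap_single (m : M) (a : K) :
    algebraMap (AddMonoidAlgebra K M) (LatticeField K M) (AddMonoidAlgebra.single m a) =
      algebraMap K _ a * mon K m := by
  rw [algebraMap_latticeField, mon, ← map_mul, AddMonoidAlgebra.single_mul_single, zero_add, mul_one]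

lemma latticeField_ringHom_ext {L : Type*} [Field L] {f g : LatticeField K M →+* L}
    (h1 : ∀ a : K, f (algebraMap K _ a) = g (algebraMap K _ a)) (h2 : ∀ m : M, f (mon K m) = g (mon K m)) :
    f = g := by
  refine IsLocalization.ringHom_ext (nonZeroDivisors (AddMonoidAlgebra K M))
    (AddMonoidAlgebra.ringHom_ext (fun a => ?_) h2)
  change f (algebraMap _ _ _) = g (algebraMap _ _ _)
  rw [← algebraMap_latticeField]; exact h1 a

lemma latticeFieldAut_algebraMap_single (s : Gal(K/k)) (g : G) (m : M) (a : K) :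
    latticeFieldAut M s g (algebraMap (AddMonoidAlgebra K M) _ (AddMonoidAlgebra.single m a)) =
      algebraMap (AddMonoidAlgebra K M) _ (AddMonoidAlgebra.single (M.ρ g m) (s a)) := by
  rw [latticeFieldAut, IsFractionRing.ringEquivOfRingEquiv_algebraMap]
  congr 1
  rw [RingEquiv.trans_apply, AddMonoidAlgebra.mapRingEquiv_single,
    AddMonoidAlgebra.mapDomainRingEquiv_single]
  rfl

lemma latticeFieldAut_mon (s : Gal(K/k)) (g : G) (m : M) :
    latticeFieldAut M s g (mon K m) = mon K (M.ρ g m) := by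
  rw [mon, latticeFieldAut_algebraMap_single, map_one, mon]

lemma latticeFieldAut_algebraMap (s : Gal(K/k)) (g : G) (a : K) :
    latticeFieldAut M s g (algebraMap K (LatticeField K M) a) = algebraMap K _ (s a) := by
  rw [algebraMap_latticeField, latticeFieldAut_algebraMap_single, map_zero, ← algebraMap_latticeField]

variable (M) in
/-- The action of `G` on `K(M)`. -/
def latticeFieldAction : G →* Gal(LatticeField K M/k) where
  toFun g := AlgEquiv.ofRingEquiv (f := latticeFieldAut M (e g) g) fun a => by
    rw [IsScalarTower.algebraMap_apply k K (LatticeField K M), latticeFieldAut_algebraMap,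
      AlgEquiv.commutes]
  map_one' := by
    refine AlgEquiv.ext fun x => ?_
    refine DFunLike.congr_fun (latticeField_ringHom_ext (f := (latticeFieldAut M (e 1) 1).toRingHom)
      (g := RingHom.id _) (fun a => ?_) fun m => ?_) x
    · refine (latticeFieldAut_algebraMap _ _ _).trans ?_
      rw [map_one]; rfl
    · refine (latticeFieldAut_mon _ _ _).trans ?_
      rw [map_one]; rfl
  map_mul' g h := by
    refine AlgEquiv.ext fun x => ?_
    refine DFunLike.congr_fun (latticeField_ringHom_ext
      (f := (latticeFieldAut M (e (g * h)) (g * h)).toRingHom)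
      (g := (latticeFieldAut M (e g) g).toRingHom.comp (latticeFieldAut M (e h) h).toRingHom)
      (fun a => ?_) fun m => ?_) x
    · change latticeFieldAut M (e (g * h)) (g * h) _ = latticeFieldAut M (e g) g (latticeFieldAut M (e h) h _)
      rw [latticeFieldAut_algebraMap, latticeFieldAut_algebraMap, latticeFieldAut_algebraMap, map_mul]
      rfl
    · change latticeFieldAut M (e (g * h)) (g * h) _ = latticeFieldAut M (e g) g (latticeFieldAut M (e h) h _)
      rw [latticeFieldAut_mon, latticeFieldAut_mon, latticeFieldAut_mon, map_mul]
      rfl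

lemma latticeFieldAction_mon (g : G) (m : M) :
    latticeFieldAction e M g (mon K m) = mon K (M.ρ g m) := latticeFieldAut_mon _ _ _

lemma latticeFieldAction_algebraMap (g : G) (a : K) :
    latticeFieldAction e M g (algebraMap K _ a) = algebraMap K _ (e g a) :=
  latticeFieldAut_algebraMap _ _ _

lemma mem_fixedField_iff {x : LatticeField K M} :
    x ∈ fixedField e M ↔ ∀ g, latticeFieldAction e M g x = x := Iff.rfl

variable (K) in
/-- The subfield of `K(M)` generated over `K` by the monomials with exponents in `N`. -/
def monField (N : Submodule ℤ M) : IntermediateField K (LatticeField K M) :=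
  IntermediateField.adjoin K (mon K '' N)

lemma mon_mem_monField {N : Submodule ℤ M} {m : M} (hm : m ∈ N) : mon K m ∈ monField K N :=
  IntermediateField.subset_adjoin _ _ ⟨m, hm, rfl⟩

lemma monField_le {N : Submodule ℤ M} {E : IntermediateField K (LatticeField K M)}
    (h : ∀ m ∈ N, mon K m ∈ E) : monField K N ≤ E := by
  rw [monField, IntermediateField.adjoin_le_iff]
  rintro _ ⟨m, hm, rfl⟩
  exact h m hm

lemma mon_mem_of_mem_span {S : Set M} {E : IntermediateField K (LatticeField K M)}
    (h : ∀ m ∈ S, mon K m ∈ E) {m : M} (hm : m ∈ Submodule.span ℤ S) : mon K m ∈ E := by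
  induction hm using Submodule.span_induction with
  | mem x hx => exact h x hx
  | zero => rw [mon_zero]; exact one_mem _
  | add x y _ _ hx hy => rw [mon_add]; exact mul_mem hx hy
  | smul n x _ hx =>
    induction n using Int.induction_on with
    | zero => rw [zero_smul, mon_zero]; exact one_mem _
    | succ i hi => rw [add_smul, one_smul, mon_add]; exact mul_mem hi hx
    | pred i hi => rw [sub_smul, one_smul, sub_eq_add_neg, mon_add, mon_neg]; exact mul_mem hi (inv_mem hx)

lemma monField_span (S : Set M) :
    monField K (Submodule.span ℤ S) = IntermediateField.adjoin K (mon K '' S) := by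
  refine le_antisymm (monField_le fun m hm => mon_mem_of_mem_span (fun m hm => ?_) hm)
    (IntermediateField.adjoin.mono _ _ _ (Set.image_mono Submodule.subset_span))
  exact IntermediateField.subset_adjoin _ _ ⟨m, hm, rfl⟩

lemma monField_top : monField K (⊤ : Submodule ℤ M) = ⊤ := by
  rw [eq_top_iff]
  intro x _
  have h : ∀ f : AddMonoidAlgebra K M, algebraMap _ (LatticeField K M) f ∈ monField K (⊤ : Submodule ℤ M) := by
    intro f
    induction f using AddMonoidAlgebra.induction_linear with
    | zero => rw [map_zero]; exact zero_mem _
    | add f g hf hg => rw [map_add]; exact add_mem hf hg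
    | single m a =>
      rw [algebraMap_single]
      exact mul_mem (IntermediateField.algebraMap_mem _ a) (mon_mem_monField trivial)
  obtain ⟨a, b, -, rfl⟩ := IsFractionRing.div_surjective (AddMonoidAlgebra K M) x
  exact div_mem (h a) (h b)

lemma algebraicIndependent_mon {ι : Type*} (b : Module.Basis ι ℤ M) :
    AlgebraicIndependent K fun i => mon K (b i) := by
  let d : (ι →₀ ℕ) →+ M :=
    (b.repr.symm : (ι →₀ ℤ) →+ M).comp (Finsupp.mapRange.addMonoidHom (Nat.castAddMonoidHom ℤ))
  have hd : Function.Injective d :=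
    b.repr.symm.injective.comp (Finsupp.mapRange_injective _ rfl Nat.cast_injective)
  have hd1 : ∀ i, d (Finsupp.single i 1) = b i := fun i => by
    change b.repr.symm (Finsupp.mapRange (Nat.castAddMonoidHom ℤ) (map_zero _) _) = _
    rw [Finsupp.mapRange_single, Nat.coe_castAddMonoidHom, Nat.cast_one]
    exact b.repr_symm_single_one i
  let f : MvPolynomial ι K →ₐ[K] LatticeField K M :=
    (IsScalarTower.toAlgHom K (AddMonoidAlgebra K M) (LatticeField K M)).comp
      (AddMonoidAlgebra.mapDomainAlgHom K K d)
  have hf : MvPolynomial.aeval (fun i => mon K (b i)) = f := by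
    refine MvPolynomial.algHom_ext fun i => ?_
    rw [MvPolynomial.aeval_X]
    change _ = algebraMap (AddMonoidAlgebra K M) (LatticeField K M)
      (AddMonoidAlgebra.mapDomain d (AddMonoidAlgebra.single (Finsupp.single i 1) 1))
    rw [AddMonoidAlgebra.mapDomain_single, hd1]
    rfl
  rw [algebraicIndependent_iff_injective_aeval, hf]
  exact (IsFractionRing.injective _ _).comp (AddMonoidAlgebra.mapDomain_injective hd)

open scoped IntermediateField.algebraAdjoinAdjoin in
/-- The monomials of one part of a basis are algebraically independent over the field generated by
those of another part. -/
lemma algebraicIndependent_monField {ι α γ : Type*} (b : Module.Basis ι ℤ M) (a : α → ι) (c : γ → ι)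
    (h : Function.Injective (Sum.elim c a)) :
    AlgebraicIndependent (monField K (Submodule.span ℤ (Set.range (b ∘ a)))) fun i => mon K (b (c i)) := by
  have h1 : AlgebraicIndependent K (Sum.elim (fun i => mon K (b (c i))) fun i => mon K (b (a i))) := by
    convert (algebraicIndependent_mon (K := K) b).comp _ h using 1
    funext i
    rcases i with i | i <;> rfl
  rw [AlgebraicIndependent.sumElim_iff] at h1
  have hS : mon K '' Set.range (b ∘ a) = Set.range fun i => mon K (b (a i)) := by
    rw [← Set.range_comp]; rfl
  rw [monField_span, hS]
  exact h1.2.extendScalars _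

lemma monField_sup (N : Submodule ℤ M) {ι : Type*} (y : ι → M) :
    (IntermediateField.adjoin (monField K N) (Set.range fun i => mon K (y i))).restrictScalars K =
      monField K (N ⊔ Submodule.span ℤ (Set.range y)) := by
  apply le_antisymm
  · refine restrictScalars_adjoin_le (monField_le fun m hm => mon_mem_monField (Submodule.mem_sup_left hm)) ?_
    rintro _ ⟨i, rfl⟩
    exact mon_mem_monField (Submodule.mem_sup_right (Submodule.subset_span ⟨i, rfl⟩))
  · refine monField_le fun m hm => ?_
    obtain ⟨n, hn, l, hl, rfl⟩ := Submodule.mem_sup.1 hm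
    rw [mon_add]
    refine mul_mem (le_restrictScalars_adjoin _ _ (mon_mem_monField hn)) (mon_mem_of_mem_span ?_ hl)
    rintro _ ⟨i, rfl⟩
    exact IntermediateField.subset_adjoin (monField K N) _ ⟨i, rfl⟩

lemma latticeFieldAction_mem {N : Submodule ℤ M} (hN : ∀ g, ∀ m ∈ N, M.ρ g m ∈ N) (g : G)
    {x : LatticeField K M} (hx : x ∈ monField K N) : latticeFieldAction e M g x ∈ monField K N := by
  rw [monField] at hx
  induction hx using IntermediateField.adjoin_induction with
  | mem x hx =>
    obtain ⟨m, hm, rfl⟩ := hx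
    rw [latticeFieldAction_mon]; exact mon_mem_monField (hN g m hm)
  | algebraMap a => rw [latticeFieldAction_algebraMap]; exact IntermediateField.algebraMap_mem _ _
  | add x y _ _ hx hy => rw [map_add]; exact add_mem hx hy
  | mul x y _ _ hx hy => rw [map_mul]; exact mul_mem hx hy
  | inv x _ hx => rw [map_inv₀]; exact inv_mem hx

/-- The invariants of the subfield generated by the monomials with exponents in `N`. -/
abbrev monInvariants (N : Submodule ℤ M) : IntermediateField k (LatticeField K M) :=
  invariants (latticeFieldAction e M) ((monField K N).restrictScalars k)

/-- The no-name lemma for the fields of monomials: if `G` permutes the `y i` modulo `N`, the monomials of the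
`y i` are permuted up to factors in the field of `N`. -/
lemma isPurelyTranscendental_monInvariants [Finite G] {N : Submodule ℤ M}
    (hN : ∀ g, ∀ m ∈ N, M.ρ g m ∈ N) {ι : Type*} [Finite ι] {y : ι → M}
    (hy : AlgebraicIndependent (monField K N) fun i => mon K (y i))
    (hyg : ∀ g i, ∃ j, M.ρ g (y i) - y j ∈ N) :
    IsPurelyTranscendental k (monInvariants e N)
      (monInvariants e (N ⊔ Submodule.span ℤ (Set.range y))) := by
  have := Fintype.ofFinite G
  rw [monInvariants, monInvariants, ← monField_sup]
  refine isPurelyTranscendental_invariants (L := (monField K N).restrictScalars k)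
    (fun g x hx => latticeFieldAction_mem e hN g hx) (fun g hg => ?_) hy fun g i => ?_
  · apply e.injective
    rw [map_one]
    refine AlgEquiv.ext fun a => ?_
    have h1 := hg (algebraMap K _ a) (IntermediateField.algebraMap_mem (monField K N) a)
    rw [latticeFieldAction_algebraMap] at h1
    exact (algebraMap K (LatticeField K M)).injective h1
  · obtain ⟨j, hj⟩ := hyg g i
    rw [latticeFieldAction_mon, ← sub_add_cancel (M.ρ g (y i)) (y j), mon_add]
    exact Submodule.smul_mem _ (⟨mon K _, mon_mem_monField hj⟩ : monField K N)
      (Submodule.subset_span ⟨j, rfl⟩)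

lemma monInvariants_bot [FiniteDimensional k K] [IsGalois k K] :
    monInvariants e (⊥ : Submodule ℤ M) = ⊥ := by
  rw [eq_bot_iff]
  intro x hx
  obtain ⟨hx, hg⟩ := mem_invariants.1 hx
  have h1 : monField K (⊥ : Submodule ℤ M) ≤ ⊥ := monField_le fun m hm => by
    rw [(Submodule.mem_bot ℤ).1 hm, mon_zero]; exact one_mem _
  obtain ⟨a, rfl⟩ := IntermediateField.mem_bot.1 (h1 hx)
  have h2 : a ∈ Set.range (algebraMap k K) := by
    rw [IsGalois.mem_range_algebraMap_iff_fixed]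
    intro s
    have h3 := hg (e.symm s)
    rw [latticeFieldAction_algebraMap, e.apply_symm_apply] at h3
    exact (algebraMap K (LatticeField K M)).injective h3
  obtain ⟨c, rfl⟩ := h2
  rw [← IsScalarTower.algebraMap_apply]
  exact IntermediateField.algebraMap_mem _ c

end LatticeField

/-! ### Stable rationality of the fixed fields -/

section Fixed

variable {G : Type v} [Group G] {k : Type t} [Field k] {K : Type u} [Field K] [Algebra k K]
  (e : G ≃* Gal(K/k)) {M : GLattice.{v, w} G} {P : GLattice.{v, 0} G}

variable (K) in
/-- The map `K[M] → K(P)` given by a map `M → P`. -/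
def algebraMapLatticeField (f : M →ₗ[ℤ] P) : AddMonoidAlgebra K M →ₐ[K] LatticeField K P :=
  (IsScalarTower.toAlgHom K (AddMonoidAlgebra K P) (LatticeField K P)).comp
    (AddMonoidAlgebra.mapDomainAlgHom K K f.toAddMonoidHom)

lemma algebraMapLatticeField_injective {f : M →ₗ[ℤ] P} (hf : Function.Injective f) :
    Function.Injective (algebraMapLatticeField K f) :=
  (IsFractionRing.injective _ _).comp (AddMonoidAlgebra.mapDomain_injective hf)

variable (K) in
/-- The embedding `K(M) → K(P)` given by an embedding `M → P`. -/
def latticeFieldMap (f : M →ₗ[ℤ] P) (hf : Function.Injective f) : LatticeField K M →ₐ[K] LatticeField K P :=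
  IsFractionRing.liftAlgHom (A := AddMonoidAlgebra K M) (algebraMapLatticeField_injective (K := K) hf)

variable (f : M →ₗ[ℤ] P) (hf : Function.Injective f)

lemma latticeFieldMap_mon (m : M) : latticeFieldMap K f hf (mon K m) = mon K (f m) := by
  rw [latticeFieldMap, IsFractionRing.liftAlgHom_apply, mon]
  refine (IsFractionRing.lift_algebraMap (algebraMapLatticeField_injective (K := K) hf) _).trans ?_
  change algebraMap (AddMonoidAlgebra K P) (LatticeField K P)
      (AddMonoidAlgebra.mapDomain f (AddMonoidAlgebra.single m 1)) = _
  rw [AddMonoidAlgebra.mapDomain_single]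
  rfl

lemma latticeFieldMap_mem (x : LatticeField K M) :
    latticeFieldMap K f hf x ∈ monField K (LinearMap.range f) := by
  have h : (⊤ : IntermediateField K (LatticeField K M)) ≤
      (monField K (LinearMap.range f)).comap (latticeFieldMap K f hf) := by
    rw [← monField_top]
    exact monField_le fun m _ => by
      change latticeFieldMap K f hf (mon K m) ∈ monField K (LinearMap.range f)
      rw [latticeFieldMap_mon]
      exact mon_mem_monField ⟨m, rfl⟩
  exact h (x := x) trivial

lemma exists_latticeFieldMap {y : LatticeField K P} (hy : y ∈ monField K (LinearMap.range f)) :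
    ∃ x, latticeFieldMap K f hf x = y := by
  have h : monField K (LinearMap.range f) ≤ (latticeFieldMap K f hf).fieldRange :=
    monField_le fun m hm => by
      obtain ⟨m, rfl⟩ := hm
      exact ⟨mon K m, latticeFieldMap_mon f hf m⟩
  exact h hy

variable (hfg : ∀ g m, f (M.ρ g m) = P.ρ g (f m))

include hfg

lemma latticeFieldMap_action (g : G) (x : LatticeField K M) :
    latticeFieldMap K f hf (latticeFieldAction e M g x) =
      latticeFieldAction e P g (latticeFieldMap K f hf x) := by
  refine DFunLike.congr_fun (latticeField_ringHom_ext
    (f := (latticeFieldMap K f hf).toRingHom.comp (latticeFieldAction e M g).toRingEquiv.toRingHom)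
    (g := (latticeFieldAction e P g).toRingEquiv.toRingHom.comp (latticeFieldMap K f hf).toRingHom)
    (fun a => ?_) fun m => ?_) x
  · change latticeFieldMap K f hf (latticeFieldAction e M g _) =
      latticeFieldAction e P g (latticeFieldMap K f hf _)
    rw [latticeFieldAction_algebraMap, AlgHom.commutes, AlgHom.commutes, latticeFieldAction_algebraMap]
  · change latticeFieldMap K f hf (latticeFieldAction e M g _) =
      latticeFieldAction e P g (latticeFieldMap K f hf _)
    rw [latticeFieldAction_mon, latticeFieldMap_mon, latticeFieldMap_mon, latticeFieldAction_mon, hfg]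

lemma latticeFieldMap_mem_monInvariants {x : LatticeField K M} (hx : x ∈ fixedField e M) :
    latticeFieldMap K f hf x ∈ monInvariants e (LinearMap.range f) :=
  mem_invariants.2 ⟨latticeFieldMap_mem f hf x, fun g => by
    rw [← latticeFieldMap_action e f hf hfg, (mem_fixedField_iff e).1 hx g]⟩

lemma exists_mem_fixedField {y : LatticeField K P} (hy : y ∈ monInvariants e (LinearMap.range f)) :
    ∃ x ∈ fixedField e M, latticeFieldMap K f hf x = y := by
  obtain ⟨hy, hg⟩ := mem_invariants.1 hy
  obtain ⟨x, rfl⟩ := exists_latticeFieldMap f hf hy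
  refine ⟨x, (mem_fixedField_iff e).2 fun g => (latticeFieldMap K f hf).injective ?_, rfl⟩
  exact (latticeFieldMap_action e f hf hfg g x).trans (hg g)

/-- The fixed field `K(M)^G` as a subfield of `K(P)`, for a sublattice `M` of `P`. -/
def fixedFieldEquiv : fixedField e M ≃ₐ[k] monInvariants e (LinearMap.range f) :=
  let F : fixedField e M →ₐ[k] monInvariants e (LinearMap.range f) :=
    { toFun := fun x => ⟨latticeFieldMap K f hf x, latticeFieldMap_mem_monInvariants e f hf hfg x.2⟩
      map_one' := Subtype.ext (map_one _)
      map_zero' := Subtype.ext (map_zero _)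
      map_mul' := fun x y => Subtype.ext (map_mul _ _ _)
      map_add' := fun x y => Subtype.ext (map_add _ _ _)
      commutes' := fun a => Subtype.ext (((latticeFieldMap K f hf).restrictScalars k).commutes a) }
  AlgEquiv.ofBijective F
    ⟨fun x y h => Subtype.ext ((latticeFieldMap K f hf).injective (congrArg Subtype.val h)), fun y => by
      obtain ⟨x, hx, hxy⟩ := exists_mem_fixedField e f hf hfg y.2
      exact ⟨⟨x, hx⟩, Subtype.ext hxy⟩⟩

omit hfg

lemma isField_fixedField (M : GLattice.{v, w} G) : IsField (fixedField e M) :=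
  { exists_pair_ne := ⟨0, 1, zero_ne_one⟩
    mul_comm := mul_comm
    mul_inv_cancel := fun {a} ha => ⟨⟨(a : LatticeField K M)⁻¹, fun g => by
      rw [map_inv₀, a.2 g]⟩, Subtype.ext (mul_inv_cancel₀ fun h => ha (Subtype.ext h))⟩ }

/-- The fixed field of a permutation lattice is rational over `k`. -/
lemma IsPermutation.isPurelyTranscendental [Finite G] [FiniteDimensional k K] [IsGalois k K]
    (hP : IsPermutation P) : IsPurelyTranscendental k ⊥ (monInvariants e (⊤ : Submodule ℤ P)) := by
  obtain ⟨n, b, hb⟩ := hP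
  have h1 := algebraicIndependent_monField (K := K) b (Empty.elim : Empty → Fin n) id (by
    rintro (i | i) (j | j) h
    · exact congrArg _ h
    · exact j.elim
    · exact i.elim
    · exact i.elim)
  have h0 : Submodule.span ℤ (Set.range (b ∘ (Empty.elim : Empty → Fin n))) = ⊥ := by
    rw [Set.range_eq_empty, Submodule.span_empty]
  rw [h0] at h1
  have h2 := isPurelyTranscendental_monInvariants e (N := (⊥ : Submodule ℤ P))
    (fun g m hm => by rw [(Submodule.mem_bot ℤ).1 hm, map_zero]; exact zero_mem _) (y := b) h1
    (fun g i => by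
      obtain ⟨j, hj⟩ := hb g i
      exact ⟨j, by rw [hj, sub_self]; exact zero_mem _⟩)
  rwa [monInvariants_bot, b.span_eq, bot_sup_eq] at h2

/-- In the situation `0 → M ⊕ Q₀ → P → Q → 0`, the fixed field of `K(P)` is rational over `k` and purely
transcendental over the fixed field of `K(M)`, via the fixed field of `K(M ⊕ Q₀)`. -/
theorem HasPermutationResolution.isStablyRational [Finite G] [FiniteDimensional k K] [IsGalois k K]
    (h : HasPermutationResolution M) : IsStablyRational k (fixedField e M) := by
  obtain ⟨Q₀, P, Q, ⟨n₀, b₀, hb₀⟩, hP, ⟨n, c, hc⟩, f, g, hf, hg, hinj, hsurj, hgf, hex⟩ := h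
  let f₁ : M →ₗ[ℤ] P := f ∘ₗ LinearMap.inl ℤ M Q₀
  have hf₁ : Function.Injective f₁ := hinj.comp LinearMap.inl_injective
  have hf₁g : ∀ s m, f₁ (M.ρ s m) = P.ρ s (f₁ m) := fun s m => by
    refine Eq.trans ?_ (hf s (m, 0))
    exact congrArg f (Prod.ext rfl (map_zero (Q₀.ρ s)).symm)
  -- a basis of `P` adapted to the filtration
  choose y hy using fun i => hsurj (c i)
  let s : Q →ₗ[ℤ] P := c.constr ℤ y
  have hs : ∀ x, g (s x) = x := fun x => by
    have : g ∘ₗ s = LinearMap.id := c.ext fun i => by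
      rw [LinearMap.comp_apply, Module.Basis.constr_basis, hy]; rfl
    exact LinearMap.congr_fun this x
  let F : ((M × Q₀) × Q) →ₗ[ℤ] P := LinearMap.coprod f s
  have hF : ∀ x, F x = f x.1 + s x.2 := fun x => LinearMap.coprod_apply _ _ _
  have hFbij : Function.Bijective F := by
    constructor
    · rw [injective_iff_map_eq_zero]
      intro x hx
      have h1 := congrArg g hx
      rw [hF, map_add, hgf, hs, zero_add, map_zero] at h1
      rw [hF, h1, map_zero, add_zero] at hx
      exact Prod.ext ((injective_iff_map_eq_zero f).1 hinj _ hx) h1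
    · intro x
      obtain ⟨a, ha⟩ := hex (x - s (g x)) (by rw [map_sub, hs, sub_self])
      exact ⟨(a, g x), by rw [hF, ha, sub_add_cancel]⟩
  let bM := Module.Free.chooseBasis ℤ M
  let B := ((bM.prod b₀).prod c).map (LinearEquiv.ofBijective F hFbij)
  have hB₁ : ∀ i, B (Sum.inl (Sum.inl i)) = f₁ (bM i) := fun i => by
    rw [Module.Basis.map_apply]
    refine (hF _).trans ?_
    simp [f₁]
  have hB₂ : ∀ i, B (Sum.inl (Sum.inr i)) = f (0, b₀ i) := fun i => by
    rw [Module.Basis.map_apply]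
    refine (hF _).trans ?_
    simp
  have hB₃ : ∀ i, B (Sum.inr i) = y i := fun i => by
    rw [Module.Basis.map_apply]
    refine (hF _).trans ?_
    simp [s]
  have hr₁ : Submodule.span ℤ (Set.range (B ∘ Sum.inl ∘ Sum.inl)) = LinearMap.range f₁ := by
    rw [show B ∘ Sum.inl ∘ Sum.inl = f₁ ∘ bM from funext hB₁, Set.range_comp, Submodule.span_image,
      bM.span_eq, Submodule.map_top]
  have hr₂ : LinearMap.range f₁ ⊔ Submodule.span ℤ (Set.range fun i => f (0, b₀ i)) = LinearMap.range f := by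
    have h1 : Set.range (fun i => f (0, b₀ i)) = (f ∘ₗ LinearMap.inr ℤ M Q₀) '' Set.range b₀ := by
      rw [← Set.range_comp]; rfl
    rw [h1, Submodule.span_image, b₀.span_eq, Submodule.map_top, LinearMap.range_comp, LinearMap.range_comp,
      ← Submodule.map_sup, LinearMap.sup_range_inl_inr, Submodule.map_top]
  have hr₃ : LinearMap.range f ⊔ Submodule.span ℤ (Set.range y) = ⊤ := by
    rw [eq_top_iff, ← B.span_eq, Submodule.span_le]
    rintro _ ⟨(i | i) | i, rfl⟩
    · rw [hB₁]; exact Submodule.mem_sup_left ⟨_, rfl⟩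
    · rw [hB₂]; exact Submodule.mem_sup_left ⟨_, rfl⟩
    · rw [hB₃]; exact Submodule.mem_sup_right (Submodule.subset_span ⟨i, rfl⟩)
  have hr₄ : Submodule.span ℤ (Set.range (B ∘ Sum.inl)) = LinearMap.range f := by
    rw [← hr₂, ← hr₁, ← Submodule.span_union]
    congr 1
    ext x
    constructor
    · rintro ⟨i | i, rfl⟩
      · exact Or.inl ⟨i, rfl⟩
      · exact Or.inr ⟨i, (hB₂ i).symm⟩
    · rintro (⟨i, rfl⟩ | ⟨i, rfl⟩)
      · exact ⟨Sum.inl i, rfl⟩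
      · exact ⟨Sum.inr i, hB₂ i⟩
  have key₁ : IsPurelyTranscendental k (monInvariants e (LinearMap.range f₁))
      (monInvariants e (LinearMap.range f)) := by
    rw [← hr₂]
    refine isPurelyTranscendental_monInvariants e (fun s m hm => ?_) ?_ fun s i => ?_
    · obtain ⟨m, rfl⟩ := hm
      exact ⟨_, hf₁g s m⟩
    · have h1 := algebraicIndependent_monField (K := K) B (Sum.inl ∘ Sum.inl) (Sum.inl ∘ Sum.inr)
        ((Sum.inl_injective.comp Sum.inr_injective).sumElim (Sum.inl_injective.comp Sum.inl_injective)
          fun i j h => Sum.inr_ne_inl (Sum.inl_injective h))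
      rw [hr₁] at h1
      simpa only [Function.comp_apply, hB₂] using h1
    · obtain ⟨j, hj⟩ := hb₀ s i
      refine ⟨j, ?_⟩
      have h1 : P.ρ s (f (0, b₀ i)) = f (0, b₀ j) := by
        rw [← hf]
        exact congrArg f (Prod.ext (map_zero (M.ρ s)) hj)
      rw [h1, sub_self]
      exact zero_mem _
  have key₂ : IsPurelyTranscendental k (monInvariants e (LinearMap.range f))
      (monInvariants e (⊤ : Submodule ℤ P)) := by
    rw [← hr₃]
    refine isPurelyTranscendental_monInvariants e (fun s m hm => ?_) ?_ fun s i => ?_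
    · obtain ⟨m, rfl⟩ := hm
      exact ⟨_, hf s m⟩
    · have h1 := algebraicIndependent_monField (K := K) B Sum.inl Sum.inr
        (Sum.inr_injective.sumElim Sum.inl_injective fun _ _ => Sum.inr_ne_inl)
      rw [hr₄] at h1
      simpa only [hB₃] using h1
    · obtain ⟨j, hj⟩ := hc s i
      exact ⟨j, hex _ (by rw [map_sub, hg, hy, hy, hj, sub_self])⟩
  exact ((key₁.trans key₂).isStablyRational (hP.isPurelyTranscendental e)).of_algEquiv
    (fixedFieldEquiv e f₁ hf₁ hf₁g).symm

end Fixed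

/-! ### The character lattice of a torus -/

section Torus

/-- The units of the group algebra of a torsion-free abelian group are the monomials. -/
lemma exists_single_of_isUnit {K N : Type*} [Field K] [AddCommGroup N] [TwoUniqueSums N]
    {x : AddMonoidAlgebra K N} (hx : IsUnit x) : ∃ m a, x = AddMonoidAlgebra.single m a := by
  classical
  obtain ⟨y, hxy⟩ := hx.exists_right_inv
  have hx0 : x ≠ 0 := fun h => by
    rw [h, zero_mul] at hxy; exact zero_ne_one hxy
  have hy0 : y ≠ 0 := fun h => by
    rw [h, mul_zero] at hxy; exact zero_ne_one hxy
  have hpos : ∀ z : AddMonoidAlgebra K N, z ≠ 0 → 0 < z.coeff.support.card := fun z hz =>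
    Finset.card_pos.2 (Finsupp.support_nonempty_iff.2 (mt AddMonoidAlgebra.coeff_eq_zero.1 hz))
  -- a unique sum of exponents contributes to the product, and must therefore vanish
  have hsum : ∀ q ∈ x.coeff.support ×ˢ y.coeff.support,
      UniqueAdd x.coeff.support y.coeff.support q.1 q.2 → q.1 + q.2 = 0 := by
    intro q hq hu
    rw [Finset.mem_product, Finsupp.mem_support_iff, Finsupp.mem_support_iff] at hq
    by_contra hne
    have h1 := AddMonoidAlgebra.coeff_mul_add_of_uniqueAdd hu
    rw [hxy, AddMonoidAlgebra.one_def, AddMonoidAlgebra.coeff_single,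
      Finsupp.single_eq_of_ne hne] at h1
    exact mul_ne_zero hq.1 hq.2 h1.symm
  have hcard : x.coeff.support.card * y.coeff.support.card ≤ 1 := by
    by_contra! h
    obtain ⟨q, hq, q', hq', hne, hu, hu'⟩ := TwoUniqueSums.uniqueAdd_of_one_lt_card h
    have h1 := Finset.mem_product.1 hq'
    have h2 := hu h1.1 h1.2 ((hsum q' hq' hu').trans (hsum q hq hu).symm)
    exact hne (Prod.ext h2.1.symm h2.2.symm)
  have h1 : x.coeff.support.card = 1 :=
    le_antisymm ((Nat.le_mul_of_pos_right _ (hpos y hy0)).trans hcard) (hpos x hx0)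
  obtain ⟨m, a, -, h⟩ := Finsupp.card_support_eq_one'.1 h1
  exact ⟨m, a, AddMonoidAlgebra.coeff_injective h⟩

variable {k : Type u} [Field k] {K : Type v} [Field K] [Algebra k K] {A : Type w} [CommRing A]
  [HopfAlgebra k A]

variable (A) in
/-- The semilinear action of the Galois group on `K ⊗ A`. -/
def twist (s : Gal(K/k)) : K ⊗[k] A ≃ₐ[k] K ⊗[k] A := Algebra.TensorProduct.congr s AlgEquiv.refl

lemma twist_tmul (s : Gal(K/k)) (a : K) (b : A) : twist A s (a ⊗ₜ b) = s a ⊗ₜ b := rfl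

lemma twist_one : twist A (1 : Gal(K/k)) = AlgEquiv.refl := by
  refine AlgEquiv.ext fun x => ?_
  induction x using TensorProduct.induction_on with
  | zero => rw [map_zero, map_zero]
  | tmul a b => rfl
  | add x y hx hy => rw [map_add, map_add, hx, hy]

lemma twist_mul (s s' : Gal(K/k)) (x : K ⊗[k] A) : twist A (s * s') x = twist A s (twist A s' x) := by
  induction x using TensorProduct.induction_on with
  | zero => simp only [map_zero]
  | tmul a b => rfl
  | add x y hx hy => simp only [map_add, hx, hy]

lemma twist_smul (s : Gal(K/k)) (c : K) (x : K ⊗[k] A) : twist A s (c • x) = s c • twist A s x := by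
  induction x using TensorProduct.induction_on with
  | zero => simp only [smul_zero, map_zero]
  | tmul a b => rw [TensorProduct.smul_tmul', twist_tmul, twist_tmul, TensorProduct.smul_tmul', smul_eq_mul,
      map_mul, smul_eq_mul]
  | add x y hx hy => rw [smul_add, map_add, map_add, hx, hy, smul_add]

lemma counit_twist (s : Gal(K/k)) (x : K ⊗[k] A) :
    Coalgebra.counit (R := K) (twist A s x) = s (Coalgebra.counit (R := K) x) := by
  induction x using TensorProduct.induction_on with
  | zero => simp only [map_zero]
  | tmul a b =>
    rw [twist_tmul, TensorProduct.counit_tmul, TensorProduct.counit_tmul, CommSemiring.counit_apply,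
      CommSemiring.counit_apply, map_smul]
  | add x y hx hy => simp only [map_add, hx, hy]

/-- Galois descent: the invariants of `K ⊗ A` are `A`. -/
lemma exists_tmul_of_twist [FiniteDimensional k K] [IsGalois k K] {x : K ⊗[k] A}
    (hx : ∀ s : Gal(K/k), twist A s x = x) : ∃ b : A, 1 ⊗ₜ b = x := by
  let bA := Module.Free.chooseBasis k A
  let β := Algebra.TensorProduct.basis K bA
  have hβ : ∀ (s : Gal(K/k)) y i, β.repr (twist A s y) i = s (β.repr y i) := by
    intro s y i
    induction y using TensorProduct.induction_on with
    | zero => simp only [map_zero, Finsupp.coe_zero, Pi.zero_apply]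
    | tmul a b =>
      rw [twist_tmul, Algebra.TensorProduct.basis_repr_tmul, Algebra.TensorProduct.basis_repr_tmul]
      simp
    | add x y hx hy => simp only [map_add, Finsupp.coe_add, Pi.add_apply, hx, hy]
  have hk : ∀ i, ∃ c : k, algebraMap k K c = β.repr x i := fun i => by
    have : β.repr x i ∈ Set.range (algebraMap k K) := by
      rw [IsGalois.mem_range_algebraMap_iff_fixed]
      intro s
      rw [← hβ, hx]
    exact this
  choose c hc using hk
  refine ⟨(β.repr x).sum fun i _ => c i • bA i, ?_⟩
  refine Eq.trans ?_ (β.linearCombination_repr x)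
  rw [Finsupp.linearCombination_apply, Finsupp.sum, Finsupp.sum, TensorProduct.tmul_sum]
  refine Finset.sum_congr rfl fun i _ => ?_
  rw [← hc, Algebra.TensorProduct.basis_apply, algebraMap_smul, TensorProduct.tmul_smul]

variable {d : ℕ} (Φ : K ⊗[k] A ≃ₐc[K] AddMonoidAlgebra K (Fin d → ℤ))

/-- The semilinear action of the Galois group on the split coordinate ring. -/
def splitTwist (s : Gal(K/k)) : AddMonoidAlgebra K (Fin d → ℤ) ≃+* AddMonoidAlgebra K (Fin d → ℤ) :=
  (Φ.toAlgEquiv.toRingEquiv.symm.trans (twist A s).toRingEquiv).trans Φ.toAlgEquiv.toRingEquiv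

lemma splitTwist_apply (s : Gal(K/k)) (x : K ⊗[k] A) : splitTwist Φ s (Φ x) = Φ (twist A s x) := by
  change Φ (twist A s (Φ.symm (Φ x))) = _
  rw [BialgEquiv.symm_apply_apply]

lemma splitTwist_one (x) : splitTwist Φ 1 x = x := by
  obtain ⟨x, rfl⟩ := EquivLike.surjective Φ x
  rw [splitTwist_apply, twist_one]; rfl

lemma splitTwist_mul (s s' : Gal(K/k)) (x) : splitTwist Φ (s * s') x = splitTwist Φ s (splitTwist Φ s' x) := by
  obtain ⟨x, rfl⟩ := EquivLike.surjective Φ x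
  rw [splitTwist_apply, splitTwist_apply, splitTwist_apply, twist_mul]

lemma splitTwist_smul (s : Gal(K/k)) (c : K) (x) : splitTwist Φ s (c • x) = s c • splitTwist Φ s x := by
  obtain ⟨x, rfl⟩ := EquivLike.surjective Φ x
  rw [← map_smul, splitTwist_apply, splitTwist_apply, twist_smul, map_smul]

lemma counit_splitTwist (s : Gal(K/k)) (x) :
    Coalgebra.counit (R := K) (splitTwist Φ s x) = s (Coalgebra.counit (R := K) x) := by
  obtain ⟨x, rfl⟩ := EquivLike.surjective Φ x
  rw [splitTwist_apply, CoalgHomClass.counit_comp_apply Φ, CoalgHomClass.counit_comp_apply Φ, counit_twist]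

/-- The image of a character under the semilinear action is a unit, hence a monomial, and its coefficient is
`1` because the action is compatible with the counit. -/
lemma exists_splitTwist_single (s : Gal(K/k)) (m : Fin d → ℤ) :
    ∃ n, splitTwist Φ s (AddMonoidAlgebra.single m 1) = AddMonoidAlgebra.single n 1 := by
  have h1 : IsUnit (AddMonoidAlgebra.single m (1 : K)) :=
    .of_mul_eq_one (AddMonoidAlgebra.single (-m) 1) (by
      rw [AddMonoidAlgebra.single_mul_single, add_neg_cancel, mul_one]; rfl)
  obtain ⟨n, a, h⟩ := exists_single_of_isUnit (h1.map (splitTwist Φ s))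
  refine ⟨n, ?_⟩
  have h2 := counit_splitTwist Φ s (AddMonoidAlgebra.single m 1)
  rw [h, AddMonoidAlgebra.counit_single, AddMonoidAlgebra.counit_single, CommSemiring.counit_apply,
    CommSemiring.counit_apply, map_one] at h2
  rw [h, h2]

/-- The action of the Galois group on the characters. -/
def charAct (s : Gal(K/k)) (m : Fin d → ℤ) : Fin d → ℤ := (exists_splitTwist_single Φ s m).choose

lemma splitTwist_single_one (s : Gal(K/k)) (m : Fin d → ℤ) :
    splitTwist Φ s (AddMonoidAlgebra.single m 1) = AddMonoidAlgebra.single (charAct Φ s m) 1 :=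
  (exists_splitTwist_single Φ s m).choose_spec

lemma splitTwist_single (s : Gal(K/k)) (m : Fin d → ℤ) (a : K) :
    splitTwist Φ s (AddMonoidAlgebra.single m a) = AddMonoidAlgebra.single (charAct Φ s m) (s a) := by
  have h : ∀ (n : Fin d → ℤ) (c : K), AddMonoidAlgebra.single n c = c • AddMonoidAlgebra.single n (1 : K) :=
    fun n c => by rw [AddMonoidAlgebra.smul_single, smul_eq_mul, mul_one]
  rw [h, splitTwist_smul, splitTwist_single_one, ← h]

lemma charAct_eq {s : Gal(K/k)} {m n : Fin d → ℤ}
    (h : splitTwist Φ s (AddMonoidAlgebra.single m 1) = AddMonoidAlgebra.single n 1) : charAct Φ s m = n := by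
  rw [splitTwist_single_one] at h
  exact AddMonoidAlgebra.single_left_injective one_ne_zero h

/-- The character lattice of the torus, as a representation of the Galois group. -/
def charRep : Representation ℤ Gal(K/k) (Fin d → ℤ) where
  toFun s := (AddMonoidHom.mk' (charAct Φ s) fun m n => charAct_eq Φ (by
    have h : ∀ m n : Fin d → ℤ, AddMonoidAlgebra.single (m + n) (1 : K) =
        AddMonoidAlgebra.single m 1 * AddMonoidAlgebra.single n 1 := fun m n => by
      rw [AddMonoidAlgebra.single_mul_single, mul_one]
    rw [h, map_mul, splitTwist_single_one, splitTwist_single_one, ← h])).toIntLinearMap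
  map_one' := LinearMap.ext fun m => charAct_eq Φ (splitTwist_one Φ _)
  map_mul' s s' := LinearMap.ext fun m => charAct_eq Φ (by
    rw [splitTwist_mul, splitTwist_single_one, splitTwist_single_one]; rfl)

variable {G : Type t} [Group G] (e : G ≃* Gal(K/k))

/-- The character lattice of the torus. -/
abbrev charLattice : GLattice.{t, 0} G where
  carrier := Fin d → ℤ
  ρ := (charRep Φ).comp e.toMonoidHom

lemma latticeFieldAction_charLattice (g : G) (x : AddMonoidAlgebra K (charLattice Φ e)) :
    latticeFieldAction e (charLattice Φ e) g (algebraMap _ (LatticeField K (charLattice Φ e)) x) =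
      algebraMap (AddMonoidAlgebra K (charLattice Φ e)) _ (splitTwist Φ (e g) x) := by
  induction x using AddMonoidAlgebra.induction_linear with
  | zero => simp only [map_zero]
  | add x y hx hy => simp only [map_add, hx, hy]
  | single m a =>
    refine (latticeFieldAut_algebraMap_single _ _ _ _).trans ?_
    rw [splitTwist_single]; rfl

/-- The coordinate ring of the torus inside of `K(M)`. -/
def coordHom : A →ₐ[k] LatticeField K (charLattice Φ e) :=
  ((IsScalarTower.toAlgHom K (AddMonoidAlgebra K (charLattice Φ e)) (LatticeField K (charLattice Φ e))).comp
    Φ.toAlgEquiv.toAlgHom).restrictScalars k |>.comp Algebra.TensorProduct.includeRight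

lemma coordHom_injective : Function.Injective (coordHom Φ e) :=
  (IsFractionRing.injective (AddMonoidAlgebra K (charLattice Φ e)) _).comp
    ((EquivLike.injective Φ).comp (Algebra.TensorProduct.includeRight_injective (algebraMap k K).injective))

lemma coordHom_mem (b : A) : coordHom Φ e b ∈ fixedField e (charLattice Φ e) := fun g => by
  refine (latticeFieldAction_charLattice Φ e g (Φ (1 ⊗ₜ b))).trans ?_
  rw [splitTwist_apply, twist_tmul, map_one]; rfl

include Φ in
lemma isDomain_of_split : IsDomain A := (coordHom_injective Φ (MulEquiv.refl _)).isDomain (coordHom Φ _).toRingHom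

variable [FiniteDimensional k K] [IsGalois k K]

/-- By Galois descent, the invariants of the split coordinate ring form the coordinate ring of the torus. -/
lemma exists_coordHom {x : AddMonoidAlgebra K (charLattice Φ e)}
    (hx : ∀ g, latticeFieldAction e (charLattice Φ e) g (algebraMap _ _ x) =
      algebraMap (AddMonoidAlgebra K (charLattice Φ e)) (LatticeField K (charLattice Φ e)) x) :
    ∃ b, coordHom Φ e b = algebraMap (AddMonoidAlgebra K (charLattice Φ e)) _ x := by
  obtain ⟨y, rfl⟩ := EquivLike.surjective Φ x
  obtain ⟨b, rfl⟩ := exists_tmul_of_twist (x := y) fun s => by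
    have h := hx (e.symm s)
    rw [latticeFieldAction_charLattice, e.apply_symm_apply] at h
    have h1 := IsFractionRing.injective (AddMonoidAlgebra K (charLattice Φ e)) _ h
    rw [splitTwist_apply] at h1
    exact (EquivLike.injective Φ) h1
  exact ⟨b, rfl⟩

lemma exists_div_coordHom [Finite G] {x : LatticeField K (charLattice Φ e)}
    (hx : x ∈ fixedField e (charLattice Φ e)) : ∃ a b, coordHom Φ e a / coordHom Φ e b = x := by
  have := Fintype.ofFinite G
  obtain ⟨a, b, -, rfl⟩ := IsFractionRing.div_surjective (AddMonoidAlgebra K (charLattice Φ e)) x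
  obtain ⟨a', ⟨a', rfl⟩, b', ⟨b', rfl⟩, ha, hb, h⟩ := exists_fixed_div
    (φ := latticeFieldAction e (charLattice Φ e))
    (S := (algebraMap (AddMonoidAlgebra K (charLattice Φ e)) (LatticeField K (charLattice Φ e))).range)
    (by
      rintro g _ ⟨y, rfl⟩
      exact ⟨_, (latticeFieldAction_charLattice Φ e g y).symm⟩) ⟨a, rfl⟩ ⟨b, rfl⟩ hx
  obtain ⟨a'', ha''⟩ := exists_coordHom Φ e ha
  obtain ⟨b'', hb''⟩ := exists_coordHom Φ e hb
  exact ⟨a'', b'', by rw [ha'', hb'', h]⟩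

/-- The function field of the torus is the fixed field of its character lattice. -/
lemma nonempty_functionField_equiv [Finite G] :
    Nonempty (FractionRing A ≃ₐ[k] fixedField e (charLattice Φ e)) := by
  have := isDomain_of_split Φ
  let F : FractionRing A →ₐ[k] LatticeField K (charLattice Φ e) :=
    IsFractionRing.liftAlgHom (A := A) (coordHom_injective Φ e)
  have hF : ∀ a, F (algebraMap A _ a) = coordHom Φ e a := fun a =>
    IsFractionRing.lift_algebraMap (coordHom_injective Φ e) a
  have hmem : ∀ x, F x ∈ fixedField e (charLattice Φ e) := fun x g => by
    obtain ⟨a, b, -, rfl⟩ := IsFractionRing.div_surjective A x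
    rw [map_div₀, hF, hF, map_div₀, coordHom_mem Φ e a g, coordHom_mem Φ e b g]
  refine ⟨AlgEquiv.ofBijective (F.codRestrict _ hmem) ⟨fun x y h => ?_, fun y => ?_⟩⟩
  · exact F.injective (congrArg Subtype.val h)
  · obtain ⟨a, b, h⟩ := exists_div_coordHom Φ e y.2
    refine ⟨algebraMap A _ a / algebraMap A _ b, Subtype.ext ?_⟩
    change F _ = y
    rw [map_div₀, hF, hF, h]

theorem IsTorusSplitBy.isStablyRational [Finite G] (hA : IsTorusSplitBy k K A)
    (h : ∀ M : GLattice.{t, 0} G, IsStablyRational k (fixedField e M)) :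
    IsDomain A ∧ IsStablyRational k (FractionRing A) := by
  obtain ⟨d, ⟨Φ⟩⟩ := hA
  obtain ⟨f⟩ := nonempty_functionField_equiv Φ e
  exact ⟨isDomain_of_split Φ, (h (charLattice Φ e)).of_algEquiv f.symm⟩

end Torus

end

end DihedralTori

theorem theorem4p9 (p : ℕ) [Fact p.Prime] (hp : p ≠ 2) (h : DihedralTori.hPlus p = 1) :
    -- the five non-split extensions exist
    (∃ V X Y₀ Y₁ Y₂ : DihedralTori.GLattice.{0, 0} (DihedralGroup p),
      DihedralTori.AreNonsplitExtensions p V X Y₀ Y₁ Y₂) ∧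
    -- for any choice of them, the ten lattices are exactly the indecomposable ones
    (∀ V X Y₀ Y₁ Y₂ : DihedralTori.GLattice.{0, 0} (DihedralGroup p),
      DihedralTori.AreNonsplitExtensions p V X Y₀ Y₁ Y₂ →
      (∀ i, DihedralTori.IsIndecomposable (DihedralTori.tenLattices p V X Y₀ Y₁ Y₂ i)) ∧
      (∀ i j, DihedralTori.IsoLattice (DihedralTori.tenLattices p V X Y₀ Y₁ Y₂ i)
        (DihedralTori.tenLattices p V X Y₀ Y₁ Y₂ j) → i = j) ∧
      (∀ M : DihedralTori.GLattice.{0, u} (DihedralGroup p), DihedralTori.IsIndecomposable M →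
        ∃ i, DihedralTori.IsoLattice M (DihedralTori.tenLattices p V X Y₀ Y₁ Y₂ i)) ∧
      (DihedralTori.IsPermutation (DihedralTori.latticeZ p) ∧
        DihedralTori.IsPermutation (DihedralTori.latticeZH p) ∧
        DihedralTori.IsPermutation V ∧ DihedralTori.IsPermutation Y₂) ∧
      (DihedralTori.IsStablyPermutation Y₀ ∧ DihedralTori.IsStablyPermutation Y₁) ∧
      (¬ DihedralTori.IsFlabby (DihedralTori.latticeZMinus p) ∧
        ¬ DihedralTori.IsFlabby (DihedralTori.latticeR p) ∧
        ¬ DihedralTori.IsFlabby (DihedralTori.latticeP p) ∧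
        ¬ DihedralTori.IsFlabby X)) ∧
    -- tori split by a Galois extension with group `D_p` are stably rational
    (∀ (k : Type v) [Field k] (K : Type w) [Field K] [Algebra k K] [FiniteDimensional k K]
      [IsGalois k K], Nonempty (DihedralGroup p ≃* Gal(K/k)) →
      ∀ (A : Type t) [CommRing A] [HopfAlgebra k A], DihedralTori.IsTorusSplitBy k K A →
        IsDomain A ∧ DihedralTori.IsStablyRational k (FractionRing A)) ∧
    -- the same in terms of the fixed fields `K(M)^G`
    (∀ (k : Type v) [Field k] (K : Type w) [Field K] [Algebra k K] [FiniteDimensional k K]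
      [IsGalois k K] (e : DihedralGroup p ≃* Gal(K/k)) (M : DihedralTori.GLattice.{0, u} (DihedralGroup p)),
      IsField (DihedralTori.fixedField e M) ∧
          DihedralTori.IsStablyRational k (DihedralTori.fixedField e M)) := by
  refine ⟨DihedralTori.exists_nonsplitExtensions hp h, ?_, ?_, ?_⟩
  · intro V X Y₀ Y₁ Y₂ H
    obtain ⟨EV, -⟩ := DihedralTori.exists_extensionV hp h
    obtain ⟨EX, -⟩ := DihedralTori.exists_extensionX hp h
    obtain ⟨hperm, Q₀, Q₁, hQ₀, hQ₁, hY₀, hY₁⟩ := DihedralTori.isPermutation_tenLattices hp H h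
    exact ⟨DihedralTori.isIndecomposable_tenLattices hp H, DihedralTori.eq_of_isoLattice hp H,
      DihedralTori.exists_isoLattice hp H h, hperm, ⟨⟨Q₀, hQ₀, hY₀⟩, ⟨Q₁, hQ₁, hY₁⟩⟩,
      DihedralTori.not_isFlabby_latticeZMinus, (DihedralTori.rankOneR p).not_isFlabby,
      (DihedralTori.rankOneP p hp).not_isFlabby,
      DihedralTori.not_isFlabby_of_isoLattice_latticeX hp (DihedralTori.isoLattice_tenLattices hp H h
        (DihedralTori.areNonsplitExtensions hp h EV EX) 6)⟩
  · rintro k _ K _ _ _ _ ⟨e⟩ A _ _ hA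
    exact hA.isStablyRational e fun M => (DihedralTori.hasPermutationResolution hp h M).isStablyRational e
  · intro k _ K _ _ _ _ e M
    exact ⟨DihedralTori.isField_fixedField e M,
      (DihedralTori.hasPermutationResolution hp h M).isStablyRational e⟩
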